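/- Let $N\ge 2$ be an integer, let $-\infty\le\gamma_*^-<0<\gamma_*\le\infty$, and put $D=(\gamma_*^-,\gamma_*]$ if $\gamma_*<\infty$ and $D=(\gamma_*^-,\infty)$ if $\gamma_*=\infty$. Let $f:D\to\mathbb R$ be continuous, locally Lipschitz in $D\setminus\{0\}$, with $f(0)=0$, and set $F(s)=\int_0^s f(t)\,dt$ and $Q(s)=2NF(s)-(N-2)sf(s)$. Assume that there is $\delta>0$ such that * $F(s)<0$ for all $0<|s|<\delta$; * $F$ has a local maximum at some $\gamma\in(\delta,\gamma_*)$ with $F(\gamma)>0$; * $f$ has finitely many zeros in $(\gamma_*^-,-\delta)\cup(\delta,\gamma_*)$ and changes sign at each of them; and that one of the following holds. **(A1)** $\gamma_*<\infty$, $f(\gamma_*)=0$, $\lim_{s\to\gamma_*^-}F(s)=F(\gamma_*)$ (the limit of $F$ at the left end point $\gamma_*^-$ of $D$), and $F(s)<F(\gamma_*)$ for all $s\in(\gamma_*^-,\gamma_*)$. **(A2)** $\gamma_*=\infty$; the limits of $F$ at $\infty$ and at the left end point $\gamma_*^-$ exist in $(-\infty,\infty]$ and are equal, and $F(s)<\lim_{t\to\infty}F(t)$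 for all $s\in D$; there is $s_0\in(\gamma_*^-,0)$ such that $Q(s)>0$ for all $s\in(\gamma_*^-,s_0)$; and there is $\theta\in(0,1)$ such that $$\lim_{s\to\infty}\ \inf_{s_1,s_2\in[\theta s,s]}Q(s_2)\Bigl(\frac{s}{f(s_1)}\Bigr)^{N/2}=\infty .$$ Put $\gamma_0=0$ and, for $i\ge0$, let $\gamma_{i+1}$ be the first local maximum point of $F$ in $(\gamma_i,\gamma_*)$ with $F(\gamma_{i+1})>F(\gamma_i)$, as long as there is one; let $\gamma_M$ be the last point so obtained, and let $\beta_*$ be the largest point of $(\gamma_M,\gamma_*)$ with $F(\beta_*)=F(\gamma_M)$. Then $\beta_*$ is well defined, and there exists $k_0\in\mathbb N\cup\{0\}$ such that for every integer $k\ge k_0$ the problem $$u''+\frac{N-1}{r}u'+f(u)=0\quad(r>0),\qquad u'(0)=0,\qquad \lim_{r\to\infty}u(r)=0$$ has at least two distinct solutions $u\in C^2([0,\infty))$ with values in $D$, with initial value $u(0)\in(\beta_*,\gamma_*)$, and having exactly $k$ sign changes in $(0,\infty)$. -/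

import Mathlib

open Set Filter Topology

/-- The interval `(γm, γs]` of real numbers, with extended real end points; for `γs = ⊤` it is
`(γm, ∞)`. This is the domain of the nonlinearity. -/
def nonlinDomain (γm γs : EReal) : Set ℝ :=
  {s : ℝ | γm < (s : EReal) ∧ (s : EReal) ≤ γs}

/-- The filter `s → a⁺` on real numbers, for an extended real `a` (`s → -∞` if `a = ⊥`). -/
noncomputable def rightOf (a : EReal) : Filter ℝ :=
  Filter.comap (fun s : ℝ => (s : EReal)) (𝓝[>] a)

/-- `F(s) = ∫₀ˢ f(t) dt`. -/
noncomputable def primitiveF (f : ℝ → ℝ) (s : ℝ) : ℝ :=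
  ∫ t in (0 : ℝ)..s, f t

/-- `Q(s) = 2 N F(s) - (N - 2) s f(s)`. -/
noncomputable def pohozaevQ (N : ℕ) (f : ℝ → ℝ) (s : ℝ) : ℝ :=
  2 * (N : ℝ) * primitiveF f s - ((N : ℝ) - 2) * s * f s

/-- `f` takes values of strictly opposite signs on the two sides of `z`, close to `z`. -/
def ChangesSignAt (f : ℝ → ℝ) (z : ℝ) : Prop :=
  ∃ ε > 0, ∀ s ∈ Ioo (z - ε) z, ∀ t ∈ Ioo z (z + ε), f s * f t < 0

/-- The finite case. Only the values of `f` on `(γm, γs]` matter. -/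
structure AssumptionA1 (f : ℝ → ℝ) (γm : EReal) (γs : ℝ) : Prop where
  lower_neg : γm < 0
  upper_pos : 0 < γs
  cont : ContinuousOn f (nonlinDomain γm γs)
  zero : f 0 = 0
  zero_top : f γs = 0
  lip : LocallyLipschitzOn (nonlinDomain γm γs \ {0}) f
  lim_lower : Tendsto (primitiveF f) (rightOf γm) (𝓝 (primitiveF f γs))
  lt_top : ∀ s : ℝ, γm < (s : EReal) → s < γs → primitiveF f s < primitiveF f γs
  exists_delta : ∃ δ > 0,
    (∀ s ∈ nonlinDomain γm γs, 0 < |s| → |s| < δ → primitiveF f s < 0) ∧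
    (∃ γ : ℝ, δ < γ ∧ γ < γs ∧ IsLocalMax (primitiveF f) γ ∧ 0 < primitiveF f γ) ∧
    {z : ℝ | ((γm < (z : EReal) ∧ z < -δ) ∨ (δ < z ∧ z < γs)) ∧ f z = 0}.Finite ∧
    (∀ z : ℝ, ((γm < (z : EReal) ∧ z < -δ) ∨ (δ < z ∧ z < γs)) → f z = 0 → ChangesSignAt f z)

/-- The infinite case. Only the values of `f` on `(γm, ∞)` matter. The common limit of `F` at the
two ends may be finite or `+∞`. -/
structure AssumptionA2 (N : ℕ) (f : ℝ → ℝ) (γm : EReal) : Prop where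
  lower_neg : γm < 0
  cont : ContinuousOn f (nonlinDomain γm ⊤)
  zero : f 0 = 0
  lip : LocallyLipschitzOn (nonlinDomain γm ⊤ \ {0}) f
  lim_ends : ∃ L : EReal,
    Tendsto (fun s : ℝ => (primitiveF f s : EReal)) atTop (𝓝 L) ∧
    Tendsto (fun s : ℝ => (primitiveF f s : EReal)) (rightOf γm) (𝓝 L) ∧
    ∀ s ∈ nonlinDomain γm ⊤, (primitiveF f s : EReal) < L
  exists_delta : ∃ δ > 0,
    (∀ s ∈ nonlinDomain γm ⊤, 0 < |s| → |s| < δ → primitiveF f s < 0) ∧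
    (∃ γ : ℝ, δ < γ ∧ IsLocalMax (primitiveF f) γ ∧ 0 < primitiveF f γ) ∧
    {z : ℝ | ((γm < (z : EReal) ∧ z < -δ) ∨ δ < z) ∧ f z = 0}.Finite ∧
    (∀ z : ℝ, ((γm < (z : EReal) ∧ z < -δ) ∨ δ < z) → f z = 0 → ChangesSignAt f z)
  q_pos : ∃ s₀ : ℝ, γm < (s₀ : EReal) ∧ s₀ < 0 ∧
    ∀ s : ℝ, γm < (s : EReal) → s < s₀ → 0 < pohozaevQ N f s
  q_growth : ∃ θ ∈ Ioo (0 : ℝ) 1,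
    Tendsto
      (fun s : ℝ => ⨅ s₁ ∈ Icc (θ * s) s, ⨅ s₂ ∈ Icc (θ * s) s,
        ((pohozaevQ N f s₂ * (s / f s₁) ^ ((N : ℝ) / 2) : ℝ) : EReal))
      atTop (𝓝 ⊤)

/-- The local maximum points of `F` in `(g, γs)` at which `F` is larger than at `g`. -/
def higherPeaks (f : ℝ → ℝ) (γs : EReal) (g : ℝ) : Set ℝ :=
  {s : ℝ | g < s ∧ (s : EReal) < γs ∧ IsLocalMax (primitiveF f) s ∧
    primitiveF f g < primitiveF f s}

/-- `γ 0 = 0 < γ 1 < ⋯ < γ M` are the successive record peaks of `F`: each `γ (i + 1)` is the first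
local maximum point of `F` after `γ i` at which `F` is larger than at `γ i` (so that
`F (γ 1) > F 0 = 0`), and `γ M` is the last one. -/
def IsPeakChain (f : ℝ → ℝ) (γs : EReal) (M : ℕ) (γ : ℕ → ℝ) : Prop :=
  γ 0 = 0 ∧ (∀ i < M, IsLeast (higherPeaks f γs (γ i)) (γ (i + 1))) ∧
    higherPeaks f γs (γ M) = ∅

/-- `β` is the largest point of `(γ_M, γs)` at which `F` takes the value `F(γ_M)`, where `γ_M` is
the last record peak. -/
def IsBetaStar (f : ℝ → ℝ) (γs : EReal) (β : ℝ) : Prop :=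
  ∃ (M : ℕ) (γ : ℕ → ℝ), IsPeakChain f γs M γ ∧
    IsGreatest {s : ℝ | γ M < s ∧ (s : EReal) < γs ∧ primitiveF f s = primitiveF f (γ M)} β

/-- `u`, restricted to `[0, ∞)`, is a `C²` solution with values in the domain of `f` of
`u'' + (N - 1)/r u' + f(u) = 0` for `r > 0`, with `u'(0) = 0` and `u(r) → 0` as `r → ∞`. -/
structure IsRadialSolution (N : ℕ) (f : ℝ → ℝ) (γm γs : EReal) (u : ℝ → ℝ) : Prop where
  smooth : ContDiffOn ℝ 2 u (Ici 0)
  mem_domain : ∀ r, 0 ≤ r → u r ∈ nonlinDomain γm γs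
  equation : ∀ r, 0 < r →
    deriv (deriv u) r + ((N : ℝ) - 1) / r * deriv u r + f (u r) = 0
  deriv_zero : HasDerivWithinAt u 0 (Ici 0) 0
  lim_zero : Tendsto u atTop (𝓝 0)

/-- There are `0 < r₀ < r₁ < ⋯ < r_k` such that `u` has strictly opposite signs at consecutive
points. -/
def HasAtLeastSignChanges (u : ℝ → ℝ) (k : ℕ) : Prop :=
  ∃ r : Fin (k + 1) → ℝ, StrictMono r ∧ (∀ i, 0 < r i) ∧
    ∀ i : Fin k, u (r i.castSucc) * u (r i.succ) < 0

/-- `u` changes sign exactly `k` times in `(0, ∞)`. -/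
def HasExactlySignChanges (u : ℝ → ℝ) (k : ℕ) : Prop :=
  HasAtLeastSignChanges u k ∧ ¬ HasAtLeastSignChanges u (k + 1)

section calculus
variable {g : ℝ → ℝ} {a b c : ℝ}

theorem monoOn_Icc (hc : ContinuousOn g (Icc a b)) (h : ∀ t ∈ Ioo a b, ∃ d, HasDerivAt g d t ∧ 0 ≤ d) :
    MonotoneOn g (Icc a b) := by
  choose! d hd h using h
  rw [← interior_Icc] at hd h
  exact monotoneOn_of_hasDerivWithinAt_nonneg (convex_Icc a b) hc (fun t ht => (hd t ht).hasDerivWithinAt) h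

theorem antiOn_Icc (hc : ContinuousOn g (Icc a b)) (h : ∀ t ∈ Ioo a b, ∃ d, HasDerivAt g d t ∧ d ≤ 0) :
    AntitoneOn g (Icc a b) := fun x hx y hy hxy => neg_le_neg_iff.1 (monoOn_Icc hc.neg (fun t ht => by
  obtain ⟨d, hd, h⟩ := h t ht
  exact ⟨-d, hd.neg, neg_nonneg.2 h⟩) hx hy hxy)

theorem strictMonoOn_Icc (hc : ContinuousOn g (Icc a b)) (h : ∀ t ∈ Ioo a b, ∃ d, HasDerivAt g d t ∧ 0 < d) :
    StrictMonoOn g (Icc a b) := strictMonoOn_of_deriv_pos (convex_Icc a b) hc fun t ht => by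
  obtain ⟨d, hd, h⟩ := h t (interior_Icc (a := a) ▸ ht)
  rwa [hd.deriv]

theorem strictAntiOn_Icc (hc : ContinuousOn g (Icc a b)) (h : ∀ t ∈ Ioo a b, ∃ d, HasDerivAt g d t ∧ d < 0) :
    StrictAntiOn g (Icc a b) := strictAntiOn_of_deriv_neg (convex_Icc a b) hc fun t ht => by
  obtain ⟨d, hd, h⟩ := h t (interior_Icc (a := a) ▸ ht)
  rwa [hd.deriv]

theorem exists_first_le (hc : ContinuousOn g (Icc a b)) (ha : c < g a) (h : ∃ t ∈ Icc a b, g t ≤ c) :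
    ∃ x ∈ Ioc a b, g x = c ∧ ∀ y ∈ Ico a x, c < g y := by
  obtain ⟨x, ⟨hx, hxc⟩, hl⟩ := (isCompact_Icc.of_isClosed_subset (hc.preimage_isClosed_of_isClosed isClosed_Icc
    isClosed_Iic) inter_subset_left).exists_isLeast h
  have hlt : ∀ y ∈ Ico a x, c < g y := fun y hy => lt_of_not_ge fun hle =>
    (hl ⟨⟨hy.1, hy.2.le.trans hx.2⟩, hle⟩).not_gt hy.2
  have hax : a < x := lt_of_le_of_ne hx.1 fun e => (e ▸ ha).not_ge hxc
  refine ⟨x, ⟨hax, hx.2⟩, le_antisymm hxc ?_, hlt⟩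
  refine ge_of_tendsto ((hc x hx).mono_left (nhdsWithin_le_iff.2 (mem_of_superset (Ico_mem_nhdsLT hax)
    (Ico_subset_Icc_self.trans (Icc_subset_Icc_right hx.2))) : 𝓝[<] x ≤ _)) ?_
  filter_upwards [Ico_mem_nhdsLT hax] with y hy using (hlt y hy).le

theorem exists_last_le (hc : ContinuousOn g (Icc a b)) (h : ∃ t ∈ Icc a b, g t ≤ c) (hb : c < g b) :
    ∃ x ∈ Ico a b, g x = c ∧ ∀ y ∈ Ioc x b, c < g y := by
  obtain ⟨t, ht, htc⟩ := h
  obtain ⟨x, hx, e, hlt⟩ := exists_first_le (g := fun x => g (-x)) (a := -b) (b := -a) (c := c)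
    (hc.comp continuousOn_neg fun x hx => ⟨by linarith [hx.2], by linarith [hx.1]⟩) (by rwa [neg_neg])
    ⟨-t, ⟨by linarith [ht.2], by linarith [ht.1]⟩, by rwa [neg_neg]⟩
  refine ⟨-x, ⟨by linarith [hx.2], by linarith [hx.1]⟩, e, fun y hy => ?_⟩
  simpa using hlt (-y) ⟨by linarith [hy.2], by linarith [hy.1]⟩

theorem exists_first_ge (hc : ContinuousOn g (Icc a b)) (ha : g a < c) (h : ∃ t ∈ Icc a b, c ≤ g t) :
    ∃ x ∈ Ioc a b, g x = c ∧ ∀ y ∈ Ico a x, g y < c := by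
  obtain ⟨x, hx, e, hlt⟩ := exists_first_le hc.neg (neg_lt_neg ha) (by simpa using h)
  exact ⟨x, hx, neg_injective e, fun y hy => neg_lt_neg_iff.1 (hlt y hy)⟩

theorem slope_sq_le {m w L : ℝ} (hab : a < b) (hc : ContinuousOn g (Icc a b))
    (hd : ∀ t ∈ Ioo a b, ∃ d, HasDerivAt g d t ∧ m ≤ d ^ 2) (hw : |g b - g a| ≤ w) (hL : 0 ≤ L) (hLb : L ≤ b - a) :
    m * L ^ 2 ≤ w ^ 2 := by
  choose! g' hd h using hd
  obtain ⟨ξ, hξ, e⟩ := exists_hasDerivAt_eq_slope g g' hab hc hd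
  have h1 := h ξ hξ
  rw [e, div_pow, le_div_iff₀ (pow_pos (sub_pos.2 hab) 2)] at h1
  have h2 := sq_le_sq' (abs_le.1 hw).1 (abs_le.1 hw).2
  have h3 : L ^ 2 ≤ (b - a) ^ 2 := by gcongr
  rcases le_total m 0 with hm | hm <;> nlinarith [sq_nonneg L, sq_nonneg w]

end calculus

/-- `u' = v`, `v' = -(n/t) v - f(u)` on `S`, with derivatives within `S`. -/
def IsTraj (n : ℕ) (f u v : ℝ → ℝ) (S : Set ℝ) : Prop := ∀ t ∈ S, HasDerivWithinAt u (v t) S t ∧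
    HasDerivWithinAt v (-((n : ℝ) / t) * v t - f (u t)) S t

theorem IsTraj.mono {n : ℕ} {f u v : ℝ → ℝ} {S T : Set ℝ} (h : IsTraj n f u v S) (hT : T ⊆ S) : IsTraj n f u v T :=
  fun t ht => ⟨(h t (hT ht)).1.mono hT, (h t (hT ht)).2.mono hT⟩

theorem exists_ultrafilter_lim {ι : Type*} (l : Ultrafilter ι) {x : ι → ℝ} {a b : ℝ}
    (h : ∀ᶠ i in (l : Filter ι), x i ∈ Icc a b) :
    ∃ y ∈ Icc a b, Tendsto x (l : Filter ι) (𝓝 y) := by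
  have := (isCompact_Icc).ultrafilter_le_nhds (l.map x) (by rw [le_principal_iff]; exact h)
  obtain ⟨y, hy, hy'⟩ := this
  exact ⟨y, hy, hy'⟩

theorem hasDerivWithinAt_of_tendsto {ι : Type*} {l : Filter ι} [NeBot l] {a b s D : ℝ} {z d : ι → ℝ → ℝ} {Z : ℝ → ℝ}
    (hs : s ∈ Icc a b) (hz : ∀ t ∈ Icc a b, Tendsto (fun i => z i t) l (𝓝 (Z t)))
    (hd : ∀ᶠ i in l, ∀ t ∈ Icc a b, HasDerivWithinAt (z i) (d i t) (Icc a b) t)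
    (h : ∀ ε > 0, ∃ δ > 0, ∀ᶠ i in l, ∀ t ∈ Icc a b, |t - s| < δ → |d i t - D| ≤ ε) :
    HasDerivWithinAt Z D (Icc a b) s := by
  rw [hasDerivWithinAt_iff_isLittleO, Asymptotics.isLittleO_iff]; intro ε hε
  obtain ⟨δ, hδ, h⟩ := h ε hε
  filter_upwards [self_mem_nhdsWithin, mem_nhdsWithin_of_mem_nhds (Metric.ball_mem_nhds s hδ)] with t ht htb
  refine le_of_tendsto (((hz t ht).sub (hz s hs)).sub_const ((t - s) * D)).abs ?_
  filter_upwards [hd, h] with i hd h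
  have hsub := ordConnected_Icc.uIcc_subset hs ht
  have := (convex_uIcc s t).norm_image_sub_le_of_norm_hasDerivWithin_le (f := fun r => z i r - r * D)
    (fun r hr => ((hd r (hsub hr)).mono hsub).sub ((hasDerivWithinAt_id r _).mul_const D)) (fun r hr => by
      rw [one_mul]
      exact h r (hsub hr) ((abs_sub_left_of_mem_uIcc hr).trans_lt htb)) left_mem_uIcc right_mem_uIcc
  simp only [Real.norm_eq_abs] at this ⊢
  grind

/-- Pointwise limits of uniformly bounded trajectories are trajectories. -/
theorem IsTraj.limit {ι : Type*} {l : Filter ι} [NeBot l] {n : ℕ} {f : ℝ → ℝ} (hf : Continuous f)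
    {a b lo hi V : ℝ} (ha : 0 < a)
    {u v : ι → ℝ → ℝ} {U W : ℝ → ℝ}
    (h : ∀ᶠ i in l, IsTraj n f (u i) (v i) (Icc a b))
    (hu : ∀ᶠ i in l, ∀ t ∈ Icc a b, u i t ∈ Icc lo hi)
    (hv : ∀ᶠ i in l, ∀ t ∈ Icc a b, |v i t| ≤ V)
    (hU : ∀ t ∈ Icc a b, Tendsto (fun i => u i t) l (𝓝 (U t)))
    (hW : ∀ t ∈ Icc a b, Tendsto (fun i => v i t) l (𝓝 (W t))) :
    IsTraj n f U W (Icc a b) := fun s hs => by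
  obtain ⟨B, hB⟩ := isCompact_Icc.exists_bound_of_continuousOn (hf.continuousOn (s := Icc lo hi))
  obtain ⟨L, hL, hL1, hL2⟩ : ∃ L : ℝ, 0 ≤ L ∧ V ≤ L ∧ n / a * V + B ≤ L :=
    ⟨max 0 (max V _), le_max_left _ _, (le_max_left _ _).trans (le_max_right _ _),
      (le_max_right _ _).trans (le_max_right _ _)⟩
  have near : ∀ ρ > 0, ∃ δ > 0, ∀ᶠ i in l, ∀ t ∈ Icc a b, |t - s| < δ → |u i t - U s| < ρ ∧ |v i t - W s| < ρ := by
    refine fun ρ hρ => ⟨ρ / 2 / (L + 1), by positivity, ?_⟩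
    filter_upwards [h, hu, hv, (hU s hs) (Metric.ball_mem_nhds _ (half_pos hρ)),
      (hW s hs) (Metric.ball_mem_nhds _ (half_pos hρ))] with i h hu hv hU hW t ht hδ
    have hU : |u i s - U s| < ρ / 2 := hU
    have hW : |v i s - W s| < ρ / 2 := hW
    have k1 : |u i t - u i s| ≤ L * |t - s| := (convex_Icc a b).norm_image_sub_le_of_norm_hasDerivWithin_le
      (fun r hr => (h r hr).1) (fun r hr => (hv r hr).trans hL1) hs ht
    have k2 : |v i t - v i s| ≤ L * |t - s| := (convex_Icc a b).norm_image_sub_le_of_norm_hasDerivWithin_le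
      (fun r hr => (h r hr).2) (fun r hr => by
        refine (norm_sub_le _ _).trans (le_trans (add_le_add ?_ (hB _ (hu r hr))) hL2)
        rw [norm_mul, norm_neg, Real.norm_of_nonneg (div_nonneg n.cast_nonneg (ha.le.trans hr.1))]
        have := hr.1
        gcongr
        exact hv r hr) hs ht
    rw [lt_div_iff₀ (by positivity)] at hδ
    have := abs_nonneg (t - s)
    exact ⟨(abs_sub_le _ (u i s) _).trans_lt (by linarith), (abs_sub_le _ (v i s) _).trans_lt (by linarith)⟩
  refine ⟨hasDerivWithinAt_of_tendsto hs hU (h.mono fun i h r hr => (h r hr).1) fun ε hε => ?_,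
    hasDerivWithinAt_of_tendsto hs hW (h.mono fun i h r hr => (h r hr).2) fun ε hε => ?_⟩
  · obtain ⟨δ, hδ, h⟩ := near ε hε
    exact ⟨δ, hδ, h.mono fun i h t ht hts => (h t ht hts).2.le⟩
  · have hc : ContinuousAt (fun p : ℝ × ℝ × ℝ => -(n / p.1) * p.2.2 - f p.2.1) (s, U s, W s) := by
      have := (ha.trans_le hs.1).ne'
      fun_prop (disch := assumption)
    obtain ⟨ρ, hρ, hc⟩ := Metric.continuousAt_iff.1 hc ε hε
    obtain ⟨δ, hδ, h⟩ := near ρ hρ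
    refine ⟨min δ ρ, lt_min hδ hρ, h.mono fun i h t ht hts => ?_⟩
    obtain ⟨h1, h2⟩ := h t ht (hts.trans_le (min_le_left _ _))
    exact (hc (x := (t, u i t, v i t)) (max_lt (hts.trans_le (min_le_right _ _)) (max_lt h1 h2))).le

/-- One step of the semi-implicit Euler scheme, arriving at time `t`. -/
noncomputable def eulerMap (n : ℕ) (g : ℝ → ℝ) (h t : ℝ) (p : ℝ × ℝ) : ℝ × ℝ :=
  (p.1 + h * p.2, (p.2 - h * g (p.1 + h * p.2)) * (1 + h * (n / t))⁻¹)

theorem abs_sub_le_of_steps {x : ℕ → ℝ} {c : ℝ} (j k : ℕ)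
    (h : ∀ m, min j k ≤ m → m < max j k → |x (m + 1) - x m| ≤ c) : |x k - x j| ≤ c * |(k : ℝ) - j| := by
  wlog hjk : j ≤ k generalizing j k
  · rw [abs_sub_comm, abs_sub_comm (k : ℝ)]
    exact this k j (by rwa [min_comm, max_comm]) (not_le.1 hjk).le
  rw [min_eq_left hjk, max_eq_right hjk] at h
  induction k, hjk using Nat.le_induction with
  | base => simp
  | succ k hk ih =>
    have h1 := ih fun m h1 h2 => h m h1 (by omega)
    have hk' : (j : ℝ) ≤ k := by exact_mod_cast hk
    rw [abs_of_nonneg (sub_nonneg.2 hk')] at h1; push_cast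
    rw [abs_of_nonneg (by linarith : (0 : ℝ) ≤ k + 1 - j)]
    linarith [abs_sub_le (x (k + 1)) (x k) (x j), h k hk (by omega)]

section euler
variable {a b : ℝ} {h : ℕ → ℝ}

theorem floor_grid (hpos : ∀ i, 0 < h i) (hend : ∀ i, a + (i + 1 : ℕ) * h i = b) (i : ℕ) {t : ℝ} (ht : t ∈ Icc a b) :
    ⌊(t - a) / h i⌋₊ ≤ i + 1 ∧ (⌊(t - a) / h i⌋₊ : ℝ) * h i ≤ t - a ∧ t - a < ⌊(t - a) / h i⌋₊ * h i + h i := by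
  refine ⟨?_, ?_, ?_⟩
  · have : (t - a) / h i ≤ (i + 1 : ℕ) := by rw [div_le_iff₀ (hpos i)]; linarith [ht.2, hend i]
    exact (Nat.floor_le_floor this).trans_eq (Nat.floor_natCast _)
  · rw [← le_div_iff₀ (hpos i)]; exact Nat.floor_le (div_nonneg (sub_nonneg.2 ht.1) (hpos i).le)
  · rw [← add_one_mul, ← div_lt_iff₀ (hpos i)]; exact Nat.lt_floor_add_one _

theorem hasDerivWithinAt_of_steps {l : Filter ℕ} [NeBot l] {s D : ℝ} (hpos : ∀ i, 0 < h i)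
    (hend : ∀ i, a + (i + 1 : ℕ) * h i = b) (hlim : Tendsto h l (𝓝 0)) {x : ℕ → ℕ → ℝ} {Z : ℝ → ℝ} (hs : s ∈ Icc a b)
    (hz : ∀ t ∈ Icc a b, Tendsto (fun i => x i ⌊(t - a) / h i⌋₊) l (𝓝 (Z t)))
    (hx : ∀ ε > 0, ∃ δ > 0, ∀ᶠ i in l, ∀ j : ℕ, j ≤ i → |a + j * h i - s| < δ → |x i (j + 1) - x i j - h i * D| ≤ ε * h i) :
    HasDerivWithinAt Z D (Icc a b) s := by
  rw [hasDerivWithinAt_iff_isLittleO, Asymptotics.isLittleO_iff]; intro ε hε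
  obtain ⟨δ, hδ, hx⟩ := hx ε hε
  filter_upwards [self_mem_nhdsWithin, mem_nhdsWithin_of_mem_nhds (Metric.ball_mem_nhds s (half_pos hδ))] with t ht htb
  have htb : |t - s| < δ / 2 := htb
  have lim : Tendsto (fun i => ε * |t - s| + h i * (ε + |D|)) l (𝓝 (ε * |t - s|)) := by
    simpa using (hlim.mul_const (ε + |D|)).const_add (ε * |t - s|)
  refine le_of_tendsto_of_tendsto (((hz t ht).sub (hz s hs)).sub_const ((t - s) * D)).abs lim ?_
  filter_upwards [hx, hlim.eventually_lt_const (half_pos hδ)] with i hi hh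
  have hi0 := (hpos i).le
  obtain ⟨k1, k2, k3⟩ := floor_grid hpos hend i ht
  obtain ⟨j1, j2, j3⟩ := floor_grid hpos hend i hs
  set k := ⌊(t - a) / h i⌋₊
  set j := ⌊(s - a) / h i⌋₊
  rw [abs_lt] at htb
  have h1 := abs_sub_le_of_steps (x := fun m => x i m - m * (h i * D)) (c := ε * h i) j k fun m h1 h2 => by
    have e : ∀ {p q : ℕ}, p ≤ q → (p : ℝ) * h i ≤ q * h i := fun h => by gcongr
    convert hi m (by omega) ?_ using 2
    · push_cast; ring
    · rw [abs_lt]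
      rcases le_total j k with h | h
      · rw [min_eq_left h, max_eq_right h] at *
        constructor <;> linarith [e h1, e h2.le]
      · rw [min_eq_right h, max_eq_left h] at *
        constructor <;> linarith [e h1, e h2.le]
  have h2 : |((k : ℝ) - j) * h i - (t - s)| ≤ h i := by rw [abs_le]; constructor <;> linarith
  have h3 := abs_sub_abs_le_abs_sub (((k : ℝ) - j) * h i) (t - s)
  rw [abs_mul, abs_of_pos (hpos i)] at h3
  calc _ = |x i k - k * (h i * D) - (x i j - j * (h i * D)) + (((k : ℝ) - j) * h i - (t - s)) * D| := by ring_nf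
    _ ≤ ε * h i * |(k : ℝ) - j| + h i * |D| := by
      refine (abs_add_le _ _).trans (add_le_add h1 ?_)
      rw [abs_mul]; gcongr
    _ ≤ _ := by nlinarith

theorem le_geom_of_step {x : ℕ → ℝ} {D c : ℝ} (hD : 1 ≤ D) (hc : 0 ≤ c) (h : ∀ j, x (j + 1) ≤ D * x j + c) (k : ℕ) :
    x k ≤ D ^ k * (x 0 + k * c) := by
  induction k with
  | zero => simp
  | succ k ih =>
    have := mul_le_mul_of_nonneg_left ih (zero_le_one.trans hD)
    have := mul_le_mul_of_nonneg_right (one_le_pow₀ hD : 1 ≤ D ^ (k + 1)) hc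
    push_cast; rw [pow_succ'] at *; linarith [h k]

/-- Limits of Euler polygons with controlled states at one time are trajectories. -/
theorem euler_limit {n : ℕ} {g : ℝ → ℝ} (hg : Continuous g) {lo hi V B : ℝ} (hB : ∀ s, |g s| ≤ B) (ha : 0 < a)
    (hpos : ∀ i, 0 < h i) (hend : ∀ i, a + (i + 1 : ℕ) * h i = b) (hlim : Tendsto h (hyperfilter ℕ) (𝓝 0))
    {p : ℕ → ℕ → ℝ × ℝ} (hp : ∀ i j, p i (j + 1) = eulerMap n g (h i) (a + (j + 1 : ℕ) * h i) (p i j)) {q : ℕ → ℕ}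
    (hq : ∀ i, q i ≤ i + 1) (hpq : ∀ i, (p i (q i)).1 ∈ Icc lo hi ∧ |(p i (q i)).2| ≤ V) :
    ∃ U W, IsTraj n g U W (Icc a b) ∧
      Tendsto (fun i => (p i 0).1) (hyperfilter ℕ) (𝓝 (U a)) ∧ Tendsto (fun i => (p i 0).2) (hyperfilter ℕ) (𝓝 (W a)) ∧
      Tendsto (fun i => (p i (i + 1)).1) (hyperfilter ℕ) (𝓝 (U b)) ∧
      Tendsto (fun i => (p i (i + 1)).2) (hyperfilter ℕ) (𝓝 (W b)) := by
  have hB0 : 0 ≤ B := (abs_nonneg _).trans (hB 0)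
  have hV : 0 ≤ V := (abs_nonneg _).trans (hpq 0).2
  have hab : a ≤ b := by rw [← hend 0]; have := hpos 0; simp [this.le]
  have step : ∀ i j, (1 + h i * (n / (a + (j + 1 : ℕ) * h i))) * (p i (j + 1)).2 = (p i j).2 - h i * g (p i (j + 1)).1 :=
    fun i j => by
      have := (hpos i).le
      have : 0 < 1 + h i * (n / (a + (j + 1 : ℕ) * h i)) := by positivity
      rw [hp i j, eulerMap]; field_simp
  have hD : ∀ i j, 1 ≤ 1 + h i * (n / (a + (j + 1 : ℕ) * h i)) ∧
      1 + h i * (n / (a + (j + 1 : ℕ) * h i)) ≤ 1 + h i * (n / a) := fun i j => by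
    have := (hpos i).le
    refine ⟨le_add_of_nonneg_right (by positivity), ?_⟩
    gcongr
    exact le_add_of_nonneg_right (by positivity)
  have hgh : ∀ i j, |h i * g (p i (j + 1)).1| ≤ h i * B := fun i j => by
    rw [abs_mul, abs_of_pos (hpos i)]; exact mul_le_mul_of_nonneg_left (hB _) (hpos i).le
  set M := Real.exp ((b - a) * (n / a)) * (V + (b - a) * B)
  have hkh : ∀ i k : ℕ, k ≤ i + 1 → k * h i ≤ b - a := fun i k hk => by
    rw [← hend i, add_sub_cancel_left]
    exact mul_le_mul_of_nonneg_right (by exact_mod_cast hk) (hpos i).le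
  have hvM : ∀ i, ∀ j ≤ i + 1, |(p i j).2| ≤ M := fun i j hj => by
    have hi := (hpos i).le
    have hD1 : 1 ≤ 1 + h i * (n / a) := (hD i 0).1.trans (hD i 0).2
    have fin : ∀ k ≤ i + 1, (1 + h i * (n / a)) ^ k * (|(p i (q i)).2| + k * (h i * B)) ≤ M := fun k hk => by
      refine mul_le_mul ?_ (add_le_add (hpq i).2 ?_) (by positivity) (Real.exp_pos _).le
      · calc _ ≤ Real.exp (h i * (n / a)) ^ k := by gcongr; linarith [Real.add_one_le_exp (h i * (n / a))]
          _ = Real.exp (k * h i * (n / a)) := by rw [← Real.exp_nat_mul, mul_assoc]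
          _ ≤ _ := by gcongr; exact hkh i k hk
      · rw [← mul_assoc]; exact mul_le_mul_of_nonneg_right (hkh i k hk) hB0
    rcases le_total (q i) j with hqj | hqj
    · refine le_trans ?_ (fin (j - q i) (by omega))
      have := le_geom_of_step (x := fun k => |(p i (q i + k)).2|) hD1 (mul_nonneg hi hB0) (fun k => ?_) (j - q i)
      · simpa [Nat.add_sub_cancel' hqj] using this
      · have h1 := step i (q i + k)
        have h2 := (hD i (q i + k)).1
        have h3 := hgh i (q i + k)
        have h4 := abs_sub (p i (q i + k)).2 (h i * g (p i (q i + k + 1)).1)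
        rw [← h1, abs_mul, abs_of_nonneg (zero_le_one.trans h2)] at h4
        have h5 := abs_nonneg (p i (q i + k)).2
        have h6 := abs_nonneg (p i (q i + k + 1)).2
        show |(p i (q i + k + 1)).2| ≤ _
        nlinarith
    · refine le_trans ?_ (fin (q i - j) (by have := hq i; omega))
      have := le_geom_of_step (x := fun k => |(p i (q i - k)).2|) hD1 (mul_nonneg hi hB0) (fun k => show |(p i (q i - (k + 1))).2| ≤ _ * |(p i (q i - k)).2| + _ from ?_) (q i - j)
      · simpa [Nat.sub_sub_self hqj] using this
      · rcases Nat.lt_or_ge k (q i) with hk | hk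
        · obtain ⟨m, hm⟩ : ∃ m, q i = k + 1 + m := ⟨q i - (k + 1), by omega⟩
          rw [show q i - k = m + 1 by omega, show q i - (k + 1) = m by omega]
          have h3 := hgh i m
          have h4 := abs_add_le ((1 + h i * (n / (a + (m + 1 : ℕ) * h i))) * (p i (m + 1)).2) (h i * g (p i (m + 1)).1)
          rw [step, sub_add_cancel, ← step, abs_mul, abs_of_nonneg (zero_le_one.trans (hD i m).1)] at h4
          have := mul_le_mul_of_nonneg_right (hD i m).2 (abs_nonneg (p i (m + 1)).2)
          linarith
        · rw [show q i - k = 0 by omega, show q i - (k + 1) = 0 by omega]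
          nlinarith [abs_nonneg (p i 0).2, mul_nonneg hi hB0]
  obtain ⟨L, hL, hL1, hL2⟩ : ∃ L : ℝ, 0 ≤ L ∧ M ≤ L ∧ n / a * M + B ≤ L :=
    ⟨max 0 (max M _), le_max_left _ _, (le_max_left _ _).trans (le_max_right _ _),
      (le_max_right _ _).trans (le_max_right _ _)⟩
  have stepu : ∀ i j, (p i (j + 1)).1 - (p i j).1 = h i * (p i j).2 := fun i j => by rw [hp, eulerMap]; ring
  have stepv : ∀ i j, (p i (j + 1)).2 - (p i j).2 =
      h i * (-(n / (a + (j + 1 : ℕ) * h i)) * (p i (j + 1)).2 - g (p i (j + 1)).1) := fun i j => by linarith [step i j]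
  have lip : ∀ i, ∀ j ≤ i + 1, ∀ k ≤ i + 1, |(p i k).1 - (p i j).1| ≤ h i * L * |(k : ℝ) - j| ∧
      |(p i k).2 - (p i j).2| ≤ h i * L * |(k : ℝ) - j| := fun i j hj k hk => by
    have hi := (hpos i).le
    refine ⟨abs_sub_le_of_steps (x := fun m => (p i m).1) j k fun m _ h2 => ?_,
      abs_sub_le_of_steps (x := fun m => (p i m).2) j k fun m _ h2 => ?_⟩
    · rw [stepu, abs_mul, abs_of_nonneg hi]; gcongr
      exact (hvM i m (by omega)).trans hL1
    · rw [stepv, abs_mul, abs_of_nonneg hi]; gcongr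
      refine (abs_sub _ _).trans (le_trans (add_le_add ?_ (hB _)) hL2)
      rw [abs_mul, abs_neg, abs_of_nonneg (by positivity)]
      gcongr
      · exact le_add_of_nonneg_right (by positivity)
      · exact hvM i (m + 1) (by omega)
  have lim : ∀ t ∈ Icc a b, ∃ y w, Tendsto (fun i => (p i ⌊(t - a) / h i⌋₊).1) (hyperfilter ℕ) (𝓝 y) ∧
      Tendsto (fun i => (p i ⌊(t - a) / h i⌋₊).2) (hyperfilter ℕ) (𝓝 w) := fun t ht => by
    obtain ⟨y, -, hy⟩ := exists_ultrafilter_lim (hyperfilter ℕ) (x := fun i => (p i ⌊(t - a) / h i⌋₊).1)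
      (a := lo - L * (b - a)) (b := hi + L * (b - a)) (Eventually.of_forall fun i => by
        have k1 := (lip i _ (hq i) _ (floor_grid hpos hend i ht).1).1
        have k2 : h i * L * |(⌊(t - a) / h i⌋₊ : ℝ) - q i| ≤ L * (b - a) := by
          rw [mul_right_comm, mul_comm, ← abs_of_pos (hpos i), ← abs_mul, abs_of_pos (hpos i)]
          refine mul_le_mul_of_nonneg_left (abs_le.2 ?_) hL
          have := hkh i _ (hq i)
          have := hkh i _ (floor_grid hpos hend i ht).1
          have := (hpos i).le
          have : 0 ≤ (q i : ℝ) * h i := by positivity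
          have : 0 ≤ (⌊(t - a) / h i⌋₊ : ℝ) * h i := by positivity
          constructor <;> linarith
        have k3 := abs_le.1 (k1.trans k2)
        have k4 := (hpq i).1
        exact ⟨by linarith [k4.1], by linarith [k4.2]⟩)
    obtain ⟨w, -, hw⟩ := exists_ultrafilter_lim (hyperfilter ℕ) (x := fun i => (p i ⌊(t - a) / h i⌋₊).2)
      (Eventually.of_forall fun i => abs_le.1 (hvM i _ (floor_grid hpos hend i ht).1))
    exact ⟨y, w, hy, hw⟩
  choose! U W hU hW using lim
  refine ⟨U, W, fun s hs => ?_, ?_⟩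
  · have near : ∀ ρ > 0, ∃ δ > 0, ∀ᶠ i in (hyperfilter ℕ : Filter ℕ), ∀ j : ℕ, j ≤ i + 1 → |a + j * h i - s| < δ →
        |(p i j).1 - U s| < ρ ∧ |(p i j).2 - W s| < ρ := by
      refine fun ρ hρ => ⟨ρ / 4 / (L + 1), by positivity, ?_⟩
      filter_upwards [(hU s hs) (Metric.ball_mem_nhds _ (half_pos hρ)), (hW s hs) (Metric.ball_mem_nhds _ (half_pos hρ)),
        hlim.eventually_lt_const (by positivity : 0 < ρ / 4 / (L + 1))] with i hU hW hh j hj hδ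
      have hU : |_ - U s| < ρ / 2 := hU
      have hW : |_ - W s| < ρ / 2 := hW
      obtain ⟨k1, k2, k3⟩ := floor_grid hpos hend i hs
      obtain ⟨l1, l2⟩ := lip i _ k1 j hj
      have k4 : h i * |(j : ℝ) - ⌊(s - a) / h i⌋₊| ≤ |a + j * h i - s| + h i := by
        rw [← abs_of_pos (hpos i), ← abs_mul, abs_of_pos (hpos i), abs_le]
        have := le_abs_self (a + j * h i - s)
        have := neg_abs_le (a + j * h i - s)
        constructor <;> linarith
      rw [mul_right_comm] at l1 l2
      rw [lt_div_iff₀ (by positivity)] at hδ hh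
      have h5 := mul_le_mul_of_nonneg_right k4 hL
      have := hpos i
      have := abs_nonneg (a + j * h i - s)
      exact ⟨(abs_sub_le _ _ _).trans_lt (add_lt_add_of_le_of_lt (l1.trans h5) hU |>.trans_le (by linarith)),
        (abs_sub_le _ _ _).trans_lt (add_lt_add_of_le_of_lt (l2.trans h5) hW |>.trans_le (by linarith))⟩
    refine ⟨hasDerivWithinAt_of_steps (x := fun i j => (p i j).1) hpos hend hlim hs hU fun ε hε => ?_,
      hasDerivWithinAt_of_steps (x := fun i j => (p i j).2) hpos hend hlim hs hW fun ε hε => ?_⟩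
    · obtain ⟨δ, hδ, hn⟩ := near ε hε
      refine ⟨δ, hδ, hn.mono fun i hi j hj hd => ?_⟩
      rw [stepu, ← mul_sub, abs_mul, abs_of_pos (hpos i), mul_comm]
      exact mul_le_mul_of_nonneg_right (hi j (by omega) hd).2.le (hpos i).le
    · have hc : ContinuousAt (fun p : ℝ × ℝ × ℝ => -(n / p.1) * p.2.2 - g p.2.1) (s, U s, W s) := by
        have := (ha.trans_le hs.1).ne'
        fun_prop (disch := assumption)
      obtain ⟨ρ, hρ, hc⟩ := Metric.continuousAt_iff.1 hc ε hε
      obtain ⟨δ, hδ, hn⟩ := near ρ hρ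
      have hm := lt_min hδ hρ
      refine ⟨min δ ρ / 2, half_pos hm, ?_⟩
      filter_upwards [hn, hlim.eventually_lt_const (half_pos hm)] with i hn hh j hj hd
      have hd : |a + (j + 1 : ℕ) * h i - s| < min δ ρ := by
        rw [abs_lt] at hd ⊢; push_cast
        constructor <;> linarith [hpos i]
      obtain ⟨h1, h2⟩ := hn (j + 1) (by omega) (hd.trans_le (min_le_left _ _))
      rw [stepv, ← mul_sub, abs_mul, abs_of_pos (hpos i), mul_comm]
      exact mul_le_mul_of_nonneg_right (hc (x := (a + (j + 1 : ℕ) * h i, (p i (j + 1)).1, (p i (j + 1)).2))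
        (max_lt (hd.trans_le (min_le_right _ _)) (max_lt h1 h2))).le (hpos i).le
  · have fb : ∀ i, ⌊(b - a) / h i⌋₊ = i + 1 := fun i => by
      rw [← hend i, add_sub_cancel_left, mul_div_cancel_right₀ _ (hpos i).ne', Nat.floor_natCast]
    have hUa := hU a ⟨le_rfl, hab⟩
    have hWa := hW a ⟨le_rfl, hab⟩
    have hUb := hU b ⟨hab, le_rfl⟩
    have hWb := hW b ⟨hab, le_rfl⟩
    simp only [fb, sub_self, zero_div, Nat.floor_zero] at hUa hWa hUb hWb; exact ⟨hUa, hWa, hUb, hWb⟩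

theorem tendsto_step (c : ℝ) : Tendsto (fun i : ℕ => c / (i + 1 : ℕ)) (hyperfilter ℕ) (𝓝 0) :=
  ((tendsto_const_div_atTop_nhds_zero_nat c).comp (tendsto_add_atTop_nat 1)).mono_left Nat.hyperfilter_le_atTop

/-- State of the Euler scheme after `j` steps of length `h`, starting at time `a`. -/
noncomputable def eulerState (n : ℕ) (g : ℝ → ℝ) (h a : ℝ) (p : ℝ × ℝ) : ℕ → ℝ × ℝ
  | 0 => p
  | j + 1 => eulerMap n g h (a + (j + 1 : ℕ) * h) (eulerState n g h a p j)

theorem exists_traj_Icc (n : ℕ) {g : ℝ → ℝ} (hg : Continuous g) {B : ℝ} (ha : 0 < a) (hab : a < b)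
    (hB : ∀ s, |g s| ≤ B) (u₀ v₀ : ℝ) : ∃ u v : ℝ → ℝ, IsTraj n g u v (Icc a b) ∧ u a = u₀ ∧ v a = v₀ := by
  obtain ⟨U, W, hT, hU, hW, -⟩ := euler_limit (n := n) (b := b) (h := fun i => (b - a) / (i + 1 : ℕ)) (lo := u₀) (hi := u₀)
    (V := |v₀|) (q := fun _ => 0) (p := fun i => eulerState n g ((b - a) / (i + 1 : ℕ)) a (u₀, v₀)) hg hB ha
    (fun i => div_pos (sub_pos.2 hab) (by positivity)) (fun i => by field_simp; ring) (tendsto_step _)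
    (fun i j => rfl) (fun i => by omega) (fun i => ⟨⟨le_rfl, le_rfl⟩, le_rfl⟩)
  exact ⟨U, W, hT, tendsto_nhds_unique hU tendsto_const_nhds, tendsto_nhds_unique hW tendsto_const_nhds⟩

end euler

/-- Standing facts on a nonlinearity `f` with primitive `F` on the open interval `O`. -/
structure Nonlin (f F : ℝ → ℝ) (O : Set ℝ) : Prop where
  isOpen : IsOpen O
  conn : O.OrdConnected
  zero_mem : (0 : ℝ) ∈ O
  cont : ContinuousOn f O
  deriv : ∀ s ∈ O, HasDerivAt F (f s) s
  lip : ∀ s ∈ O, s ≠ 0 → ∃ K, ∃ t ∈ 𝓝 s, LipschitzOnWith K f t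
  f_zero : f 0 = 0
  F_zero : F 0 = 0

theorem IsTraj.hasDerivWithinAt_energy {n : ℕ} {f F u v : ℝ → ℝ} {S : Set ℝ} {t : ℝ} (h : IsTraj n f u v S)
    (ht : t ∈ S) (hF : HasDerivAt F (f (u t)) (u t)) :
    HasDerivWithinAt (fun t => v t ^ 2 / 2 + F (u t)) (-((n : ℝ) / t) * v t ^ 2) S t := by
  obtain ⟨h1, h2⟩ := h t ht
  refine (((h2.pow 2).div_const 2).add (hF.comp_hasDerivWithinAt t h1)).congr_deriv ?_
  push_cast; ring

theorem IsTraj.weighted {n : ℕ} {f u v : ℝ → ℝ} {S : Set ℝ} {t : ℝ} (h : IsTraj n f u v S) (ht : t ∈ S) (h0 : t ≠ 0) :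
    HasDerivWithinAt (fun t => t ^ n * v t) (-(t ^ n * f (u t))) S t := by
  refine (((hasDerivAt_pow n t).hasDerivWithinAt (s := S)).mul (h t ht).2).congr_deriv ?_
  rcases n with _ | n
  · simp
  · rw [Nat.add_sub_cancel]; push_cast; field_simp; ring

theorem IsTraj.continuousOn {n : ℕ} {f u v : ℝ → ℝ} {S : Set ℝ} (h : IsTraj n f u v S) :
    ContinuousOn u S ∧ ContinuousOn v S :=
  ⟨fun t ht => (h t ht).1.continuousWithinAt, fun t ht => (h t ht).2.continuousWithinAt⟩

theorem abs_sub_le_of_hasDerivAt {g g' : ℝ → ℝ} {a b C : ℝ} (hab : a ≤ b)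
    (hc : ContinuousOn g (Icc a b)) (hg : ∀ x ∈ Ioo a b, HasDerivAt g (g' x) x)
    (hC : ∀ x ∈ Ioo a b, |g' x| ≤ C) : |g b - g a| ≤ C * (b - a) := by
  rcases hab.eq_or_lt with rfl | hab
  · simp
  obtain ⟨c, hc, h⟩ := exists_hasDerivAt_eq_slope g g' hab hc hg
  rw [eq_div_iff (by linarith)] at h
  rw [← h, abs_mul, abs_of_pos (by linarith : 0 < b - a)]
  exact mul_le_mul_of_nonneg_right (hC c hc) (by linarith)

theorem abs_le_of_weighted {n : ℕ} {w g : ℝ → ℝ} {a t B : ℝ} (ha : 0 ≤ a) (hat : a ≤ t)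
    (hc : ContinuousOn w (Icc a t)) (hw : w a = 0)
    (hd : ∀ s ∈ Ioo a t, HasDerivAt (fun s => s ^ n * w s) (-(s ^ n * g s)) s)
    (hg : ∀ s ∈ Ioo a t, |g s| ≤ B) : |w t| ≤ B * (t - a) := by
  rcases hat.eq_or_lt with rfl | hlt
  · simp [hw]
  have ht : 0 < t ^ n := pow_pos (ha.trans_lt hlt) n
  have := abs_sub_le_of_hasDerivAt hat ((continuous_pow n).continuousOn.mul hc) hd fun s hs => by
    rw [abs_neg, abs_mul, abs_of_nonneg (pow_nonneg (ha.trans hs.1.le) n)]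
    exact mul_le_mul (pow_le_pow_left₀ (ha.trans hs.1.le) hs.2.le n) (hg s hs) (abs_nonneg _) ht.le
  simp only [Pi.mul_apply, hw, mul_zero, sub_zero, abs_mul, abs_of_pos ht, mul_assoc] at this
  exact le_of_mul_le_mul_left this ht

theorem exists_limit {ι : Type*} {l : Ultrafilter ι} {n : ℕ} {f : ℝ → ℝ} (hf : Continuous f) {α B : ℝ}
    {β : ι → ℝ} (hβ : Tendsto β l (𝓝 α)) {u v : ι → ℝ → ℝ}
    (h : ∀ a > 0, ∀ b, ∀ᶠ i in (l : Filter ι), IsTraj n f (u i) (v i) (Icc a b) ∧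
      ∀ t ∈ Icc a b, |v i t| ≤ B * t ∧ |u i t - β i| ≤ B * t ^ 2) :
    ∃ U W, IsTraj n f U W (Ioi 0) ∧ U 0 = α ∧ W 0 = 0 ∧ ContinuousOn U (Ici 0) ∧ ContinuousOn W (Ici 0) ∧
      ∀ t, 0 < t → Tendsto (fun i => u i t) l (𝓝 (U t)) ∧ Tendsto (fun i => v i t) l (𝓝 (W t)) := by
  have hB : 0 ≤ B := by
    obtain ⟨i, -, hi⟩ := (h 1 one_pos 1).exists
    linarith [(abs_nonneg _).trans (hi 1 (left_mem_Icc.2 le_rfl)).1]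
  have hb : ∀ a > 0, ∀ b, ∀ᶠ i in (l : Filter ι), ∀ t ∈ Icc a b,
      u i t ∈ Icc (α - 1 - B * b ^ 2) (α + 1 + B * b ^ 2) ∧ |v i t| ≤ B * b := fun a ha b => by
    filter_upwards [h a ha b, hβ (Metric.ball_mem_nhds α one_pos)] with i hi h2
    intro t ht
    obtain ⟨h3, h4⟩ := hi.2 t ht
    have h5 : B * t ^ 2 ≤ B * b ^ 2 := by have := ha.le.trans ht.1; gcongr; exact ht.2
    have h2 : |β i - α| < 1 := h2
    rw [abs_le] at h4; rw [abs_lt] at h2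
    exact ⟨⟨by linarith, by linarith⟩, h3.trans (mul_le_mul_of_nonneg_left ht.2 hB)⟩
  have lim : ∀ t, ∃ y w, (0 < t → Tendsto (fun i => u i t) l (𝓝 y) ∧ Tendsto (fun i => v i t) l (𝓝 w)) ∧
      (t = 0 → y = α ∧ w = 0) := fun t => by
    by_cases ht : 0 < t
    · have hb := (hb t ht t).mono fun i hi => hi t (left_mem_Icc.2 le_rfl)
      obtain ⟨y, -, hy⟩ := exists_ultrafilter_lim l (hb.mono fun i hi => hi.1)
      obtain ⟨w, -, hw⟩ := exists_ultrafilter_lim l (hb.mono fun i hi => abs_le.1 hi.2)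
      exact ⟨y, w, fun _ => ⟨hy, hw⟩, fun e => absurd e ht.ne'⟩
    · exact ⟨α, 0, fun h => absurd h ht, fun _ => ⟨rfl, rfl⟩⟩
  choose U W hl h0 using lim
  have hT : IsTraj n f U W (Ioi 0) := fun t (ht : 0 < t) => by
    have ha : 0 < t / 2 := by positivity
    have hn : Icc (t / 2) (2 * t) ∈ 𝓝 t := Icc_mem_nhds (by linarith) (by linarith)
    obtain ⟨k1, k2⟩ := IsTraj.limit hf ha ((h _ ha (2 * t)).mono fun i hi => hi.1)
      ((hb _ ha _).mono fun i hi s hs => (hi s hs).1) ((hb _ ha _).mono fun i hi s hs => (hi s hs).2)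
      (fun s hs => (hl s (ha.trans_le hs.1)).1) (fun s hs => (hl s (ha.trans_le hs.1)).2) t (mem_of_mem_nhds hn)
    exact ⟨(k1.hasDerivAt hn).hasDerivWithinAt, (k2.hasDerivAt hn).hasDerivWithinAt⟩
  have cont : ∀ w : ℝ → ℝ, (∀ t, 0 < t → ContinuousAt w t ∧ |w t - w 0| ≤ B * t + B * t ^ 2) →
      ContinuousOn w (Ici 0) := fun w hw t ht => by
    rcases (mem_Ici.1 ht).eq_or_lt with rfl | ht
    · rw [ContinuousWithinAt, tendsto_iff_norm_sub_tendsto_zero]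
      have l0 : Tendsto (fun t : ℝ => B * t + B * t ^ 2) (𝓝 0) (𝓝 (B * 0 + B * 0 ^ 2)) := Continuous.tendsto (by fun_prop) 0
      refine squeeze_zero' (Eventually.of_forall fun _ => norm_nonneg _) ?_ ((by simpa using l0 :
        Tendsto (fun t : ℝ => B * t + B * t ^ 2) (𝓝 0) (𝓝 0)).mono_left nhdsWithin_le_nhds)
      filter_upwards [self_mem_nhdsWithin] with s hs
      rcases (mem_Ici.1 hs).eq_or_lt with rfl | hs
      · simp
      · exact (hw s hs).2
    · exact (hw t ht).1.continuousWithinAt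
  have e := h0 0 rfl
  refine ⟨U, W, hT, e.1, e.2, cont U fun t ht => ⟨((hT t ht).1.hasDerivAt (Ioi_mem_nhds ht)).continuousAt, ?_⟩,
    cont W fun t ht => ⟨((hT t ht).2.hasDerivAt (Ioi_mem_nhds ht)).continuousAt, ?_⟩, hl⟩
  · rw [e.1]
    exact (le_of_tendsto ((hl t ht).1.sub hβ).abs ((h t ht t).mono fun i hi =>
      (hi.2 t (left_mem_Icc.2 le_rfl)).2)).trans (le_add_of_nonneg_left (by positivity))
  · rw [e.2, sub_zero]
    exact (le_of_tendsto (hl t ht).2.abs ((h t ht t).mono fun i hi =>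
      (hi.2 t (left_mem_Icc.2 le_rfl)).1)).trans (le_add_of_nonneg_right (by positivity))

/-- Existence of regular solutions for bounded nonlinearities. -/
theorem exists_regular (n : ℕ) {f : ℝ → ℝ} (hf : Continuous f) {B : ℝ} (hB : ∀ s, |f s| ≤ B) (α : ℝ) :
    ∃ u v : ℝ → ℝ, IsTraj n f u v (Ioi 0) ∧ u 0 = α ∧ v 0 = 0 ∧ ContinuousOn u (Ici 0) ∧ ContinuousOn v (Ici 0) := by
  have hB0 : 0 ≤ B := (abs_nonneg _).trans (hB 0)
  have hi0 : ∀ i : ℕ, 0 < 1 / (i + 1 : ℝ) := fun i => by positivity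
  have ex : ∀ i : ℕ, ∃ u v : ℝ → ℝ, IsTraj n f u v (Icc (1 / (i + 1 : ℝ)) (i + 2)) ∧
      u (1 / (i + 1 : ℝ)) = α ∧ v (1 / (i + 1 : ℝ)) = 0 := fun i => by
    have hi := (Nat.cast_nonneg i : (0 : ℝ) ≤ i)
    have : (1 : ℝ) / (i + 1) ≤ 1 := div_le_one_of_le₀ (by linarith) (by linarith)
    exact exists_traj_Icc n hf (hi0 i) (by linarith) hB α 0
  choose u v hT hu hv using ex
  have hs : ∀ (i : ℕ) {t : ℝ}, t ∈ Icc (1 / (i + 1 : ℝ)) (i + 2) →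
      IsTraj n f (u i) (v i) (Icc (1 / (i + 1 : ℝ)) t) := fun i t ht => (hT i).mono (Icc_subset_Icc_right ht.2)
  have vb : ∀ i : ℕ, ∀ t ∈ Icc (1 / (i + 1 : ℝ)) (i + 2), |v i t| ≤ B * t := fun i t ht =>
    (abs_le_of_weighted (n := n) (hi0 i).le ht.1 (hs i ht).continuousOn.2 (hv i) (fun s hs' => ((hs i ht).weighted
      (Ioo_subset_Icc_self hs') ((hi0 i).trans hs'.1).ne').hasDerivAt (Icc_mem_nhds hs'.1 hs'.2))
      fun s _ => hB _).trans (mul_le_mul_of_nonneg_left (by linarith [hi0 i]) hB0)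
  have ub : ∀ i : ℕ, ∀ t ∈ Icc (1 / (i + 1 : ℝ)) (i + 2), |u i t - α| ≤ B * t ^ 2 := fun i t ht => by
    have ht0 := (hi0 i).trans_le ht.1
    have := abs_sub_le_of_hasDerivAt (C := B * t) ht.1 (hs i ht).continuousOn.1 (fun s hs' =>
      (hs i ht s (Ioo_subset_Icc_self hs')).1.hasDerivAt (Icc_mem_nhds hs'.1 hs'.2)) fun s hs' =>
      (vb i s ⟨hs'.1.le, hs'.2.le.trans ht.2⟩).trans (mul_le_mul_of_nonneg_left hs'.2.le hB0)
    rw [hu] at this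
    have := mul_nonneg (mul_nonneg hB0 ht0.le) (hi0 i).le
    linarith
  obtain ⟨U, W, h1, h2, h3, h4, h5, -⟩ := exists_limit (l := hyperfilter ℕ) hf (tendsto_const_nhds (x := α))
    (u := u) (v := v) (B := B) fun a ha b => by
      filter_upwards [((tendsto_one_div_add_atTop_nhds_zero_nat).eventually_lt_const ha).filter_mono
        Nat.hyperfilter_le_atTop, (tendsto_natCast_atTop_atTop.eventually_ge_atTop b).filter_mono
        Nat.hyperfilter_le_atTop] with i h1 h2
      have hs : Icc a b ⊆ Icc (1 / (i + 1 : ℝ)) (i + 2) := Icc_subset_Icc h1.le (by linarith)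
      exact ⟨(hT i).mono hs, fun t ht => ⟨vb i t (hs ht), ub i t (hs ht)⟩⟩
  exact ⟨U, W, h1, h2, h3, h4, h5⟩

theorem Nonlin.exists_lipschitz_F {f F : ℝ → ℝ} {O : Set ℝ} (H : Nonlin f F O) {s : ℝ}
    (hs : s ∈ O) : ∃ K : ℝ, 0 ≤ K ∧ ∃ r > 0, ∀ p ∈ Icc (s - r) (s + r),
      ∀ q ∈ Icc (s - r) (s + r), |F p - F q| ≤ K * |p - q| := by
  obtain ⟨r, hr, hrO⟩ := Metric.isOpen_iff.1 H.isOpen s hs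
  have hsub : Icc (s - r / 2) (s + r / 2) ⊆ O := fun p hp => hrO (by
    rw [Metric.mem_ball, Real.dist_eq, abs_lt]
    constructor <;> linarith [hp.1, hp.2])
  obtain ⟨K, hK⟩ := isCompact_Icc.exists_bound_of_continuousOn (H.cont.mono hsub)
  refine ⟨max K 0, le_max_right _ _, r / 2, by positivity, fun p hp q hq => ?_⟩
  exact (convex_Icc _ _).norm_image_sub_le_of_norm_hasDerivWithin_le (fun x hx => (H.deriv x (hsub hx)).hasDerivWithinAt)
    (fun x hx => (hK x hx).trans (le_max_left _ _)) hq hp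

section uniqueness
variable {n : ℕ} {f F u v u' v' : ℝ → ℝ} {a b : ℝ}

theorem IsTraj.at (h : IsTraj n f u v (Ioo a b)) {t : ℝ} (ht : t ∈ Ioo a b) :
    HasDerivAt u (v t) t ∧ HasDerivAt v (-((n : ℝ) / t) * v t - f (u t)) t :=
  ⟨(h t ht).1.hasDerivAt (Ioo_mem_nhds ht.1 ht.2), (h t ht).2.hasDerivAt (Ioo_mem_nhds ht.1 ht.2)⟩

theorem uniq_local_lip (ha : 0 ≤ a) (hab : a < b) (h : IsTraj n f u v (Ioo a b)) (h' : IsTraj n f u' v' (Ioo a b))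
    (hcu : ContinuousOn u (Icc a b)) (hcv : ContinuousOn v (Icc a b)) (hcu' : ContinuousOn u' (Icc a b))
    (hcv' : ContinuousOn v' (Icc a b)) (hlip : ∃ K, ∃ t ∈ 𝓝 (u a), LipschitzOnWith K f t) (hu : u a = u' a)
    (hv : v a = v' a) : ∀ᶠ t in 𝓝[>] a, u t = u' t ∧ v t = v' t := by
  obtain ⟨K, N, hN, hK⟩ := hlip
  have hK0 : (0 : ℝ) ≤ K := K.2
  have lim : ∀ {w : ℝ → ℝ}, ContinuousOn w (Icc a b) → Tendsto w (𝓝[≥] a) (𝓝 (w a)) := fun hw =>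
    (hw a ⟨le_rfl, hab.le⟩).mono_of_mem_nhdsWithin (Icc_mem_nhdsGE hab)
  obtain ⟨c, hc, hcN⟩ := mem_nhdsGE_iff_exists_Icc_subset.1 (((lim hcu).eventually hN).and
    (((lim hcu').eventually (hu ▸ hN)).and (((lim (w := fun t => K * (t - a) ^ 2) (by fun_prop)).eventually_lt_const
      (by simp : (K : ℝ) * (a - a) ^ 2 < 1)).and (Icc_mem_nhdsGE hab))))
  have hc : a < c := hc
  have sub : ∀ {t}, t ∈ Icc a c → Icc a t ⊆ Icc a b := fun ht => Icc_subset_Icc_right (hcN ht).2.2.2.2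
  have mem : ∀ {s t}, t ∈ Icc a c → s ∈ Ioo a t → s ∈ Icc a c ∧ s ∈ Ioo a b := fun ht hs =>
    ⟨⟨hs.1.le, hs.2.le.trans ht.2⟩, hs.1, hs.2.trans_le (hcN ht).2.2.2.2⟩
  obtain ⟨x, hx, hmax⟩ := isCompact_Icc.exists_isMaxOn ⟨a, le_rfl, hc.le⟩ ((hcu.sub hcu').abs.mono (sub ⟨hc.le, le_rfl⟩))
  have hM : ∀ t ∈ Icc a c, |u t - u' t| ≤ |u x - u' x| := hmax
  set M := |u x - u' x|
  have hM0 : 0 ≤ M := abs_nonneg _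
  have hvM : ∀ t ∈ Icc a c, |v t - v' t| ≤ K * M * (t - a) := fun t ht =>
    abs_le_of_weighted (n := n) (w := fun t => v t - v' t) (g := fun t => f (u t) - f (u' t)) ha ht.1
      ((hcv.sub hcv').mono (sub ht)) (by simp [hv]) (fun s hs => by
        have hs := (mem ht hs).2
        have h0 := (ha.trans_lt hs.1).ne'
        simp only [mul_sub]
        exact (((h.weighted hs h0).sub (h'.weighted hs h0)).hasDerivAt (Ioo_mem_nhds hs.1 hs.2)).congr_deriv
          (by ring)) fun s hs => by
        have hs := (mem ht hs).1
        exact (hK.dist_le_mul _ (hcN hs).1 _ (hcN hs).2.1).trans (mul_le_mul_of_nonneg_left (hM s hs) hK0)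
  have h1 := abs_sub_le_of_hasDerivAt (C := K * M * (x - a)) hx.1 ((hcu.sub hcu').mono (sub hx))
    (fun s hs => (h.at (mem hx hs).2).1.sub (h'.at (mem hx hs).2).1) fun s hs => (hvM s (mem hx hs).1).trans
      (mul_le_mul_of_nonneg_left (by linarith [hs.2]) (mul_nonneg hK0 hM0))
  have h2 : M ≤ 0 := by
    have h3 : (K : ℝ) * (x - a) ^ 2 < 1 := (hcN hx).2.2.1
    have h1 : M ≤ K * M * (x - a) * (x - a) := by simpa [hu] using h1
    nlinarith
  filter_upwards [Ioc_mem_nhdsGT hc] with t ht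
  have ht := Ioc_subset_Icc_self ht
  refine ⟨sub_eq_zero.1 (abs_nonpos_iff.1 ((hM t ht).trans h2)), sub_eq_zero.1 (abs_nonpos_iff.1 ((hvM t ht).trans ?_))⟩
  rw [le_antisymm h2 hM0, mul_zero, zero_mul]

theorem uniq_local_energy {O : Set ℝ} (H : Nonlin f F O) (ha : 0 < a) (hab : a < b) (h : IsTraj n f u v (Ioo a b))
    (h' : IsTraj n f u' v' (Ioo a b)) (hcu : ContinuousOn u (Icc a b)) (hcv : ContinuousOn v (Icc a b))
    (hcu' : ContinuousOn u' (Icc a b)) (hcv' : ContinuousOn v' (Icc a b)) (hO : ∀ t ∈ Icc a b, u t ∈ O)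
    (hO' : ∀ t ∈ Icc a b, u' t ∈ O) (hu : u a = u' a) (hv : v a = v' a) (hva : v a ≠ 0) :
    ∀ᶠ t in 𝓝[>] a, u t = u' t ∧ v t = v' t := by
  obtain ⟨K, hK0, r, hr, hK⟩ := H.exists_lipschitz_F (hO a ⟨le_rfl, hab.le⟩)
  have lim : ∀ {w : ℝ → ℝ}, ContinuousOn w (Icc a b) → Tendsto w (𝓝[≥] a) (𝓝 (w a)) := fun hw =>
    (hw a ⟨le_rfl, hab.le⟩).mono_of_mem_nhdsWithin (Icc_mem_nhdsGE hab)
  have hm0 := abs_pos.2 hva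
  set m := |v a|
  set C := 2 * (1 + K) * (1 / m + n / a)
  have hN : Icc (u a - r) (u a + r) ∈ 𝓝 (u a) := Icc_mem_nhds (by linarith) (by linarith)
  obtain ⟨c, hc, hcN⟩ := mem_nhdsGE_iff_exists_Icc_subset.1 (((lim hcu).eventually hN).and
    (((lim hcu').eventually (p := (· ∈ Icc (u a - r) (u a + r))) (by rwa [← hu])).and (((lim (w := fun t => C * (t - a)) (by fun_prop)).eventually_lt_const
      (by simp : C * (a - a) < 1)).and ((((lim (hcv.add hcv')).abs.eventually_const_lt (by
        rw [Pi.add_apply, ← hv, ← two_mul, abs_mul, abs_two]; linarith : m < _))).and (Icc_mem_nhdsGE hab)))))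
  have hc : a < c := hc
  have sub : ∀ {t}, t ∈ Icc a c → Icc a t ⊆ Icc a b := fun ht => Icc_subset_Icc_right (hcN ht).2.2.2.2.2
  have mem : ∀ {s t}, t ∈ Icc a c → s ∈ Ioo a t → s ∈ Icc a c ∧ s ∈ Ioo a b := fun ht hs =>
    ⟨⟨hs.1.le, hs.2.le.trans ht.2⟩, hs.1, hs.2.trans_le (hcN ht).2.2.2.2.2⟩
  have cE : ∀ {w w' : ℝ → ℝ}, ContinuousOn w (Icc a b) → ContinuousOn w' (Icc a b) → (∀ t ∈ Icc a b, w t ∈ O) →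
      ContinuousOn (fun t => w' t ^ 2 / 2 + F (w t)) (Icc a b) := fun hw hw' hO =>
    ((hw'.pow 2).div_const 2).add fun t ht => (H.deriv _ (hO t ht)).continuousAt.comp_continuousWithinAt (hw t ht)
  have cE := (cE hcu hcv hO).sub (cE hcu' hcv' hO')
  obtain ⟨x, hx, hmax⟩ := isCompact_Icc.exists_isMaxOn ⟨a, le_rfl, hc.le⟩
    (((hcu.sub hcu').abs.add cE.abs).mono (sub ⟨hc.le, le_rfl⟩))
  have hM : ∀ t ∈ Icc a c, |u t - u' t| + |v t ^ 2 / 2 + F (u t) - (v' t ^ 2 / 2 + F (u' t))| ≤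
    |u x - u' x| + |v x ^ 2 / 2 + F (u x) - (v' x ^ 2 / 2 + F (u' x))| := hmax
  set M := |u x - u' x| + |v x ^ 2 / 2 + F (u x) - (v' x ^ 2 / 2 + F (u' x))| with hMd
  have hM0 : 0 ≤ M := by positivity
  have hD : ∀ t ∈ Icc a c, |v t ^ 2 - v' t ^ 2| ≤ 2 * (1 + K) * M := fun t ht => by
    have h1 := hK _ (hcN ht).1 _ (hcN ht).2.1
    have h2 := hM t ht
    have h3 := abs_nonneg (u t - u' t)
    have h4 : |v t ^ 2 - v' t ^ 2| ≤ 2 * |v t ^ 2 / 2 + F (u t) - (v' t ^ 2 / 2 + F (u' t))| + 2 * |F (u t) - F (u' t)| := by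
      rw [← abs_two, ← abs_mul, ← abs_mul, abs_two]
      exact (abs_sub _ _).trans' (le_of_eq (by ring_nf))
    nlinarith [abs_nonneg (v t ^ 2 / 2 + F (u t) - (v' t ^ 2 / 2 + F (u' t)))]
  have hvM : ∀ t ∈ Icc a c, |v t - v' t| ≤ 2 * (1 + K) * M / m := fun t ht => by
    rw [le_div_iff₀ hm0]
    refine (mul_le_mul_of_nonneg_left (hcN ht).2.2.2.1.le (abs_nonneg _)).trans (le_trans (le_of_eq ?_) (hD t ht))
    rw [← abs_mul, Pi.add_apply]; ring_nf
  have h1 := abs_sub_le_of_hasDerivAt hx.1 ((hcu.sub hcu').mono (sub hx))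
    (fun s hs => (h.at (mem hx hs).2).1.sub (h'.at (mem hx hs).2).1) fun s hs => hvM s (mem hx hs).1
  have h2 := abs_sub_le_of_hasDerivAt (C := n / a * (2 * (1 + K) * M)) hx.1 (cE.mono (sub hx)) (fun s hs => by
      have hs := (mem hx hs).2
      have hn := Ioo_mem_nhds hs.1 hs.2
      exact ((h.hasDerivWithinAt_energy hs (H.deriv _ (hO s (Ioo_subset_Icc_self hs)))).hasDerivAt hn).sub
        ((h'.hasDerivWithinAt_energy hs (H.deriv _ (hO' s (Ioo_subset_Icc_self hs)))).hasDerivAt hn)) fun s hs => by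
      rw [← mul_sub, abs_mul, abs_neg, abs_of_nonneg (div_nonneg n.cast_nonneg (ha.trans hs.1).le)]
      have := hs.1.le
      gcongr; exact hD s (mem hx hs).1
  have h3 : M ≤ 0 := by
    have h4 : C * (x - a) < 1 := (hcN hx).2.2.1
    have h5 : M ≤ C * (x - a) * M := by
      simp only [Pi.sub_apply, hu, hv, sub_self, sub_zero] at h1 h2
      refine (add_le_add h1 h2).trans (le_of_eq ?_)
      simp only [C]; ring
    nlinarith
  filter_upwards [Ioc_mem_nhdsGT hc] with t ht
  have ht := Ioc_subset_Icc_self ht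
  have z : M = 0 := le_antisymm h3 hM0
  have hv := hvM t ht
  have hu := hM t ht
  rw [z] at hu hv; rw [mul_zero, zero_div] at hv
  exact ⟨sub_eq_zero.1 (abs_nonpos_iff.1 (by linarith [abs_nonneg (v t ^ 2 / 2 + F (u t) - (v' t ^ 2 / 2 + F (u' t)))])),
    sub_eq_zero.1 (abs_nonpos_iff.1 hv)⟩

/-- Forward uniqueness, as long as `(0,0)` is not reached. -/
theorem uniq_forward {O : Set ℝ} (H : Nonlin f F O) (ha : 0 ≤ a) (h : IsTraj n f u v (Ioo a b))
    (h' : IsTraj n f u' v' (Ioo a b)) (hcu : ContinuousOn u (Icc a b)) (hcv : ContinuousOn v (Icc a b))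
    (hcu' : ContinuousOn u' (Icc a b)) (hcv' : ContinuousOn v' (Icc a b)) (hO : ∀ t ∈ Icc a b, u t ∈ O)
    (hO' : ∀ t ∈ Icc a b, u' t ∈ O) (hu : u a = u' a) (hv : v a = v' a)
    (hne : ∀ t ∈ Ico a b, u t ≠ 0 ∨ 0 < t ∧ v t ≠ 0) : ∀ t ∈ Icc a b, u t = u' t ∧ v t = v' t := by
  have hcl : IsClosed ({t | u t = u' t ∧ v t = v' t} ∩ Icc a b) := by
    convert IsClosed.isClosed_eq isClosed_Icc (hcu.prodMk hcv) (hcu'.prodMk hcv') using 1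
    ext t
    simp [and_comm]
  refine fun t ht => hcl.Icc_subset_of_forall_mem_nhdsWithin ⟨hu, hv⟩ (fun x hx => ?_) ht
  obtain ⟨⟨hxu, hxv⟩, hx1, hx2⟩ := hx
  have hs : Icc x b ⊆ Icc a b := Icc_subset_Icc_left hx1
  have hs' : Ioo x b ⊆ Ioo a b := Ioo_subset_Ioo_left hx1
  rcases hne x ⟨hx1, hx2⟩ with hx0 | ⟨h0, hx0⟩
  · exact uniq_local_lip (ha.trans hx1) hx2 (h.mono hs') (h'.mono hs') (hcu.mono hs) (hcv.mono hs) (hcu'.mono hs)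
      (hcv'.mono hs) (H.lip _ (hO x ⟨hx1, hx2.le⟩) hx0) hxu hxv
  · exact uniq_local_energy H h0 hx2 (h.mono hs') (h'.mono hs') (hcu.mono hs) (hcv.mono hs) (hcu'.mono hs)
      (hcv'.mono hs) (fun t ht => hO t (hs ht)) (fun t ht => hO' t (hs ht)) hxu hxv hx0

end uniqueness

/-- Solution on `[0, ∞)` with `u(0) = α`, `v(0) = 0`, which stays at rest once it has reached
`(0,0)`. -/
structure RegSol (n : ℕ) (f : ℝ → ℝ) (α : ℝ) (u v : ℝ → ℝ) : Prop where
  traj : IsTraj n f u v (Ioi 0)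
  u_zero : u 0 = α
  v_zero : v 0 = 0
  cont_u : ContinuousOn u (Ici 0)
  cont_v : ContinuousOn v (Ici 0)
  rest : ∀ T, 0 < T → u T = 0 → v T = 0 → ∀ t, T ≤ t → u t = 0 ∧ v t = 0

/-- The energy `v²/2 + F(u)`. -/
noncomputable def energy (F u v : ℝ → ℝ) (t : ℝ) : ℝ := v t ^ 2 / 2 + F (u t)

theorem IsTraj.hasDerivAt {n : ℕ} {f u v : ℝ → ℝ} (h : IsTraj n f u v (Ioi 0)) {t : ℝ}
    (ht : 0 < t) : HasDerivAt u (v t) t ∧ HasDerivAt v (-((n : ℝ) / t) * v t - f (u t)) t :=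
  ⟨(h t ht).1.hasDerivAt (Ioi_mem_nhds ht), (h t ht).2.hasDerivAt (Ioi_mem_nhds ht)⟩

theorem IsTraj.hasDerivAt_energy {n : ℕ} {f F u v : ℝ → ℝ} (h : IsTraj n f u v (Ioi 0)) {t : ℝ}
    (ht : 0 < t) (hF : HasDerivAt F (f (u t)) (u t)) :
    HasDerivAt (energy F u v) (-((n : ℝ) / t) * v t ^ 2) t :=
  (h.hasDerivWithinAt_energy (mem_Ioi.2 ht) hF).hasDerivAt (Ioi_mem_nhds ht)

section regular
variable {n : ℕ} {f F u v : ℝ → ℝ} {α : ℝ}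

theorem RegSol.antitone_energy (h : RegSol n f α u v)
    (hF : ∀ t, 0 ≤ t → HasDerivAt F (f (u t)) (u t)) : AntitoneOn (energy F u v) (Ici 0) := by
  refine antitoneOn_of_hasDerivWithinAt_nonpos (f' := fun t => -((n : ℝ) / t) * v t ^ 2) (convex_Ici 0) ?_ ?_ ?_
  · refine ContinuousOn.add ((h.cont_v.pow 2).div_const 2) fun t ht => ?_
    exact (hF t ht).continuousAt.comp_continuousWithinAt (h.cont_u t ht)
  · intro t ht; rw [interior_Ici] at ht; exact (h.traj.hasDerivAt_energy ht (hF t (le_of_lt ht))).hasDerivWithinAt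
  · intro t ht; rw [interior_Ici] at ht
    have : 0 < t := ht
    have : 0 ≤ (n : ℝ) / t * v t ^ 2 := by positivity
    linarith

theorem RegSol.F_le (h : RegSol n f α u v)
    (hF : ∀ t, 0 ≤ t → HasDerivAt F (f (u t)) (u t)) {t : ℝ} (ht : 0 ≤ t) : F (u t) ≤ F α := by
  have h1 := h.antitone_energy hF (mem_Ici.2 le_rfl) (mem_Ici.2 ht) ht
  simp only [energy, h.u_zero, h.v_zero] at h1
  have := sq_nonneg (v t)
  linarith

theorem RegSol.confined (h : RegSol n f α u v)
    (hF : ∀ t, 0 ≤ t → HasDerivAt F (f (u t)) (u t)) {lo c : ℝ} (hlo : lo < α) (hc : α < c)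
    (hFlo : F α < F lo) (hFc : ∀ s, α < s → s < c → F α < F s) {t : ℝ} (ht : 0 ≤ t) :
    u t ∈ Ioc lo α := by
  have hcont : ContinuousOn u (uIcc 0 t) := h.cont_u.mono (by rw [uIcc_of_le ht]; exact fun s hs => hs.1)
  have hval : ∀ y ∈ uIcc α (u t), F y ≤ F α := fun y hy => by
    rw [← h.u_zero] at hy
    obtain ⟨s, hs, rfl⟩ := intermediate_value_uIcc hcont hy
    rw [uIcc_of_le ht] at hs; exact h.F_le hF hs.1
  constructor
  · by_contra! hlt
    exact (hval lo (mem_uIcc.2 (Or.inr ⟨hlt, hlo.le⟩))).not_gt hFlo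
  · by_contra! hlt
    obtain ⟨y, hy1, hy2⟩ := exists_between (lt_min hc hlt)
    exact (hval y (mem_uIcc.2 (Or.inl ⟨hy1.le, (hy2.trans_le (min_le_right _ _)).le⟩))).not_gt
      (hFc y hy1 (hy2.trans_le (min_le_left _ _)))

theorem RegSol.bounds (h : RegSol n f α u v) {B : ℝ} (hB : ∀ t, 0 ≤ t → |f (u t)| ≤ B)
    {t : ℝ} (ht : 0 ≤ t) : |v t| ≤ B * t ∧ |u t - α| ≤ B * t ^ 2 := by
  have hv : ∀ t, 0 ≤ t → |v t| ≤ B * t := fun t ht => by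
    simpa using abs_le_of_weighted (n := n) le_rfl ht (h.cont_v.mono fun s hs => hs.1) h.v_zero
      (fun s hs => (h.traj.weighted hs.1 hs.1.ne').hasDerivAt (Ioi_mem_nhds hs.1)) fun s hs => hB s hs.1.le
  refine ⟨hv t ht, ?_⟩
  have := abs_sub_le_of_hasDerivAt (C := B * t) ht (h.cont_u.mono fun s hs => hs.1)
    (fun s hs => (h.traj.hasDerivAt hs.1).1) fun s hs => (hv s hs.1.le).trans
      (mul_le_mul_of_nonneg_left hs.2.le ((abs_nonneg _).trans (hB 0 le_rfl)))
  rw [h.u_zero] at this; linarith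

theorem RegSol.lipschitz (h : RegSol n f α u v) {B : ℝ} (hB : ∀ t, 0 ≤ t → |f (u t)| ≤ B)
    {s t T : ℝ} (hs : s ∈ Icc 0 T) (ht : t ∈ Icc 0 T) :
    |u t - u s| ≤ B * T * |t - s| ∧ |v t - v s| ≤ (n + 1) * B * |t - s| := by
  have hB0 : 0 ≤ B := (abs_nonneg _).trans (hB 0 le_rfl)
  have key : ∀ s ∈ Icc 0 T, ∀ t ∈ Icc 0 T, s ≤ t →
      |u t - u s| ≤ B * T * |t - s| ∧ |v t - v s| ≤ (n + 1) * B * |t - s| := by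
    intro s hs t ht hst; rw [abs_of_nonneg (sub_nonneg.2 hst)]; constructor
    · refine abs_sub_le_of_hasDerivAt hst (h.cont_u.mono fun r hr => hs.1.trans hr.1)
        (fun r hr => (h.traj.hasDerivAt (hs.1.trans_lt hr.1)).1) (fun r hr => ?_)
      exact ((h.bounds hB (hs.1.trans hr.1.le)).1).trans (mul_le_mul_of_nonneg_left (hr.2.le.trans ht.2) hB0)
    · refine abs_sub_le_of_hasDerivAt hst (h.cont_v.mono fun r hr => hs.1.trans hr.1)
        (fun r hr => (h.traj.hasDerivAt (hs.1.trans_lt hr.1)).2) (fun r hr => ?_)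
      have hr0 : 0 < r := hs.1.trans_lt hr.1
      have h1 := (h.bounds hB hr0.le).1
      have h2 := hB r hr0.le
      have h3 : |(n : ℝ) / r * v r| ≤ n * B := by
        rw [abs_mul, abs_of_nonneg (by positivity), div_mul_eq_mul_div, div_le_iff₀ hr0]
        have := mul_le_mul_of_nonneg_left h1 (Nat.cast_nonneg n : (0 : ℝ) ≤ n)
        linarith
      have e : -((n : ℝ) / r) * v r - f (u r) = -((n : ℝ) / r * v r) + - f (u r) := by ring
      rw [e]
      refine (abs_add_le _ _).trans ?_
      rw [abs_neg, abs_neg]; linarith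
  rcases le_total s t with hst | hst
  · exact key s hs t ht hst
  · rw [abs_sub_comm (u t), abs_sub_comm (v t), abs_sub_comm t]; exact key t ht s hs hst

end regular

theorem IsTraj.congr_nonlin {n : ℕ} {f g u v : ℝ → ℝ} {S : Set ℝ} (h : IsTraj n f u v S)
    (hfg : ∀ t ∈ S, f (u t) = g (u t)) : IsTraj n g u v S := fun t ht => by
  rw [← hfg t ht]; exact h t ht

theorem exists_rest {n : ℕ} {f u v : ℝ → ℝ} {α : ℝ} (hα : α ≠ 0) (hf0 : f 0 = 0)
    (hT : IsTraj n f u v (Ioi 0)) (hu0 : u 0 = α) (hv0 : v 0 = 0) (hcu : ContinuousOn u (Ici 0))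
    (hcv : ContinuousOn v (Ici 0)) : ∃ u' v', RegSol n f α u' v' := by
  by_cases hit : ∃ T₁, 0 < T₁ ∧ u T₁ = 0 ∧ v T₁ = 0
  swap
  · push Not at hit
    exact ⟨u, v, hT, hu0, hv0, hcu, hcv, fun T hT h1 h2 => absurd h2 (hit T hT h1)⟩
  obtain ⟨T₁, hT₁, hT₁u, hT₁v⟩ := hit
  obtain ⟨T, ⟨hT0, -⟩, hTz, hlt⟩ := exists_first_le (g := fun t => |u t| + |v t|) (c := 0) (a := 0)
    ((hcu.abs.add hcv.abs).mono fun s hs => hs.1) (by simpa [hu0, hv0]) ⟨T₁, ⟨hT₁.le, le_rfl⟩, by simp [hT₁u, hT₁v]⟩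
  obtain ⟨hTu, hTv⟩ : u T = 0 ∧ v T = 0 := by
    constructor <;> rw [← abs_nonpos_iff] <;> linarith [abs_nonneg (u T), abs_nonneg (v T)]
  have glue : ∀ w w' : ℝ → ℝ, (∀ t, 0 < t → HasDerivAt w (w' t) t) → w' T = 0 → ∀ t, 0 < t →
      HasDerivAt (fun s => w (min s T)) (w' (min t T)) t := fun w w' hd hw t ht => by
    rcases lt_trichotomy t T with h | rfl | h
    · rw [min_eq_left h.le]
      exact (hd t ht).congr_of_eventuallyEq (mem_of_superset (Iio_mem_nhds h) fun s (hs : s < T) => by simp [hs.le])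
    · rw [min_self, hw, ← hasDerivWithinAt_univ, ← Iic_union_Ici]
      exact ((hw ▸ hd t ht).hasDerivWithinAt.congr (fun s hs => by rw [min_eq_left hs]) (by simp)).union
        ((hasDerivWithinAt_const t _ (w t)).congr (fun s hs => by rw [min_eq_right hs]) (by simp))
    · rw [min_eq_right h.le, hw]
      exact (hasDerivAt_const t (w T)).congr_of_eventuallyEq (mem_of_superset (Ioi_mem_nhds h) fun s (hs : T < s) => by
        simp [hs.le])
  have hmin : ∀ t ∈ Ici (0 : ℝ), min t T ∈ Ici 0 := fun t ht => le_min ht hT0.le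
  have hmc : ContinuousOn (fun t => min t T) (Ici 0) := by fun_prop
  refine ⟨fun s => u (min s T), fun s => v (min s T), fun t ht => ⟨(glue u v (fun t ht => (hT.hasDerivAt ht).1)
    hTv t ht).hasDerivWithinAt, ((glue v _ (fun t ht => (hT.hasDerivAt ht).2) (by simp [hTu, hTv, hf0])
      t ht).congr_deriv ?_).hasDerivWithinAt⟩, by simp [hT0.le, hu0], by simp [hT0.le, hv0], hcu.comp hmc hmin,
    hcv.comp hmc hmin, fun s hs h1 h2 t hst => ?_⟩
  · rcases le_total t T with h | h
    · simp only [min_eq_left h]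
    · simp only [min_eq_right h, hTv, mul_zero]
  · have hTs : T ≤ s := by
      by_contra! h
      rw [min_eq_left h.le] at h1 h2
      exact (hlt s ⟨hs.le, h⟩).ne' (by simp [h1, h2])
    simp [min_eq_right (hTs.trans hst), hTu, hTv]

theorem Nonlin.icc_subset {f F : ℝ → ℝ} {O : Set ℝ} (H : Nonlin f F O) {a b : ℝ} (ha : a ∈ O)
    (hb : b ∈ O) : Icc a b ⊆ O := H.conn.out ha hb

/-- A family of regular solutions, one for each initial value in the interval `I`. -/
structure Family (n : ℕ) (f F : ℝ → ℝ) (O I : Set ℝ) (u v : ℝ → ℝ → ℝ) : Prop where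
  nl : Nonlin f F O
  sub : I ⊆ O
  pos : ∀ α ∈ I, 0 < α
  isOpen : IsOpen I
  conn : I.OrdConnected
  mono : StrictMonoOn F I
  f_pos : ∀ α ∈ I, 0 < f α
  lower : ∀ c ∈ I, ∃ lo ∈ O, lo < 0 ∧ F c < F lo
  reg : ∀ α ∈ I, RegSol n f α (u α) (v α)
  mem : ∀ α ∈ I, ∀ t, 0 ≤ t → u α t ∈ O

theorem Nonlin.exists_extension {f F : ℝ → ℝ} {O : Set ℝ} (H : Nonlin f F O) {a b : ℝ} (hab : a ≤ b)
    (h0 : (0 : ℝ) ∈ Icc a b) (hsub : Icc a b ⊆ O) :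
    ∃ (g G : ℝ → ℝ) (B : ℝ), Continuous g ∧ (∀ s, HasDerivAt G (g s) s) ∧ (∀ s ∈ Icc a b, g s = f s) ∧
      (∀ s ∈ Icc a b, G s = F s) ∧ (∀ s, |g s| ≤ B) ∧ (∀ s ≤ a, g s = f a) ∧ ∀ s, b ≤ s → g s = f b := by
  have hf := H.cont.mono hsub
  obtain ⟨B, hB⟩ := isCompact_Icc.exists_bound_of_continuousOn hf
  set g := IccExtend hab ((Icc a b).domRestrict f)
  have hg : Continuous g := (continuousOn_iff_continuous_domRestrict.1 hf).Icc_extend'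
  have e : ∀ s ∈ Icc a b, g s = f s := fun s hs => IccExtend_of_mem hab _ hs
  have hG : ∀ s, HasDerivAt (fun s => ∫ t in 0..s, g t) (g s) s := fun s =>
    intervalIntegral.integral_hasDerivAt_right (hg.intervalIntegrable _ _) (hg.stronglyMeasurableAtFilter _ _)
      hg.continuousAt
  refine ⟨g, _, B, hg, hG, e, fun s hs => ?_, fun s => hB _ (projIcc a b hab s).2,
    fun s hs => IccExtend_of_le_left hab _ hs, fun s hs => IccExtend_of_right_le hab _ hs⟩
  have := (convex_Icc a b).norm_image_sub_le_of_norm_hasDerivWithin_le (C := 0)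
    (fun x hx => ((hG x).sub (H.deriv x (hsub hx))).hasDerivWithinAt) (fun x hx => by simp [e x hx]) h0 hs
  rw [zero_mul, norm_le_zero_iff] at this; simpa [H.F_zero, sub_eq_zero] using this

theorem exists_Icc_subset {I : Set ℝ} (hI : IsOpen I) {α : ℝ} (hα : α ∈ I) : ∃ c > α, Icc α c ⊆ I :=
  mem_nhdsGE_iff_exists_Icc_subset.1 (mem_nhdsWithin_of_mem_nhds (hI.mem_nhds hα))

theorem exists_regSol {n : ℕ} {f F : ℝ → ℝ} {O : Set ℝ} (H : Nonlin f F O) {lo α c : ℝ}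
    (hlo : lo ∈ O) (hc : c ∈ O) (hlo0 : lo < 0) (hα : 0 < α) (hαc : α < c) (hF : F α < F lo)
    (hFc : ∀ s, α < s → s < c → F α < F s) :
    ∃ u v, RegSol n f α u v ∧ ∀ t, 0 ≤ t → u t ∈ O := by
  obtain ⟨g, G, B, hgc, hGd, e, hGF, hgB, -⟩ := H.exists_extension (by linarith) ⟨hlo0.le, by linarith⟩ (H.icc_subset hlo hc)
  obtain ⟨u, v, hT, hu0, hv0, hcu, hcv⟩ := exists_regular n hgc hgB α
  obtain ⟨u', v', hR⟩ := exists_rest hα.ne' ((e 0 ⟨hlo0.le, by linarith⟩).trans H.f_zero) hT hu0 hv0 hcu hcv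
  have conf : ∀ t, 0 ≤ t → u' t ∈ Ioc lo α := fun t ht => by
    refine hR.confined (fun t _ => hGd _) (by linarith) hαc ?_ (fun s h1 h2 => ?_) ht
    · rw [hGF α ⟨by linarith, hαc.le⟩, hGF lo ⟨le_rfl, (by linarith)⟩]; exact hF
    · rw [hGF α ⟨by linarith, hαc.le⟩, hGF s ⟨by linarith, h2.le⟩]; exact hFc s h1 h2
  have conf' : ∀ t, 0 ≤ t → u' t ∈ Icc lo c := by grind
  exact ⟨u', v', ⟨hR.traj.congr_nonlin fun t ht => e _ (conf' t (le_of_lt ht)), hR.u_zero, hR.v_zero,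
    hR.cont_u, hR.cont_v, hR.rest⟩, fun t ht => (H.icc_subset hlo hc) (conf' t ht)⟩

theorem exists_family (n : ℕ) {f F : ℝ → ℝ} {O I : Set ℝ} (H : Nonlin f F O) (sub : I ⊆ O)
    (pos : ∀ α ∈ I, 0 < α) (isOpen : IsOpen I) (conn : I.OrdConnected) (mono : StrictMonoOn F I)
    (f_pos : ∀ α ∈ I, 0 < f α) (lower : ∀ c ∈ I, ∃ lo ∈ O, lo < 0 ∧ F c < F lo) : ∃ u v, Family n f F O I u v := by
  have : ∀ α ∈ I, ∃ u v, RegSol n f α u v ∧ ∀ t, 0 ≤ t → u t ∈ O := fun α hα => by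
    obtain ⟨lo, hlo, hlo0, hFlo⟩ := lower α hα
    obtain ⟨c, hc, hcI⟩ := exists_Icc_subset isOpen hα
    exact exists_regSol H hlo (sub (hcI ⟨hc.le, le_rfl⟩)) hlo0 (pos α hα) hc hFlo
      fun s h1 h2 => mono hα (hcI ⟨h1.le, h2.le⟩) h1
  choose! u v h using this
  exact ⟨u, v, H, sub, pos, isOpen, conn, mono, f_pos, lower, fun α hα => (h α hα).1, fun α hα => (h α hα).2⟩

section family
variable {n : ℕ} {f F : ℝ → ℝ} {O I : Set ℝ} {u v : ℝ → ℝ → ℝ}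

theorem Family.hasDerivAt_F (H : Family n f F O I u v) {α t : ℝ} (hα : α ∈ I) (ht : 0 ≤ t) :
    HasDerivAt F (f (u α t)) (u α t) := H.nl.deriv _ (H.mem α hα t ht)

theorem Family.range (H : Family n f F O I u v) {c : ℝ} (hc : c ∈ I) :
    ∃ lo < 0, lo ∈ O ∧ F c < F lo ∧ Icc lo c ⊆ O ∧ ∀ α ∈ I, α ≤ c → ∀ t, 0 ≤ t → u α t ∈ Ioc lo α := by
  obtain ⟨lo, hlo, hlo0, hF⟩ := H.lower c hc
  refine ⟨lo, hlo0, hlo, hF, H.nl.icc_subset hlo (H.sub hc), fun α hα hαc t ht => ?_⟩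
  obtain ⟨d, hd, hdI⟩ := exists_Icc_subset H.isOpen hα
  refine (H.reg α hα).confined (fun t ht => H.hasDerivAt_F hα ht) (hlo0.trans (H.pos α hα)) hd
    ((H.mono.monotoneOn hα hc hαc).trans_lt hF) (fun s h1 h2 => H.mono hα (hdI ⟨h1.le, h2.le⟩) h1) ht

theorem Family.bound (H : Family n f F O I u v) {c : ℝ} (hc : c ∈ I) :
    ∃ B, 0 ≤ B ∧ ∀ α ∈ I, α ≤ c → (∀ t, 0 ≤ t → |f (u α t)| ≤ B) ∧ (∀ t, 0 ≤ t → |v α t| ≤ B * t ∧ |u α t - α| ≤ B * t ^ 2) ∧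
      ∀ T, ∀ s ∈ Icc 0 T, ∀ t ∈ Icc 0 T, |u α t - u α s| ≤ B * T * |t - s| ∧
        |v α t - v α s| ≤ (n + 1) * B * |t - s| := by
  obtain ⟨lo, -, -, -, hsub, hr⟩ := H.range hc
  obtain ⟨B, hB⟩ := isCompact_Icc.exists_bound_of_continuousOn (H.nl.cont.mono hsub)
  refine ⟨max B 0, le_max_right _ _, fun α hα hαc => ?_⟩
  have hb : ∀ t, 0 ≤ t → |f (u α t)| ≤ max B 0 := fun t ht =>
    (hB _ ⟨(hr α hα hαc t ht).1.le, (hr α hα hαc t ht).2.trans hαc⟩).trans (le_max_left _ _)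
  exact ⟨hb, fun t ht => (H.reg α hα).bounds hb ht, fun T s hs t ht => (H.reg α hα).lipschitz hb hs ht⟩

/-- Continuous dependence on the initial value. -/
theorem Family.close (H : Family n f F O I u v) {α T : ℝ} (hα : α ∈ I)
    (hne : ∀ t ∈ Ico 0 T, u α t ≠ 0 ∨ v α t ≠ 0) {ε : ℝ} (hε : 0 < ε) :
    ∀ᶠ a in 𝓝 α, a ∈ I ∧ ∀ t ∈ Icc 0 T, |u a t - u α t| < ε ∧ |v a t - v α t| < ε := by
  by_contra hcon
  obtain ⟨c, hc, hcI⟩ := exists_Icc_subset H.isOpen hα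
  have hcI := hcI ⟨hc.le, le_rfl⟩
  have hbad : ∃ᶠ a in 𝓝 α, (a ∈ I ∧ a ≤ c) ∧ ∃ t ∈ Icc 0 T, ¬ (|u a t - u α t| < ε ∧ |v a t - v α t| < ε) := by
    refine ((not_eventually.1 hcon).and_eventually ((H.isOpen.eventually_mem hα).and
      (Iic_mem_nhds hc))).mono fun a ⟨h1, h2⟩ => ⟨h2, ?_⟩
    grind
  have := Filter.frequently_iff_neBot.1 hbad
  obtain ⟨l, hl'⟩ := Ultrafilter.exists_le (𝓝 α ⊓ 𝓟 {a | (a ∈ I ∧ a ≤ c) ∧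
    ∃ t ∈ Icc 0 T, ¬ (|u a t - u α t| < ε ∧ |v a t - v α t| < ε)})
  have hl := hl'.trans inf_le_left
  have hlb : ∀ᶠ a in l, (a ∈ I ∧ a ≤ c) ∧ ∃ t ∈ Icc 0 T, ¬ (|u a t - u α t| < ε ∧ |v a t - v α t| < ε) :=
    le_principal_iff.1 (hl'.trans inf_le_right)
  obtain ⟨lo, hlo, -, -, hsub, hr⟩ := H.range hcI
  obtain ⟨B, hB0, hB⟩ := H.bound hcI
  have hc0 := (H.pos c hcI).le
  obtain ⟨g, -, -, hg, -, e, -⟩ := H.nl.exists_extension (hlo.le.trans hc0) ⟨hlo.le, hc0⟩ hsub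
  have hgood := hlb.mono fun a h => h.1
  have huI : ∀ a, a ∈ I ∧ a ≤ c → ∀ t, 0 ≤ t → u a t ∈ Icc lo c := fun a h t ht =>
    ⟨(hr a h.1 h.2 t ht).1.le, (hr a h.1 h.2 t ht).2.trans h.2⟩
  obtain ⟨U, W, hUT, hU0, hW0, hUc, hWc, hUW⟩ := exists_limit hg hl fun a ha b =>
    hgood.mono fun x hx => ⟨((H.reg x hx.1).traj.mono fun t ht => ha.trans_le ht.1).congr_nonlin fun t ht =>
      (e _ (huI x hx t (ha.le.trans ht.1))).symm, fun t ht => (hB x hx.1 hx.2).2.1 t (ha.le.trans ht.1)⟩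
  have hUm := fun t ht =>
    isClosed_Icc.mem_of_tendsto (hUW t ht).1 (hgood.mono fun x hx => huI x hx t ht.le)
  have R := H.reg α hα
  have hlim : ∀ t, 0 ≤ t → Tendsto (fun a => u a t) l (𝓝 (U t)) ∧ Tendsto (fun a => v a t) l (𝓝 (W t)) := fun t ht => by
    rcases ht.eq_or_lt with rfl | ht
    · rw [hU0, hW0]
      exact ⟨Tendsto.congr' (hgood.mono fun a h => (H.reg a h.1).u_zero.symm) hl,
        tendsto_const_nhds.congr' (hgood.mono fun a h => (H.reg a h.1).v_zero.symm)⟩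
    · exact hUW t ht
  have sub : Icc 0 T ⊆ Ici 0 := fun t ht => ht.1
  have agree := uniq_forward H.nl le_rfl (R.traj.mono fun t ht => ht.1) ((hUT.congr_nonlin fun t ht => e _ (hUm t ht)).mono fun t ht => ht.1) (R.cont_u.mono sub)
    (R.cont_v.mono sub) (hUc.mono sub) (hWc.mono sub) (fun t ht => H.mem α hα t ht.1) (fun t ht =>
      hsub (isClosed_Icc.mem_of_tendsto (hlim t ht.1).1 (hgood.mono fun x hx => huI x hx t ht.1)))
    (R.u_zero.trans hU0.symm) (R.v_zero.trans hW0.symm) fun t ht => by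
      rcases ht.1.eq_or_lt with rfl | h0
      · exact Or.inl (R.u_zero.trans_ne (H.pos α hα).ne')
      · exact (hne t ht).imp_right fun h => ⟨h0, h⟩
  have : ∀ a : ℝ, (∃ t ∈ Icc 0 T, ¬ (|u a t - u α t| < ε ∧ |v a t - v α t| < ε)) → _ := fun _ h => h
  choose! τ' hτ' using this
  replace hτ' := hlb.mono fun a h => hτ' a h.2
  obtain ⟨s, hs, hsl⟩ := exists_ultrafilter_lim l (hτ'.mono fun a h => h.1)
  have hs0 : Tendsto (fun a => |τ' a - s|) l (𝓝 0) := by simpa using (hsl.sub_const s).abs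
  have t1 : Tendsto (fun a => 2 * (B * T * |τ' a - s|) + |u a s - u α s|) l (𝓝 0) := by
    simpa using ((hs0.const_mul (B * T)).const_mul 2).add (by simpa [(agree s hs).1] using ((hlim s hs.1).1.sub_const (u α s)).abs)
  have t2 : Tendsto (fun a => 2 * ((n + 1) * B * |τ' a - s|) + |v a s - v α s|) l (𝓝 0) := by
    simpa using ((hs0.const_mul ((n + 1) * B)).const_mul 2).add (by simpa [(agree s hs).2] using ((hlim s hs.1).2.sub_const (v α s)).abs)
  obtain ⟨a, ⟨ha1, ha2⟩, ha3, h4, h5⟩ := (hτ'.and (hgood.and ((t1.eventually_lt_const hε).and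
    (t2.eventually_lt_const hε)))).exists
  have b1 := (hB a ha3.1 ha3.2).2.2 T s hs (τ' a) ha1
  have b2 := (hB α hα hc.le).2.2 T s hs (τ' a) ha1
  refine ha2 ⟨?_, ?_⟩
  · calc _ = |(u a (τ' a) - u a s) + (u a s - u α s) + -(u α (τ' a) - u α s)| := by ring_nf
      _ ≤ |u a (τ' a) - u a s| + |u a s - u α s| + |u α (τ' a) - u α s| :=
        (abs_add_le _ _).trans (by rw [abs_neg]; gcongr; exact abs_add_le _ _)
      _ < ε := by linarith [b1.1, b2.1]
  · calc _ = |(v a (τ' a) - v a s) + (v a s - v α s) + -(v α (τ' a) - v α s)| := by ring_nf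
      _ ≤ |v a (τ' a) - v a s| + |v a s - v α s| + |v α (τ' a) - v α s| :=
        (abs_add_le _ _).trans (by rw [abs_neg]; gcongr; exact abs_add_le _ _)
      _ < ε := by linarith [b1.2, b2.2]

end family

/-- The odd rescaling `s ↦ s e^{C s²}` used to define angles in the phase plane. -/
noncomputable def kap (C s : ℝ) : ℝ := s * Real.exp (C * s ^ 2)

theorem hasDerivAt_kap (C s : ℝ) : HasDerivAt (kap C) (Real.exp (C * s ^ 2) * (1 + 2 * C * s ^ 2)) s := by
  refine ((hasDerivAt_id s).mul (((hasDerivAt_pow 2 s).const_mul C).exp)).congr_deriv ?_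
  simp; ring

theorem continuous_kap (C : ℝ) : Continuous (kap C) := by unfold kap; fun_prop

theorem kap_zero (C : ℝ) : kap C 0 = 0 := by simp [kap]

theorem kap_pos {C s : ℝ} (hs : 0 < s) : 0 < kap C s := mul_pos hs (Real.exp_pos _)

theorem kap_eq_zero {C s : ℝ} : kap C s = 0 ↔ s = 0 := by simp [kap, Real.exp_ne_zero]

theorem kap_neg (C s : ℝ) : kap C (-s) = -kap C s := by simp [kap]

/-- Squared radius in the rescaled phase plane. -/
noncomputable def rho (C : ℝ) (u v : ℝ → ℝ) (t : ℝ) : ℝ := √(kap C (u t) ^ 2 + v t ^ 2)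

/-- Angular velocity in the rescaled phase plane. -/
noncomputable def angVel (n : ℕ) (f : ℝ → ℝ) (C : ℝ) (u v : ℝ → ℝ) (t : ℝ) : ℝ :=
  (Real.exp (C * u t ^ 2) * (1 + 2 * C * u t ^ 2) * v t ^ 2 +
    kap C (u t) * (f (u t) + n * (v t / t))) / (kap C (u t) ^ 2 + v t ^ 2)

/-- Angle in the rescaled phase plane, measured from `t = 0`. -/
noncomputable def ang (n : ℕ) (f : ℝ → ℝ) (C : ℝ) (u v : ℝ → ℝ) (t : ℝ) : ℝ := ∫ s in (0 : ℝ)..t, angVel n f C u v s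

section angle
variable {n : ℕ} {f u v : ℝ → ℝ} {α T : ℝ}

theorem RegSol.alive (h : RegSol n f α u v) (hα : 0 < α) (hT : u T ≠ 0 ∨ v T ≠ 0) {t : ℝ}
    (ht : t ∈ Icc 0 T) : u t ≠ 0 ∨ v t ≠ 0 := by
  rcases ht.1.eq_or_lt with rfl | ht0
  · left; rw [h.u_zero]; exact hα.ne'
  · by_contra! hc
    have := h.rest t ht0 hc.1 hc.2 T ht.2
    simp [this.1, this.2] at hT

theorem sq_add_sq_pos_of {C a b : ℝ} (h : a ≠ 0 ∨ b ≠ 0) : 0 < kap C a ^ 2 + b ^ 2 := by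
  rcases h with h | h
  · have : kap C a ≠ 0 := fun e => h (kap_eq_zero.1 e)
    positivity
  · positivity

theorem RegSol.vdiv_bound (h : RegSol n f α u v) (hfc : ContinuousOn (fun t => f (u t)) (Ici 0))
    (T : ℝ) : ∃ B, ∀ t ∈ Ioc 0 T, |v t / t| ≤ B := by
  obtain ⟨B, hB⟩ := isCompact_Icc.exists_bound_of_continuousOn (hfc.mono (fun t ht => ht.1 : Icc 0 T ⊆ Ici 0))
  refine ⟨B, fun t ht => ?_⟩
  rw [abs_div, abs_of_pos ht.1, div_le_iff₀ ht.1]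
  simpa using abs_le_of_weighted (n := n) le_rfl ht.1.le (h.cont_v.mono fun s hs => hs.1) h.v_zero
    (fun s hs => (h.traj.weighted hs.1 hs.1.ne').hasDerivAt (Ioi_mem_nhds hs.1))
    fun s hs => hB s ⟨hs.1.le, hs.2.le.trans ht.2⟩

theorem RegSol.continuousAt_angVel (h : RegSol n f α u v) (C : ℝ)
    (hfc : ContinuousOn (fun t => f (u t)) (Ici 0)) {t : ℝ} (ht : 0 < t) (hne : u t ≠ 0 ∨ v t ≠ 0) :
    ContinuousAt (angVel n f C u v) t := by
  have hu := (h.traj.hasDerivAt ht).1.continuousAt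
  have hv := (h.traj.hasDerivAt ht).2.continuousAt
  have hf : ContinuousAt (fun t => f (u t)) t := hfc.continuousAt (Ici_mem_nhds ht)
  have hk : ContinuousAt (fun t => kap C (u t)) t := (continuous_kap C).continuousAt.comp hu
  unfold angVel
  refine ContinuousAt.div ?_ ((hk.pow 2).add (hv.pow 2)) (sq_add_sq_pos_of hne).ne'
  refine ContinuousAt.add (ContinuousAt.mul (by fun_prop) (hv.pow 2)) (hk.mul (hf.add ?_))
  exact continuousAt_const.mul (hv.div continuousAt_id ht.ne')

theorem RegSol.intervalIntegrable_angVel (h : RegSol n f α u v) (hα : 0 < α) (C : ℝ)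
    (hfc : ContinuousOn (fun t => f (u t)) (Ici 0)) (hT : u T ≠ 0 ∨ v T ≠ 0) (hT0 : 0 ≤ T) :
    (∃ W, ∀ t ∈ Ioc 0 T, |angVel n f C u v t| ≤ W) ∧
    IntervalIntegrable (angVel n f C u v) MeasureTheory.volume 0 T := by
  have hsub : Icc 0 T ⊆ Ici 0 := fun t ht => ht.1
  have hk : ContinuousOn (fun t => kap C (u t)) (Icc 0 T) := (continuous_kap C).comp_continuousOn (h.cont_u.mono hsub)
  obtain ⟨B, hB⟩ := h.vdiv_bound hfc T
  have hden : ContinuousOn (fun t => kap C (u t) ^ 2 + v t ^ 2) (Icc 0 T) := (hk.pow 2).add ((h.cont_v.mono hsub).pow 2)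
  have hden0 : ∀ t ∈ Icc 0 T, kap C (u t) ^ 2 + v t ^ 2 ≠ 0 := fun t ht => (sq_add_sq_pos_of (h.alive hα hT ht)).ne'
  have hu' := h.cont_u.mono hsub
  have hv' := h.cont_v.mono hsub
  have hf' := hfc.mono hsub
  have c1 : ContinuousOn (fun t => (Real.exp (C * u t ^ 2) * (1 + 2 * C * u t ^ 2) * v t ^ 2 +
    kap C (u t) * f (u t)) / (kap C (u t) ^ 2 + v t ^ 2)) (Icc 0 T) :=
    ((ContinuousOn.mul (by fun_prop) (hv'.pow 2)).add (hk.mul hf')).div hden hden0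
  have c2 := (hk.mul (continuousOn_const (c := (n : ℝ)))).div hden hden0
  obtain ⟨W1, hW1⟩ := isCompact_Icc.exists_bound_of_continuousOn c1
  obtain ⟨W2, hW2⟩ := isCompact_Icc.exists_bound_of_continuousOn c2
  have bd : ∀ t ∈ Ioc 0 T, |angVel n f C u v t| ≤ W1 + W2 * B := by
    intro t ht
    have htI := Ioc_subset_Icc_self ht
    have e : angVel n f C u v t = (Real.exp (C * u t ^ 2) * (1 + 2 * C * u t ^ 2) * v t ^ 2 +
      kap C (u t) * f (u t)) / (kap C (u t) ^ 2 + v t ^ 2) +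
      kap C (u t) * n / (kap C (u t) ^ 2 + v t ^ 2) * (v t / t) := by
      unfold angVel; ring
    rw [e]
    refine (abs_add_le _ _).trans (add_le_add (hW1 t htI) ((abs_mul _ _).trans_le ?_))
    exact mul_le_mul (hW2 t htI) (hB t ht) (abs_nonneg _) ((abs_nonneg _).trans (hW2 t htI))
  refine ⟨⟨_, bd⟩, ?_⟩
  rw [intervalIntegrable_iff_integrableOn_Ioc_of_le hT0]
  refine MeasureTheory.Integrable.of_bound (C := W1 + W2 * B) ?_ ?_
  · refine ContinuousOn.aestronglyMeasurable (fun t ht => ?_) measurableSet_Ioc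
    exact (h.continuousAt_angVel C hfc ht.1 (h.alive hα hT (Ioc_subset_Icc_self ht))).continuousWithinAt
  · exact (MeasureTheory.ae_restrict_iff' measurableSet_Ioc).2 (Eventually.of_forall bd)

theorem ang_zero (C : ℝ) : ang n f C u v 0 = 0 := by simp [ang]

theorem RegSol.continuousOn_ang (h : RegSol n f α u v) (hα : 0 < α) (C : ℝ)
    (hfc : ContinuousOn (fun t => f (u t)) (Ici 0)) (hT : u T ≠ 0 ∨ v T ≠ 0) (hT0 : 0 ≤ T) :
    ContinuousOn (ang n f C u v) (Icc 0 T) := by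
  have := intervalIntegral.continuousOn_primitive_interval' (h.intervalIntegrable_angVel hα C hfc hT hT0).2 left_mem_uIcc
  rwa [uIcc_of_le hT0] at this

theorem RegSol.hasDerivAt_ang (h : RegSol n f α u v) (hα : 0 < α) (C : ℝ)
    (hfc : ContinuousOn (fun t => f (u t)) (Ici 0)) {t : ℝ} (ht : u t ≠ 0 ∨ v t ≠ 0) (ht0 : 0 < t) :
    HasDerivAt (ang n f C u v) (angVel n f C u v t) t := by
  have hc := h.continuousAt_angVel C hfc ht0 ht
  refine intervalIntegral.integral_hasDerivAt_right (h.intervalIntegrable_angVel hα C hfc ht ht0.le).2 ?_ hc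
  have hev : ∀ᶠ s in 𝓝 t, 0 < s ∧ (u s ≠ 0 ∨ v s ≠ 0) := by
    obtain ⟨hu, hv⟩ := h.traj.hasDerivAt ht0
    refine (lt_mem_nhds ht0).and (ht.elim (fun ht => ?_) fun ht => ?_)
    · exact (hu.continuousAt.eventually_ne ht).mono fun s => Or.inl
    · exact (hv.continuousAt.eventually_ne ht).mono fun s => Or.inr
  obtain ⟨S, hS, hSo, htS⟩ := mem_nhds_iff.1 hev
  exact ContinuousOn.stronglyMeasurableAtFilter hSo (fun s hs =>
    (h.continuousAt_angVel C hfc (hS hs).1 (hS hs).2).continuousWithinAt) t htS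

theorem polar_of_hasDerivAt {θ : ℝ → ℝ} {a : ℝ} (C : ℝ) (haT : a ≤ T)
    (hu : ContinuousOn u (Icc a T)) (hv : ContinuousOn v (Icc a T)) (hθc : ContinuousOn θ (Icc a T))
    (hal : ∀ t ∈ Icc a T, u t ≠ 0 ∨ v t ≠ 0)
    (hd : ∀ t ∈ Ioo a T, HasDerivAt u (v t) t ∧ HasDerivAt v (-((n : ℝ) / t) * v t - f (u t)) t ∧
      HasDerivAt θ (angVel n f C u v t) t)
    (hk0 : kap C (u a) = rho C u v a * Real.cos (θ a)) (hv0 : v a = -(rho C u v a * Real.sin (θ a))) :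
    kap C (u T) = rho C u v T * Real.cos (θ T) ∧ v T = -(rho C u v T * Real.sin (θ T)) := by
  set ρ := rho C u v with hρ
  have hρ0 : ∀ t ∈ Icc a T, 0 < ρ t := fun t ht => Real.sqrt_pos.2 (sq_add_sq_pos_of (hal t ht))
  have hk : ContinuousOn (fun t => kap C (u t)) (Icc a T) := (continuous_kap C).comp_continuousOn hu
  have hρc : ContinuousOn ρ (Icc a T) := ((hk.pow 2).add (hv.pow 2)).sqrt
  have hp : ContinuousOn (fun t => kap C (u t) / ρ t) (Icc a T) := hk.div hρc fun t ht => (hρ0 t ht).ne'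
  have hq : ContinuousOn (fun t => v t / ρ t) (Icc a T) := hv.div hρc fun t ht => (hρ0 t ht).ne'
  have der : ∀ t ∈ Ioo a T, HasDerivAt (fun t => kap C (u t) / ρ t) (angVel n f C u v t * (v t / ρ t)) t ∧
      HasDerivAt (fun t => v t / ρ t) (-(angVel n f C u v t * (kap C (u t) / ρ t))) t ∧
      HasDerivAt θ (angVel n f C u v t) t := by
    intro t ht
    have hne := hal t (Ioo_subset_Icc_self ht)
    have hpos := sq_add_sq_pos_of (C := C) hne
    have hr := hρ0 t (Ioo_subset_Icc_self ht)
    have hrs : ρ t ^ 2 = kap C (u t) ^ 2 + v t ^ 2 := Real.sq_sqrt hpos.le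
    obtain ⟨d1, d2, d3⟩ := hd t ht
    have dk := (hasDerivAt_kap C (u t)).comp t d1
    have dr : HasDerivAt ρ _ t := ((dk.pow 2).add (d2.pow 2)).sqrt hpos.ne'
    set κ' := Real.exp (C * u t ^ 2) * (1 + 2 * C * u t ^ 2)
    set k := kap C (u t)
    set w := -((n : ℝ) / t) * v t - f (u t) with hw
    have hom : angVel n f C u v t = (κ' * v t ^ 2 - k * w) / ρ t ^ 2 := by rw [hrs]; unfold angVel; congr 1; rw [hw]; ring
    have dr' : HasDerivAt ρ ((k * (κ' * v t) + v t * w) / ρ t) t := by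
      refine dr.congr_deriv ?_
      show _ / (2 * ρ t) = _
      simp only [Function.comp_apply]; field_simp; ring
    refine ⟨(dk.div dr' hr.ne').congr_deriv ?_, (d2.div dr' hr.ne').congr_deriv ?_, d3⟩
    · rw [hom]
      simp only [Function.comp_apply, show kap C (u t) = k from rfl]
      field_simp; rw [hrs]; ring
    · rw [hom]; field_simp; rw [hrs]; ring
  have c1 := abs_sub_le_of_hasDerivAt (C := 0) haT
    (g := fun t => kap C (u t) / ρ t * Real.cos (θ t) - v t / ρ t * Real.sin (θ t)) (g' := fun _ => 0)
    ((hp.mul (Real.continuous_cos.comp_continuousOn hθc)).sub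
      (hq.mul (Real.continuous_sin.comp_continuousOn hθc))) (fun t ht => by
      obtain ⟨e1, e2, e3⟩ := der t ht
      refine ((e1.mul e3.cos).sub (e2.mul e3.sin)).congr_deriv ?_
      ring) (by simp)
  have c2 := abs_sub_le_of_hasDerivAt (C := 0) haT
    (g := fun t => kap C (u t) / ρ t * Real.sin (θ t) + v t / ρ t * Real.cos (θ t)) (g' := fun _ => 0)
    ((hp.mul (Real.continuous_sin.comp_continuousOn hθc)).add
      (hq.mul (Real.continuous_cos.comp_continuousOn hθc))) (fun t ht => by
      obtain ⟨e1, e2, e3⟩ := der t ht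
      refine ((e1.mul e3.sin).add (e2.mul e3.cos)).congr_deriv ?_
      ring) (by simp)
  have hra := hρ0 a ⟨le_rfl, haT⟩
  have sa := Real.sin_sq_add_cos_sq (θ a)
  have e1 : kap C (u a) / ρ a = Real.cos (θ a) := by rw [hk0]; field_simp
  have e2 : v a / ρ a = -Real.sin (θ a) := by rw [hv0]; field_simp
  simp only [e1, e2, zero_mul, abs_nonpos_iff] at c1 c2
  have hr := hρ0 T ⟨haT, le_rfl⟩
  have s2 := Real.sin_sq_add_cos_sq (θ T)
  have c1' : kap C (u T) * Real.cos (θ T) - v T * Real.sin (θ T) = ρ T := by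
    have : kap C (u T) / ρ T * Real.cos (θ T) - v T / ρ T * Real.sin (θ T) = 1 := by linear_combination c1 + sa
    field_simp at this; linarith
  have c2' : kap C (u T) * Real.sin (θ T) + v T * Real.cos (θ T) = 0 := by
    have : kap C (u T) / ρ T * Real.sin (θ T) + v T / ρ T * Real.cos (θ T) = 0 := by linear_combination c2
    field_simp at this; linarith
  constructor
  · linear_combination Real.sin (θ T) * c2' + Real.cos (θ T) * c1' - kap C (u T) * s2
  · linear_combination Real.cos (θ T) * c2' - Real.sin (θ T) * c1' - v T * s2

theorem RegSol.polar (h : RegSol n f α u v) (hα : 0 < α) (C : ℝ)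
    (hfc : ContinuousOn (fun t => f (u t)) (Ici 0)) (hT : u T ≠ 0 ∨ v T ≠ 0) (hT0 : 0 ≤ T) :
    kap C (u T) = rho C u v T * Real.cos (ang n f C u v T) ∧ v T = -(rho C u v T * Real.sin (ang n f C u v T)) := by
  have hsub : Icc 0 T ⊆ Ici 0 := fun t ht => ht.1
  refine polar_of_hasDerivAt C hT0 (h.cont_u.mono hsub) (h.cont_v.mono hsub)
    (h.continuousOn_ang hα C hfc hT hT0) (fun t ht => h.alive hα hT ht) (fun t ht =>
      ⟨(h.traj.hasDerivAt ht.1).1, (h.traj.hasDerivAt ht.1).2,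
        h.hasDerivAt_ang hα C hfc (h.alive hα hT (Ioo_subset_Icc_self ht)) ht.1⟩) ?_ ?_
  · simp only [rho, h.u_zero, h.v_zero, ang_zero, Real.cos_zero, mul_one]
    rw [zero_pow two_ne_zero, add_zero, Real.sqrt_sq (kap_pos hα).le]
  · simp [h.v_zero, ang_zero]

/-- The levels `(k - 1/2)π` of the angle are crossed upwards only. -/
theorem RegSol.ang_persist (h : RegSol n f α u v) (hα : 0 < α) (C : ℝ)
    (hfc : ContinuousOn (fun t => f (u t)) (Ici 0)) {s t : ℝ} (ht : u t ≠ 0 ∨ v t ≠ 0)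
    (hs0 : 0 ≤ s) (hst : s ≤ t) {k : ℤ} (hk : (k - 1 / 2) * Real.pi < ang n f C u v s) :
    (k - 1 / 2) * Real.pi < ang n f C u v t := by
  set θ := ang n f C u v
  by_contra! hcon
  have hθc : ContinuousOn θ (Icc s t) := (h.continuousOn_ang hα C hfc ht (hs0.trans hst)).mono (Icc_subset_Icc_left hs0)
  obtain ⟨τ, ⟨hsτ, hτt⟩, heq, before⟩ := exists_first_le hθc hk ⟨t, ⟨hst, le_rfl⟩, hcon⟩
  have hτ0 : 0 < τ := hs0.trans_lt hsτ
  have hal := h.alive hα ht ⟨hτ0.le, hτt⟩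
  have hd := h.hasDerivAt_ang hα C hfc hal hτ0
  have hpol := (h.polar hα C hfc hal hτ0.le).1
  have hcos : Real.cos (θ τ) = 0 := by
    rw [heq, Real.cos_eq_zero_iff]
    exact ⟨k - 1, by push_cast; ring⟩
  have hu0 : u τ = 0 := by
    rw [show ang n f C u v τ = θ τ from rfl, hcos, mul_zero] at hpol
    exact kap_eq_zero.1 hpol
  have hv0 : v τ ≠ 0 := hal.resolve_left (not_not.2 hu0)
  rw [show angVel n f C u v τ = 1 by simp [angVel, hu0, kap_zero, hv0]] at hd
  have hlt : ∀ᶠ x in 𝓝[<] τ, θ x < θ τ := by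
    have hsl := (hasDerivAt_iff_tendsto_slope_left_right.1 hd).1
    filter_upwards [hsl.eventually_const_lt (zero_lt_one), self_mem_nhdsWithin] with x h1 hx
    have hx : x < τ := hx
    rw [slope_def_field] at h1
    by_contra! hc
    exact h1.not_ge (div_nonpos_of_nonneg_of_nonpos (sub_nonneg.2 hc) (by linarith))
  obtain ⟨x, hx1, hx2⟩ := (hlt.and (Ico_mem_nhdsLT hsτ)).exists
  exact (hx1.trans_eq heq).not_gt (before x hx2)

theorem RegSol.sign_of_ang (h : RegSol n f α u v) (hα : 0 < α) (C : ℝ)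
    (hfc : ContinuousOn (fun t => f (u t)) (Ici 0)) {t : ℝ} (ht : u t ≠ 0 ∨ v t ≠ 0)
    (ht0 : 0 ≤ t) (k : ℕ) :
    (|ang n f C u v t - k * Real.pi| < Real.pi / 2 → 0 < (-1) ^ k * u t) ∧
    (|ang n f C u v t - k * Real.pi| ≤ Real.pi / 2 → 0 ≤ (-1) ^ k * u t) := by
  have hr : 0 < rho C u v t := Real.sqrt_pos.2 (sq_add_sq_pos_of ht)
  have hp := (h.polar hα C hfc ht ht0).1
  have e : (-1 : ℝ) ^ k * u t * Real.exp (C * u t ^ 2) = rho C u v t * Real.cos (ang n f C u v t - k * Real.pi) := by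
    rw [Real.cos_sub_nat_mul_pi]
    have : u t * Real.exp (C * u t ^ 2) = kap C (u t) := rfl
    rw [mul_assoc, this, hp]; ring
  have he := Real.exp_pos (C * u t ^ 2)
  constructor
  · intro hc; rw [abs_lt] at hc
    exact pos_of_mul_pos_left (e ▸ mul_pos hr (Real.cos_pos_of_mem_Ioo ⟨by linarith, hc.2⟩)) he.le
  · intro hc; rw [abs_le] at hc
    exact nonneg_of_mul_nonneg_left (e ▸ mul_nonneg hr.le (Real.cos_nonneg_of_mem_Icc ⟨by linarith, hc.2⟩)) he

theorem RegSol.lt_ang_of_alternating (h : RegSol n f α u v) (hα : 0 < α) (C : ℝ)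
    (hfc : ContinuousOn (fun t => f (u t)) (Ici 0)) {k : ℕ} (hk : 1 ≤ k) {r : Fin (k + 1) → ℝ}
    (hr : StrictMono r) (hr0 : ∀ i, 0 < r i) (hs : ∀ i : Fin k, u (r i.castSucc) * u (r i.succ) < 0) :
    u (r (Fin.last k)) ≠ 0 ∧ (k - 1 / 2) * Real.pi < ang n f C u v (r (Fin.last k)) := by
  set θ := ang n f C u v with hθ
  have hpi := Real.pi_pos
  have hne : u (r (Fin.last k)) ≠ 0 := by
    obtain ⟨k', rfl⟩ : ∃ k', k = k' + 1 := ⟨k - 1, by omega⟩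
    have := hs (Fin.last k')
    rw [Fin.succ_last] at this; exact right_ne_zero_of_mul this.ne
  have hal : ∀ i, u (r i) ≠ 0 ∨ v (r i) ≠ 0 := fun i => h.alive hα (Or.inl hne) ⟨(hr0 i).le, hr.monotone (Fin.le_last i)⟩
  have key : ∀ i : Fin (k + 1), ((i : ℕ) - 1 / 2) * Real.pi < θ (r i) := by
    intro i
    induction i using Fin.induction with
    | zero =>
      have := h.ang_persist hα C hfc (hal 0) le_rfl (hr0 0).le (k := 0) (by rw [ang_zero]; push_cast; nlinarith)
      simpa using this
    | succ i ih =>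
      have hrl : r i.castSucc ≤ r i.succ := hr.monotone (Fin.castSucc_lt_succ).le
      simp only [Fin.val_castSucc] at ih; simp only [Fin.val_succ]
      rcases lt_or_ge (((i : ℕ) + 1 - 1 / 2) * Real.pi) (θ (r i.castSucc)) with h1 | h1
      · have := h.ang_persist hα C hfc (hal i.succ) (hr0 _).le hrl (k := (i : ℕ) + 1) (by push_cast; exact h1)
        push_cast at this ⊢; exact this
      · by_contra! hcon
        have h2 := h.ang_persist hα C hfc (hal i.succ) (hr0 _).le hrl (k := (i : ℕ)) (by push_cast; exact ih)
        push_cast at h2 hcon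
        have s1 := (h.sign_of_ang hα C hfc (hal i.castSucc) (hr0 _).le i).2 (by rw [abs_le]; constructor <;> linarith)
        have s2 := (h.sign_of_ang hα C hfc (hal i.succ) (hr0 _).le i).2 (by rw [abs_le]; constructor <;> linarith)
        have s3 := hs i
        rcases neg_one_pow_eq_or ℝ (i : ℕ) with e | e <;> rw [e] at s1 s2 <;> nlinarith
  refine ⟨hne, ?_⟩
  simpa using key (Fin.last k)

theorem RegSol.signChanges_iff (h : RegSol n f α u v) (hα : 0 < α) (C : ℝ)
    (hfc : ContinuousOn (fun t => f (u t)) (Ici 0)) {k : ℕ} (hk : 1 ≤ k) :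
    HasAtLeastSignChanges u k ↔ ∃ t, 0 ≤ t ∧ (u t ≠ 0 ∨ v t ≠ 0) ∧ (k - 1 / 2) * Real.pi < ang n f C u v t := by
  set θ := ang n f C u v with hθ
  have hpi := Real.pi_pos
  constructor
  · rintro ⟨r, hr, hr0, hs⟩
    obtain ⟨h1, h2⟩ := h.lt_ang_of_alternating hα C hfc hk hr hr0 hs
    exact ⟨r (Fin.last k), (hr0 _).le, Or.inl h1, h2⟩
  · rintro ⟨t, ht0, hal, ht⟩
    have hθc : ContinuousOn θ (Icc 0 t) := h.continuousOn_ang hα C hfc hal ht0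
    have hk1 : (1 : ℝ) ≤ k := by exact_mod_cast hk
    have ex : ∀ i : Fin (k + 1), ∃ r ∈ Ioc 0 t, |θ r - (i : ℕ) * Real.pi| < Real.pi / 2 := by
      intro i
      have hi0 : (0 : ℝ) ≤ (i : ℕ) := Nat.cast_nonneg _
      have hik : ((i : ℕ) : ℝ) ≤ k := by exact_mod_cast Nat.lt_succ_iff.1 i.2
      have hθt : 0 < θ t := by nlinarith
      obtain ⟨r, hr, hrv⟩ := intermediate_value_Icc ht0 hθc
        (show min (((i : ℕ) + 1 / 4) * Real.pi) (θ t) ∈ Icc (θ 0) (θ t) from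
          ⟨by rw [show θ 0 = 0 from ang_zero C]; exact le_min (by positivity) hθt.le, min_le_right _ _⟩)
      refine ⟨r, ⟨hr.1.lt_of_ne ?_, hr.2⟩, abs_lt.2 ⟨?_, ?_⟩⟩
      · rintro rfl; rw [hθ, ang_zero] at hrv
        exact (lt_min (by positivity) hθt).ne hrv
      · have : ((i : ℕ) - 1 / 2) * Real.pi < θ r := by
          rw [hrv]
          exact lt_min (by nlinarith) (by nlinarith)
        linarith
      · have := hrv.trans_le (min_le_left _ _)
        linarith
    choose r hr hrθ using ex
    have halr : ∀ i, u (r i) ≠ 0 ∨ v (r i) ≠ 0 := fun i => h.alive hα hal ⟨(hr i).1.le, (hr i).2⟩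
    refine ⟨r, fun i j hij => ?_, fun i => (hr i).1, fun i => ?_⟩
    · by_contra! hc
      have h1 := h.ang_persist hα C hfc (halr i) (hr j).1.le hc (k := (j : ℕ)) (by
        have := (abs_lt.1 (hrθ j)).1
        push_cast
        linarith)
      have h2 := (abs_lt.1 (hrθ i)).2
      have h3 : ((i : ℕ) : ℝ) + 1 ≤ (j : ℕ) := by exact_mod_cast hij
      push_cast at h1
      have h4 : ang n f C u v (r i) = θ (r i) := rfl
      rw [h4] at h1; nlinarith
    · have s1 := (h.sign_of_ang hα C hfc (halr i.castSucc) (hr _).1.le _).1 (hrθ i.castSucc)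
      have s2 := (h.sign_of_ang hα C hfc (halr i.succ) (hr _).1.le _).1 (hrθ i.succ)
      simp only [Fin.val_castSucc, Fin.val_succ, pow_succ] at s1 s2
      rcases neg_one_pow_eq_or ℝ (i : ℕ) with e | e <;> rw [e] at s1 s2 <;> nlinarith

end angle

theorem Nonlin.neg {f F : ℝ → ℝ} {O : Set ℝ} (H : Nonlin f F O) :
    Nonlin (fun s => -f (-s)) (fun s => F (-s)) (Neg.neg ⁻¹' O) where
  isOpen := H.isOpen.preimage continuous_neg
  conn := ⟨fun x hx y hy z hz => H.conn.out hy hx ⟨neg_le_neg hz.2, neg_le_neg hz.1⟩⟩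
  zero_mem := by simpa using H.zero_mem
  cont := (H.cont.comp continuous_neg.continuousOn fun s hs => hs).neg
  deriv s hs := by
    have := (H.deriv (-s) hs).comp s (hasDerivAt_neg s)
    simpa [Function.comp_def] using this
  lip s hs hs0 := by
    obtain ⟨K, t, ht, hK⟩ := H.lip (-s) hs (neg_ne_zero.2 hs0)
    refine ⟨K, Neg.neg ⁻¹' t, continuous_neg.continuousAt.preimage_mem_nhds ht, ?_⟩
    refine LipschitzOnWith.of_dist_le_mul fun x hx y hy => ?_
    have := hK.dist_le_mul (-x) hx (-y) hy
    simpa [dist_neg_neg] using this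
  f_zero := by simp [H.f_zero]
  F_zero := by simp [H.F_zero]

theorem IsTraj.neg {n : ℕ} {f u v : ℝ → ℝ} {S : Set ℝ} (h : IsTraj n f u v S) :
    IsTraj n (fun s => -f (-s)) (fun t => -u t) (fun t => -v t) S := fun t ht => by
  refine ⟨(h t ht).1.neg, (h t ht).2.neg.congr_deriv ?_⟩
  simp only [neg_neg]; ring

theorem energy_neg (F u v : ℝ → ℝ) : energy (fun s => F (-s)) (fun t => -u t) (fun t => -v t) = energy F u v := by
  ext t
  simp [energy]

section traj
variable {n : ℕ} {f F u v : ℝ → ℝ} {O : Set ℝ} {a b : ℝ}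

theorem IsTraj.antitoneOn_energy (h : IsTraj n f u v (Icc a b)) (ha : 0 < a)
    (hF : ∀ t ∈ Icc a b, HasDerivAt F (f (u t)) (u t)) : AntitoneOn (energy F u v) (Icc a b) := by
  refine antiOn_Icc (fun t ht => (h.hasDerivWithinAt_energy ht (hF t ht)).continuousWithinAt) fun t ht =>
    ⟨_, (h.hasDerivWithinAt_energy (Ioo_subset_Icc_self ht) (hF t (Ioo_subset_Icc_self ht))).hasDerivAt (Icc_mem_nhds ht.1 ht.2), ?_⟩
  have : 0 < t := ha.trans ht.1
  have : 0 ≤ (n : ℝ) / t * v t ^ 2 := by positivity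
  linarith

theorem IsTraj.antitone_energy (h : IsTraj n f u v (Ioi 0)) (ha : 0 < a)
    (hF : ∀ t ∈ Icc a b, HasDerivAt F (f (u t)) (u t)) : AntitoneOn (energy F u v) (Icc a b) :=
  IsTraj.antitoneOn_energy (fun t ht => h.mono (fun _ hx => ha.trans_le hx.1) t ht) ha hF

theorem F_le_energy (F u v : ℝ → ℝ) (t : ℝ) : F (u t) ≤ energy F u v t := by
  have := sq_nonneg (v t)
  unfold energy; linarith

theorem IsTraj.drop_le (h : IsTraj n f u v (Ioi 0)) (ha : 0 < a) (hab : a ≤ b)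
    (hF : ∀ t ∈ Icc a b, HasDerivAt F (f (u t)) (u t)) {V : ℝ}
    (hv : ∀ t ∈ Icc a b, 0 ≤ v t ∧ v t ≤ V) :
    energy F u v a - energy F u v b ≤ n * V / a * (u b - u a) := by
  have hd := fun t (ht : t ∈ Icc a b) => (h.hasDerivAt_energy (ha.trans_le ht.1) (hF t ht)).add
    ((h.hasDerivAt (ha.trans_le ht.1)).1.const_mul (n * V / a))
  have := monoOn_Icc (fun t ht => (hd t ht).continuousAt.continuousWithinAt) (fun t ht => by
    have ht := Ioo_subset_Icc_self ht
    refine ⟨_, hd t ht, ?_⟩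
    have ht0 : 0 < t := ha.trans_le ht.1
    obtain ⟨h1, h2⟩ := hv t ht
    have h3 : (n : ℝ) / t * v t ^ 2 ≤ n / a * (V * v t) := by
      refine mul_le_mul (div_le_div_of_nonneg_left (Nat.cast_nonneg n) ha ht.1) ?_ (sq_nonneg _) (by positivity)
      nlinarith
    have : (n : ℝ) * V / a * v t = n / a * (V * v t) := by ring
    linarith) (left_mem_Icc.2 hab) (right_mem_Icc.2 hab) hab
  simp only [Pi.add_apply] at this; linarith

theorem IsTraj.drop_le' (h : IsTraj n f u v (Ioi 0)) (ha : 0 < a) (hab : a ≤ b)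
    (hF : ∀ t ∈ Icc a b, HasDerivAt F (f (u t)) (u t)) {V : ℝ}
    (hv : ∀ t ∈ Icc a b, v t ≤ 0 ∧ -V ≤ v t) :
    energy F u v a - energy F u v b ≤ n * V / a * (u a - u b) := by
  have := h.neg.drop_le (F := fun s => F (-s)) ha hab (V := V) (fun t ht => by
    have hd := hF t ht
    rw [← neg_neg (u t)] at hd
    simpa [Function.comp_def] using (hd.comp (-u t) (hasDerivAt_neg _))) (fun t ht => by
      have := hv t ht; constructor <;> linarith)
  rw [energy_neg] at this
  calc _ ≤ _ := this
    _ = _ := by ring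

theorem le_drop (h : IsTraj n f u v (Ioi 0)) (ha : 0 < a) (hab : a ≤ b)
    (hF : ∀ t ∈ Icc a b, HasDerivAt F (f (u t)) (u t)) {w : ℝ} (hw : 0 ≤ w)
    (hv : ∀ t ∈ Icc a b, w ≤ v t) :
    n * w / b * (u b - u a) ≤ energy F u v a - energy F u v b := by
  have hb : 0 < b := ha.trans_le hab
  have hd := fun t (ht : t ∈ Icc a b) => (h.hasDerivAt_energy (ha.trans_le ht.1) (hF t ht)).add
    ((h.hasDerivAt (ha.trans_le ht.1)).1.const_mul (n * w / b))
  have := antiOn_Icc (fun t ht => (hd t ht).continuousAt.continuousWithinAt) (fun t ht => by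
    have ht := Ioo_subset_Icc_self ht
    refine ⟨_, hd t ht, ?_⟩
    have ht0 : 0 < t := ha.trans_le ht.1
    have h1 := hv t ht
    have h3 : n / b * (w * v t) ≤ (n : ℝ) / t * v t ^ 2 := by
      refine mul_le_mul (div_le_div_of_nonneg_left (Nat.cast_nonneg n) ht0 ht.2) ?_ (by nlinarith) (by positivity)
      nlinarith
    have : (n : ℝ) * w / b * v t = n / b * (w * v t) := by ring
    linarith) (left_mem_Icc.2 hab) (right_mem_Icc.2 hab) hab
  simp only [Pi.add_apply] at this; linarith

theorem continuousOn_ne_zero_pos {g : ℝ → ℝ} {a b c : ℝ} (hg : ContinuousOn g (Icc a b))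
    (hne : ∀ t ∈ Icc a b, g t ≠ 0) (hc : c ∈ Icc a b) (hpos : 0 < g c) :
    ∀ t ∈ Icc a b, 0 < g t := by
  intro t ht
  by_contra! hle
  obtain ⟨x, hx, hx0⟩ := isPreconnected_Icc.intermediate_value ht hc hg ⟨hle, hpos.le⟩
  exact hne x hx hx0

/-- A trajectory that comes close to a strict local maximum point of `F` with hardly any energy to
spare cannot leave its neighbourhood upwards as long as its energy is not lower than that of the
maximum. -/
theorem no_exit_above (hn : 1 ≤ n) (H : Nonlin f F O) {s ρ : ℝ} (hρ : 0 < ρ)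
    (hsub : Icc (s - ρ) (s + ρ) ⊆ O) (hs : ∀ w ∈ Icc (s - ρ) (s + ρ), w ≠ s → F w < F s)
    {τ : ℝ} (hτ : 0 < τ) :
    ∃ η > 0, ∀ u v : ℝ → ℝ, IsTraj n f u v (Ioi 0) → ∀ T ≥ τ, ∀ t ≥ T, |u T - s| < η →
      energy F u v T - F s < η / T → (∀ r ∈ Icc T t, |u r - s| ≤ ρ) →
      F s ≤ energy F u v t → u t ≠ s + ρ := by
  have hcF : ContinuousOn F (Icc (s + ρ / 2) (s + ρ)) := fun w hw =>
    (H.deriv w (hsub ⟨by linarith [hw.1], hw.2⟩)).continuousAt.continuousWithinAt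
  obtain ⟨w₀, hw₀, hmax⟩ := isCompact_Icc.exists_isMaxOn ⟨s + ρ, by linarith, le_rfl⟩ hcF
  have hd0 : 0 < F s - F w₀ := sub_pos.2 (hs w₀ ⟨by linarith [hw₀.1], hw₀.2⟩ (by linarith [hw₀.1] : s < w₀).ne')
  set d := F s - F w₀ with hd
  set c := n * √(2 * d) * (ρ / 2) with hc
  have hn0 : (0 : ℝ) < n := by exact_mod_cast hn
  have hc0 : 0 < c := by positivity
  refine ⟨min (ρ / 2) (min (c / 2) (min (c ^ 2 * τ / (16 * ρ ^ 2)) (d * τ))), by positivity, ?_⟩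
  intro u v h T hT t ht h1 h2 h3 h4 hcon
  set η := min (ρ / 2) (min (c / 2) (min (c ^ 2 * τ / (16 * ρ ^ 2)) (d * τ))) with hη
  have η1 : η ≤ ρ / 2 := min_le_left _ _
  have η2 : η ≤ c / 2 := (min_le_right _ _).trans (min_le_left _ _)
  have η3 : η ≤ c ^ 2 * τ / (16 * ρ ^ 2) := (min_le_right _ _).trans ((min_le_right _ _).trans (min_le_left _ _))
  have η4 : η ≤ d * τ := (min_le_right _ _).trans ((min_le_right _ _).trans (min_le_right _ _))
  have hη0 : 0 < η := by positivity
  have hT0 : 0 < T := hτ.trans_le hT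
  have ht0 : 0 < t := hT0.trans_le ht
  have hO : ∀ r ∈ Icc T t, u r ∈ O := fun r hr => hsub (by have := abs_le.1 (h3 r hr); constructor <;> linarith)
  have hF : ∀ r ∈ Icc T t, HasDerivAt F (f (u r)) (u r) := fun r hr => H.deriv _ (hO r hr)
  have hanti := h.antitone_energy hT0 hF
  have hE : ∀ r ∈ Icc T t, F s ≤ energy F u v r := fun r hr => h4.trans (hanti hr (right_mem_Icc.2 ht) hr.2)
  have hcu : ContinuousOn u (Icc T t) := fun r hr => (h.hasDerivAt (hT0.trans_le hr.1)).1.continuousAt.continuousWithinAt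
  have hcv : ContinuousOn v (Icc T t) := fun r hr => (h.hasDerivAt (hT0.trans_le hr.1)).2.continuousAt.continuousWithinAt
  obtain ⟨m, ⟨hmI, hmt⟩, hum, after⟩ := exists_last_le hcu ⟨T, left_mem_Icc.2 ht, by
    have := (abs_lt.1 h1).2; linarith⟩ (by linarith : s + ρ / 2 < u t)
  have hm0 : 0 < m := hT0.trans_le hmI
  have hmtI : ∀ r ∈ Icc m t, r ∈ Icc T t := fun r hr => ⟨hmI.trans hr.1, hr.2⟩
  have hv2 : ∀ r ∈ Icc m t, 2 * d ≤ v r ^ 2 := by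
    intro r hr
    have hur : u r ∈ Icc (s + ρ / 2) (s + ρ) := by
      refine ⟨?_, by have := (abs_le.1 (h3 r (hmtI r hr))).2; linarith⟩
      rcases hr.1.eq_or_lt with rfl | hlt
      · exact hum.ge
      · exact (after r ⟨hlt, hr.2⟩).le
    have e1 := hE r (hmtI r hr)
    have e2 : F (u r) ≤ F w₀ := hmax hur
    unfold energy at e1; linarith
  have hpos : ∃ r ∈ Icc m t, 0 < v r := by
    obtain ⟨r, hr, hrv⟩ := exists_hasDerivAt_eq_slope u v hmt
      (hcu.mono (Icc_subset_Icc_left hmI)) (fun r hr => (h.hasDerivAt (hm0.trans hr.1)).1)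
    refine ⟨r, Ioo_subset_Icc_self hr, ?_⟩
    rw [hrv, hcon, hum]
    exact div_pos (by linarith) (by linarith)
  obtain ⟨r₀, hr₀, hr₀v⟩ := hpos
  have hvpos := continuousOn_ne_zero_pos (hcv.mono (Icc_subset_Icc_left hmI)) (fun r hr h0 => by
    have := hv2 r hr
    rw [h0] at this
    linarith) hr₀ hr₀v
  have hvd : ∀ r ∈ Icc m t, √(2 * d) ≤ v r := fun r hr => Real.sqrt_le_iff.2 ⟨(hvpos r hr).le, hv2 r hr⟩
  have hdrop := le_drop h hm0 hmt.le (fun r hr => hF r (hmtI r hr)) (Real.sqrt_nonneg _) hvd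
  rw [hcon, hum] at hdrop
  have hct : c / t ≤ energy F u v m - F s := by
    have e : c / t = n * √(2 * d) / t * (s + ρ - (s + ρ / 2)) := by rw [hc]; ring
    rw [e]; linarith
  have hmT : energy F u v m ≤ energy F u v T := hanti (left_mem_Icc.2 ht) ⟨hmI, hmt.le⟩ hmI
  have htT : c * T < η * t := by
    have : c / t < η / T := by linarith
    rwa [div_lt_div_iff₀ ht0 hT0] at this
  have hv3 : ∀ r ∈ Ioo T t, ∃ d, HasDerivAt u d r ∧ 2 * (c / t) ≤ d ^ 2 := by
    intro r hr
    refine ⟨_, (h.hasDerivAt (hT0.trans hr.1)).1, ?_⟩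
    have hr := Ioo_subset_Icc_self hr
    rcases le_total r m with hrm | hrm
    · have e1 : energy F u v m ≤ energy F u v r := hanti hr ⟨hmI, hmt.le⟩ hrm
      have e2 : F (u r) ≤ F s := by
        by_cases hus : u r = s
        · rw [hus]
        · exact (hs _ (by have := abs_le.1 (h3 r hr); constructor <;> linarith) hus).le
      unfold energy at e1 hct; linarith
    · have e1 := hv2 r ⟨hrm, hr.2⟩
      have e2 : c / t ≤ d := by
        rw [div_le_iff₀ ht0]
        have : c * τ ≤ c * T := mul_le_mul_of_nonneg_left hT hc0.le
        have : η * t ≤ d * τ * t := mul_le_mul_of_nonneg_right η4 ht0.le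
        exact le_of_mul_le_mul_right (by linarith : c * τ ≤ d * t * τ) hτ
      linarith
  have hhalf : t / 2 ≤ t - T := by
    have h5 : η * t ≤ c / 2 * t := mul_le_mul_of_nonneg_right η2 ht0.le
    linarith [le_of_mul_le_mul_left (by linarith : c * T ≤ c * (t / 2)) hc0]
  have hw3 := slope_sq_le (hmI.trans_lt hmt) hcu hv3 (w := 2 * ρ) (by
    have := abs_le.1 (h3 T (left_mem_Icc.2 ht))
    rw [hcon, abs_le]
    constructor <;> linarith) (by positivity) hhalf
  have hw4 : c * t ≤ 8 * ρ ^ 2 := by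
    have : 2 * (c / t) * (t / 2) ^ 2 = c * t / 2 := by field_simp
    linarith
  have h6 : c * τ < η * t := (mul_le_mul_of_nonneg_left hT hc0.le).trans_lt htT
  have h7 : c * (c * τ) < η * (8 * ρ ^ 2) := by
    calc c * (c * τ) < c * (η * t) := mul_lt_mul_of_pos_left h6 hc0
      _ = η * (c * t) := by ring
      _ ≤ _ := mul_le_mul_of_nonneg_left hw4 hη0.le
  rw [le_div_iff₀ (by positivity)] at η3
  have : 0 < c ^ 2 * τ := by positivity
  nlinarith

end traj

section
variable {n : ℕ} {f F u v : ℝ → ℝ} {O : Set ℝ} {a b : ℝ}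

theorem near_max (hn : 1 ≤ n) (H : Nonlin f F O) {s ρ : ℝ} (hρ : 0 < ρ)
    (hsub : Icc (s - ρ) (s + ρ) ⊆ O) (hs : ∀ w ∈ Icc (s - ρ) (s + ρ), w ≠ s → F w < F s)
    {τ : ℝ} (hτ : 0 < τ) :
    ∃ η > 0, ∀ u v : ℝ → ℝ, IsTraj n f u v (Ioi 0) → ∀ T ≥ τ, ∀ t ≥ T, |u T - s| < η →
      energy F u v T - F s < η / T → (∀ r ∈ Icc T t, u r ∈ O) →
      F s ≤ energy F u v t → ∀ r ∈ Icc T t, |u r - s| < ρ := by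
  obtain ⟨η₁, hη₁, h₁⟩ := no_exit_above hn H hρ hsub hs hτ
  obtain ⟨η₂, hη₂, h₂⟩ := no_exit_above hn H.neg (s := -s) hρ (fun w hw => hsub ⟨by linarith [hw.2], by linarith [hw.1]⟩)
    (fun w hw hne => by
      simp only [neg_neg]
      exact hs _ ⟨by linarith [hw.2], by linarith [hw.1]⟩ fun e => hne (by rw [← e, neg_neg])) hτ
  refine ⟨min ρ (min η₁ η₂), by positivity, fun u v h T hT t ht hu hE hO hEt => ?_⟩
  have hT0 : 0 < T := hτ.trans_le hT
  have hcu : ContinuousOn u (Icc T t) := fun r hr => (h.hasDerivAt (hT0.trans_le hr.1)).1.continuousAt.continuousWithinAt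
  by_contra! hcon
  obtain ⟨r, hr, hrρ⟩ := hcon
  obtain ⟨m, ⟨hTm, hmt⟩, hm, before⟩ := exists_first_ge (g := fun x => |u x - s|) (hcu.sub continuousOn_const).abs
    (hu.trans_le (min_le_left _ _)) ⟨r, hr, hrρ⟩
  have all : ∀ x ∈ Icc T m, |u x - s| ≤ ρ := fun x hx => by
    rcases hx.2.eq_or_lt with rfl | hlt
    · exact hm.le
    · exact (before x ⟨hx.1, hlt⟩).le
  have hEm : F s ≤ energy F u v m := hEt.trans (h.antitone_energy (hT0.trans hTm) (fun x hx =>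
    H.deriv _ (hO x ⟨hTm.le.trans hx.1, hx.2⟩)) (left_mem_Icc.2 hmt) (right_mem_Icc.2 hmt) hmt)
  have e1 : min ρ (min η₁ η₂) ≤ η₁ := (min_le_right _ _).trans (min_le_left _ _)
  have e2 : min ρ (min η₁ η₂) ≤ η₂ := (min_le_right _ _).trans (min_le_right _ _)
  have c1 := h₁ u v h T hT m hTm.le (hu.trans_le e1) (hE.trans_le (div_le_div_of_nonneg_right e1 hT0.le)) all hEm
  have c2 := h₂ _ _ h.neg T hT m hTm.le (by rw [neg_sub_neg, abs_sub_comm]; exact hu.trans_le e2) (by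
      rw [energy_neg, neg_neg]
      exact hE.trans_le (div_le_div_of_nonneg_right e2 hT0.le))
    (fun x hx => by
      rw [neg_sub_neg, abs_sub_comm]
      exact all x hx)
    (by rw [energy_neg, neg_neg]; exact hEm)
  rcases abs_cases (u m - s) with ⟨e, -⟩ | ⟨e, -⟩
  · apply c1; linarith
  · apply c2; linarith

/-- Zeros with negative derivative are crossed downwards only. -/
theorem neg_persist {g g' : ℝ → ℝ} (hc : ContinuousOn g (Icc a b))
    (hd : ∀ t ∈ Ico a b, g t = 0 → HasDerivAt g (g' t) t ∧ g' t < 0) (ha : g a ≤ 0) :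
    ∀ t ∈ Icc a b, g t ≤ 0 := by
  intro t ht
  by_contra! hpos
  obtain ⟨m, hmI, hm0, after⟩ := exists_last_le (hc.mono (Icc_subset_Icc_right ht.2)) ⟨a, left_mem_Icc.2 ht.1, ha⟩ hpos
  have hmt := hmI.2
  obtain ⟨d1, d2⟩ := hd m ⟨hmI.1, hmt.trans_le ht.2⟩ hm0
  have hsl := (hasDerivAt_iff_tendsto_slope_left_right.1 d1).2
  obtain ⟨x, hx1, hx2⟩ := ((hsl.eventually_lt_const d2).and (Ioc_mem_nhdsGT hmt)).exists
  rw [slope_def_field, hm0, sub_zero] at hx1; exact hx1.not_ge (div_nonneg (after x hx2).le (sub_nonneg.2 hx2.1.le))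

theorem deriv_nonneg_of_le_left {g : ℝ → ℝ} {d s : ℝ} (hd : HasDerivAt g d s) (h : ∀ᶠ x in 𝓝[<] s, g x ≤ g s) : 0 ≤ d := by
  refine ge_of_tendsto (hasDerivAt_iff_tendsto_slope_left_right.1 hd).1 ?_
  filter_upwards [h, self_mem_nhdsWithin] with x hx hxs
  have : x < s := hxs
  rw [slope_def_field]
  exact div_nonneg_of_nonpos (by linarith) (by linarith)

/-- An energy band `(ℓ', ℓ)` without critical values, inside the well `(bm, bp)` of depth `ℓ`. -/
structure Slab (f F : ℝ → ℝ) (O : Set ℝ) (ℓ' ℓ bm bp : ℝ) : Prop where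
  nn : 0 ≤ ℓ'
  lt : ℓ' < ℓ
  bm_neg : bm < 0
  bp_pos : 0 < bp
  bm_mem : bm ∈ O
  bp_mem : bp ∈ O
  F_bm : F bm = ℓ
  F_bp : F bp = ℓ
  below : ∀ s ∈ Ioo bm bp, F s < ℓ
  crit : ∀ s ∈ Ioo bm bp, f s = 0 → F s ≤ ℓ'

variable {ℓ' ℓ bm bp : ℝ}

theorem Slab.neg (S : Slab f F O ℓ' ℓ bm bp) :
    Slab (fun s => -f (-s)) (fun s => F (-s)) (Neg.neg ⁻¹' O) ℓ' ℓ (-bp) (-bm) where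
  nn := S.nn
  lt := S.lt
  bm_neg := by linarith [S.bp_pos]
  bp_pos := by linarith [S.bm_neg]
  bm_mem := by simpa using S.bp_mem
  bp_mem := by simpa using S.bm_mem
  F_bm := by simpa using S.F_bp
  F_bp := by simpa using S.F_bm
  below s hs := S.below _ ⟨by linarith [hs.2], by linarith [hs.1]⟩
  crit s hs h := S.crit _ ⟨by linarith [hs.2], by linarith [hs.1]⟩ (neg_eq_zero.1 h)

theorem Slab.sub (S : Slab f F O ℓ' ℓ bm bp) (H : Nonlin f F O) : Icc bm bp ⊆ O := H.icc_subset S.bm_mem S.bp_mem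

theorem Slab.contF (S : Slab f F O ℓ' ℓ bm bp) (H : Nonlin f F O) : ContinuousOn F (Icc bm bp) :=
  fun s hs => (H.deriv s (S.sub H hs)).continuousAt.continuousWithinAt

theorem Slab.mono (S : Slab f F O ℓ' ℓ bm bp) (H : Nonlin f F O) {s s' : ℝ} (hs : 0 ≤ s)
    (hss : s < s') (hs' : s' < bp) (hF : ℓ' < F s') : F s < F s' := by
  by_contra! hcon
  have hsub : Icc 0 s' ⊆ Icc bm bp := fun x hx => ⟨by linarith [hx.1, S.bm_neg], by linarith [hx.2]⟩
  have h0 : (0 : ℝ) ≤ s' := hs.trans hss.le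
  obtain ⟨z, hz, hmax⟩ := isCompact_Icc.exists_isMaxOn ⟨0, le_rfl, h0⟩ ((S.contF H).mono hsub)
  obtain ⟨z, hz, hzs, hmax⟩ : ∃ z ∈ Icc 0 s', z ≠ s' ∧ IsMaxOn F (Icc 0 s') z := by
    by_cases hzs : z = s'
    · refine ⟨s, ⟨hs, hss.le⟩, hss.ne, fun x hx => ?_⟩
      have := hmax hx
      simp only [mem_ofPred_eq] at this ⊢; rw [hzs] at this; linarith
    · exact ⟨z, hz, hzs, hmax⟩
  have hFz : F s' ≤ F z := hmax ⟨h0, le_rfl⟩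
  have hz0 : z ≠ 0 := by rintro rfl; rw [H.F_zero] at hFz; linarith [S.nn]
  have hzi : z ∈ Ioo 0 s' := ⟨lt_of_le_of_ne hz.1 hz0.symm, lt_of_le_of_ne hz.2 hzs⟩
  have hloc : IsLocalMax F z := hmax.isLocalMax (Icc_mem_nhds hzi.1 hzi.2)
  have hfz := hloc.hasDerivAt_eq_zero (H.deriv z (S.sub H (hsub hz)))
  have := S.crit z ⟨by linarith [hzi.1, S.bm_neg], by linarith [hzi.2]⟩ hfz
  linarith

theorem Slab.f_pos (S : Slab f F O ℓ' ℓ bm bp) (H : Nonlin f F O) {s : ℝ} (hs : 0 ≤ s)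
    (hs' : s < bp) (hF : ℓ' < F s) : 0 < f s := by
  have hs0 : 0 < s := lt_of_le_of_ne hs (by rintro rfl; rw [H.F_zero] at hF; linarith [S.nn])
  have hsI : s ∈ Ioo bm bp := ⟨by linarith [S.bm_neg], hs'⟩
  refine lt_of_le_of_ne (deriv_nonneg_of_le_left (H.deriv s (S.sub H (Ioo_subset_Icc_self hsI))) ?_)
    fun h => (S.crit s hsI h.symm).not_gt hF
  filter_upwards [Ioo_mem_nhdsLT hs0] with x hx
  exact (S.mono H hx.1.le hx.2 hs' hF).le

theorem Slab.mul_pos (S : Slab f F O ℓ' ℓ bm bp) (H : Nonlin f F O) {s : ℝ} (hs : s ∈ Ioo bm bp)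
    (hF : ℓ' < F s) : 0 < s * f s := by
  rcases lt_trichotomy s 0 with h | h | h
  · have := S.neg.f_pos H.neg (s := -s) (by linarith) (by linarith [hs.1]) (by simpa using hF)
    rw [neg_neg] at this
    exact mul_pos_of_neg_of_neg h (by linarith)
  · rw [h, H.F_zero] at hF; linarith [S.nn]
  · exact _root_.mul_pos h (S.f_pos H h.le hs.2 hF)

theorem Slab.stay (S : Slab f F O ℓ' ℓ bm bp) (H : Nonlin f F O) (h : IsTraj n f u v (Ioi 0))
    (hO : ∀ t, 0 < t → u t ∈ O) {T t : ℝ} (hT : 0 < T) (hTt : T ≤ t)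
    (hE : energy F u v T < ℓ) (hu : u T ∈ Ioo bm bp) :
    energy F u v t < ℓ ∧ u t ∈ Ioo bm bp := by
  have hanti : ∀ r ∈ Icc T t, energy F u v r < ℓ := fun r hr =>
    (h.antitone_energy hT (fun x hx => H.deriv _ (hO x (hT.trans_le hx.1))) (left_mem_Icc.2 hTt) hr hr.1).trans_lt hE
  have hcu : ContinuousOn u (Icc T t) := fun r hr => (h.hasDerivAt (hT.trans_le hr.1)).1.continuousAt.continuousWithinAt
  refine ⟨hanti t ⟨hTt, le_rfl⟩, ?_⟩
  have key : ∀ y, F y = ℓ → y ∉ uIcc (u T) (u t) := fun y hy hmem => by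
    obtain ⟨r, hr, rfl⟩ := intermediate_value_uIcc (hcu.mono (uIcc_of_le hTt).subset) hmem
    rw [uIcc_of_le hTt] at hr
    have := hanti r hr
    have := F_le_energy F u v r
    linarith
  constructor
  · by_contra! hc
    exact key bm S.F_bm (mem_uIcc.2 (Or.inr ⟨hc, hu.1.le⟩))
  · by_contra! hc
    exact key bp S.F_bp (mem_uIcc.2 (Or.inl ⟨hu.2.le, hc⟩))

theorem Slab.inner (S : Slab f F O ℓ' ℓ bm bp) (H : Nonlin f F O) {e : ℝ} (he : e < ℓ) :
    ∃ lo hi, bm < lo ∧ lo < hi ∧ hi < bp ∧ ∀ w ∈ Ioo bm bp, F w ≤ e → w ∈ Icc lo hi := by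
  have h1 : ∀ᶠ w in 𝓝 bp, e < F w := (H.deriv bp S.bp_mem).continuousAt.eventually (by rw [S.F_bp]; exact lt_mem_nhds he)
  have h2 : ∀ᶠ w in 𝓝 bm, e < F w := (H.deriv bm S.bm_mem).continuousAt.eventually (by rw [S.F_bm]; exact lt_mem_nhds he)
  obtain ⟨x, hx, hx'⟩ := mem_nhdsLE_iff_exists_Icc_subset.1 (mem_nhdsWithin_of_mem_nhds h1 : _ ∈ 𝓝[≤] bp)
  obtain ⟨y, hy, hy'⟩ := mem_nhdsGE_iff_exists_Icc_subset.1 (mem_nhdsWithin_of_mem_nhds h2 : _ ∈ 𝓝[≥] bm)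
  have hx : x < bp := hx
  have hy : bm < y := hy
  refine ⟨min y (bm / 2), max x (bp / 2), lt_min hy (by linarith [S.bm_neg]), ?_,
    max_lt hx (by linarith [S.bp_pos]), fun w hw hwe => ⟨?_, ?_⟩⟩
  · have := min_le_right y (bm / 2)
    have := le_max_right x (bp / 2)
    linarith [S.bm_neg, S.bp_pos]
  · by_contra! hc
    have : e < F w := hy' ⟨hw.1.le, hc.le.trans (min_le_left _ _)⟩
    linarith
  · by_contra! hc
    have : e < F w := hx' ⟨(le_max_left _ _).trans hc.le, hw.2.le⟩
    linarith

theorem Slab.exists_speed (S : Slab f F O ℓ' ℓ bm bp) (H : Nonlin f F O) :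
    ∃ V, 0 < V ∧ ∀ u v : ℝ → ℝ, ∀ t, energy F u v t < ℓ → u t ∈ Ioo bm bp → |v t| ≤ V := by
  obtain ⟨B, hB⟩ := isCompact_Icc.exists_bound_of_continuousOn (S.contF H)
  have hB0 : 0 ≤ B := (norm_nonneg _).trans (hB bp ⟨by linarith [S.bm_neg, S.bp_pos], le_rfl⟩)
  have hℓ : 0 < ℓ := S.nn.trans_lt S.lt
  refine ⟨√(2 * (ℓ + B)), by positivity, fun u v t hE hu => Real.abs_le_sqrt ?_⟩
  have := (abs_le.1 (hB _ (Ioo_subset_Icc_self hu))).1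
  unfold energy at hE; linarith

/-- Below `ℓ` the energy decreases to the bottom `ℓ'` of the band. -/
theorem Slab.energy_decays (S : Slab f F O ℓ' ℓ bm bp) (H : Nonlin f F O) (hn : 1 ≤ n)
    (h : IsTraj n f u v (Ioi 0)) (hO : ∀ t, 0 < t → u t ∈ O) {T : ℝ} (hT : 0 < T)
    (hE : energy F u v T < ℓ) (hu : u T ∈ Ioo bm bp) {e : ℝ} (he : ℓ' < e) :
    ∃ t ≥ T, energy F u v t < e := by
  by_contra! hcon
  have hstay := fun t (ht : T ≤ t) => S.stay H h hO hT ht hE hu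
  obtain ⟨lo, hi, hlo, -, hhi, hin⟩ := S.inner H hE
  obtain ⟨V, hV0, hV⟩ := S.exists_speed H
  have hsub : Icc lo hi ⊆ Ioo bm bp := fun x hx => ⟨hlo.trans_le hx.1, hx.2.trans_lt hhi⟩
  have hsubO : Icc lo hi ⊆ O := fun x hx => S.sub H (Ioo_subset_Icc_self (hsub hx))
  have hanti : ∀ t, T ≤ t → energy F u v t ≤ energy F u v T := fun t ht =>
    h.antitone_energy hT (fun x hx => H.deriv _ (hO x (hT.trans_le hx.1))) (left_mem_Icc.2 ht) (right_mem_Icc.2 ht) ht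
  have huI : ∀ t, T ≤ t → u t ∈ Icc lo hi := fun t ht => hin _ (hstay t ht).2 ((F_le_energy F u v t).trans (hanti t ht))
  set e2 := (e + ℓ') / 2 with he2
  have hcont : ContinuousOn (fun s => s * f s) (Icc lo hi) := continuousOn_id.mul (H.cont.mono hsubO)
  obtain ⟨C', hC'⟩ := isCompact_Icc.exists_bound_of_continuousOn hcont
  obtain ⟨c₁, hc₁, hc₁'⟩ : ∃ c₁ > 0, ∀ s ∈ Icc lo hi, e2 ≤ F s → c₁ ≤ s * f s := by
    have hK : IsCompact {s ∈ Icc lo hi | e2 ≤ F s} := isCompact_Icc.of_isClosed_subset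
      (((S.contF H).mono (hsub.trans Ioo_subset_Icc_self)).preimage_isClosed_of_isClosed
        isClosed_Icc isClosed_Ici) (sep_subset _ _)
    rcases {s ∈ Icc lo hi | e2 ≤ F s}.eq_empty_or_nonempty with hem | hne
    · refine ⟨1, one_pos, fun s hs hsF => ?_⟩
      have : s ∈ {s ∈ Icc lo hi | e2 ≤ F s} := ⟨hs, hsF⟩
      rw [hem] at this; exact this.elim
    · obtain ⟨z, hz, hmin⟩ := hK.exists_isMinOn hne (hcont.mono (sep_subset _ _))
      exact ⟨z * f z, S.mul_pos H (hsub hz.1) (by linarith [hz.2]), fun s hs hsF => hmin ⟨hs, hsF⟩⟩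
  have hC'0 : 0 ≤ C' := (norm_nonneg _).trans (hC' _ (huI T le_rfl))
  set K := (C' + 1) / (e - ℓ') with hK
  have hK0 : 0 ≤ K := div_nonneg (by linarith) (by linarith)
  set c := min c₁ 1 with hc
  have hc0 : 0 < c := by positivity
  have main : ∀ t, T ≤ t → c ≤ K * v t ^ 2 + u t * f (u t) := by
    intro t ht
    rcases le_total e2 (F (u t)) with hcase | hcase
    · have := hc₁' _ (huI t ht) hcase
      have := mul_nonneg hK0 (sq_nonneg (v t))
      linarith [min_le_left c₁ 1]
    · have h1 : e ≤ v t ^ 2 / 2 + F (u t) := hcon t ht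
      have h2 : e - ℓ' ≤ v t ^ 2 := by linarith
      have h3 := (abs_le.1 (hC' _ (huI t ht))).1
      have h4 : C' + 1 ≤ K * v t ^ 2 := by
        rw [hK, div_mul_eq_mul_div, le_div_iff₀ (by linarith)]
        exact mul_le_mul_of_nonneg_left h2 (by linarith)
      linarith [min_le_right c₁ 1]
  obtain ⟨M, hM0, hM⟩ : ∃ M, 0 ≤ M ∧ ∀ t, T ≤ t → |u t| ≤ M :=
    ⟨max |lo| |hi|, by positivity, fun t ht => abs_le_max_abs_abs (huI t ht).1 (huI t ht).2⟩
  have hVt : ∀ t, T ≤ t → |v t| ≤ V := fun t ht => hV u v t (hstay t ht).1 (hstay t ht).2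
  have hn0 : (0 : ℝ) < n := by exact_mod_cast hn
  set Φ : ℝ → ℝ := fun t => -(n * (u t * v t / t)) - (K + 1) * energy F u v t - n * c * Real.log t
    - (n ^ 2 + n) * (M * V) * t⁻¹ with hΦ
  have huv : ∀ t, T ≤ t → -(M * V) ≤ u t * v t := fun t ht => (abs_le.1 (by
    rw [abs_mul]; exact mul_le_mul (hM t ht) (hVt t ht) (abs_nonneg _) hM0)).1
  have hmono : ∀ b, MonotoneOn Φ (Icc T b) := by
    have hd := fun t (ht : T ≤ t) => by
      have ht0 : 0 < t := hT.trans_le ht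
      obtain ⟨d1, d2⟩ := h.hasDerivAt ht0
      exact (((((d1.mul d2).div (hasDerivAt_id t) ht0.ne').const_mul (n : ℝ)).neg.sub
        ((h.hasDerivAt_energy ht0 (H.deriv _ (hO t ht0))).const_mul (K + 1))).sub
        ((Real.hasDerivAt_log ht0.ne').const_mul (n * c))).sub ((hasDerivAt_inv ht0.ne').const_mul ((n ^ 2 + n) * (M * V)))
    refine fun b => monoOn_Icc (fun t ht => (hd t ht.1).continuousAt.continuousWithinAt) fun t ht => ⟨_, hd t ht.1.le, ?_⟩
    have ht0 : 0 < t := hT.trans ht.1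
    have : 0 ≤ n / t * (K * v t ^ 2 + u t * f (u t) - c) := mul_nonneg (by positivity) (by linarith [main t ht.1.le])
    have : 0 ≤ ((n : ℝ) ^ 2 + n) / t ^ 2 * (M * V + u t * v t) := mul_nonneg (by positivity) (by linarith [huv t ht.1.le])
    refine (add_nonneg ‹0 ≤ n / t * _› this).trans_eq ?_
    simp only [id, Pi.mul_apply]; field_simp; ring
  have bound : ∀ t, T ≤ t → n * c * Real.log t ≤ n * (M * V / T) - (K + 1) * e - Φ T := by
    intro t ht
    have ht0 : 0 < t := hT.trans_le ht
    have h1 : Φ T ≤ Φ t := hmono t ⟨le_rfl, ht⟩ ⟨ht, le_rfl⟩ ht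
    have h2 : -(n * (u t * v t / t)) ≤ n * (M * V / T) := by
      rw [← mul_neg]
      refine mul_le_mul_of_nonneg_left ?_ hn0.le
      rw [← neg_div]
      exact div_le_div₀ (by positivity) (by linarith [huv t ht]) hT ht
    have h3 : (K + 1) * e ≤ (K + 1) * energy F u v t := mul_le_mul_of_nonneg_left (hcon t ht) (by linarith)
    have h4 : 0 ≤ ((n : ℝ) ^ 2 + n) * (M * V) * t⁻¹ := by positivity
    simp only [hΦ] at h1 ⊢; linarith
  have hlim : Tendsto (fun t => n * c * Real.log t) atTop atTop := Real.tendsto_log_atTop.const_mul_atTop (by positivity)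
  obtain ⟨t, ht1, ht2⟩ := ((hlim.eventually_gt_atTop _).and (eventually_ge_atTop T)).exists
  exact (bound t ht2).not_gt ht1

theorem Slab.swing_down (S : Slab f F O ℓ' ℓ bm bp) (H : Nonlin f F O) (hn : 1 ≤ n)
    (h : IsTraj n f u v (Ioi 0)) (hO : ∀ t, 0 < t → u t ∈ O) {T : ℝ} (hT : 0 < T)
    (hE : energy F u v T < ℓ) (hu : u T ∈ Ioo bm bp) {V : ℝ} (hV0 : 0 ≤ V)
    (hV : ∀ t, T ≤ t → |v t| ≤ V) (hpos : 0 < u T) {κ : ℝ} (hκ : ℓ' < κ)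
    (hκE : κ + 2 * (n * V * (bp - bm)) / T < energy F u v T) :
    ∃ t > T, u t < 0 ∧ κ < energy F u v t := by
  by_contra! hcon
  have hn0 : (0 : ℝ) < n := by exact_mod_cast hn
  have hw : 0 < bp - bm := by linarith [S.bm_neg, S.bp_pos]
  obtain ⟨t₂, ht₂, hEt₂⟩ := S.energy_decays H hn h hO hT hE hu hκ
  have hstay := fun t (ht : T ≤ t) => S.stay H h hO hT ht hE hu
  have hEc : ∀ t, 0 < t → ContinuousAt (energy F u v) t := fun t ht =>
    (h.hasDerivAt_energy ht (H.deriv _ (hO t ht))).continuousAt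
  have hC0 : 0 ≤ 2 * (n * V * (bp - bm)) / T := by positivity
  obtain ⟨t₃, ⟨hTt₃, -⟩, hE₃, hEgt⟩ := exists_first_le (fun t (ht : t ∈ Icc T t₂) =>
    (hEc t (hT.trans_le ht.1)).continuousWithinAt) (by linarith) ⟨t₂, ⟨ht₂, le_rfl⟩, hEt₂.le⟩
  have hupos : ∀ t ∈ Ico T t₃, 0 ≤ u t := fun t ht => by
    rcases ht.1.eq_or_lt with rfl | hlt
    · exact hpos.le
    · by_contra! hc
      exact (hcon t hlt hc).not_gt (hEgt t ht)
  have hvd : ∀ t ∈ Ico T t₃, v t = 0 →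
      HasDerivAt v (-((n : ℝ) / t) * v t - f (u t)) t ∧ -((n : ℝ) / t) * v t - f (u t) < 0 := by
    intro t ht h0
    refine ⟨(h.hasDerivAt (hT.trans_le ht.1)).2, ?_⟩
    have h1 := hEgt t ht
    have h2 : energy F u v t = F (u t) := by simp [energy, h0]
    have := S.f_pos H (hupos t ht) (hstay t ht.1).2.2 (by linarith)
    rw [h0, mul_zero]; linarith
  have hcv : ∀ a b, T ≤ a → ContinuousOn v (Icc a b) := fun a b ha t ht =>
    (h.hasDerivAt (hT.trans_le (ha.trans ht.1))).2.continuousAt.continuousWithinAt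
  have hF : ∀ a b, T ≤ a → ∀ t ∈ Icc a b, HasDerivAt F (f (u t)) (u t) := fun a b ha t ht =>
    H.deriv _ (hO t (hT.trans_le (ha.trans ht.1)))
  have hdiff : ∀ s t, T ≤ s → T ≤ t → u s - u t ≤ bp - bm := fun s t hs ht => by
    linarith [(hstay s hs).2.2, (hstay t ht).2.1]
  have hnV : 0 ≤ (n : ℝ) * V / T := by positivity
  have hvle : ∀ a t, T ≤ a → t ∈ Icc a t₃ → v t ≤ V ∧ -V ≤ v t := fun a t ha ht => by
    have := abs_le.1 (hV t (ha.trans ht.1)); exact ⟨this.2, this.1⟩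
  have down : ∀ a ∈ Icc T t₃, v a ≤ 0 → energy F u v a - energy F u v t₃ ≤ n * V / T * (bp - bm) := by
    intro a ha hva
    have hneg := neg_persist (b := t₃) (hcv a t₃ ha.1) (fun t ht h0 => hvd t ⟨ha.1.trans ht.1, ht.2⟩ h0) hva
    refine (h.drop_le' (hT.trans_le ha.1) ha.2 (hF a t₃ ha.1) (V := V)
      fun t ht => ⟨hneg t ht, (hvle a t ha.1 ht).2⟩).trans ?_
    have h1 : n * V / a ≤ n * V / T := div_le_div_of_nonneg_left (by positivity) hT ha.1
    have h2 := hdiff a t₃ ha.1 hTt₃.le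
    calc n * V / a * (u a - u t₃) ≤ n * V / a * (bp - bm) :=
          mul_le_mul_of_nonneg_left h2 (div_nonneg (by positivity) (hT.le.trans ha.1))
      _ ≤ _ := mul_le_mul_of_nonneg_right h1 hw.le
  have up : ∀ b ∈ Icc T t₃, (∀ t ∈ Icc T b, 0 ≤ v t) → energy F u v T - energy F u v b ≤ n * V / T * (bp - bm) := by
    intro b hb hvb
    refine (h.drop_le hT hb.1 (hF T b le_rfl) (V := V)
      fun t ht => ⟨hvb t ht, (hvle T t le_rfl ⟨ht.1, ht.2.trans hb.2⟩).1⟩).trans ?_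
    exact mul_le_mul_of_nonneg_left (hdiff b T hb.1 le_rfl) hnV
  have e : 2 * (n * V * (bp - bm)) / T = n * V / T * (bp - bm) + n * V / T * (bp - bm) := by ring
  have hnn : 0 ≤ n * V / T * (bp - bm) := by positivity
  have total : energy F u v T - energy F u v t₃ ≤ 2 * (n * V * (bp - bm)) / T := by
    rw [e]
    rcases le_or_gt (v T) 0 with hvT | hvT
    · linarith [down T ⟨le_rfl, hTt₃.le⟩ hvT]
    by_cases hall : ∃ t ∈ Icc T t₃, v t ≤ 0
    · obtain ⟨m, hm, hvm, before⟩ := exists_first_le (hcv T t₃ le_rfl) hvT hall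
      have hmI := Ioc_subset_Icc_self hm
      linarith [down m hmI hvm.le, up m hmI fun t ht => ht.2.eq_or_lt.elim (fun e => (e ▸ hvm).ge)
        fun hlt => (before t ⟨ht.1, hlt⟩).le]
    · push Not at hall
      linarith [up t₃ ⟨hTt₃.le, le_rfl⟩ fun t ht => (hall t ht).le]
  linarith

theorem Slab.swing (S : Slab f F O ℓ' ℓ bm bp) (H : Nonlin f F O) (hn : 1 ≤ n)
    (h : IsTraj n f u v (Ioi 0)) (hO : ∀ t, 0 < t → u t ∈ O) {T : ℝ} (hT : 0 < T)
    (hE : energy F u v T < ℓ) (hu : u T ∈ Ioo bm bp) {V : ℝ} (hV0 : 0 ≤ V)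
    (hV : ∀ t, T ≤ t → |v t| ≤ V) (hne : u T ≠ 0) {κ : ℝ} (hκ : ℓ' < κ)
    (hκE : κ + 2 * (n * V * (bp - bm)) / T < energy F u v T) :
    ∃ t > T, u T * u t < 0 ∧ κ < energy F u v t := by
  rcases hne.lt_or_gt with hneg | hpos
  · obtain ⟨t, ht, h1, h2⟩ := S.neg.swing_down H.neg hn h.neg (fun t ht => by simpa using hO t ht) hT
      (by rwa [energy_neg]) ⟨by linarith [hu.2], by linarith [hu.1]⟩ hV0
      (fun t ht => by rw [abs_neg]; exact hV t ht) (by linarith) hκ (by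
        rw [energy_neg]
        have : -bm - -bp = bp - bm := by ring
        rwa [this])
    rw [energy_neg] at h2
    exact ⟨t, ht, mul_neg_of_neg_of_pos hneg (by linarith), h2⟩
  · obtain ⟨t, ht, h1, h2⟩ := S.swing_down H hn h hO hT hE hu hV0 hV hpos hκ hκE
    exact ⟨t, ht, mul_neg_of_pos_of_neg hpos h1, h2⟩

/-- A late time at which the energy is still well inside the band is followed by many sign
changes. -/
theorem Slab.many_swings (S : Slab f F O ℓ' ℓ bm bp) (H : Nonlin f F O) (hn : 1 ≤ n) {κ : ℝ} (hκ : ℓ' < κ) :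
    ∃ C, 0 ≤ C ∧ ∀ u v : ℝ → ℝ, IsTraj n f u v (Ioi 0) → (∀ t, 0 < t → u t ∈ O) →
      ∀ k : ℕ, ∀ T, 0 < T → energy F u v T < ℓ → u T ∈ Ioo bm bp →
      κ + k * C / T < energy F u v T →
      ∃ r : Fin (k + 1) → ℝ, StrictMono r ∧ (∀ i, T ≤ r i) ∧ u (r 0) ≠ 0 ∧
        (∀ i, κ < energy F u v (r i)) ∧ ∀ i : Fin k, u (r i.castSucc) * u (r i.succ) < 0 := by
  obtain ⟨V, hV0, hV⟩ := S.exists_speed H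
  have hw : 0 < bp - bm := by linarith [S.bm_neg, S.bp_pos]
  set C := 2 * (n * V * (bp - bm)) with hC
  have hC0 : 0 ≤ C := by positivity
  refine ⟨C, hC0, fun u v h hO k => ?_⟩
  have core : ∀ k : ℕ, ∀ T, 0 < T → energy F u v T < ℓ → u T ∈ Ioo bm bp → u T ≠ 0 → κ + k * C / T < energy F u v T →
      ∃ r : Fin (k + 1) → ℝ, StrictMono r ∧ r 0 = T ∧ (∀ i, T ≤ r i) ∧
        (∀ i, κ < energy F u v (r i)) ∧ ∀ i : Fin k, u (r i.castSucc) * u (r i.succ) < 0 := by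
    intro k
    induction k with
    | zero =>
      intro T hT hE hu hne hκE
      refine ⟨fun _ => T, fun i j hij => absurd hij (by rw [Fin.lt_def]; omega), rfl, fun _ => le_rfl, fun _ => ?_, fun i => i.elim0⟩
      simpa using hκE
    | succ k ih =>
      intro T hT hE hu hne hκE
      have hkC : 0 ≤ k * C / T := by positivity
      obtain ⟨t, ht, h1, h2⟩ := S.swing H hn h hO hT hE hu hV0.le (fun t ht => by
          have := S.stay H h hO hT ht hE hu
          exact hV u v t this.1 this.2) hne (κ := κ + k * C / T) (by linarith) (by
          have e : κ + k * C / T + C / T = κ + (k + 1 : ℕ) * C / T := by push_cast; ring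
          rw [e]
          exact hκE)
      have hst := S.stay H h hO hT (le_of_lt ht) hE hu
      have ht0 : 0 < t := hT.trans ht
      obtain ⟨r, hr, hr0, hrT, hrE, hrs⟩ := ih t ht0 hst.1 hst.2 (fun e => by simp [e] at h1) (by
        have : k * C / t ≤ k * C / T := div_le_div_of_nonneg_left (by positivity) hT (le_of_lt ht)
        linarith)
      have hC1 : 0 ≤ (k + 1 : ℕ) * C / T := by positivity
      refine ⟨Fin.cons T r, ?_, rfl, ?_, ?_, ?_⟩
      · intro i j hij
        induction i using Fin.cases with
        | zero =>
          induction j using Fin.cases with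
          | zero => exact absurd hij (lt_irrefl _)
          | succ j => simpa using lt_of_lt_of_le ht (hrT j)
        | succ i =>
          induction j using Fin.cases with
          | zero => exact absurd hij (Fin.not_lt_zero _)
          | succ j => simpa using hr (Fin.succ_lt_succ_iff.1 hij)
      · intro i
        induction i using Fin.cases with
        | zero => exact le_rfl
        | succ i => simpa using (le_of_lt ht).trans (hrT i)
      · intro i
        induction i using Fin.cases with
        | zero => simp only [Fin.cons_zero]; linarith
        | succ i => simpa using hrE i
      · intro i
        induction i using Fin.cases with
        | zero => simpa [hr0] using h1
        | succ i =>
          have := hrs i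
          rw [← Fin.succ_castSucc]; simpa using this
  intro T hT hE hu hκE
  by_cases hne : u T = 0
  · have hkC : 0 ≤ k * C / T := by positivity
    have hv : v T ≠ 0 := by
      intro hv
      have : energy F u v T = 0 := by simp [energy, hv, hne, H.F_zero]
      linarith [S.nn]
    obtain ⟨d1, -⟩ := h.hasDerivAt hT
    have hEc : ContinuousAt (energy F u v) T := (h.hasDerivAt_energy hT (H.deriv _ (hO T hT))).continuousAt
    have e1 : ∀ᶠ t in 𝓝[>] T, u t ≠ 0 := by
      have := d1.eventually_ne (c := 0) hv
      exact this.filter_mono (nhdsWithin_mono _ fun t (ht : T < t) => ht.ne')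
    have e2 : ∀ᶠ t in 𝓝[>] T, κ + k * C / T < energy F u v t :=
      (hEc.eventually (lt_mem_nhds hκE)).filter_mono nhdsWithin_le_nhds
    obtain ⟨t, h1, h2, h3⟩ := (e1.and (e2.and self_mem_nhdsWithin)).exists
    have h3 : T < t := h3
    have hst := S.stay H h hO hT h3.le hE hu
    obtain ⟨r, a1, a2, a3, a4, a5⟩ := core k t (hT.trans h3) hst.1 hst.2 h1 (by
      have : k * C / t ≤ k * C / T := div_le_div_of_nonneg_left (by positivity) hT h3.le
      linarith)
    exact ⟨r, a1, fun i => h3.le.trans (a3 i), by rwa [a2], a4, a5⟩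
  · obtain ⟨r, a1, a2, a3, a4, a5⟩ := core k T hT hE hu hne hκE
    exact ⟨r, a1, a3, by rwa [a2], a4, a5⟩

end

section angle
variable {n : ℕ} {f F u v : ℝ → ℝ} {α T : ℝ} {O : Set ℝ}

theorem RegSol.ang_persist_lt (h : RegSol n f α u v) (hα : 0 < α) (C : ℝ)
    (hfc : ContinuousOn (fun t => f (u t)) (Ici 0)) {s t : ℝ} (ht : u t ≠ 0 ∨ v t ≠ 0)
    (hs0 : 0 ≤ s) (hst : s < t) {k : ℤ} (hk : (k - 1 / 2) * Real.pi ≤ ang n f C u v s) :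
    (k - 1 / 2) * Real.pi < ang n f C u v t := by
  rcases hk.lt_or_eq with hlt | heq
  · exact h.ang_persist hα C hfc ht hs0 hst.le hlt
  have hal := h.alive hα ht ⟨hs0, hst.le⟩
  have hcos : Real.cos (ang n f C u v s) = 0 := by
    rw [← heq, Real.cos_eq_zero_iff]
    exact ⟨k - 1, by push_cast; ring⟩
  have hu0 : u s = 0 := by
    have hpol := (h.polar hα C hfc hal hs0).1
    rw [hcos, mul_zero] at hpol; exact kap_eq_zero.1 hpol
  have hs1 := lt_of_le_of_ne hs0 (by
    rintro rfl; rw [h.u_zero] at hu0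
    exact hα.ne' hu0)
  have hv0 : v s ≠ 0 := by grind
  have hom : angVel n f C u v s = 1 := by simp only [angVel, hu0, kap_zero]; simp [hv0]
  have hd := h.hasDerivAt_ang hα C hfc hal hs1
  rw [hom] at hd
  obtain ⟨x, h1, hx⟩ := ((((hasDerivAt_iff_tendsto_slope_left_right.1 hd).2).eventually_const_lt zero_lt_one).and (Ioo_mem_nhdsGT hst)).exists
  rw [slope_def_field, lt_div_iff₀ (sub_pos.2 hx.1), zero_mul] at h1
  exact h.ang_persist hα C hfc ht (hs0.trans hx.1.le) hx.2.le (by linarith)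

theorem RegSol.eventually_sign (h : RegSol n f α u v) (hα : 0 < α)
    (hfc : ContinuousOn (fun t => f (u t)) (Ici 0)) (hal : ∀ t, 0 ≤ t → u t ≠ 0 ∨ v t ≠ 0) {k : ℕ}
    (hk : ¬ HasAtLeastSignChanges u k) : ∃ j : ℕ, ∃ T > 0, ∀ t ≥ T, 0 < (-1) ^ j * u t := by
  have hpi := Real.pi_pos
  have hk1 : 1 ≤ k := by
    by_contra! h0
    obtain rfl : k = 0 := by omega
    exact hk ⟨fun _ => 1, fun i j hij => absurd hij (by rw [Fin.lt_def]; omega), fun _ => one_pos, fun i => i.elim0⟩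
  rw [h.signChanges_iff hα 0 hfc hk1] at hk
  classical
  let P : ℕ → Prop := fun j => ∃ t, 0 ≤ t ∧ (j - 1 / 2) * Real.pi < ang n f 0 u v t
  have hPk : ¬ P k := by grind
  obtain ⟨j, hj, hj'⟩ : ∃ j, P j ∧ ¬ P (j + 1) := by
    by_contra! hc
    exact hPk (Nat.rec ⟨0, le_rfl, by rw [ang_zero]; push_cast; nlinarith⟩ (fun j hj => hc j hj) k)
  obtain ⟨T, hT, hlt⟩ := hj
  refine ⟨j, T + 1, by linarith, fun t ht => ?_⟩
  have ht0 : 0 ≤ t := by linarith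
  refine (h.sign_of_ang hα 0 hfc (hal t ht0) ht0 j).1 ?_
  have h1 := h.ang_persist hα 0 hfc (hal t ht0) hT (by linarith) (by exact_mod_cast hlt)
  have h2 : ang n f 0 u v t < (j + 1 - 1 / 2) * Real.pi := by
    by_contra! hc
    have := h.ang_persist_lt hα 0 hfc (hal (t + 1) (by linarith)) ht0 (by linarith : t < t + 1)
      (k := j + 1) (by push_cast; exact hc)
    exact hj' ⟨t + 1, by linarith, by push_cast at this ⊢; exact this⟩
  push_cast at h1; rw [abs_lt]
  constructor <;> linarith

theorem equilibrium_left {a b s : ℝ} (ha : 0 < a) (hab : a < b) (h : IsTraj n f u v (Icc a b)) (hs : f s = 0)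
    (hlip : ∃ K, ∃ t ∈ 𝓝 s, LipschitzOnWith K f t) (hu : u b = s) (hv : v b = 0) :
    ∀ᶠ t in 𝓝[<] b, u t = s ∧ v t = 0 := by
  obtain ⟨K, N, hN, hK⟩ := hlip
  have hbI := right_mem_Icc.2 hab.le
  obtain ⟨c, hc, hcI⟩ := (mem_nhdsLE_iff_exists_Icc_subset.1 ((((h b hbI).1.continuousWithinAt.mono_of_mem_nhdsWithin (Icc_mem_nhdsLE hab)).eventually (hu ▸ hN)).and (Icc_mem_nhdsLE hab)))
  have hsub : Icc c b ⊆ Icc a b := fun t ht => (hcI ht).2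
  have hac := (hsub (left_mem_Icc.2 hc.le)).1
  have key := ODE_solution_unique_of_mem_Icc_left (a := c) (b := b)
    (v := fun t p => (p.2, -(n / t) * p.2 - f p.1))
    (s := fun _ => N ×ˢ univ) (K := 1 + (⟨n / a, by positivity⟩ + K))
    (f := fun t => (u t, v t)) (g := fun t => (s, 0)) ?_ ?_ ?_ ?_ ?_ ?_ ?_ ?_
  · filter_upwards [Ico_mem_nhdsLT hc] with t ht
    simpa using (key (Ico_subset_Icc_self ht))
  · intro t ht
    have hta := hac.trans ht.1.le
    refine LipschitzOnWith.of_dist_le_mul fun p hp q hq => ?_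
    have h1 : |p.1 - q.1| ≤ dist p q := by rw [← Real.dist_eq]; exact le_max_left _ _
    have h2 : |p.2 - q.2| ≤ dist p q := by rw [← Real.dist_eq]; exact le_max_right _ _
    have h3 := hK.dist_le_mul p.1 hp.1 q.1 hq.1
    rw [Real.dist_eq, Real.dist_eq] at h3
    have h4 := div_le_div_of_nonneg_left (Nat.cast_nonneg n) ha hta
    have h6 : 0 ≤ dist p q := dist_nonneg
    have h7 := K.2
    rw [Prod.dist_eq]; simp only [Real.dist_eq]
    have e : ((1 + (⟨n / a, by positivity⟩ + K) : NNReal) : ℝ) = 1 + (n / a + K) := rfl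
    rw [e]
    refine max_le ?_ ?_
    · refine h2.trans ?_
      have : 0 ≤ (n / a + K) * dist p q := by positivity
      linarith
    · have e3 : -(n / t) * p.2 - f p.1 - (-(n / t) * q.2 - f q.1) =
        -((n / t) * (p.2 - q.2)) + -(f p.1 - f q.1) := by ring
      rw [e3]
      refine (abs_add_le _ _).trans ?_
      rw [abs_neg, abs_neg, abs_mul, abs_of_nonneg (div_nonneg (Nat.cast_nonneg n) (ha.le.trans hta))]
      have i2 : (K : ℝ) * |p.1 - q.1| ≤ K * dist p q := mul_le_mul_of_nonneg_left h1 h7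
      linarith [mul_le_mul h4 h2 (abs_nonneg _) (by positivity)]
  · exact (h.mono hsub).continuousOn.1.prodMk (h.mono hsub).continuousOn.2
  · intro t ht
    have htb := hsub (Ioc_subset_Icc_self ht)
    have hm := mem_of_superset (Icc_mem_nhdsLE (hac.trans_lt ht.1)) (Icc_subset_Icc_right ht.2)
    exact ((h t htb).1.mono_of_mem_nhdsWithin hm).prodMk ((h t htb).2.mono_of_mem_nhdsWithin hm)
  · intro t ht; exact ⟨(hcI (Ioc_subset_Icc_self ht)).1, trivial⟩
  · exact continuousOn_const
  · intro t ht; simp only [hs, mul_zero, sub_zero]; exact hasDerivWithinAt_const _ _ _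
  · intro t ht; exact ⟨mem_of_mem_nhds hN, trivial⟩
  · simp [hu, hv]

/-- A regular solution does not reach a nonzero rest point. -/
theorem RegSol.not_equilibrium (h : RegSol n f α u v) (H : Nonlin f F O)
    (hO : ∀ t, 0 ≤ t → u t ∈ O) (hfα : f α ≠ 0) {t : ℝ} (ht : 0 < t) (hv : v t = 0)
    (hu : u t ≠ 0) : f (u t) ≠ 0 := by
  intro hf
  have hlip := H.lip _ (hO t ht.le) hu
  have key : ∀ a, 0 < a → a ≤ t → u a = u t := by
    intro a ha hat
    have hcl : IsClosed ({x | u (-x) = u t ∧ v (-x) = 0} ∩ Icc (-t) (-a)) := by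
      have hcu : ContinuousOn (fun x => u (-x)) (Icc (-t) (-a)) := h.cont_u.comp continuous_neg.continuousOn fun x hx => by
          rw [mem_Ici]; linarith [hx.2]
      have hcv : ContinuousOn (fun x => v (-x)) (Icc (-t) (-a)) := h.cont_v.comp continuous_neg.continuousOn fun x hx => by
          rw [mem_Ici]; linarith [hx.2]
      have h1 : IsClosed {x ∈ Icc (-t) (-a) | (u (-x), v (-x)) = (u t, 0)} :=
        IsClosed.isClosed_eq isClosed_Icc (hcu.prodMk hcv) continuousOn_const
      convert h1 using 1
      grind
    have := hcl.Icc_subset_of_forall_mem_nhdsWithin ⟨by simp, by simp [hv]⟩ (fun x hx => by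
      obtain ⟨⟨hxu, hxv⟩, hx1, hx2⟩ := hx
      exact tendsto_neg_nhdsGT.eventually (equilibrium_left (a := a) (b := -x) (s := u t) ha (by linarith) (h.traj.mono fun y hy => ha.trans_le hy.1) hf hlip hxu hxv))
    simpa using (this (⟨by linarith, le_rfl⟩ : -a ∈ Icc (-t) (-a))).1
  have h0 : u t = α := by
    rw [← h.u_zero]
    refine (tendsto_nhds_unique ((h.cont_u 0 (mem_Ici.2 le_rfl)).mono Ioi_subset_Ici_self) ?_).symm
    refine tendsto_const_nhds.congr' ?_
    filter_upwards [Ioc_mem_nhdsGT ht] with x hx using (key x hx.1 hx.2).symm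
  rw [h0] at hf; exact hfα hf

theorem IsTraj.rest_of_energy_le {a b : ℝ} (hn : 1 ≤ n) (h : IsTraj n f u v (Icc a b)) (ha : 0 < a)
    (hF : ∀ t ∈ Icc a b, HasDerivAt F (f (u t)) (u t)) (hE : energy F u v a ≤ energy F u v b) :
    ∀ x ∈ Ioo a b, v x = 0 ∧ f (u x) = 0 := by
  have han := h.antitoneOn_energy ha hF
  have hI : ∀ x ∈ Ioo a b, x ∈ Icc a b ∧ Icc a b ∈ 𝓝 x := fun x hx => ⟨Ioo_subset_Icc_self hx, Icc_mem_nhds hx.1 hx.2⟩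
  have hv : ∀ x ∈ Ioo a b, v x = 0 := fun x hx => by
    have e := ((h.hasDerivWithinAt_energy (hI x hx).1 (hF x (hI x hx).1)).hasDerivAt (hI x hx).2).unique
      ((hasDerivAt_const x (energy F u v a)).congr_of_eventuallyEq (by
        filter_upwards [Ioo_mem_nhds hx.1 hx.2] with y hy
        exact le_antisymm (han ⟨le_rfl, ((hy.1.trans hy.2).le)⟩ (hI y hy).1 hy.1.le) (hE.trans (han (hI y hy).1 ⟨((hy.1.trans hy.2).le), le_rfl⟩ hy.2.le))))
    have hn0 : (0 : ℝ) < n := by exact_mod_cast hn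
    grind
  refine fun x hx => ⟨hv x hx, ?_⟩
  have e := ((h x (hI x hx).1).2.hasDerivAt (hI x hx).2).unique ((hasDerivAt_const x 0).congr_of_eventuallyEq (by
    filter_upwards [Ioo_mem_nhds hx.1 hx.2] with y hy using hv y hy))
  rwa [hv x hx, mul_zero, zero_sub, neg_eq_zero] at e

/-- The energy decreases strictly as long as the solution is not at rest. -/
theorem RegSol.energy_lt (hn : 1 ≤ n) (h : RegSol n f α u v) (H : Nonlin f F O)
    (hO : ∀ t, 0 ≤ t → u t ∈ O) (hfα : f α ≠ 0) {s t : ℝ} (hs : 0 ≤ s) (hst : s < t)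
    (hal : u s ≠ 0 ∨ v s ≠ 0) : energy F u v t < energy F u v s := by
  have hF := fun t ht => H.deriv _ (hO t ht)
  by_contra! hcon
  have hev : ∀ᶠ r in 𝓝[>] s, u r ≠ 0 ∨ v r ≠ 0 := by
    have hle : 𝓝[>] s ≤ 𝓝[Ici 0] s := nhdsWithin_mono _ fun x hx => hs.trans hx.le
    rcases hal with h1 | h1
    · exact (((h.cont_u s hs).eventually_ne h1).filter_mono hle).mono fun _ h => Or.inl h
    · exact (((h.cont_v s hs).eventually_ne h1).filter_mono hle).mono fun _ h => Or.inr h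
  obtain ⟨r, hr1, hr2⟩ := (hev.and (Ioo_mem_nhdsGT hst)).exists
  obtain ⟨a, hsa, har⟩ := exists_between hr2.1
  have ha := hs.trans_lt hsa
  obtain ⟨k1, k2⟩ := IsTraj.rest_of_energy_le hn (h.traj.mono fun x hx => ha.trans_le hx.1) ha
    (fun x hx => hF x (ha.le.trans hx.1)) (((h.antitone_energy hF) hs ha.le hsa.le).trans hcon) r ⟨har, hr2.2⟩
  exact h.not_equilibrium H hO hfα (ha.trans har) k1 (hr1.resolve_right fun h => h k1) k2

theorem limit_deriv_eq_zero {g g' : ℝ → ℝ} {T L L' : ℝ} (hd : ∀ t ≥ T, HasDerivAt g (g' t) t)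
    (hg : Tendsto g atTop (𝓝 L)) (hg' : Tendsto g' atTop (𝓝 L')) : L' = 0 := by
  have ex : ∀ t, ∃ r, t ≤ r ∧ (T ≤ t → g' r = g (t + 1) - g t) := by
    intro t
    by_cases ht : T ≤ t
    · obtain ⟨r, hr, h⟩ := exists_hasDerivAt_eq_slope g g' (lt_add_one t)
        (fun x hx => (hd x (ht.trans hx.1)).continuousAt.continuousWithinAt)
        (fun x hx => hd x (ht.trans hx.1.le))
      grind
    · grind
  choose r hr1 hr2 using ex
  have h2 :=
    (hg.comp (tendsto_atTop_add_const_right _ 1 tendsto_id)).sub hg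
  rw [sub_self] at h2
  refine tendsto_nhds_unique (hg'.comp (tendsto_atTop_mono hr1 tendsto_id)) (h2.congr' ?_)
  filter_upwards [eventually_ge_atTop T] with t ht using (hr2 t ht).symm

theorem tendsto_of_antitoneOn {g : ℝ → ℝ} {T B : ℝ} (hg : AntitoneOn g (Ici T))
    (hB : ∀ t ≥ T, B ≤ g t) : ∃ L, B ≤ L ∧ Tendsto g atTop (𝓝 L) := by
  have ha : Antitone fun t => g (max t T) := fun s t hst =>
    hg (mem_Ici.2 (le_max_right _ _)) (mem_Ici.2 (le_max_right _ _)) (max_le_max_right T hst)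
  refine ⟨_, le_ciInf fun t => hB _ (le_max_right _ _), (tendsto_atTop_ciInf ha ⟨B, by rintro _ ⟨t, rfl⟩; exact hB _ (le_max_right _ _)⟩).congr' ?_⟩
  filter_upwards [eventually_ge_atTop T] with t ht
  rw [max_eq_left ht]

/-- A positive bounded trajectory that never drops below a barrier converges to a critical point. -/
theorem limit_of_pos (H : Nonlin f F O) (h : IsTraj n f u v (Ioi 0)) {lo hi : ℝ}
    (hsub : Icc lo hi ⊆ O) (hT : 0 < T) (hu : ∀ t ≥ T, u t ∈ Icc lo hi) (hpos : ∀ t ≥ T, 0 < u t)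
    (hW : ∀ t ≥ T, ∀ w ∈ Icc 0 (u t), F w ≤ energy F u v t)
    (hne : ∀ t ≥ T, v t = 0 → f (u t) ≠ 0) :
    ∃ s ∈ Icc lo hi, 0 ≤ s ∧ f s = 0 ∧ Tendsto u atTop (𝓝 s) ∧ Tendsto v atTop (𝓝 0) ∧
      Tendsto (energy F u v) atTop (𝓝 (F s)) ∧ (∀ w ∈ Icc 0 s, F w ≤ F s) ∧
      ∀ η > 0, ∀ᶠ t in atTop, |u t - s| < η ∧ energy F u v t - F s < η / t := by
  have hF := fun t ht => H.deriv _ (hsub (hu t ht))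
  have hd : ∀ t ≥ T, HasDerivAt u (v t) t ∧ HasDerivAt v (-(n / t) * v t - f (u t)) t :=
    fun t ht => h.hasDerivAt (hT.trans_le ht)
  have hEanti : AntitoneOn (energy F u v) (Ici T) := fun s hs t ht hst =>
    h.antitone_energy (hT.trans_le hs) (fun x hx => hF x (le_trans hs hx.1)) (left_mem_Icc.2 hst) (right_mem_Icc.2 hst) hst
  have hvneg : ∀ t ≥ T, v t = 0 → -(n / t) * v t - f (u t) < 0 := by
    intro t ht h0
    have hE : energy F u v t = F (u t) := by simp [energy, h0]
    have := lt_of_le_of_ne (by refine deriv_nonneg_of_le_left (hF t ht) ?_; filter_upwards [Ioo_mem_nhdsLT (hpos t ht)] with x hx; rw [← hE]; exact hW t ht x ⟨hx.1.le, hx.2.le⟩) (hne t ht h0).symm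
    rw [h0, mul_zero]; linarith
  -- eventually monotone
  obtain ⟨T₁, hT₁, σ, hσ, hmon⟩ : ∃ T₁ ≥ T, ∃ σ : ℝ, (σ = 1 ∨ σ = -1) ∧ ∀ t ≥ T₁, σ * v t ≤ 0 := by
    by_cases hc : ∃ t ≥ T, v t ≤ 0
    · obtain ⟨t, ht, hvt⟩ := hc
      refine ⟨t, ht, 1, Or.inl rfl, fun r hr => ?_⟩
      rw [one_mul]
      exact neg_persist (fun x hx => (hd x (le_trans ht hx.1)).2.continuousAt.continuousWithinAt)
        (fun x hx h0 => ⟨(hd x (le_trans ht hx.1)).2, hvneg x (le_trans ht hx.1) h0⟩) hvt r ⟨hr, le_rfl⟩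
    · push Not at hc
      exact ⟨T, le_rfl, -1, Or.inr rfl, fun t ht => by linarith [hc t ht]⟩
  have hσ2 : σ * σ = 1 := by rcases hσ with rfl | rfl <;> norm_num
  obtain ⟨S, -, hS⟩ := tendsto_of_antitoneOn (by have hdc := fun t (ht : T₁ ≤ t) => (hd t (le_trans hT₁ ht)).1.const_mul σ; exact fun x hx y _ hxy => antiOn_Icc (fun t ht => (hdc t (le_trans hx ht.1)).continuousAt.continuousWithinAt) (fun t ht => ⟨_, hdc t (le_trans hx ht.1.le), hmon t (le_trans hx ht.1.le)⟩) ⟨le_rfl, hxy⟩ ⟨hxy, le_rfl⟩ hxy) fun t ht => by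
    have h1 : |σ * u t| ≤ max |lo| |hi| := by
      rw [abs_mul]
      have : |σ| = 1 := by rcases hσ with rfl | rfl <;> simp
      rw [this, one_mul]; exact abs_le_max_abs_abs (hu t (le_trans hT₁ ht)).1 (hu t (le_trans hT₁ ht)).2
    exact (abs_le.1 h1).1
  have hus : Tendsto u atTop (𝓝 (σ * S)) := by
    refine (hS.const_mul σ).congr fun t => ?_
    rw [← mul_assoc, hσ2, one_mul]
  set s := σ * S
  have hsI := isClosed_Icc.mem_of_tendsto hus ((eventually_ge_atTop T).mono fun t ht => hu t ht)
  have hsO := hsub hsI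
  have hFs : Tendsto (fun t => F (u t)) atTop (𝓝 (F s)) := (H.deriv s hsO).continuousAt.tendsto.comp hus
  have hfs := ((H.cont.continuousAt (H.isOpen.mem_nhds hsO)).tendsto).comp hus
  obtain ⟨L, hL, hE⟩ := tendsto_of_antitoneOn hEanti (B := 0) fun t ht => by
    rw [← H.F_zero]; exact hW t ht 0 ⟨le_rfl, (hpos t ht).le⟩
  have hvs : Tendsto v atTop (𝓝 (-σ * √(2 * (L - F s)))) := by
    refine (((((hE.sub hFs).const_mul 2).sqrt)).const_mul _).congr' ?_
    filter_upwards [eventually_ge_atTop T₁] with t ht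
    have e : 2 * (energy F u v t - F (u t)) = (-σ * v t) ^ 2 := by
      unfold energy
      grind
    rw [e, Real.sqrt_sq (by linarith [hmon t ht])]
    grind
  rw [(limit_deriv_eq_zero (fun t ht => (hd t ht).1) hus hvs)] at hvs
  have hLF : L = F s := by
    have := tendsto_nhds_unique hE (((hvs.pow 2).div_const 2).add hFs)
    rw [this]; ring
  rw [hLF] at hE
  have hfs0 : f s = 0 := by
    have := limit_deriv_eq_zero (fun t ht => (hd t ht).2) hvs ((((tendsto_const_nhds.div_atTop tendsto_id).neg).mul hvs).sub hfs)
    linarith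
  have hFw : ∀ w ∈ Icc 0 s, F w ≤ F s := by
    intro w hw
    rcases hw.2.eq_or_lt with rfl | hlt
    · exact le_rfl
    · refine ge_of_tendsto hE ?_
      filter_upwards [hus.eventually (lt_mem_nhds hlt), eventually_ge_atTop T] with t h1 h2
      exact hW t h2 w ⟨hw.1, le_of_lt h1⟩
  refine ⟨s, hsI, (ge_of_tendsto hus ((eventually_ge_atTop T).mono fun t ht => (hpos t ht).le)), hfs0, hus, hvs, hE, hFw, fun η hη => ?_⟩
  have hη' : 0 < η / (n + 1) := by positivity
  have ev2 : ∀ᶠ t in atTop, ∀ r ≥ t, |v r| ≤ 1 := by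
    have := hvs.abs
    rw [abs_zero] at this
    obtain ⟨a, ha⟩ := eventually_atTop.1 (this.eventually_lt_const one_pos)
    filter_upwards [eventually_ge_atTop a] with t ht r hr using (ha r (le_trans ht hr)).le
  filter_upwards [(by have := (hus.sub_const s).abs; rw [sub_self, abs_zero] at this; exact this.eventually_lt_const hη'), ev2, eventually_ge_atTop T₁] with t h1 h2 h3
  have ht0 := (hT.trans_le hT₁).trans_le h3
  refine ⟨h1.trans_le (div_le_self hη.le (by linarith [(Nat.cast_nonneg n : (0 : ℝ) ≤ n)])), ?_⟩
  have hdrop : ∀ r ≥ t, energy F u v t - energy F u v r ≤ n * 1 / t * |u r - u t| := by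
    intro r hr
    have hFr : ∀ x ∈ Icc t r, HasDerivAt F (f (u x)) (u x) := fun x hx => hF x (hT₁.le.trans (h3.trans hx.1))
    have hn0 : 0 ≤ n * 1 / t := by positivity
    rcases hσ with rfl | rfl
    · refine (h.drop_le' ht0 hr hFr fun x hx => ⟨?_, (abs_le.1 (h2 x hx.1)).1⟩).trans ?_
      · have := hmon x (h3.trans hx.1); linarith
      · refine mul_le_mul_of_nonneg_left ?_ hn0
        rw [abs_sub_comm]; exact le_abs_self _
    · refine (h.drop_le ht0 hr hFr fun x hx => ⟨?_, (abs_le.1 (h2 x hx.1)).2⟩).trans ?_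
      · have := hmon x (h3.trans hx.1); linarith
      · exact mul_le_mul_of_nonneg_left (le_abs_self _) hn0
  have hlim : energy F u v t - F s ≤ n * 1 / t * |s - u t| := by
    refine le_of_tendsto_of_tendsto (hE.const_sub _) (((hus.sub_const _).abs).const_mul _) ?_
    filter_upwards [eventually_ge_atTop t] with r hr using hdrop r hr
  refine hlim.trans_lt ?_
  rw [abs_sub_comm, mul_one, div_mul_eq_mul_div, div_lt_div_iff_of_pos_right ht0]
  calc n * |u t - s| ≤ (n + 1) * |u t - s| := by have := abs_nonneg (u t - s); linarith
    _ < (n + 1) * (η / (n + 1)) := mul_lt_mul_of_pos_left h1 (by positivity)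
    _ = η := by field_simp

/-- A solution with finitely many sign changes that never drops below a barrier converges to a
critical point of `F`, and approaches it with hardly any energy to spare. -/
theorem RegSol.exists_limit (h : RegSol n f α u v) (hα : 0 < α) (H : Nonlin f F O) {lo hi : ℝ}
    (hsub : Icc lo hi ⊆ O) (hu : ∀ t, 0 ≤ t → u t ∈ Icc lo hi) (hfα : f α ≠ 0)
    (hal : ∀ t, 0 ≤ t → u t ≠ 0 ∨ v t ≠ 0)
    (hW : ∀ t, 0 ≤ t → ∀ w ∈ uIcc 0 (u t), F w ≤ energy F u v t) {k : ℕ}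
    (hk : ¬ HasAtLeastSignChanges u k) :
    ∃ s ∈ Icc lo hi, f s = 0 ∧ Tendsto u atTop (𝓝 s) ∧ Tendsto v atTop (𝓝 0) ∧
      Tendsto (energy F u v) atTop (𝓝 (F s)) ∧ (∀ w ∈ uIcc 0 s, F w ≤ F s) ∧
      ∀ η > 0, ∀ᶠ t in atTop, |u t - s| < η ∧ energy F u v t - F s < η / t := by
  have hO := fun t ht => hsub (hu t ht)
  obtain ⟨j, T, hT, hsign⟩ := h.eventually_sign hα (H.cont.comp h.cont_u fun t ht => hO t ht) hal hk
  have hT' : ∀ t ≥ T, 0 ≤ t := fun t ht => hT.le.trans ht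
  rcases neg_one_pow_eq_or ℝ j with e | e
  · simp only [e, one_mul] at hsign
    obtain ⟨s, h1, h2, h3, h4, h5, h6, h7, h8⟩ := limit_of_pos H h.traj hsub hT (fun t ht => hu t (hT' t ht)) hsign
      (fun t ht w hw => hW t (hT' t ht) w (by rwa [uIcc_of_le (hsign t ht).le]))
      (fun t ht h0 => h.not_equilibrium H hO hfα (hT.trans_le ht) h0 (hsign t ht).ne')
    exact ⟨s, h1, h3, h4, h5, h6, by rwa [uIcc_of_le h2], h8⟩
  · simp only [e, neg_mul, one_mul] at hsign
    obtain ⟨s, h1, h2, h3, h4, h5, h6, h7, h8⟩ := limit_of_pos H.neg h.traj.neg (lo := -hi) (hi := -lo)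
      (fun w hw => hsub ⟨by linarith [hw.2], by linarith [hw.1]⟩) hT
      (fun t ht => by
        have := hu t (hT' t ht)
        exact ⟨by linarith [this.2], by linarith [this.1]⟩) hsign
      (fun t ht w hw => by
        rw [energy_neg]
        refine hW t (hT' t ht) (-w) ?_
        rw [uIcc_of_ge (by linarith [hsign t ht])]
        exact ⟨by linarith [hw.2], by linarith [hw.1]⟩)
      (fun t ht h0 => by
        rw [neg_neg, neg_ne_zero]
        exact h.not_equilibrium H hO hfα (hT.trans_le ht) (neg_eq_zero.1 h0)
          (by have := hsign t ht; intro h0; rw [h0] at this; linarith))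
    rw [energy_neg] at h6 h8
    refine ⟨-s, ⟨by linarith [h1.2], by linarith [h1.1]⟩, neg_eq_zero.1 h3, ?_, ?_, h6, ?_, ?_⟩
    · simpa using h4.neg
    · simpa using h5.neg
    · intro w hw
      rw [uIcc_of_ge (by linarith)] at hw
      simpa using h7 (-w) ⟨by linarith [hw.2], by linarith [hw.1]⟩
    · intro η hη
      filter_upwards [h8 η hη] with t ht
      grind

end angle

section compare
variable {n : ℕ} {f u v u' v' : ℝ → ℝ} {α α' T : ℝ}

theorem abs_sub_lt_pi_div_two {θ₁ θ₂ : ℝ → ℝ} (hT : 0 ≤ T) (h1 : ContinuousOn θ₁ (Icc 0 T))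
    (h2 : ContinuousOn θ₂ (Icc 0 T)) (h0 : θ₁ 0 = θ₂ 0)
    (hc : ∀ t ∈ Icc 0 T, 0 < Real.cos (θ₁ t - θ₂ t)) : |θ₁ T - θ₂ T| < Real.pi / 2 := by
  by_contra! hcon
  obtain ⟨t, ht, hv⟩ := intermediate_value_Icc hT (h1.sub h2).abs (show Real.pi / 2 ∈ Icc |θ₁ 0 - θ₂ 0| |θ₁ T - θ₂ T| from
      ⟨by rw [h0, sub_self, abs_zero]; positivity, hcon⟩)
  exact (hc t ht).ne' (by rw [← Real.cos_abs, show |θ₁ t - θ₂ t| = Real.pi / 2 from hv, Real.cos_pi_div_two])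

theorem RegSol.inner_eq (h : RegSol n f α u v) (h' : RegSol n f α' u' v') (hα : 0 < α) (hα' : 0 < α')
    (C C' : ℝ) (hfc : ContinuousOn (fun t => f (u t)) (Ici 0))
    (hfc' : ContinuousOn (fun t => f (u' t)) (Ici 0)) (hT : u T ≠ 0 ∨ v T ≠ 0)
    (hT' : u' T ≠ 0 ∨ v' T ≠ 0) (hT0 : 0 ≤ T) :
    kap C (u T) * kap C' (u' T) + v T * v' T =
      rho C u v T * rho C' u' v' T * Real.cos (ang n f C u v T - ang n f C' u' v' T) ∧
    kap C (u T) * v' T - v T * kap C' (u' T) =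
      rho C u v T * rho C' u' v' T * Real.sin (ang n f C u v T - ang n f C' u' v' T) := by
  obtain ⟨a1, a2⟩ := h.polar hα C hfc hT hT0
  obtain ⟨b1, b2⟩ := h'.polar hα' C' hfc' hT' hT0
  rw [Real.cos_sub, Real.sin_sub, a1, a2, b1, b2]
  constructor <;> ring

theorem RegSol.abs_ang_sub_lt (h : RegSol n f α u v) (h' : RegSol n f α' u' v') (hα : 0 < α)
    (hα' : 0 < α') (C C' : ℝ) (hfc : ContinuousOn (fun t => f (u t)) (Ici 0))
    (hfc' : ContinuousOn (fun t => f (u' t)) (Ici 0)) (hT0 : 0 ≤ T)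
    (hpos : ∀ t ∈ Icc 0 T, 0 < kap C (u t) * kap C' (u' t) + v t * v' t) :
    |ang n f C u v T - ang n f C' u' v' T| < Real.pi / 2 := by
  have al : ∀ t ∈ Icc 0 T, (u t ≠ 0 ∨ v t ≠ 0) ∧ (u' t ≠ 0 ∨ v' t ≠ 0) := by
    intro t ht
    have := hpos t ht
    constructor <;> by_contra! hc <;> simp [hc.1, hc.2, kap_zero] at this
  refine abs_sub_lt_pi_div_two hT0 (h.continuousOn_ang hα C hfc (al T ⟨hT0, le_rfl⟩).1 hT0)
    (h'.continuousOn_ang hα' C' hfc' (al T ⟨hT0, le_rfl⟩).2 hT0) (by rw [ang_zero, ang_zero]) fun t ht => ?_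
  have hp := hpos t ht
  rw [((h.inner_eq h' hα hα' C C' hfc hfc' (al t ht).1 (al t ht).2 ht.1).1)] at hp
  exact pos_of_mul_pos_right hp (by unfold rho; positivity)

/-- The angle depends on the rescaling by less than a quarter turn. -/
theorem RegSol.abs_ang_sub_ang_lt (h : RegSol n f α u v) (hα : 0 < α) (C C' : ℝ)
    (hfc : ContinuousOn (fun t => f (u t)) (Ici 0)) (hT : u T ≠ 0 ∨ v T ≠ 0) (hT0 : 0 ≤ T) :
    |ang n f C u v T - ang n f C' u v T| < Real.pi / 2 := by
  refine h.abs_ang_sub_lt h hα hα C C' hfc hfc hT0 fun t ht => ?_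
  have e : kap C (u t) * kap C' (u t) = u t ^ 2 * (Real.exp (C * u t ^ 2) * Real.exp (C' * u t ^ 2)) := by unfold kap; ring
  rw [e, ← sq]
  rcases h.alive hα hT ht with h1 | h1 <;> positivity

theorem RegSol.exists_zero (h : RegSol n f α u v) (hα : 0 < α) (C : ℝ)
    (hfc : ContinuousOn (fun t => f (u t)) (Ici 0)) {s t : ℝ} (hs : 0 ≤ s) (hst : s < t)
    (ht : u t ≠ 0 ∨ v t ≠ 0) {k : ℤ} (h1 : ang n f C u v s < (k - 1 / 2) * Real.pi)
    (h2 : (k - 1 / 2) * Real.pi < ang n f C u v t) :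
    ∃ z ∈ Ioo s t, u z = 0 ∧ v z ≠ 0 ∧ ang n f C u v z = (k - 1 / 2) * Real.pi := by
  obtain ⟨z, hz, hzv⟩ := intermediate_value_Ioo hst.le ((h.continuousOn_ang hα C hfc ht (hs.trans hst.le)).mono (Icc_subset_Icc_left hs)) ⟨h1, h2⟩
  have hal := h.alive hα ht ⟨hs.trans hz.1.le, hz.2.le⟩
  have hp := (h.polar hα C hfc hal (hs.trans hz.1.le)).1
  have hcos : Real.cos (ang n f C u v z) = 0 := by
    rw [hzv, Real.cos_eq_zero_iff]
    exact ⟨k - 1, by push_cast; ring⟩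
  rw [hcos, mul_zero] at hp
  have hu := kap_eq_zero.1 hp
  grind

theorem RegSol.exists_later (h : RegSol n f α u v) (hα : 0 < α)
    (hfc : ContinuousOn (fun t => f (u t)) (Ici 0)) {k : ℕ} (hk1 : 1 ≤ k)
    (hk : HasAtLeastSignChanges u k) (hal : u T ≠ 0 ∨ v T ≠ 0)
    (ha : ang n f 0 u v T < (k - 1 / 2) * Real.pi) :
    ∃ t > T, (u t ≠ 0 ∨ v t ≠ 0) ∧ (k - 1 / 2) * Real.pi < ang n f 0 u v t := by
  obtain ⟨t, ht0, htal, ht⟩ := (h.signChanges_iff hα 0 hfc hk1).1 hk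
  refine ⟨t, ?_, htal, ht⟩
  by_contra! hc
  have := h.ang_persist hα 0 hfc hal ht0 hc (by exact_mod_cast ht)
  push_cast at this; linarith

end compare

section family
variable {n : ℕ} {f F : ℝ → ℝ} {O I : Set ℝ} {u v : ℝ → ℝ → ℝ} {α T : ℝ}

theorem Family.cont_f (H : Family n f F O I u v) (hα : α ∈ I) : ContinuousOn (fun t => f (u α t)) (Ici 0) :=
  H.nl.cont.comp (H.reg α hα).cont_u fun t ht => H.mem α hα t ht

theorem Family.tendsto (H : Family n f F O I u v) (hα : α ∈ I) (hT : 0 ≤ T) (hne : ∀ t ∈ Ico 0 T, u α t ≠ 0 ∨ v α t ≠ 0) :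
    Tendsto (fun a => u a T) (𝓝 α) (𝓝 (u α T)) ∧ Tendsto (fun a => v a T) (𝓝 α) (𝓝 (v α T)) ∧
      Tendsto (fun a => energy F (u a) (v a) T) (𝓝 α) (𝓝 (energy F (u α) (v α) T)) := by
  have h1 : Tendsto (fun a => u a T) (𝓝 α) (𝓝 (u α T)) := Metric.tendsto_nhds.2 fun ε hε =>
    (H.close hα hne hε).mono fun a h => (h.2 T ⟨hT, le_rfl⟩).1
  have h2 : Tendsto (fun a => v a T) (𝓝 α) (𝓝 (v α T)) := Metric.tendsto_nhds.2 fun ε hε =>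
    (H.close hα hne hε).mono fun a h => (h.2 T ⟨hT, le_rfl⟩).2
  exact ⟨h1, h2, ((h2.pow 2).div_const 2).add ((H.hasDerivAt_F hα hT).continuousAt.tendsto.comp h1)⟩

theorem Family.energy_le (H : Family n f F O I u v) (hα : α ∈ I) {s t : ℝ} (hs : 0 ≤ s) (hst : s ≤ t) :
    energy F (u α) (v α) t ≤ energy F (u α) (v α) s :=
  (H.reg α hα).antitone_energy (fun _ ht => H.hasDerivAt_F hα ht) hs (hs.trans hst) hst

theorem Family.F_le (H : Family n f F O I u v) (hα : α ∈ I) {s t : ℝ} (hs : 0 ≤ s) (hst : s ≤ t) :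
    F (u α t) ≤ energy F (u α) (v α) s :=
  (F_le_energy F (u α) (v α) t).trans (H.energy_le hα hs hst)

theorem Family.continuousOn_energy (H : Family n f F O I u v) (hα : α ∈ I) :
    ContinuousOn (energy F (u α) (v α)) (Ici 0) := fun t ht =>
  ((((H.reg α hα).cont_v t ht).pow 2).div_const 2).add
    ((H.hasDerivAt_F hα ht).continuousAt.comp_continuousWithinAt ((H.reg α hα).cont_u t ht))

theorem Family.alive (H : Family n f F O I u v) (hα : α ∈ I) (hT : u α T ≠ 0 ∨ v α T ≠ 0) :
    ∀ t ∈ Icc 0 T, u α t ≠ 0 ∨ v α t ≠ 0 := fun _ ht => (H.reg α hα).alive (H.pos α hα) hT ht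

theorem Family.ang_close (H : Family n f F O I u v) (hα : α ∈ I) (C : ℝ) (hT : 0 ≤ T)
    (hal : u α T ≠ 0 ∨ v α T ≠ 0) {ε : ℝ} (hε : 0 < ε) :
    ∀ᶠ a in 𝓝 α, a ∈ I ∧ (u a T ≠ 0 ∨ v a T ≠ 0) ∧
      ∀ t ∈ Icc 0 T, |ang n f C (u a) (v a) t - ang n f C (u α) (v α) t| < ε := by
  have hreg := H.reg α hα
  have hall := H.alive hα hal
  have hsub : Icc 0 T ⊆ Ici 0 := fun t ht => ht.1
  have hkc := (continuous_kap C).comp_continuousOn (hreg.cont_u.mono hsub)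
  have hvc := hreg.cont_v.mono hsub
  obtain ⟨t₀, ht₀, hmin⟩ := isCompact_Icc.exists_isMinOn ⟨0, le_rfl, hT⟩ ((hkc.pow 2).add (hvc.pow 2))
  set m := kap C (u α t₀) ^ 2 + v α t₀ ^ 2 with hm
  have hm0 : 0 < m := sq_add_sq_pos_of (hall t₀ ht₀)
  have hmle : ∀ t ∈ Icc 0 T, m ≤ kap C (u α t) ^ 2 + v α t ^ 2 := fun t ht => hmin ht
  obtain ⟨M1, hM1⟩ := isCompact_Icc.exists_bound_of_continuousOn hkc
  obtain ⟨M2, hM2⟩ := isCompact_Icc.exists_bound_of_continuousOn hvc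
  have hM10 := (abs_nonneg _).trans (hM1 0 ⟨le_rfl, hT⟩)
  have hM20 := (abs_nonneg _).trans (hM2 0 ⟨le_rfl, hT⟩)
  set q := min (m / 2) (ε * m / 4) with hq
  have hq0 : 0 < q := lt_min (by positivity) (by positivity)
  set μ := q / (M1 + M2 + 1) with hμ
  have hμ0 : 0 < μ := by positivity
  have hμq : (M1 + M2) * μ < q := by
    rw [hμ, mul_div_assoc', div_lt_iff₀ (by positivity)]
    nlinarith
  obtain ⟨c, hc, hcI⟩ := (mem_nhdsGE_iff_exists_Icc_subset.1
        (mem_nhdsWithin_of_mem_nhds (H.isOpen.mem_nhds hα) : I ∈ 𝓝[≥] α))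
  have hc := hc
  obtain ⟨lo, -, -, -, -, hr⟩ := H.range (hcI ⟨hc.le, le_rfl⟩)
  obtain ⟨η, hη, hηk⟩ := Metric.uniformContinuousOn_iff.1 (isCompact_Icc.uniformContinuousOn_of_continuous ((continuous_kap C).continuousOn (s := Icc lo c))) μ hμ0
  filter_upwards [H.close hα (fun t ht => hall t (Ico_subset_Icc_self ht)) (lt_min hη hμ0),
    Iic_mem_nhds hc] with a ⟨haI, hcl⟩ hac
  have hac := hac
  have k1 : ∀ t ∈ Icc 0 T, |kap C (u a t) - kap C (u α t)| < μ := fun t ht => by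
    have r1 := hr a haI hac t ht.1
    have r2 := hr α hα hc.le t ht.1
    exact hηk _ ⟨r1.1.le, r1.2.trans hac⟩ _ ⟨r2.1.le, r2.2.trans hc.le⟩ ((hcl t ht).1.trans_le (min_le_left _ _))
  have k2 := fun t ht => (hcl t ht).2.trans_le (min_le_right _ _)
  have inn : ∀ t ∈ Icc 0 T, m / 2 < kap C (u a t) * kap C (u α t) + v a t * v α t := fun t ht => by
    have e : kap C (u a t) * kap C (u α t) + v a t * v α t = (kap C (u α t) ^ 2 + v α t ^ 2) +
      ((kap C (u a t) - kap C (u α t)) * kap C (u α t) + (v a t - v α t) * v α t) := by ring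
    have b1 : |(kap C (u a t) - kap C (u α t)) * kap C (u α t)| ≤ μ * M1 := by
      rw [abs_mul]; exact mul_le_mul (k1 t ht).le (hM1 t ht) (abs_nonneg _) hμ0.le
    have b2 : |(v a t - v α t) * v α t| ≤ μ * M2 := by
      rw [abs_mul]; exact mul_le_mul (k2 t ht).le (hM2 t ht) (abs_nonneg _) hμ0.le
    rw [e]; linarith [hmle t ht, min_le_left (m / 2) (ε * m / 4), (abs_le.1 b1).1, (abs_le.1 b2).1]
  have crs : ∀ t ∈ Icc 0 T, |kap C (u a t) * v α t - v a t * kap C (u α t)| < q := fun t ht => by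
    have e : kap C (u a t) * v α t - v a t * kap C (u α t) =
      (kap C (u a t) - kap C (u α t)) * v α t + -((v a t - v α t) * kap C (u α t)) := by ring
    have b1 : |(kap C (u a t) - kap C (u α t)) * v α t| ≤ μ * M2 := by
      rw [abs_mul]; exact mul_le_mul (k1 t ht).le (hM2 t ht) (abs_nonneg _) hμ0.le
    have b2 : |(v a t - v α t) * kap C (u α t)| ≤ μ * M1 := by
      rw [abs_mul]; exact mul_le_mul (k2 t ht).le (hM1 t ht) (abs_nonneg _) hμ0.le
    grind
  have al : ∀ t ∈ Icc 0 T, u a t ≠ 0 ∨ v a t ≠ 0 := fun t ht => by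
    have := (half_pos hm0).trans (inn t ht)
    by_contra! hcon
    simp [hcon.1, hcon.2, kap_zero] at this
  refine ⟨haI, al T ⟨hT, le_rfl⟩, fun t ht => ?_⟩
  have hΔ := (H.reg a haI).abs_ang_sub_lt hreg (H.pos a haI) (H.pos α hα) C C (H.cont_f haI)
    (H.cont_f hα) ht.1 fun s hs => (half_pos hm0).trans (inn s ⟨hs.1, hs.2.trans ht.2⟩)
  obtain ⟨e1, e2⟩ := (H.reg a haI).inner_eq hreg (H.pos a haI) (H.pos α hα) C C (H.cont_f haI)
    (H.cont_f hα) (al t ht) (hall t ht) ht.1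
  set Δ := ang n f C (u a) (v a) t - ang n f C (u α) (v α) t
  set ρρ := rho C (u a) (v a) t * rho C (u α) (v α) t
  have i1 := inn t ht
  have i2 := crs t ht
  rw [e1] at i1; rw [e2] at i2
  have hρ0 : 0 ≤ ρρ := by simp only [ρρ, rho]; positivity
  rcases eq_or_ne Δ 0 with h0 | h0
  · rw [h0, abs_zero]; exact hε
  have hρpos : 0 < ρρ := by
    grind
  refine (Real.lt_tan (abs_pos.2 h0) hΔ).trans ?_
  have habs : Real.tan |Δ| = |Real.sin Δ| / Real.cos Δ := by
    rw [Real.tan_eq_sin_div_cos, Real.cos_abs, Real.abs_sin_eq_sin_abs_of_abs_le_pi (by linarith [Real.pi_pos])]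
  rw [habs, div_lt_iff₀ (Real.cos_pos_of_mem_Ioo (abs_lt.1 hΔ))]; rw [abs_mul, abs_of_pos hρpos] at i2
  have hqε : q ≤ ε * (m / 2) := by
    grind
  exact lt_of_mul_lt_mul_left (by nlinarith) hρ0

theorem Family.ang_lt_of_not (H : Family n f F O I u v) (hα : α ∈ I) {k : ℕ} (hk1 : 1 ≤ k)
    (hk : ¬ HasAtLeastSignChanges (u α) k) {t : ℝ} (hT : 0 ≤ T) (hTt : T < t) (ht : u α t ≠ 0 ∨ v α t ≠ 0) :
    ang n f 0 (u α) (v α) T < (k - 1 / 2) * Real.pi := by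
  by_contra! hc
  rw [(H.reg α hα).signChanges_iff (H.pos α hα) 0 (H.cont_f hα) hk1] at hk
  have := (H.reg α hα).ang_persist_lt (H.pos α hα) 0 (H.cont_f hα) ht hT hTt (by exact_mod_cast hc)
  exact hk ⟨t, hT.trans hTt.le, ht, by exact_mod_cast this⟩

theorem Family.eventually_signChanges (H : Family n f F O I u v) (hα : α ∈ I) {k : ℕ} (hk1 : 1 ≤ k)
    (hk : HasAtLeastSignChanges (u α) k) :
    ∀ᶠ a in 𝓝 α, a ∈ I ∧ HasAtLeastSignChanges (u a) k := by
  obtain ⟨r, hr, hr0, hs⟩ := hk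
  have hne := ((H.reg α hα).lt_ang_of_alternating (H.pos α hα) 0 (H.cont_f hα) hk1 hr hr0 hs).1
  have ht := fun i => (H.tendsto hα (hr0 i).le fun t ht =>
      (H.alive hα (Or.inl hne)) t ⟨ht.1, ht.2.le.trans (hr.monotone (Fin.le_last i))⟩).1
  filter_upwards [(eventually_all.2 fun i => ((ht _).mul (ht _)).eventually_lt_const (hs i)), H.isOpen.mem_nhds hα] with a h1 h2 using ⟨h2, r, hr, hr0, h1⟩

theorem Family.eventually_later (H : Family n f F O I u v) (hα : α ∈ I) {k : ℕ} (hk1 : 1 ≤ k)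
    (hT : 0 ≤ T) (hal : u α T ≠ 0 ∨ v α T ≠ 0)
    {x : ℝ} (ha : ang n f 0 (u α) (v α) T < x) (hx : x ≤ (k - 1 / 2) * Real.pi) :
    ∀ᶠ a in 𝓝 α, a ∈ I ∧ (u a T ≠ 0 ∨ v a T ≠ 0) ∧ ang n f 0 (u a) (v a) T < x ∧ (HasAtLeastSignChanges (u a) k →
        ∃ t > T, (u a t ≠ 0 ∨ v a t ≠ 0) ∧ (k - 1 / 2) * Real.pi < ang n f 0 (u a) (v a) t) := by
  filter_upwards [H.ang_close hα 0 hT hal (sub_pos.2 ha)] with a ⟨h1, h2, h3⟩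
  have h4 : ang n f 0 (u a) (v a) T < x := by grind
  exact ⟨h1, h2, h4, fun hA => (H.reg a h1).exists_later (H.pos a h1) (H.cont_f h1) hk1 hA h2 (h4.trans_le hx)⟩

theorem Family.eventually_zero (H : Family n f F O I u v) (hα : α ∈ I) {k : ℕ} (hk1 : 1 ≤ k)
    (hT : 0 ≤ T) (hal : u α T ≠ 0 ∨ v α T ≠ 0)
    (ha : ang n f 0 (u α) (v α) T < (k - 1 / 2) * Real.pi) :
    ∀ᶠ a in 𝓝 α, a ∈ I ∧ (HasAtLeastSignChanges (u a) k → ∃ z > T, u a z = 0 ∧ v a z ≠ 0) := by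
  filter_upwards [H.eventually_later hα hk1 hT hal ha le_rfl] with a ⟨h1, h2, h3, h4⟩
  refine ⟨h1, fun hA => ?_⟩
  obtain ⟨t, ht, htal, hta⟩ := h4 hA
  obtain ⟨z, hz, hz1, hz2, -⟩ := (H.reg a h1).exists_zero (H.pos a h1) 0 (H.cont_f h1) hT ht htal
    (by exact_mod_cast h3) (by exact_mod_cast hta)
  exact ⟨z, hz.1, hz1, hz2⟩

theorem Family.eventually_two_zeros (H : Family n f F O I u v) (hα : α ∈ I) {k : ℕ} (hk1 : 2 ≤ k)
    (hT : 0 ≤ T) (hal : u α T ≠ 0 ∨ v α T ≠ 0)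
    (ha : ang n f 0 (u α) (v α) T < (k - 1 - 1 / 2) * Real.pi) :
    ∀ᶠ a in 𝓝 α, a ∈ I ∧ (HasAtLeastSignChanges (u a) k → ∃ z z', T < z ∧ z < z' ∧ u a z = 0 ∧ u a z' = 0 ∧ v a z' ≠ 0) := by
  have hpi := Real.pi_pos
  filter_upwards [H.eventually_later hα (by omega : 1 ≤ k) hT hal ha (by nlinarith)] with a ⟨h1, h2, h3, h4⟩
  refine ⟨h1, fun hA => ?_⟩
  obtain ⟨t, ht, htal, hta⟩ := h4 hA
  obtain ⟨z, hz, hz1, hz2, hz3⟩ := (H.reg a h1).exists_zero (H.pos a h1) 0 (H.cont_f h1) hT ht htal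
    (k := k - 1) (by push_cast; linarith) (by push_cast; nlinarith)
  obtain ⟨z', hz', hz1', hz2', -⟩ := (H.reg a h1).exists_zero (H.pos a h1) 0 (H.cont_f h1) (hT.trans hz.1.le) hz.2 htal
    (k := k) (by rw [hz3]; push_cast; nlinarith) (by exact_mod_cast hta)
  grind

/-- Solutions close to one that is trapped behind a barrier have no further zeros. -/
theorem Family.eventually_not_of_barrier (H : Family n f F O I u v) (hα : α ∈ I) {k : ℕ}
    (hk1 : 1 ≤ k) (hT : 0 ≤ T) (hal : u α T ≠ 0 ∨ v α T ≠ 0)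
    (ha : ang n f 0 (u α) (v α) T < (k - 1 / 2) * Real.pi) {w : ℝ} (hw : w ∈ uIcc 0 (u α T))
    (hF : energy F (u α) (v α) T < F w) :
    ∀ᶠ a in 𝓝 α, ¬ HasAtLeastSignChanges (u a) k := by
  have hwu : w ≠ u α T := by rintro rfl; exact hF.not_ge (F_le_energy F (u α) (v α) T)
  obtain ⟨t1, -, t3⟩ := H.tendsto hα hT fun t ht => H.alive hα hal t (Ico_subset_Icc_self ht)
  have hev : ∀ᶠ a in 𝓝 α, w ∈ uIcc 0 (u a T) := by
    rcases mem_uIcc.1 hw with h | h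
    · filter_upwards [t1.eventually_const_lt (lt_of_le_of_ne h.2 hwu)] with a h1
      exact mem_uIcc.2 (Or.inl ⟨h.1, h1.le⟩)
    · filter_upwards [t1.eventually_lt_const (lt_of_le_of_ne h.1 hwu.symm)] with a h1
      exact mem_uIcc.2 (Or.inr ⟨h1.le, h.2⟩)
  filter_upwards [H.eventually_zero hα hk1 hT hal ha, hev, t3.eventually_lt_const hF] with a ⟨haI, hz⟩ h2 h3 hA
  obtain ⟨z, hz, hz0, -⟩ := hz hA
  have hcu : ContinuousOn (u a) (uIcc T z) := (H.reg a haI).cont_u.mono (by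
    rw [uIcc_of_le hz.le]; exact fun t ht => hT.trans ht.1)
  rw [uIcc_comm, ← hz0] at h2
  obtain ⟨s, hs, rfl⟩ := intermediate_value_uIcc hcu h2
  rw [uIcc_of_le hz.le] at hs; exact (H.F_le haI hT hs.1).not_gt h3

/-- Near the origin of the phase plane at most one more sign change is possible. -/
theorem Family.eventually_not_of_small (H : Family n f F O I u v) (hn : 1 ≤ n) {ρ : ℝ} (hρ : 0 < ρ)
    (hsub : Icc (-ρ) ρ ⊆ O) (hneg : ∀ w ∈ Icc (-ρ) ρ, w ≠ 0 → F w < 0) {τ : ℝ} (hτ : 0 < τ) :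
    ∃ η > 0, ∀ α ∈ I, ∀ T ≥ τ, (u α T ≠ 0 ∨ v α T ≠ 0) → |u α T| < η → energy F (u α) (v α) T < η / T → ∀ k : ℕ, 2 ≤ k →
      ang n f 0 (u α) (v α) T < (k - 1 - 1 / 2) * Real.pi →
      ∀ᶠ a in 𝓝 α, ¬ HasAtLeastSignChanges (u a) k := by
  obtain ⟨η, hη, key⟩ := near_max (s := 0) hn H.nl hρ (by simpa using hsub) (by simpa [H.nl.F_zero] using hneg) hτ
  refine ⟨η, hη, fun α hα T hT hal h1 h2 k hk ha => ?_⟩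
  have hT0 := hτ.trans_le hT
  obtain ⟨t1, -, t3⟩ := H.tendsto hα hT0.le fun t ht => H.alive hα hal t (Ico_subset_Icc_self ht)
  filter_upwards [H.eventually_two_zeros hα hk hT0.le hal ha, t1.abs.eventually_lt_const h1,
    t3.eventually_lt_const h2] with a ⟨haI, hz⟩ h3 h4 hA
  obtain ⟨z, z', hTz, hzz', hz0, hz0', hv'⟩ := hz hA
  have hE : ∀ t ∈ Icc 0 z', 0 ≤ energy F (u a) (v a) t := fun t ht => by
    simpa only [hz0', H.nl.F_zero] using H.F_le haI ht.1 ht.2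
  obtain ⟨r, hr, hvr⟩ := exists_hasDerivAt_eq_zero hzz'
    ((H.reg a haI).cont_u.mono fun t ht => (hT0.trans hTz).le.trans ht.1) (hz0.trans hz0'.symm)
    (fun t ht => ((H.reg a haI).traj.hasDerivAt ((hT0.trans hTz).trans ht.1)).1)
  have hr0 := (hT0.trans hTz).trans hr.1
  have hEr := hE r ⟨hr0.le, hr.2.le⟩
  have hur : u a r = 0 := by
    by_contra hne
    have h6 := (key (u a) (v a) (H.reg a haI).traj T hT z' (hTz.trans hzz').le (by simpa using h3) (by simpa [H.nl.F_zero] using h4) (fun r hr => H.mem a haI r (hT0.le.trans hr.1)) (by rw [H.nl.F_zero]; exact hE z' ⟨by linarith, le_rfl⟩)) r ⟨(hTz.trans hr.1).le, hr.2.le⟩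
    rw [sub_zero] at h6
    simp only [energy, hvr] at hEr; linarith [hneg (u a r) (abs_le.1 h6.le) hne]
  exact hv' ((H.reg a haI).rest r hr0 hur hvr z' hr.2.le).2

end family

/-- `α` drops below the energy level `ℓ` inside the well `(bm, bp)`. -/
def Under (F : ℝ → ℝ) (u v : ℝ → ℝ → ℝ) (ℓ bm bp α : ℝ) : Prop := ∃ t > 0, energy F (u α) (v α) t < ℓ ∧ u α t ∈ Ioo bm bp

/-- An open interval of initial values all of which drop below the level `ℓ`, but later and later
towards the right end. -/
structure Good (F : ℝ → ℝ) (I : Set ℝ) (u v : ℝ → ℝ → ℝ) (ℓ bm bp : ℝ) (J : Set ℝ) : Prop where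
  sub : J ⊆ I
  isOpen : IsOpen J
  conn : J.OrdConnected
  under : ∀ α ∈ J, Under F u v ℓ bm bp α
  right : ∀ T > 0, ∀ e < ℓ, ∃ p ∈ J, ∀ α ∈ J, p ≤ α → e < energy F (u α) (v α) T

theorem exists_first_notMem {A : Set ℝ} {a b : ℝ} (hA : IsOpen A) (ha : a ∈ A) (hb : b ∉ A) :
    ∃ t ∈ Ioc (0 : ℝ) 1, a + t * (b - a) ∉ A ∧ ∀ s ∈ Ico 0 t, a + s * (b - a) ∈ A := by
  obtain ⟨t, ⟨ht, hn⟩, hl⟩ := (isCompact_Icc.inter_right (hA.isClosed_compl.preimage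
    (by fun_prop : Continuous fun t : ℝ => a + t * (b - a)))).exists_isLeast ⟨1, ⟨zero_le_one, le_rfl⟩, by simpa⟩
  refine ⟨t, ⟨ht.1.lt_of_ne ?_, ht.2⟩, hn, fun s hs => ?_⟩
  · rintro rfl; simp [ha] at hn
  · by_contra hc
    exact (hl ⟨⟨hs.1, hs.2.le.trans ht.2⟩, hc⟩).not_gt hs.2

section family
variable {n : ℕ} {f F : ℝ → ℝ} {O I J : Set ℝ} {u v : ℝ → ℝ → ℝ} {α T ℓ' ℓ bm bp : ℝ}

theorem Family.mem_pos (H : Family n f F O I u v) (hα : α ∈ I) : ∀ t, 0 < t → u α t ∈ O := fun t ht => H.mem α hα t ht.le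

theorem Family.energy_of_dead (H : Family n f F O I u v) {t : ℝ} (hu : u α t = 0) (hv : v α t = 0) :
    energy F (u α) (v α) t = 0 := by simp [energy, hu, hv, H.nl.F_zero]

theorem Family.energy_lt (H : Family n f F O I u v) (hn : 1 ≤ n) (hα : α ∈ I) {s t : ℝ} (hs : 0 ≤ s)
    (hst : s < t) (hal : u α s ≠ 0 ∨ v α s ≠ 0) :
    energy F (u α) (v α) t < energy F (u α) (v α) s :=
  (H.reg α hα).energy_lt hn H.nl (H.mem α hα) (H.f_pos α hα).ne' hs hst hal

theorem Under.mem (H : Family n f F O I u v) (S : Slab f F O ℓ' ℓ bm bp) (hα : α ∈ I)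
    (hU : Under F u v ℓ bm bp α) (hT : 0 < T) (hE : energy F (u α) (v α) T < ℓ) :
    u α T ∈ Ioo bm bp := by
  obtain ⟨t, ht, hEt, hut⟩ := hU
  rcases le_total t T with h | h
  · exact (S.stay H.nl (H.reg α hα).traj (H.mem_pos hα) ht h hEt hut).2
  have hcu : ContinuousOn (u α) (uIcc T t) := (H.reg α hα).cont_u.mono (by
    rw [uIcc_of_le h]; exact fun x hx => hT.le.trans hx.1)
  have key : ∀ w, F w = ℓ → w ∉ uIcc (u α T) (u α t) := by
    intro w hw hmem
    obtain ⟨s, hs, rfl⟩ := intermediate_value_uIcc hcu hmem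
    rw [uIcc_of_le h] at hs; linarith [H.F_le hα hT.le hs.1]
  constructor
  · by_contra! hc
    exact key bm S.F_bm (mem_uIcc.2 (Or.inl ⟨hc, hut.1.le⟩))
  · by_contra! hc
    exact key bp S.F_bp (mem_uIcc.2 (Or.inr ⟨hut.2.le, hc⟩))

theorem Under.exists_time (H : Family n f F O I u v) (S : Slab f F O ℓ' ℓ bm bp) (hα : α ∈ I)
    (hU : Under F u v ℓ bm bp α) (hT : 0 < T) {e : ℝ} (he : e < ℓ)
    (hE : e < energy F (u α) (v α) T) :
    ∃ t ≥ T, e < energy F (u α) (v α) t ∧ energy F (u α) (v α) t < ℓ ∧ u α t ∈ Ioo bm bp := by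
  obtain ⟨t, ht, hEt, -⟩ := id hU
  rcases lt_or_ge (energy F (u α) (v α) T) ℓ with h | h
  · exact ⟨T, le_rfl, hE, h, hU.mem H S hα hT h⟩
  obtain ⟨r, hr, hrv⟩ := intermediate_value_Icc' (not_lt.1 fun hc => by linarith [H.energy_le hα ht.le hc.le]) ((H.continuousOn_energy hα).mono fun x hx => hT.le.trans hx.1)
    (show max (energy F (u α) (v α) t) ((e + ℓ) / 2) ∈ Icc _ _ from ⟨le_max_left _ _, max_le (by linarith) (by linarith)⟩)
  have h2 := hrv.trans_lt (max_lt hEt (by linarith))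
  exact ⟨r, hr.1, by rw [hrv]; exact lt_max_of_lt_right (by linarith), h2, hU.mem H S hα (hT.trans_le hr.1) h2⟩

theorem Family.many_of_high (H : Family n f F O I u v) (S : Slab f F O ℓ' ℓ bm bp) (hn : 1 ≤ n)
    {κ : ℝ} (hκ : ℓ' < κ) (hκℓ : κ < ℓ) {k : ℕ} (hk : 1 ≤ k) :
    ∃ T > 0, ∃ e < ℓ, ∀ α ∈ I, Under F u v ℓ bm bp α → e < energy F (u α) (v α) T →
      HasAtLeastSignChanges (u α) k ∧ ∃ t > 0, u α t ≠ 0 ∧ κ < energy F (u α) (v α) t ∧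
        (k - 1 / 2) * Real.pi < ang n f 0 (u α) (v α) t := by
  obtain ⟨C, hC, key⟩ := S.many_swings H.nl hn hκ
  set d := ℓ - κ with hd
  have hd0 : 0 < d := sub_pos.2 hκℓ
  set T := k * C / (d / 2) + 1 with hTdef
  have hT : 0 < T := by positivity
  have hsm : k * C / T ≤ d / 2 := by
    rw [div_le_iff₀ hT]
    have : d / 2 * T = k * C + d / 2 := by rw [hTdef]; field_simp
    rw [this]; linarith
  refine ⟨T, hT, κ + d / 2, by linarith, fun α hα hU hE => ?_⟩
  obtain ⟨t, ht, h1, h2, h3⟩ := hU.exists_time H S hα hT (by linarith) hE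
  have hsm' : k * C / t ≤ k * C / T := div_le_div_of_nonneg_left (by positivity) hT ht
  obtain ⟨r, hr, hrt, -, hrE, hrs⟩ := key (u α) (v α) (H.reg α hα).traj (H.mem_pos hα) k t (hT.trans_le ht) h2 h3 (by linarith)
  have hr0 := fun i => (hT.trans_le ht).trans_le (hrt i)
  obtain ⟨g1, g2⟩ := (H.reg α hα).lt_ang_of_alternating (H.pos α hα) 0 (H.cont_f hα) hk hr hr0 hrs
  exact ⟨⟨r, hr, hr0, hrs⟩, r (Fin.last k), hr0 _, g1, hrE _, g2⟩

theorem Family.exists_first_hit (H : Family n f F O I u v) (hα : α ∈ I) {t : ℝ} (ht : 0 ≤ t)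
    (hu : u α t = 0) (hv : v α t = 0) :
    ∃ T₀, 0 < T₀ ∧ T₀ ≤ t ∧ u α T₀ = 0 ∧ v α T₀ = 0 ∧ ∀ s ∈ Ico 0 T₀, u α s ≠ 0 ∨ v α s ≠ 0 := by
  obtain ⟨T₀, hT₀, h0, hl⟩ := exists_first_le (g := fun x => |u α x| + |v α x|)
    (((H.reg α hα).cont_u.mono (fun x hx => hx.1)).abs.add ((H.reg α hα).cont_v.mono (fun x hx => hx.1)).abs)
    (add_pos_of_pos_of_nonneg (abs_pos.2 (by rw [(H.reg α hα).u_zero]; exact (H.pos α hα).ne')) (abs_nonneg _))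
    ⟨t, ⟨ht, le_rfl⟩, by simp [hu, hv]⟩
  grind

theorem Under.eventually (H : Family n f F O I u v) (S : Slab f F O ℓ' ℓ bm bp) (hα : α ∈ I)
    (hU : Under F u v ℓ bm bp α) : ∀ᶠ a in 𝓝 α, a ∈ I ∧ Under F u v ℓ bm bp a := by
  obtain ⟨t, ht, hE, hm, hal⟩ : ∃ t > 0, energy F (u α) (v α) t < ℓ ∧ u α t ∈ Ioo bm bp ∧
      ∀ s ∈ Ico 0 t, u α s ≠ 0 ∨ v α s ≠ 0 := by
    obtain ⟨t, ht, hE, hm⟩ := hU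
    by_cases hal : u α t = 0 ∧ v α t = 0
    · obtain ⟨T₀, h1, -, h3, h4, h5⟩ := H.exists_first_hit hα ht.le hal.1 hal.2
      exact ⟨T₀, h1, by rw [H.energy_of_dead h3 h4]; exact S.nn.trans_lt S.lt, by rw [h3]; exact ⟨S.bm_neg, S.bp_pos⟩, h5⟩
    · exact ⟨t, ht, hE, hm, fun s hs => H.alive hα (by tauto) s (Ico_subset_Icc_self hs)⟩
  obtain ⟨t1, -, t3⟩ := H.tendsto hα ht.le hal
  filter_upwards [H.isOpen.mem_nhds hα, t3.eventually_lt_const hE, t1.eventually (Ioo_mem_nhds hm.1 hm.2)]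
    with a h1 h2 h3 using ⟨h1, t, ht, h2, h3⟩

theorem Family.high_of_boundary (H : Family n f F O I u v) (S : Slab f F O ℓ' ℓ bm bp) (hα : α ∈ I)
    (hU : ¬ Under F u v ℓ bm bp α) (hfr : ∃ᶠ a in 𝓝 α, a ∈ I ∧ Under F u v ℓ bm bp a) (hT : 0 < T)
    {e : ℝ} (he : e < ℓ) : ∀ᶠ a in 𝓝 α, e < energy F (u a) (v a) T := by
  have hge : ∀ t > 0, ℓ ≤ energy F (u α) (v α) t := by
    intro t ht
    by_contra! hlt
    have hFu := (F_le_energy F (u α) (v α) t).trans_lt hlt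
    have hu : u α t ∉ Icc bm bp := fun hc => (fun hm => hU ⟨t, ht, hlt, hm⟩) ⟨hc.1.lt_of_ne fun h => hFu.ne (h ▸ S.F_bm),
      hc.2.lt_of_ne fun h => hFu.ne (h ▸ S.F_bp)⟩
    obtain ⟨t1, -, t3⟩ := H.tendsto hα ht.le fun s hs => H.alive hα (Or.inl fun h0 => hu (by rw [h0]; exact ⟨S.bm_neg.le, S.bp_pos.le⟩)) s (Ico_subset_Icc_self hs)
    obtain ⟨a, ⟨haI, haU⟩, h2, h3⟩ := (hfr.and_eventually ((t3.eventually_lt_const hlt).and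
      (t1.eventually (isClosed_Icc.isOpen_compl.mem_nhds hu)))).exists
    exact h3 (Ioo_subset_Icc_self (haU.mem H S haI ht h2))
  have hal : u α T ≠ 0 ∨ v α T ≠ 0 := by
    by_contra! hc
    have := hge T hT
    rw [H.energy_of_dead hc.1 hc.2] at this; linarith [S.nn.trans_lt S.lt]
  exact (H.tendsto hα hT.le fun s hs =>
    H.alive hα hal s (Ico_subset_Icc_self hs)).2.2.eventually_const_lt (he.trans_le (hge T hT))

/-- The component of an initial value that drops below the level `ℓ`. -/
theorem Family.exists_good (H : Family n f F O I u v) (S : Slab f F O ℓ' ℓ bm bp)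
    (hright : ∀ T > 0, ∀ e < ℓ, ∃ p ∈ I, ∀ α ∈ I, p ≤ α → e < energy F (u α) (v α) T)
    (hα : α ∈ I) (hU : Under F u v ℓ bm bp α) :
    ∃ J, Good F I u v ℓ bm bp J ∧ ((∃ c ∈ I, c ≤ α ∧ ¬ Under F u v ℓ bm bp c) →
      ∀ T > 0, ∀ e < ℓ, ∃ p ∈ J, ∀ a ∈ J, a ≤ p → e < energy F (u a) (v a) T) := by
  set U := {a ∈ I | Under F u v ℓ bm bp a} with hUdef
  set J := connectedComponentIn U α with hJ
  have hJU := connectedComponentIn_subset U α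
  have hJo : IsOpen J := (isOpen_iff_mem_nhds.2 fun a ha => (ha.2.eventually H S ha.1)).connectedComponentIn
  have hαJ : α ∈ J := mem_connectedComponentIn ⟨hα, hU⟩
  have hJc : J.OrdConnected := isPreconnected_connectedComponentIn.ordConnected
  have core : ∀ q ∈ I, q ∉ J → ∃ q₀ ∈ uIcc α q, q₀ ∉ J ∧ ∀ T > 0, ∀ e < ℓ, ∃ p ∈ J, p ∈ uIcc α q₀ ∧
      ∀ a ∈ uIcc p q₀, e < energy F (u a) (v a) T := by
    intro q hq hqJ
    obtain ⟨t, ht, hn, hlt⟩ := exists_first_notMem hJo hαJ hqJ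
    set g : ℝ → ℝ := fun s => α + s * (q - α) with hg
    have hgc : Continuous g := by fun_prop
    have hmem : ∀ {x y s : ℝ}, s ∈ Icc 0 1 → x + s * (y - x) ∈ uIcc x y := fun hs =>
      (convex_uIcc _ _).add_smul_sub_mem left_mem_uIcc right_mem_uIcc hs
    have hqI := H.conn.uIcc_subset hα hq (hmem (Ioc_subset_Icc_self ht))
    have hnU := fun hc => hn (by
      refine (isPreconnected_Icc.image g hgc.continuousOn).subset_connectedComponentIn
        ⟨0, ⟨le_rfl, ht.1.le⟩, by simp [hg]⟩ ?_ ⟨t, ⟨ht.1.le, le_rfl⟩, rfl⟩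
      rintro - ⟨s, hs, rfl⟩
      rcases hs.2.eq_or_lt with rfl | h
      · exact ⟨hqI, hc⟩
      · exact hJU (hlt s ⟨hs.1, h⟩))
    have hgt : Tendsto g (𝓝[<] t) (𝓝 (g t)) := (hgc.tendsto t).mono_left nhdsWithin_le_nhds
    have hev : ∀ᶠ s in 𝓝[<] t, s ∈ Ico 0 t := Ico_mem_nhdsLT ht.1
    refine ⟨g t, hmem (Ioc_subset_Icc_self ht), hn, fun T hT e he => ?_⟩
    obtain ⟨ε, hε, hb⟩ := Metric.eventually_nhds_iff_ball.1 (H.high_of_boundary S hqI hnU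
      (hgt.frequently (hev.mono fun s hs => hJU (hlt s hs)).frequently) hT he)
    obtain ⟨s, hs, hsb⟩ := (hev.and (hgt.eventually (Metric.ball_mem_nhds _ hε))).exists
    refine ⟨g s, hlt s hs, ?_, fun a ha => hb a ((convex_ball _ _).ordConnected.uIcc_subset hsb
      (Metric.mem_ball_self hε) ha)⟩
    have : g s = α + s / t * (g t - α) := by have := ht.1.ne'; simp only [hg]; field_simp; ring
    rw [this]; exact hmem ⟨div_nonneg hs.1 ht.1.le, (div_le_one ht.1).2 hs.2.le⟩
  refine ⟨J, ⟨fun a ha => (hJU ha).1, hJo, hJc, fun a ha => (hJU ha).2, ?_⟩, ?_⟩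
  · intro T hT e he
    by_cases hq : ∀ q ∈ I, α ≤ q → q ∈ J
    · grind
    · push Not at hq
      obtain ⟨q, hqI, hαq, hqJ⟩ := hq
      obtain ⟨q₀, hq₀, h3, h⟩ := core q hqI hqJ
      rw [uIcc_of_le hαq] at hq₀
      obtain ⟨p, hpJ, hp, h⟩ := h T hT e he
      exact ⟨p, hpJ, fun a ha hpa => h a (mem_uIcc.2 (Or.inl ⟨hpa, not_lt.1 fun hc => h3 (hJc.out hαJ ha ⟨hq₀.1, hc.le⟩)⟩))⟩
  · rintro ⟨c, hcI, hcα, hcU⟩ T hT e he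
    obtain ⟨q₀, hq₀, h3, h⟩ := core c hcI fun h => hcU (hJU h).2
    rw [uIcc_of_ge hcα] at hq₀
    obtain ⟨p, hpJ, hp, h⟩ := h T hT e he
    exact ⟨p, hpJ, fun a ha hpa => h a (mem_uIcc.2 (Or.inr ⟨not_lt.1 fun hc => h3 (hJc.out ha hαJ ⟨hc.le, hq₀.2⟩), hpa⟩))⟩

theorem tendsto_ray (x σ : ℝ) : Tendsto (fun τ => x + σ * τ) (𝓝[>] 0) (𝓝 x) := by
  have : Tendsto (fun τ => x + σ * τ) (𝓝 0) (𝓝 (x + σ * 0)) := Continuous.tendsto (by fun_prop) 0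
  rw [mul_zero, add_zero] at this; exact this.mono_left nhdsWithin_le_nhds

/-- Between initial values with and without `k` sign changes there is a boundary point. -/
theorem Good.exists_boundary (H : Family n f F O I u v) (G : Good F I u v ℓ bm bp J) (hα : α ∈ J) {p : ℝ}
    (hp : p ∈ J) {k : ℕ} (hk1 : 1 ≤ k) (hk : ¬ HasAtLeastSignChanges (u α) k) (hpk : HasAtLeastSignChanges (u p) k) :
    ∃ x ∈ J, x ∈ uIcc p α ∧ ¬ HasAtLeastSignChanges (u x) k ∧
      ∀ᶠ τ in 𝓝[>] (0 : ℝ), HasAtLeastSignChanges (u (x + (p - α) * τ)) k := by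
  obtain ⟨t, ht, hn, hlt⟩ := exists_first_notMem (isOpen_iff_mem_nhds.2 fun a ha => H.eventually_signChanges ha.1 hk1 ha.2) ⟨G.sub hp, hpk⟩ fun h => hk h.2
  have hx : p + t * (α - p) ∈ uIcc p α := (convex_uIcc _ _).add_smul_sub_mem left_mem_uIcc right_mem_uIcc
    (Ioc_subset_Icc_self ht)
  have hxJ := G.conn.uIcc_subset hp hα hx
  refine ⟨_, hxJ, hx, fun h => hn ⟨G.sub hxJ, h⟩, ?_⟩
  filter_upwards [Ioc_mem_nhdsGT ht.1] with τ hτ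
  convert (hlt (t - τ) ⟨by linarith [hτ.2], by linarith [hτ.1]⟩).2 using 2
  ring

/-- Behaviour of a solution on the boundary of the set of solutions with `k` sign changes. -/
theorem Family.boundary_cases (H : Family n f F O I u v) (S : Slab f F O ℓ' ℓ bm bp) (hn : 1 ≤ n)
    (hα : α ∈ I) (hU : Under F u v ℓ bm bp α) {k : ℕ} (hk1 : 1 ≤ k)
    (hk : ¬ HasAtLeastSignChanges (u α) k) (hfr : ∃ᶠ a in 𝓝 α, HasAtLeastSignChanges (u a) k) :
    (∃ T₀, 0 < T₀ ∧ u α T₀ = 0 ∧ v α T₀ = 0 ∧ ∀ s ∈ Ico 0 T₀, u α s ≠ 0 ∨ v α s ≠ 0) ∨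
    ((∀ t, 0 ≤ t → u α t ≠ 0 ∨ v α t ≠ 0) ∧ ∃ s ∈ O, f s = 0 ∧ Tendsto (u α) atTop (𝓝 s) ∧
      Tendsto (energy F (u α) (v α)) atTop (𝓝 (F s)) ∧ (∀ w ∈ uIcc 0 s, F w ≤ F s) ∧ F s ≤ ℓ' ∧
      ∀ η > 0, ∀ᶠ t in atTop, |u α t - s| < η ∧ energy F (u α) (v α) t - F s < η / t) := by
  by_cases hal : ∀ t, 0 ≤ t → u α t ≠ 0 ∨ v α t ≠ 0
  · right
    obtain ⟨lo, -, -, -, hsub, hr⟩ := H.range hα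
    have hW : ∀ t, 0 ≤ t → ∀ w ∈ uIcc 0 (u α t), F w ≤ energy F (u α) (v α) t := by
      intro t ht w hw
      by_contra! hc
      exact hfr (H.eventually_not_of_barrier hα hk1 ht (hal t ht)
        (H.ang_lt_of_not hα hk1 hk ht (lt_add_one t) (hal _ (by linarith))) hw hc)
    obtain ⟨s, hs, h1, h2, -, h4, h5, h6⟩ := (H.reg α hα).exists_limit (H.pos α hα) H.nl hsub
      (fun t ht => Ioc_subset_Icc_self (hr α hα le_rfl t ht)) (H.f_pos α hα).ne' hal hW hk
    refine ⟨hal, s, hsub hs, h1, h2, h4, h5, ?_, h6⟩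
    by_contra! hc
    obtain ⟨T, hT, hE, hm⟩ := hU
    obtain ⟨t, ht, hlt⟩ := S.energy_decays H.nl hn (H.reg α hα).traj (H.mem_pos hα) hT hE hm hc
    have : F s ≤ energy F (u α) (v α) t := by
      refine le_of_tendsto h4 ?_
      filter_upwards [eventually_ge_atTop t] with r hr using H.energy_le hα (hT.le.trans ht) hr
    linarith
  · left
    push Not at hal
    obtain ⟨t, ht, h1, h2⟩ := hal
    obtain ⟨T₀, g1, -, g3, g4, g5⟩ := H.exists_first_hit hα ht h1 h2
    grind

theorem exists_nat_ang (x : ℝ) : ∃ k : ℕ, 2 ≤ k ∧ ∀ j ≥ k, x < ((j : ℝ) - 1 - 1 / 2) * Real.pi := by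
  obtain ⟨m, hm⟩ := exists_nat_gt (x / Real.pi)
  rw [div_lt_iff₀ Real.pi_pos] at hm
  refine ⟨m + 2, by omega, fun j hj => hm.trans_le (mul_le_mul_of_nonneg_right ?_ Real.pi_pos.le)⟩
  have : ((m + 2 : ℕ) : ℝ) ≤ j := by exact_mod_cast hj
  push_cast at this; linarith

/-- Passing from one energy slab to the one below. -/
theorem Good.descend (H : Family n f F O I u v) (S : Slab f F O ℓ' ℓ bm bp) (hn : 1 ≤ n)
    (G : Good F I u v ℓ bm bp J) {bm' bp' : ℝ} (hℓ' : 0 < ℓ') (hbm : bm' < 0) (hbp : 0 < bp')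
    (hFm : F bm' = ℓ') (hFp : F bp' = ℓ')
    (hpeak : ∀ s ∈ O, f s = 0 → F s = ℓ' → (∀ w ∈ uIcc 0 s, F w ≤ F s) →
      ∃ ρ > 0, ρ < |s| ∧ Icc (s - ρ) (s + ρ) ⊆ O ∧ ∀ w ∈ Icc (s - ρ) (s + ρ), w ≠ s → F w < F s)
    (hlow : ∃ α ∈ J, ∃ t > 0, energy F (u α) (v α) t ≤ ℓ') :
    ∃ α ∈ J, Under F u v ℓ' bm' bp' α := by
  obtain ⟨α, hαJ, t, ht, hEt⟩ := hlow
  have hα := G.sub hαJ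
  by_cases hdead : u α t = 0 ∧ v α t = 0
  · exact ⟨α, hαJ, t, ht, by rwa [H.energy_of_dead hdead.1 hdead.2], by rw [hdead.1]; exact ⟨hbm, hbp⟩⟩
  have hal : u α t ≠ 0 ∨ v α t ≠ 0 := by tauto
  have hE := (H.energy_lt hn hα ht.le (lt_add_one t) hal).trans_le hEt
  by_cases hm : u α (t + 1) ∈ Ioo bm' bp'
  · exact ⟨α, hαJ, t + 1, by linarith, hE, hm⟩
  obtain ⟨w, hw, hFw⟩ : ∃ w ∈ uIcc 0 (u α (t + 1)), F w = ℓ' := by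
    by_cases h1 : bm' < u α (t + 1)
    · exact ⟨bp', mem_uIcc.2 (Or.inl ⟨hbp.le, not_lt.1 fun h2 => hm ⟨h1, h2⟩⟩), hFp⟩
    · exact ⟨bm', mem_uIcc.2 (Or.inr ⟨not_lt.1 h1, hbm.le⟩), hFm⟩
  obtain ⟨k, hk2, hk⟩ := exists_nat_ang (ang n f 0 (u α) (v α) (t + 1))
  have hk1 : 1 ≤ k := by omega
  have hpi := Real.pi_pos
  have hnot := (H.eventually_not_of_barrier hα hk1 (by linarith) (Or.inl fun h0 => hm (by rw [h0]; exact ⟨hbm, hbp⟩))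
      ((hk k le_rfl).trans (by nlinarith)) hw (by rwa [hFw])).self_of_nhds
  obtain ⟨κ, g1, g2⟩ := exists_between S.lt
  obtain ⟨T, hT, e, he, many⟩ := H.many_of_high S hn g1 g2 hk1
  obtain ⟨p, hpJ, hp⟩ := G.right T hT e he
  obtain ⟨x, hxJ, -, hx, hxev⟩ := G.exists_boundary H hαJ hpJ hk1 hnot
    (many p (G.sub hpJ) (G.under p hpJ) (hp p hpJ le_rfl)).1
  have hxI := G.sub hxJ
  have hfr : ∃ᶠ a in 𝓝 x, HasAtLeastSignChanges (u a) k := (tendsto_ray x _).frequently hxev.frequently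
  rcases H.boundary_cases S hn hxI (G.under x hxJ) hk1 hx hfr with
    ⟨T₀, h1, h2, h3, -⟩ | ⟨hal, s, hsO, h1, h2, h3, h4, h5, h6⟩
  · exact ⟨x, hxJ, T₀, h1, by rwa [H.energy_of_dead h2 h3], by rw [h2]; exact ⟨hbm, hbp⟩⟩
  rcases h5.lt_or_eq with hlt | heq
  · have hs : s ∈ Ioo bm' bp' := by
      constructor <;> by_contra! hc
      · linarith [h4 bm' (mem_uIcc.2 (Or.inr ⟨hc, hbm.le⟩))]
      · linarith [h4 bp' (mem_uIcc.2 (Or.inl ⟨hbp.le, hc⟩))]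
    obtain ⟨r, g1, g2, g3⟩ := ((h3.eventually_lt_const hlt).and ((h2.eventually
      (Ioo_mem_nhds hs.1 hs.2)).and (eventually_gt_atTop 0))).exists
    exact ⟨x, hxJ, r, g3, g1, g2⟩
  obtain ⟨ρ, hρ, hρs, hρO, hρF⟩ := hpeak s hsO h1 heq h4
  obtain ⟨η, hη, key⟩ := near_max hn H.nl hρ hρO hρF one_pos
  obtain ⟨T, ⟨g1, g2⟩, g3⟩ := ((h6 η hη).and (eventually_ge_atTop 1)).exists
  have hT0 : 0 < T := by linarith
  obtain ⟨t1, -, t3⟩ := H.tendsto hxI hT0.le fun t ht => hal t ht.1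
  have hz := H.eventually_zero hxI hk1 hT0.le (hal T hT0.le)
    (H.ang_lt_of_not hxI hk1 hx hT0.le (lt_add_one T) (hal _ (by linarith)))
  obtain ⟨a, haA, ⟨⟨haI, haz⟩, e1, e2⟩, haJ⟩ := (hfr.and_eventually ((hz.and
    (((t1.sub_const s).abs.eventually_lt_const g1).and ((t3.sub_const (F s)).eventually_lt_const g2))).and
    (G.isOpen.mem_nhds hxJ))).exists
  obtain ⟨z, hz, hz0, -⟩ := haz haA
  refine ⟨a, haJ, z, hT0.trans hz, ?_, by rw [hz0]; exact ⟨hbm, hbp⟩⟩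
  by_contra! hc
  rw [← heq] at hc
  have := key (u a) (v a) (H.reg a haI).traj T g3 z hz.le e1 e2
    (fun r hr => H.mem a haI r (hT0.le.trans hr.1)) hc z ⟨hz.le, le_rfl⟩
  rw [hz0, zero_sub, abs_neg] at this; linarith

theorem Family.small_of_hit (H : Family n f F O I u v) (hα : α ∈ I) {T₀ η : ℝ} (hT₀ : 0 < T₀)
    (hu : u α T₀ = 0) (hv : v α T₀ = 0) (hη : 0 < η) :
    ∃ T ∈ Ico (T₀ / 2) T₀, |u α T| < η ∧ energy F (u α) (v α) T < η / T := by
  have h1 := ((H.reg α hα).cont_u T₀ hT₀.le).abs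
  have h2 := H.continuousOn_energy hα T₀ hT₀.le
  rw [ContinuousWithinAt, hu, abs_zero] at h1; rw [ContinuousWithinAt, H.energy_of_dead hu hv] at h2
  have hle : 𝓝[<] T₀ ≤ 𝓝[Ici 0] T₀ := by
    rw [nhdsWithin_le_iff]
    exact mem_of_superset (Ioo_mem_nhdsLT hT₀) fun x hx => hx.1.le
  obtain ⟨T, g1, g2, g3⟩ := (((h1.eventually_lt_const hη).filter_mono hle).and
    (((h2.eventually_lt_const (div_pos hη hT₀)).filter_mono hle).and (Ico_mem_nhdsLT (half_lt_self hT₀)))).exists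
  exact ⟨T, g3, g1, lt_of_lt_of_le g2 (div_le_div_of_nonneg_left hη.le (by linarith) g3.2.le)⟩

/-- A solution that converges to a degenerate maximum point of `F` at height zero is not a limit, along a
ray of initial values, of solutions that return to zero. -/
def NoLimitPath (f F : ℝ → ℝ) (O I : Set ℝ) (u v : ℝ → ℝ → ℝ) : Prop :=
  ∀ s ∈ O, s ≠ 0 → f s = 0 → F s = 0 → (∀ w ∈ uIcc 0 s, F w ≤ 0) → ∀ α ∈ I, (∀ t, 0 ≤ t → u α t ≠ 0 ∨ v α t ≠ 0) →
    (∀ η > 0, ∀ᶠ t in atTop, |u α t - s| < η ∧ energy F (u α) (v α) t < η / t) → ∀ σ : ℝ,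
    ¬ ∀ T > 0, ∀ᶠ τ in 𝓝[>] (0 : ℝ), α + σ * τ ∈ I ∧ ∃ z > T, u (α + σ * τ) z = 0 ∧ v (α + σ * τ) z ≠ 0

/-- A boundary point of the set of solutions with `k` sign changes in the lowest slab is a solution
that tends to zero and has exactly `k - 1` sign changes. -/
theorem Family.boundary_bottom (H : Family n f F O I u v) (S : Slab f F O 0 ℓ bm bp) (hn : 1 ≤ n)
    {ρ : ℝ} (hρ : 0 < ρ) (hsub : Icc (-ρ) ρ ⊆ O) (hneg : ∀ w ∈ Icc (-ρ) ρ, w ≠ 0 → F w < 0)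
    (hα : α ∈ I) (hU : Under F u v ℓ bm bp α) {k : ℕ} (hk1 : 1 ≤ k)
    (hk : ¬ HasAtLeastSignChanges (u α) (k + 1)) {σ : ℝ}
    (hev : ∀ᶠ τ in 𝓝[>] (0 : ℝ), HasAtLeastSignChanges (u (α + σ * τ)) (k + 1))
    (hpeak : NoLimitPath f F O I u v) :
    HasExactlySignChanges (u α) k ∧ Tendsto (u α) atTop (𝓝 0) := by
  have hlim := tendsto_ray α σ
  obtain ⟨η, hη, small⟩ := H.eventually_not_of_small hn hρ hsub hneg one_pos
  rcases H.boundary_cases S hn hα hU (by omega) hk (hlim.frequently hev.frequently) with ⟨T₀, h1, h2, h3, h4⟩ | ⟨hal, s, hsO, h1, h2, h3, h4, h5, h6⟩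
  · refine ⟨⟨?_, hk⟩, ?_⟩
    · by_contra hc
      obtain ⟨η, hη, small⟩ := H.eventually_not_of_small hn hρ hsub hneg (half_pos h1)
      obtain ⟨T, hT, g1, g2⟩ := H.small_of_hit hα h1 h2 h3 hη
      have hT0 : 0 ≤ T := by linarith [hT.1]
      refine (hlim.frequently hev.frequently) (small α hα T hT.1 (h4 T ⟨hT0, hT.2⟩) g1 g2 (k + 1) (by omega) ?_)
      push_cast; linarith [H.ang_lt_of_not hα hk1 hc hT0 (t := (T + T₀) / 2) (by linarith [hT.2]) (h4 _ ⟨by linarith, by linarith [hT.2]⟩)]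
    · refine tendsto_const_nhds.congr' ?_
      filter_upwards [eventually_ge_atTop T₀] with t ht using ((H.reg α hα).rest T₀ h1 h2 h3 t ht).1.symm
  · have hFs := le_antisymm h5 (by rw [← H.nl.F_zero]; exact h4 0 left_mem_uIcc)
    rw [hFs] at h3 h4 h6; simp only [sub_zero] at h6
    by_cases hs : s = 0
    · subst hs
      refine ⟨⟨?_, hk⟩, h2⟩
      by_contra hc
      obtain ⟨T, ⟨g1, g2⟩, g3⟩ := ((h6 η hη).and (eventually_ge_atTop 1)).exists
      refine (hlim.frequently hev.frequently) (small α hα T g3 (hal T (by linarith)) (by simpa using g1) g2 (k + 1) (by omega) ?_)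
      have := H.ang_lt_of_not hα hk1 hc (by linarith) (lt_add_one T) (hal _ (by linarith))
      push_cast; linarith
    · refine (hpeak s hsO hs h1 hFs h4 α hα hal h6 σ fun T hT => ?_).elim
      filter_upwards [(hlim.eventually (H.eventually_zero hα (by omega : 1 ≤ k + 1) hT.le (hal T hT.le) (H.ang_lt_of_not hα (by omega) hk hT.le (lt_add_one T) (hal _ (by linarith))))), hev] with τ h7 h8 using ⟨h7.1, h7.2 h8⟩

/-- The lowest slab contains two solutions with exactly `k` sign changes. -/
theorem Good.bottom (H : Family n f F O I u v) (S : Slab f F O 0 ℓ bm bp) (hn : 1 ≤ n) (G : Good F I u v ℓ bm bp J)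
    (hleft : ∀ T > 0, ∀ e < ℓ, ∃ p ∈ J, ∀ a ∈ J, a ≤ p → e < energy F (u a) (v a) T)
    {ρ : ℝ} (hρ : 0 < ρ) (hsub : Icc (-ρ) ρ ⊆ O) (hneg : ∀ w ∈ Icc (-ρ) ρ, w ≠ 0 → F w < 0)
    (hpeak : NoLimitPath f F O I u v)
    (hlow : ∃ α ∈ J, ∃ t > 0, energy F (u α) (v α) t ≤ 0) :
    ∃ k₀ : ℕ, ∀ k ≥ k₀, ∃ x₁ ∈ J, ∃ x₂ ∈ J, x₁ < x₂ ∧ (HasExactlySignChanges (u x₁) k ∧ Tendsto (u x₁) atTop (𝓝 0)) ∧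
      (HasExactlySignChanges (u x₂) k ∧ Tendsto (u x₂) atTop (𝓝 0)) := by
  have hpi := Real.pi_pos
  obtain ⟨α, hαJ, k₀, hk₀⟩ : ∃ α ∈ J, ∃ k₀ : ℕ, ∀ k ≥ k₀, ∀ᶠ a in 𝓝 α, ¬ HasAtLeastSignChanges (u a) k := by
    obtain ⟨α, hαJ, t, ht, hEt⟩ := hlow
    have hα := G.sub hαJ
    refine ⟨α, hαJ, ?_⟩
    by_cases hdead : u α t = 0 ∧ v α t = 0
    · obtain ⟨T₀, g1, -, g3, g4, g5⟩ := H.exists_first_hit hα ht.le hdead.1 hdead.2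
      obtain ⟨η, hη, small⟩ := H.eventually_not_of_small hn hρ hsub hneg (half_pos g1)
      obtain ⟨T, hT, e1, e2⟩ := H.small_of_hit hα g1 g3 g4 hη
      obtain ⟨k, hk2, hk⟩ := exists_nat_ang (ang n f 0 (u α) (v α) T)
      exact ⟨k, fun j hj => small α hα T hT.1 (g5 T ⟨by linarith [hT.1], hT.2⟩) e1 e2 j (by omega) (hk j hj)⟩
    have hE := (H.energy_lt hn hα ht.le (lt_add_one t) (by tauto)).trans_le hEt
    have hal' : u α (t + 1) ≠ 0 ∨ v α (t + 1) ≠ 0 := by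
      by_contra! hc
      rw [H.energy_of_dead hc.1 hc.2] at hE; exact lt_irrefl _ hE
    obtain ⟨k, hk2, hk⟩ := exists_nat_ang (ang n f 0 (u α) (v α) (t + 1))
    refine ⟨k, fun j hj => H.eventually_not_of_barrier hα (by omega) (by linarith) hal'
      ((hk j hj).trans (by nlinarith)) left_mem_uIcc (by rwa [H.nl.F_zero])⟩
  refine ⟨k₀ + 1, fun k hk => ?_⟩
  obtain ⟨ε, hε, hball⟩ := Metric.eventually_nhds_iff.1 ((hk₀ (k + 1) (by omega)).and (G.isOpen.mem_nhds hαJ))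
  have hα' := hball (by
    rw [Real.dist_eq, add_sub_cancel_left, abs_of_pos (half_pos hε)]
    exact half_lt_self hε)
  have hα0 := hball (y := α) (by simpa using hε)
  obtain ⟨κ, g1, g2⟩ := exists_between S.lt
  obtain ⟨T, hT, e, he, many⟩ := H.many_of_high S hn g1 g2 (k := k + 1) (by omega)
  have core : ∀ {α p : ℝ}, α ∈ J → p ∈ J → ¬ HasAtLeastSignChanges (u α) (k + 1) → e < energy F (u p) (v p) T →
      ∃ x ∈ J, x ∈ uIcc p α ∧ HasExactlySignChanges (u x) k ∧ Tendsto (u x) atTop (𝓝 0) := by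
    intro α p hα hp hk hE
    obtain ⟨x, hxJ, hxα, hx, hev⟩ := G.exists_boundary H hα hp (by omega) hk (many p (G.sub hp) (G.under p hp) hE).1
    exact ⟨x, hxJ, hxα, H.boundary_bottom S hn hρ hsub hneg (G.sub hxJ) (G.under x hxJ) (by omega) hx hev hpeak⟩
  have hle : ∀ {α}, α ∈ J → ¬ HasAtLeastSignChanges (u α) (k + 1) → ¬ e < energy F (u α) (v α) T :=
    fun hα hk hE => hk (many _ (G.sub hα) (G.under _ hα) hE).1
  obtain ⟨p, hpJ, hp⟩ := G.right T hT e he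
  obtain ⟨q, hqJ, hq⟩ := hleft T hT e he
  obtain ⟨x, hxJ, hx, hxs⟩ := core hα'.2 hpJ hα'.1 (hp p hpJ le_rfl)
  obtain ⟨y, hyJ, hy, hys⟩ := core hα0.2 hqJ hα0.1 (hq q hqJ le_rfl)
  rw [uIcc_of_ge (not_lt.1 fun h => hle hα'.2 hα'.1 (hp _ hα'.2 h.le))] at hx
  rw [uIcc_of_le (not_lt.1 fun h => hle hα0.2 hα0.1 (hq _ hα0.2 h.le))] at hy
  exact ⟨y, hyJ, x, hxJ, by linarith [hx.1, hy.2], hys, hxs⟩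

end family

section area
open MeasureTheory

theorem volume_preimage_eulerMap (n : ℕ) {g : ℝ → ℝ} (hg : Continuous g) {h t : ℝ} (hh : 0 ≤ h)
    (ht : 0 < t) {A : Set (ℝ × ℝ)} (hA : MeasurableSet A) :
    volume (eulerMap n g h t ⁻¹' A) = ENNReal.ofReal (1 + h * (n / t)) * volume A := by
  set c := 1 + h * (n / t) with hc
  have hc0 : 0 < c := by positivity
  have m1 : MeasurePreserving (fun p : ℝ × ℝ => (p.1, p.2 + h * p.1)) :=
    (MeasurePreserving.id volume).skew_product (by fun_prop)
      (Eventually.of_forall fun a => (measurePreserving_add_right volume (h * a)).map_eq)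
  have m2 : MeasurePreserving (fun p : ℝ × ℝ => (p.1, (p.2 - h * g p.1) * c⁻¹)) (volume.prod volume)
      (volume.prod (ENNReal.ofReal c • volume)) := by
    refine (MeasurePreserving.id volume).skew_product (g := fun a b => (b - h * g a) * c⁻¹)
      (Continuous.measurable (by fun_prop)) (Eventually.of_forall fun a => ?_)
    have e : (fun b => (b - h * g a) * c⁻¹) = (fun b => b * c⁻¹) ∘ fun b => b - h * g a := rfl
    rw [e, ← Measure.map_map (by fun_prop) (by fun_prop), (measurePreserving_sub_right volume (h * g a)).map_eq,
      Real.map_volume_mul_right (inv_ne_zero hc0.ne'), inv_inv, abs_of_pos hc0]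
  have m3 := m2.comp ((Measure.measurePreserving_swap.comp m1).comp Measure.measurePreserving_swap)
  have e : (fun p : ℝ × ℝ => (p.1, (p.2 - h * g p.1) * c⁻¹)) ∘
      ((Prod.swap ∘ fun p : ℝ × ℝ => (p.1, p.2 + h * p.1)) ∘ Prod.swap) = eulerMap n g h t := rfl
  have := m3.measure_preimage hA.nullMeasurableSet
  rw [Measure.prod_smul_right] at this; exact this

theorem le_volume_preimage_eulerState (n : ℕ) {g : ℝ → ℝ} (hg : Continuous g) {h a b : ℝ} (hh : 0 ≤ h)
    (ha : 0 < a) (m : ℕ) (hm : a + m * h ≤ b) {A : Set (ℝ × ℝ)} (hA : MeasurableSet A) :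
    ENNReal.ofReal ((1 + h * (n / b)) ^ m) * volume A ≤ volume ((fun p => eulerState n g h a p m) ⁻¹' A) := by
  have hb := ha.trans_le (le_trans (le_add_of_nonneg_right (by positivity)) hm)
  induction m generalizing A with
  | zero => simp [eulerState]
  | succ m ih =>
    have hcm : Measurable (eulerMap n g h (a + (m + 1 : ℕ) * h)) := by apply Continuous.measurable; unfold eulerMap; fun_prop
    have e : (fun p => eulerState n g h a p (m + 1)) ⁻¹' A =
      (fun p => eulerState n g h a p m) ⁻¹' (eulerMap n g h (a + (m + 1 : ℕ) * h) ⁻¹' A) := rfl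
    refine le_trans ?_ (ih (by push_cast at hm; nlinarith) (hcm hA))
    rw [volume_preimage_eulerMap n hg hh (by positivity) hA, pow_succ, ENNReal.ofReal_mul (by positivity), mul_assoc]
    gcongr

theorem exists_traj_across {n : ℕ} (hn : 1 ≤ n) {g G : ℝ → ℝ} (hg : Continuous g) {B : ℝ}
    (hB : ∀ s, |g s| ≤ B) (hG : Continuous G) {c e lo hi V : ℝ}
    (hbd : ∀ p : ℝ × ℝ, p.2 ^ 2 / 2 + G p.1 ≤ c → p.1 ∈ Icc lo hi ∧ |p.2| ≤ V)
    (hvol : volume {p : ℝ × ℝ | p.2 ^ 2 / 2 + G p.1 < e} <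
      ENNReal.ofReal (3 / 2) * volume {p : ℝ × ℝ | p.2 ^ 2 / 2 + G p.1 ≤ c}) {R : ℝ} (hR : 0 < R) :
    ∃ u v, IsTraj n g u v (Icc R (2 * R)) ∧ e ≤ energy G u v R ∧ energy G u v (2 * R) ≤ c := by
  set K := {p : ℝ × ℝ | p.2 ^ 2 / 2 + G p.1 ≤ c} with hK
  have hKm : MeasurableSet K := (isClosed_le (by fun_prop) continuous_const).measurableSet
  set h : ℕ → ℝ := fun i => (2 * R - R) / (i + 1 : ℕ) with hh
  have hpos : ∀ i, 0 < h i := fun i => div_pos (by linarith) (by positivity)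
  have hmh : ∀ i : ℕ, ((i + 1 : ℕ) : ℝ) * h i = R := by grind
  have ex : ∀ i : ℕ, ∃ p : ℕ → ℝ × ℝ, (∀ j, p (j + 1) = eulerMap n g (h i) (R + (j + 1 : ℕ) * h i) (p j)) ∧
      e ≤ (p 0).2 ^ 2 / 2 + G (p 0).1 ∧ p (i + 1) ∈ K := by
    intro i
    by_contra! hc
    have h2 : (fun p => eulerState n g (h i) R p (i + 1)) ⁻¹' K ⊆ {p : ℝ × ℝ | p.2 ^ 2 / 2 + G p.1 < e} := by
      intro p hp
      by_contra hc2
      exact hc (eulerState n g (h i) R p) (fun _ => rfl) (not_lt.1 hc2) hp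
    have h3 : (3 / 2 : ℝ) ≤ (1 + h i * (n / (2 * R))) ^ (i + 1) := by
      have hn' : (1 : ℝ) ≤ n := by exact_mod_cast hn
      have h0 : 0 ≤ h i * (n / (2 * R)) := by have := hpos i; positivity
      refine le_trans ?_ (one_add_mul_le_pow (by linarith) (i + 1))
      have : ((i + 1 : ℕ) : ℝ) * (h i * (n / (2 * R))) = n / 2 := by grind
      rw [this]; linarith
    exact (hvol.trans_le (le_trans (mul_le_mul_left (ENNReal.ofReal_le_ofReal h3) _) ((le_volume_preimage_eulerState n hg (hpos i).le hR (i + 1) (b := 2 * R) (by rw [hmh]; linarith) hKm).trans (measure_mono h2)))).false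
  choose p hp hp1 hp2 using ex
  obtain ⟨U, W, hT, hU0, hW0, hU1, hW1⟩ := euler_limit (b := 2 * R) hg hB hR hpos (fun i => by rw [hmh]; ring) (tendsto_step _) hp
    (fun i => le_rfl) (fun i => hbd _ (hp2 i))
  refine ⟨U, W, hT, ?_, ?_⟩
  · exact ge_of_tendsto' (((hW0.pow 2).div_const 2).add ((hG.tendsto _).comp hU0)) hp1
  · exact le_of_tendsto' (((hW1.pow 2).div_const 2).add ((hG.tendsto _).comp hU1)) hp2

end area

section crossing
open MeasureTheory
variable {n : ℕ} {f F : ℝ → ℝ} {O : Set ℝ} {ℓ' ℓ bm bp : ℝ}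

theorem Slab.exists_level (S : Slab f F O ℓ' ℓ bm bp) (H : Nonlin f F O) {e : ℝ} (he : ℓ' < e)
    (heℓ : e < ℓ) : ∃ hi ∈ Ioo 0 bp, F hi = e ∧ 0 < f hi ∧ ∀ w ∈ Ico hi bp, e ≤ F w := by
  have hc := (S.contF H).mono (Icc_subset_Icc_left S.bm_neg.le)
  obtain ⟨hi, h1, h2⟩ := intermediate_value_Ioo S.bp_pos.le hc
    (show e ∈ Ioo (F 0) (F bp) by rw [H.F_zero, S.F_bp]; exact ⟨S.nn.trans_lt he, heℓ⟩)
  refine ⟨hi, h1, h2, S.f_pos H h1.1.le h1.2 (by rwa [h2]), fun w hw => ?_⟩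
  by_contra! hlt
  obtain ⟨y, hy1, hy2⟩ := intermediate_value_Ioo hw.2.le (hc.mono (Icc_subset_Icc_left (h1.1.le.trans hw.1)))
    (⟨hlt, by rwa [S.F_bp]⟩)
  exact (S.mono H h1.1.le (hw.1.trans_lt hy1.1) hy1.2 (by rwa [hy2])).ne (h2.trans hy2.symm)

theorem Slab.exists_extension (S : Slab f F O ℓ' ℓ bm bp) (H : Nonlin f F O) {e : ℝ} (he : ℓ' < e)
    (heℓ : e < ℓ) : ∃ lo hi B, ∃ g G : ℝ → ℝ, bm < lo ∧ lo < 0 ∧ 0 < hi ∧ hi < bp ∧ Continuous g ∧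
      (∀ s, |g s| ≤ B) ∧ (∀ s, HasDerivAt G (g s) s) ∧ (∀ s ∈ Icc lo hi, g s = f s) ∧
      (∀ s ∈ Icc lo hi, G s = F s) ∧ (∀ s, G s < e → s ∈ Ioo lo hi) ∧
      ∀ s ∈ Ioo bm bp, F s < e → s ∈ Ioo lo hi := by
  obtain ⟨hi, h1, h2, h3, h4⟩ := S.exists_level H he heℓ
  obtain ⟨lo', g1, g2, g3, g4⟩ := S.neg.exists_level H.neg he heℓ
  obtain ⟨lo, rfl⟩ : ∃ lo, lo' = -lo := ⟨-lo', by ring⟩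
  simp only [neg_neg] at g2 g3
  have hlo : bm < lo ∧ lo < 0 := by grind
  have hlc : lo ≤ hi := by linarith [h1.1]
  have hsub := (Icc_subset_Icc hlo.1.le h1.2.le).trans (S.sub H)
  obtain ⟨g, G, B, hgc, hGd, ge, hGF, hB, gl, gr⟩ := H.exists_extension hlc ⟨hlo.2.le, h1.1.le⟩ hsub
  refine ⟨lo, hi, B, g, G, hlo.1, hlo.2, h1.1, h1.2, hgc, hB, hGd, ge, hGF, fun s hs => ?_, fun s hs hFs => ?_⟩
  · constructor
    · by_contra! hc
      have := antiOn_Icc (fun x _ => (hGd x).continuousAt.continuousWithinAt) (fun x hx => ⟨_, hGd x, by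
        rw [gl _ hx.2.le]
        linarith⟩) ⟨le_rfl, hc⟩ ⟨hc, le_rfl⟩ hc
      rw [hGF lo ⟨le_rfl, hlc⟩] at this; linarith
    · by_contra! hc
      have := monoOn_Icc (fun x _ => (hGd x).continuousAt.continuousWithinAt) (fun x hx => ⟨_, hGd x, (gr _ hx.1.le).symm ▸ h3.le⟩) ⟨le_rfl, hc⟩ ⟨hc, le_rfl⟩ hc
      rw [hGF hi ⟨hlc, le_rfl⟩] at this; linarith
  · constructor
    · by_contra! hc
      have := g4 (-s) ⟨neg_le_neg hc, neg_lt_neg hs.1⟩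
      rw [neg_neg] at this; linarith
    · grind

/-- Trajectories crossing the slab take place at arbitrarily late times: the phase flow contracts
area, so it cannot carry all states that end up at low energy from low energies. -/
theorem Slab.exists_crossing (S : Slab f F O ℓ' ℓ bm bp) (H : Nonlin f F O) (hn : 1 ≤ n) (hneg : ∃ s ∈ Ioo bm bp, F s < ℓ') :
    ∃ e, ℓ' < e ∧ e < ℓ ∧ ∀ R > 0, ∃ R', R ≤ R' ∧ R' < 2 * R ∧ ∃ u v, IsTraj n f u v (Icc R' (2 * R)) ∧
      (∀ t ∈ Icc R' (2 * R), u t ∈ Ioo bm bp) ∧ energy F u v R' = e ∧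
      energy F u v (2 * R) ≤ ℓ' := by
  obtain ⟨e₂, he₂, he₂'⟩ := exists_between S.lt
  obtain ⟨lo, hi, B, g, G, a1, a2, a3, a4, hgc, hB, hGd, hgf, hGF, hGe, hFe⟩ := S.exists_extension H he₂ he₂'
  have hGc := continuous_iff_continuousAt.2 fun s => (hGd s).continuousAt
  have hEc : Continuous fun p : ℝ × ℝ => p.2 ^ 2 / 2 + G p.1 := by fun_prop
  obtain ⟨m, hm⟩ := isCompact_Icc.exists_bound_of_continuousOn (hGc.continuousOn)
  set V := √(2 * (|e₂| + m)) with hV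
  have hbd : ∀ p : ℝ × ℝ, p.2 ^ 2 / 2 + G p.1 < e₂ → p.1 ∈ Icc lo hi ∧ |p.2| ≤ V := by
    intro p hp
    have h1 := hGe _ (by nlinarith [sq_nonneg p.2])
    have h2 := (abs_le.1 (hm _ (Ioo_subset_Icc_self h1))).1
    refine ⟨Ioo_subset_Icc_self h1, Real.abs_le_sqrt ?_⟩
    linarith [le_abs_self e₂]
  set K := {p : ℝ × ℝ | p.2 ^ 2 / 2 + G p.1 ≤ ℓ'} with hK
  have hfin : ∀ r ≤ e₂, volume {p : ℝ × ℝ | p.2 ^ 2 / 2 + G p.1 < r} ≠ ⊤ := fun r hr =>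
    ((measure_mono (fun p hp => ⟨(hbd p (lt_of_lt_of_le hp hr)).1, abs_le.1 (hbd p (lt_of_lt_of_le hp hr)).2⟩ :
      _ ⊆ Icc lo hi ×ˢ Icc (-V) V)).trans_lt (isCompact_Icc.prod isCompact_Icc).measure_lt_top).ne
  have hlim := tendsto_measure_biInter_gt (a := ℓ')
    (fun r _ => (isOpen_lt hEc continuous_const).measurableSet.nullMeasurableSet)
    (fun i j _ hij p hp => lt_of_lt_of_le hp hij) ⟨e₂, he₂, hfin e₂ le_rfl⟩
  have hAK : ⋂ r > ℓ', {p : ℝ × ℝ | p.2 ^ 2 / 2 + G p.1 < r} = K := by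
    ext p
    simp only [mem_iInter]
    exact ⟨fun hp => le_of_forall_gt fun r hr => hp r hr, fun hp r hr => lt_of_le_of_lt hp hr⟩
  rw [hAK] at hlim
  have hKpos : volume K ≠ 0 := by
    obtain ⟨s, hs, hFs⟩ := hneg
    have := (isOpen_lt hEc continuous_const).measure_pos volume ⟨(s, 0), by
      show 0 ^ 2 / 2 + G s < ℓ'
      rw [hGF s (Ioo_subset_Icc_self (hFe s hs (hFs.trans he₂)))]; simpa using hFs⟩
    refine (this.trans_le (measure_mono fun p hp => ?_)).ne'
    grind
  have hlt : volume K < ENNReal.ofReal (3 / 2) * volume K := by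
    conv_lhs => rw [← one_mul (volume K)]
    refine ENNReal.mul_lt_mul_left hKpos (ne_top_of_le_ne_top (hfin e₂ le_rfl) (measure_mono fun p hp => lt_of_le_of_lt hp he₂)) ?_
    rw [← ENNReal.ofReal_one]
    exact (ENNReal.ofReal_lt_ofReal_iff (by norm_num)).2 (by norm_num)
  obtain ⟨e, hj, heℓ', hje⟩ := ((hlim.eventually_lt_const hlt).and (Ioo_mem_nhdsGT he₂)).exists
  refine ⟨e, heℓ', hje.trans he₂', fun R hR => ?_⟩
  obtain ⟨u, v, hT, hE1, hE2⟩ := exists_traj_across hn hgc hB hGc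
    (fun p hp => hbd p (hp.trans_lt he₂)) hj hR
  have hcont : ContinuousOn (energy G u v) (Icc R (2 * R)) := fun t ht =>
    (hT.hasDerivWithinAt_energy ht (hGd _)).continuousWithinAt
  obtain ⟨R', hR', hR'e⟩ := intermediate_value_Icc' (by linarith) hcont (show e ∈ Icc _ _ from ⟨hE2.trans heℓ'.le, hE1⟩)
  have hR'2 := lt_of_le_of_ne hR'.2 (by
    rintro rfl
    linarith)
  have hsub : Icc R' (2 * R) ⊆ Icc R (2 * R) := Icc_subset_Icc_left hR'.1
  have hmem : ∀ t ∈ Icc R' (2 * R), u t ∈ Ioo lo hi := fun t ht => hGe _ (by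
    have h1 := (hT.antitoneOn_energy hR fun t _ => hGd (u t)) hR' (hsub ht) ht.1
    have h2 := F_le_energy G u v t
    linarith)
  have hEE : ∀ t ∈ Icc R' (2 * R), energy F u v t = energy G u v t := fun t ht => by
    simp only [energy, hGF _ (Ioo_subset_Icc_self (hmem t ht))]
  refine ⟨R', hR'.1, hR'2, u, v, (hT.mono hsub).congr_nonlin fun t ht => hgf _ (Ioo_subset_Icc_self (hmem t ht)),
    fun t ht => ⟨a1.trans (hmem t ht).1, (hmem t ht).2.trans a4⟩, ?_, ?_⟩
  · rw [hEE R' ⟨le_rfl, hR'2.le⟩, hR'e]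
  · rw [hEE _ ⟨hR'2.le, le_rfl⟩]; exact hE2

end crossing

section ray
variable {n : ℕ} {f F : ℝ → ℝ} {O : Set ℝ} {ℓ' ℓ bm bp : ℝ}

/-- For a suitable rescaling, the energy increases along rays at all energies above `e`. -/
theorem Slab.exists_ray (S : Slab f F O ℓ' ℓ bm bp) (H : Nonlin f F O) {e : ℝ} (he : ℓ' < e) :
    ∃ C, 0 ≤ C ∧ ∀ s ∈ Ioo bm bp, ∀ w, e ≤ w ^ 2 / 2 + F s → 0 < (1 + 2 * C * s ^ 2) * w ^ 2 + s * f s := by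
  obtain ⟨M, hM⟩ := isCompact_Icc.exists_bound_of_continuousOn (H.cont.mono (S.sub H))
  set d := e - ℓ' with hd
  have hd0 : 0 < d := sub_pos.2 he
  refine ⟨(M / d) ^ 2, sq_nonneg _, fun s hs w hw => ?_⟩
  rcases lt_or_ge ℓ' (F s) with h | h
  · have := S.mul_pos H hs h
    have : 0 ≤ (1 + 2 * (M / d) ^ 2 * s ^ 2) * w ^ 2 := by positivity
    linarith
  · have hw2 : 2 * d ≤ w ^ 2 := by linarith
    have h2 := (abs_le.1 ((abs_mul _ _).trans_le (mul_le_mul_of_nonneg_left (hM s (Ioo_subset_Icc_self hs))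
      (abs_nonneg s)))).1
    have h3 : (1 + 2 * (M / d) ^ 2 * s ^ 2) * (2 * d) ≤ (1 + 2 * (M / d) ^ 2 * s ^ 2) * w ^ 2 :=
      mul_le_mul_of_nonneg_left hw2 (by positivity)
    set y := |s| * (M / d) with hy
    have e1 : 2 * (M / d) ^ 2 * s ^ 2 = 2 * y ^ 2 := by rw [hy, mul_pow, sq_abs]; ring
    have e2 : |s| * M = y * d := by rw [hy]; field_simp
    rw [e1] at h3 ⊢
    have : 0 < d * (2 + 4 * y ^ 2 - y) := _root_.mul_pos hd0 (by nlinarith [sq_nonneg (y - 1)])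
    linarith

theorem ray_unique_pos (H : Nonlin f F O) (hO : Ioo bm bp ⊆ O) (hbm : bm < 0) {C e e' : ℝ}
    (hray : ∀ s ∈ Ioo bm bp, ∀ w, e' ≤ w ^ 2 / 2 + F s → 0 < (1 + 2 * C * s ^ 2) * w ^ 2 + s * f s)
    (he : e' ≤ e) {s s' w w' : ℝ} (hs0 : 0 < s) (hss : s < s') (hs' : s' < bp)
    (hw : w * kap C s' = w' * kap C s) (hE : w ^ 2 / 2 + F s = e) : e < w' ^ 2 / 2 + F s' := by
  have hk := kap_pos (C := C) hs0
  have hk' := kap_pos (C := C) (hs0.trans hss)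
  set m := w / kap C s with hm
  have e1 : w = m * kap C s := by rw [hm]; field_simp
  have e2 : w' = m * kap C s' := by rw [hm]; field_simp; linarith
  have hmem : ∀ x ∈ Icc s s', x ∈ Ioo bm bp := fun x hx => ⟨hbm.trans (hs0.trans_le hx.1), hx.2.trans_lt hs'⟩
  set φ : ℝ → ℝ := fun x => (m * kap C x) ^ 2 / 2 + F x with hφ
  have hd : ∀ x ∈ Icc s s', ∃ d, HasDerivAt φ d x ∧ (e' ≤ φ x → 0 < d) := by
    intro x hx
    refine ⟨_, (((hasDerivAt_kap C x).const_mul m).pow 2).div_const 2 |>.add (H.deriv x (hO (hmem x hx))),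
      fun hle => pos_of_mul_pos_right ((hray x (hmem x hx) (m * kap C x) hle).trans_eq ?_) (hs0.trans_le hx.1).le⟩
    simp [kap]; ring
  choose! φ' hd hpos using hd
  have hφs : φ s = e := by rw [hφ, ← hE, e1]
  have hge : ∀ x ∈ Icc s s', e - φ x ≤ 0 := neg_persist (g' := fun x => -φ' x)
    (fun x hx => ((hd x hx).const_sub e).continuousAt.continuousWithinAt)
    (fun x hx h0 => ⟨(hd x (Ico_subset_Icc_self hx)).const_sub e, neg_neg_of_pos
      (hpos x (Ico_subset_Icc_self hx) (by linarith))⟩) (by rw [hφs, sub_self])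
  have := strictMonoOn_Icc (HasDerivAt.continuousOn hd) (fun x hx => ⟨_, hd x (Ioo_subset_Icc_self hx),
    hpos x (Ioo_subset_Icc_self hx) (by linarith [hge x (Ioo_subset_Icc_self hx)])⟩)
    ⟨le_rfl, hss.le⟩ ⟨hss.le, le_rfl⟩ hss
  rw [hφs] at this; simpa [hφ, ← e2] using this

theorem eq_of_ray_of_pos (H : Nonlin f F O) (hO : Ioo bm bp ⊆ O) (hbm : bm < 0) {C e e' : ℝ}
    (hray : ∀ s ∈ Ioo bm bp, ∀ w, e' ≤ w ^ 2 / 2 + F s → 0 < (1 + 2 * C * s ^ 2) * w ^ 2 + s * f s)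
    (he : e' ≤ e) {s s' w w' : ℝ} (h : 0 < s) (h' : 0 < s') (hs : s < bp) (hs' : s' < bp)
    (hw : w * kap C s' = w' * kap C s) (hE : w ^ 2 / 2 + F s = e) (hE' : w' ^ 2 / 2 + F s' = e) : s = s' :=
  le_antisymm (not_lt.1 fun hl => (ray_unique_pos H hO hbm hray he h' hl hs hw.symm hE').ne' hE)
    (not_lt.1 fun hl => (ray_unique_pos H hO hbm hray he h hl hs' hw hE).ne' hE')

/-- A state is determined by its energy and its angle. -/
theorem Slab.ray_unique (S : Slab f F O ℓ' ℓ bm bp) (H : Nonlin f F O) {C e e' : ℝ}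
    (hray : ∀ s ∈ Ioo bm bp, ∀ w, e' ≤ w ^ 2 / 2 + F s → 0 < (1 + 2 * C * s ^ 2) * w ^ 2 + s * f s)
    (he : e' ≤ e) {s s' w w' ρ ρ' θ : ℝ} (hs : s ∈ Ioo bm bp) (hs' : s' ∈ Ioo bm bp) (hρ : 0 < ρ)
    (hρ' : 0 < ρ') (hk : kap C s = ρ * Real.cos θ) (hk' : kap C s' = ρ' * Real.cos θ)
    (hw : w = -(ρ * Real.sin θ)) (hw' : w' = -(ρ' * Real.sin θ)) (hE : w ^ 2 / 2 + F s = e)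
    (hE' : w' ^ 2 / 2 + F s' = e) : s = s' ∧ w = w' := by
  have hx : w * kap C s' = w' * kap C s := by rw [hk, hk', hw, hw']; ring
  have hO : Ioo bm bp ⊆ O := Ioo_subset_Icc_self.trans (S.sub H)
  have hO' : Ioo (-bp) (-bm) ⊆ Neg.neg ⁻¹' O := fun x hx => hO ⟨by linarith [hx.2], by linarith [hx.1]⟩
  have hray' : ∀ s ∈ Ioo (-bp) (-bm), ∀ w, e' ≤ w ^ 2 / 2 + F (-s) →
      0 < (1 + 2 * C * s ^ 2) * w ^ 2 + s * -f (-s) := fun s hs w hw => by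
    have := hray (-s) ⟨by linarith [hs.2], by linarith [hs.1]⟩ w hw
    rw [neg_sq] at this; linarith
  have pos : ∀ {x ρ c : ℝ}, 0 < ρ → 0 < c → kap C x = ρ * c → 0 < x := fun h1 h2 h =>
    (mul_pos_iff_of_pos_right (Real.exp_pos _)).1 (h.symm ▸ _root_.mul_pos h1 h2 : 0 < kap C _)
  have heq : s = s' := by
    rcases lt_trichotomy (Real.cos θ) 0 with hc | hc | hc
    · exact neg_injective (eq_of_ray_of_pos H.neg hO' (by linarith [S.bp_pos]) hray' he (w := -w) (w' := -w')
        (pos hρ (neg_pos.2 hc) (by rw [kap_neg, hk, mul_neg])) (pos hρ' (neg_pos.2 hc) (by rw [kap_neg, hk', mul_neg]))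
        (by linarith [hs.1]) (by linarith [hs'.1]) (by rw [kap_neg, kap_neg]; linarith) (by simpa using hE)
        (by simpa using hE'))
    · rw [hc, mul_zero] at hk hk'; rw [kap_eq_zero.1 hk, kap_eq_zero.1 hk']
    · exact eq_of_ray_of_pos H hO S.bm_neg hray he (pos hρ hc hk) (pos hρ' hc hk') hs.2 hs'.2 hx hE hE'
  refine ⟨heq, ?_⟩
  rw [← heq] at hE' hk' hx
  by_cases h0 : kap C s = 0
  · have hc : Real.cos θ = 0 := by rw [h0] at hk; exact (mul_eq_zero.1 hk.symm).resolve_left hρ.ne'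
    have h1 : w ^ 2 = w' ^ 2 := by linarith
    have h2 : 0 ≤ w * w' := by
      have : 0 ≤ ρ * ρ' * Real.sin θ ^ 2 := by positivity
      rw [hw, hw']; linarith
    rcases sq_eq_sq_iff_eq_or_eq_neg.1 h1 with h | h
    · exact h
    · rw [h] at h2
      have : w' = 0 := by nlinarith
      rw [h, this, neg_zero]
  · exact mul_right_cancel₀ h0 hx

end ray

section rate
variable {n : ℕ} {f F u v θ : ℝ → ℝ} {C a b t₀ : ℝ}

/-- A trajectory on a compact time interval together with its angle. -/
structure AngTraj (n : ℕ) (f F : ℝ → ℝ) (C : ℝ) (u v θ : ℝ → ℝ) (a b : ℝ) : Prop where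
  pos : 0 < a
  traj : IsTraj n f u v (Icc a b)
  hF : ∀ t ∈ Icc a b, HasDerivAt F (f (u t)) (u t)
  ang : ∀ t ∈ Icc a b, HasDerivWithinAt θ (angVel n f C u v t) (Icc a b) t
  polar : ∀ t ∈ Icc a b, kap C (u t) = rho C u v t * Real.cos (θ t) ∧ v t = -(rho C u v t * Real.sin (θ t))

theorem nhdsGT_le_Icc (ht : t₀ ∈ Ico a b) : 𝓝[>] t₀ ≤ 𝓝[Icc a b] t₀ := by
  rw [nhdsWithin_le_iff]
  exact mem_of_superset (Ioc_mem_nhdsGT ht.2) fun x hx => ⟨ht.1.trans hx.1.le, hx.2⟩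

theorem tendsto_slope_of_within {g : ℝ → ℝ} {g' : ℝ} (ht : t₀ ∈ Ico a b) (h : HasDerivWithinAt g g' (Icc a b) t₀) :
    Tendsto (fun t => (g t - g t₀) / (t - t₀)) (𝓝[>] t₀) (𝓝 g') := by
  exact ((hasDerivWithinAt_iff_tendsto_slope' self_notMem_Ioi).1 (h.mono_of_mem_nhdsWithin
    (nhdsGT_le_Icc ht self_mem_nhdsWithin))).congr fun t => slope_def_field _ _ _

theorem AngTraj.rate (A : AngTraj n f F C u v θ a b) (hn : 1 ≤ n) (ht : t₀ ∈ Ico a b) (hv : v t₀ ≠ 0) :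
    Tendsto (fun t => (θ t - θ t₀) / (energy F u v t₀ - energy F u v t)) (𝓝[>] t₀)
      (𝓝 (angVel n f C u v t₀ / ((n : ℝ) / t₀ * v t₀ ^ 2))) := by
  have htI := Ico_subset_Icc_self ht
  have h1 := tendsto_slope_of_within ht (A.ang t₀ htI)
  have h2 := tendsto_slope_of_within (g := energy F u v) ht (A.traj.hasDerivWithinAt_energy htI (A.hF t₀ htI))
  have hn0 : (0 : ℝ) < n := by exact_mod_cast hn
  have ht0 : 0 < t₀ := A.pos.trans_le ht.1
  have h3 := h1.div h2.neg (by
    have : 0 < (n : ℝ) / t₀ * v t₀ ^ 2 := by positivity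
    linarith)
  rw [neg_mul, neg_neg] at h3
  refine h3.congr' ?_
  filter_upwards [self_mem_nhdsWithin] with t htt
  have : t - t₀ ≠ 0 := (sub_pos.2 htt).ne'
  simp only [Pi.div_apply]; rw [← neg_div, neg_sub, div_div_div_cancel_right₀ this]

theorem AngTraj.rate_turning (A : AngTraj n f F C u v θ a b) (hn : 1 ≤ n) (ht : t₀ ∈ Ico a b)
    (hv : v t₀ = 0) (hf : f (u t₀) ≠ 0) :
    Tendsto (fun t => (θ t - θ t₀) ^ 3 / (energy F u v t₀ - energy F u v t)) (𝓝[>] t₀)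
      (𝓝 (angVel n f C u v t₀ ^ 3 / ((n : ℝ) / t₀ * f (u t₀) ^ 2 / 3))) := by
  have htI := Ico_subset_Icc_self ht
  have hn0 : (0 : ℝ) < n := by exact_mod_cast hn
  have ht0 : 0 < t₀ := A.pos.trans_le ht.1
  have h1 := tendsto_slope_of_within ht (A.ang t₀ htI)
  have h2 := tendsto_slope_of_within ht (A.traj t₀ htI).2
  simp only [hv, mul_zero, zero_sub, sub_zero] at h2
  have hle := nhdsGT_le_Icc ht
  have hinv : Tendsto (fun t : ℝ => (n : ℝ) / t) (𝓝[>] t₀) (𝓝 (n / t₀)) :=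
    (tendsto_const_nhds.div tendsto_id ht0.ne').mono_left nhdsWithin_le_nhds
  have h3 : Tendsto (fun t => (energy F u v t₀ - energy F u v t) / (t - t₀) ^ 3) (𝓝[>] t₀)
      (𝓝 ((n : ℝ) / t₀ * f (u t₀) ^ 2 / 3)) := by
    refine HasDerivAt.lhopital_zero_nhdsGT (f' := fun t => (n : ℝ) / t * v t ^ 2)
      (g' := fun t => 3 * (t - t₀) ^ 2) ?_ ?_ ?_ ?_ ?_ ?_
    · filter_upwards [Ioo_mem_nhdsGT ht.2] with t htt
      have hI : t ∈ Icc a b := ⟨ht.1.trans htt.1.le, htt.2.le⟩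
      have := (A.traj.hasDerivWithinAt_energy hI (A.hF t hI)).hasDerivAt (Icc_mem_nhds (ht.1.trans_lt htt.1) htt.2)
      refine (this.const_sub (energy F u v t₀)).congr_deriv ?_
      ring
    · refine Eventually.of_forall fun t => ?_
      refine (((hasDerivAt_id t).sub_const t₀).pow 3).congr_deriv ?_
      simp
    · filter_upwards [self_mem_nhdsWithin] with t htt
      have : t - t₀ ≠ 0 := (sub_pos.2 htt).ne'
      positivity
    · have := ((A.traj.hasDerivWithinAt_energy htI (A.hF t₀ htI)).continuousWithinAt.mono_left hle).const_sub
        (energy F u v t₀)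
      simp only at this
      rw [show v t₀ ^ 2 / 2 + F (u t₀) = energy F u v t₀ from rfl, sub_self] at this
      exact this
    · have : Tendsto (fun t : ℝ => (t - t₀) ^ 3) (𝓝 t₀) (𝓝 ((t₀ - t₀) ^ 3)) := Continuous.tendsto (by fun_prop) t₀
      rw [sub_self, zero_pow three_ne_zero] at this; exact this.mono_left nhdsWithin_le_nhds
    · have := (hinv.mul (h2.pow 2)).div_const 3
      rw [neg_sq] at this
      refine this.congr' ?_
      filter_upwards [self_mem_nhdsWithin] with t htt
      have : t - t₀ ≠ 0 := (sub_pos.2 htt).ne'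
      field_simp
  have h4 := (h1.pow 3).div h3 (by positivity)
  refine h4.congr' ?_
  filter_upwards [self_mem_nhdsWithin] with t htt
  have : t - t₀ ≠ 0 := (sub_pos.2 htt).ne'
  simp only [Pi.div_apply]; rw [div_pow, div_div_div_cancel_right₀ (pow_ne_zero 3 this)]

/-- Of two trajectories through the same state the earlier one gains less angle per energy. -/
theorem AngTraj.compare {u' v' θ' r r' : ℝ → ℝ} {a' b' t₁ e lo hi : ℝ} (A : AngTraj n f F C u v θ a b)
    (A' : AngTraj n f F C u' v' θ' a' b') (hn : 1 ≤ n) (he : e ∈ Ioc lo hi)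
    (hr : ContinuousWithinAt r (Icc lo hi) e) (hr' : ContinuousWithinAt r' (Icc lo hi) e)
    (hrI : ∀ x ∈ Icc lo hi, r x ∈ Icc a b ∧ energy F u v (r x) = x)
    (hrI' : ∀ x ∈ Icc lo hi, r' x ∈ Icc a' b' ∧ energy F u' v' (r' x) = x)
    (han : AntitoneOn (energy F u v) (Icc a b)) (han' : AntitoneOn (energy F u' v') (Icc a' b'))
    (ht0 : r e = t₀) (ht1 : r' e = t₁) (htt : t₀ < t₁) (hu : u t₀ = u' t₁) (hv : v t₀ = v' t₁)
    (hθ : θ t₀ = θ' t₁)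
    (hΛ : 0 < (1 + 2 * C * u t₀ ^ 2) * v t₀ ^ 2 + u t₀ * f (u t₀)) :
    ∀ᶠ x in 𝓝[<] e, θ (r x) < θ' (r' x) := by
  have hn0 : (0 : ℝ) < n := by exact_mod_cast hn
  have heI : e ∈ Icc lo hi := Ioc_subset_Icc_self he
  have hle : 𝓝[<] e ≤ 𝓝[Icc lo hi] e := by
    rw [nhdsWithin_le_iff]
    exact mem_of_superset (Ico_mem_nhdsLT he.1) fun x hx => ⟨hx.1, hx.2.le.trans he.2⟩
  have hevI : ∀ᶠ x in 𝓝[<] e, x ∈ Icc lo hi ∧ x < e := by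
    filter_upwards [Ico_mem_nhdsLT he.1] with x hx using ⟨⟨hx.1, hx.2.le.trans he.2⟩, hx.2⟩
  have lt : ∀ {u v r : ℝ → ℝ} {a b : ℝ}, AntitoneOn (energy F u v) (Icc a b) →
      (∀ x ∈ Icc lo hi, r x ∈ Icc a b ∧ energy F u v (r x) = x) → ∀ x ∈ Icc lo hi, x < e → r e < r x := by
    intro u v r a b h1 h2 x hx hxe
    exact h1.reflect_lt (h2 x hx).1 (h2 e heI).1 (by rwa [(h2 x hx).2, (h2 e heI).2])
  have tr : ∀ {u v r : ℝ → ℝ} {a b : ℝ}, AntitoneOn (energy F u v) (Icc a b) →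
      (∀ x ∈ Icc lo hi, r x ∈ Icc a b ∧ energy F u v (r x) = x) →
      ContinuousWithinAt r (Icc lo hi) e → Tendsto r (𝓝[<] e) (𝓝[>] (r e)) ∧ r e ∈ Ico a b := by
    intro u v r a b h1 h2 h3
    refine ⟨tendsto_nhdsWithin_iff.2 ⟨h3.mono_left hle, ?_⟩, (h2 e heI).1.1, ?_⟩
    · filter_upwards [hevI] with x hx using lt h1 h2 x hx.1 hx.2
    · obtain ⟨x, hx, hxe⟩ := hevI.exists
      exact (lt h1 h2 x hx hxe).trans_le (h2 x hx).1.2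
  obtain ⟨k1, k2⟩ := tr han hrI hr
  obtain ⟨k1', k2'⟩ := tr han' hrI' hr'
  have hE0 := (hrI e heI).2
  have hE1 := (hrI' e heI).2
  rw [ht0] at k1 k2 hE0; rw [ht1] at k1' k2' hE1
  have hpt : 0 < t₀ := A.pos.trans_le k2.1
  have hpt1 : 0 < t₁ := hpt.trans htt
  have hne : u t₀ ≠ 0 ∨ v t₀ ≠ 0 := by
    by_contra! hc
    simp [hc.1, hc.2] at hΛ
  set D := kap C (u t₀) ^ 2 + v t₀ ^ 2 with hD
  have hD0 : 0 < D := sq_add_sq_pos_of hne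
  set Λ := Real.exp (C * u t₀ ^ 2) * (1 + 2 * C * u t₀ ^ 2) * v t₀ ^ 2 + kap C (u t₀) * f (u t₀) with hΛd
  have hΛ0 : 0 < Λ := by
    have : Λ = Real.exp (C * u t₀ ^ 2) * ((1 + 2 * C * u t₀ ^ 2) * v t₀ ^ 2 + u t₀ * f (u t₀)) := by
      rw [hΛd]; unfold kap; ring
    rw [this]; exact _root_.mul_pos (Real.exp_pos _) hΛ
  have hω : angVel n f C u v t₀ = (Λ + kap C (u t₀) * n * v t₀ / t₀) / D := by unfold angVel; rw [hΛd, hD]; congr 1; ring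
  have hω' : angVel n f C u' v' t₁ = (Λ + kap C (u t₀) * n * v t₀ / t₁) / D := by
    unfold angVel; rw [hΛd, hD, ← hu, ← hv]; congr 1; ring
  by_cases hv0 : v t₀ = 0
  · have hf0 : f (u t₀) ≠ 0 := by intro h0; simp [hv0, h0] at hΛ
    have L := (A.rate_turning hn k2 hv0 hf0).comp k1
    have L' := (A'.rate_turning hn k2' (by rw [← hv]; exact hv0) (by rw [← hu]; exact hf0)).comp k1'
    rw [hω, hv0] at L; rw [hω', hv0, ← hu] at L'; simp only [mul_zero, zero_div, add_zero] at L L'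
    have hlt : (Λ / D) ^ 3 / ((n : ℝ) / t₀ * f (u t₀) ^ 2 / 3) < (Λ / D) ^ 3 / ((n : ℝ) / t₁ * f (u t₀) ^ 2 / 3) := by gcongr
    filter_upwards [L.eventually_lt L' hlt, hevI] with x hx hxI
    simp only [Function.comp_apply] at hx
    rw [hE0, hE1, (hrI x hxI.1).2, (hrI' x hxI.1).2, div_lt_div_iff_of_pos_right (sub_pos.2 hxI.2),
      ← hθ, (Odd.strictMono_pow (by decide : Odd 3)).lt_iff_lt] at hx
    linarith
  · have L := (A.rate hn k2 hv0).comp k1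
    have L' := (A'.rate hn k2' (by rw [← hv]; exact hv0)).comp k1'
    rw [hω] at L; rw [hω', ← hv] at L'
    have hlt : (Λ + kap C (u t₀) * n * v t₀ / t₀) / D / ((n : ℝ) / t₀ * v t₀ ^ 2) <
        (Λ + kap C (u t₀) * n * v t₀ / t₁) / D / ((n : ℝ) / t₁ * v t₀ ^ 2) := by
      have e1 : ∀ τ : ℝ, 0 < τ → (Λ + kap C (u t₀) * n * v t₀ / τ) / D / ((n : ℝ) / τ * v t₀ ^ 2) =
          (Λ * τ + kap C (u t₀) * n * v t₀) / (D * (n * v t₀ ^ 2)) := fun τ hτ => by field_simp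
      rw [e1 _ hpt, e1 _ hpt1]; gcongr
    filter_upwards [L.eventually_lt L' hlt, hevI] with x hx hxI
    simp only [Function.comp_apply] at hx
    rw [hE0, hE1, (hrI x hxI.1).2, (hrI' x hxI.1).2, div_lt_div_iff_of_pos_right (sub_pos.2 hxI.2), ← hθ] at hx; linarith

end rate

/-- The time at which a level is attained depends continuously on parameters. -/
theorem exists_levelTime {P : Set ℝ} {E : ℝ → ℝ → ℝ} {a b lo hi : ℝ} (hab : a ≤ b)
    (hx : ∀ t ∈ Icc a b, ContinuousOn (fun x => E x t) P) (hc : ∀ x ∈ P, ContinuousOn (E x) (Icc a b))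
    (han : ∀ x ∈ P, AntitoneOn (E x) (Icc a b))
    (hs : ∀ x ∈ P, ∀ s ∈ Icc a b, ∀ t ∈ Icc a b, s < t → lo ≤ E x s → E x t < E x s)
    (h1 : ∀ x ∈ P, hi ≤ E x a) (h2 : ∀ x ∈ P, E x b ≤ lo) :
    ∃ r : ℝ → ℝ → ℝ, (∀ x ∈ P, ∀ e ∈ Icc lo hi, r x e ∈ Icc a b ∧ E x (r x e) = e) ∧
      ContinuousOn (fun p : ℝ × ℝ => r p.1 p.2) (P ×ˢ Icc lo hi) := by
  have ex : ∀ x e, x ∈ P → e ∈ Icc lo hi → ∃ t, t ∈ Icc a b ∧ E x t = e := fun x e hx he =>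
    intermediate_value_Icc' hab (hc x hx) ⟨(h2 x hx).trans he.1, he.2.trans (h1 x hx)⟩
  choose! r hr using ex
  refine ⟨r, fun x hx e he => hr x e hx he, ?_⟩
  rintro ⟨x₀, e₀⟩ ⟨hx₀, he₀⟩; simp only at hx₀ he₀
  obtain ⟨hrI, hrE⟩ := hr x₀ e₀ hx₀ he₀
  have hfst : Tendsto (fun p : ℝ × ℝ => p.1) (𝓝[P ×ˢ Icc lo hi] (x₀, e₀)) (𝓝[P] x₀) :=
    tendsto_nhdsWithin_iff.2 ⟨continuous_fst.continuousWithinAt, by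
      filter_upwards [self_mem_nhdsWithin] with p hp using hp.1⟩
  have hsnd : Tendsto (fun p : ℝ × ℝ => p.2) (𝓝[P ×ˢ Icc lo hi] (x₀, e₀)) (𝓝 e₀) := continuous_snd.continuousWithinAt
  have hsub : ∀ t ∈ Icc a b, Tendsto (fun p : ℝ × ℝ => E p.1 t - p.2) (𝓝[P ×ˢ Icc lo hi] (x₀, e₀))
      (𝓝 (E x₀ t - e₀)) := fun t ht => ((hx t ht x₀ hx₀).tendsto.comp hfst).sub hsnd
  refine tendsto_order.2 ⟨fun y hy => ?_, fun y hy => ?_⟩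
  · simp only at hy
    rcases lt_or_ge y a with hya | hya
    · filter_upwards [self_mem_nhdsWithin] with p hp using hya.trans_le (hr p.1 p.2 hp.1 hp.2).1.1
    · obtain ⟨t, ht1, ht2⟩ := exists_between hy
      have htI : t ∈ Icc a b := ⟨hya.trans ht1.le, ht2.le.trans hrI.2⟩
      have hgt : 0 < E x₀ t - e₀ := by
        have h3 := han x₀ hx₀ htI hrI ht2.le
        rw [hrE] at h3
        have := hs x₀ hx₀ t htI _ hrI ht2 (he₀.1.trans h3)
        rw [hrE] at this; linarith
      filter_upwards [(hsub t htI).eventually_const_lt hgt, self_mem_nhdsWithin] with p hp hpP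
      obtain ⟨g1, g2⟩ := hr p.1 p.2 hpP.1 hpP.2
      exact ht1.trans ((han _ hpP.1).reflect_lt g1 htI (by linarith))
  · simp only at hy
    rcases lt_or_ge b y with hyb | hyb
    · filter_upwards [self_mem_nhdsWithin] with p hp using (hr p.1 p.2 hp.1 hp.2).1.2.trans_lt hyb
    · obtain ⟨t, ht1, ht2⟩ := exists_between hy
      have htI : t ∈ Icc a b := ⟨hrI.1.trans ht1.le, ht2.le.trans hyb⟩
      have hgt : E x₀ t - e₀ < 0 := by
        have := hs x₀ hx₀ _ hrI t htI ht1 (by rw [hrE]; exact he₀.1)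
        rw [hrE] at this; linarith
      filter_upwards [(hsub t htI).eventually_lt_const hgt, self_mem_nhdsWithin] with p hp hpP
      obtain ⟨g1, g2⟩ := hr p.1 p.2 hpP.1 hpP.2
      exact ((han _ hpP.1).reflect_lt htI g1 (by linarith)).trans ht2

theorem mem_Ioo_of_avoid {φ : ℝ → ℝ} {a b x y lo hi : ℝ} (hφ : ContinuousOn φ (Icc a b))
    (hx : x ∈ Icc a b) (hy : y ∈ Icc a b) (hav : ∀ z ∈ Icc a b, φ z ≠ lo ∧ φ z ≠ hi)
    (hm : φ x ∈ Ioo lo hi) : φ y ∈ Ioo lo hi := by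
  have hsub : uIcc x y ⊆ Icc a b := uIcc_subset_Icc hx hy
  have hc := hφ.mono hsub
  constructor
  · by_contra! h
    obtain ⟨z, hz, hzv⟩ := intermediate_value_uIcc hc (mem_uIcc.2 (Or.inr ⟨h, hm.1.le⟩))
    exact (hav z (hsub hz)).1 hzv
  · by_contra! h
    obtain ⟨z, hz, hzv⟩ := intermediate_value_uIcc hc (mem_uIcc.2 (Or.inl ⟨hm.2.le, h⟩))
    exact (hav z (hsub hz)).2 hzv

/-- A planar winding argument on a rectangle. -/
theorem exists_zero_below {X Y : ℝ → ℝ → ℝ} {a b c d : ℝ} (hab : a ≤ b) (hcd : c ≤ d)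
    (hX : ContinuousOn (fun p : ℝ × ℝ => X p.1 p.2) (Icc a b ×ˢ Icc c d))
    (hY : ContinuousOn (fun p : ℝ × ℝ => Y p.1 p.2) (Icc a b ×ˢ Icc c d))
    (hne : ∀ x ∈ Icc a b, ∀ y ∈ Icc c d, ¬ (X x y = 0 ∧ Y x y = 0))
    (htop : ∀ x ∈ Icc a b, ¬ (X x d ≤ 0 ∧ 0 ≤ Y x d)) (hright : ∀ y ∈ Icc c d, 0 < X b y)
    (hcorner : X a d ≤ 0)
    (hleft : ∀ y ∈ Ioc c d, X a y = 0 → Y a y < 0 → ∀ᶠ z in 𝓝[<] y, X a z < 0) :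
    ∃ x ∈ Icc a b, X x c = 0 ∧ Y x c < 0 := by
  have hpi := Real.pi_pos
  set pr : ℝ × ℝ → ℝ × ℝ := fun p => (projIcc a b hab p.1, projIcc c d hcd p.2) with hpr
  have hprc : Continuous pr := (continuous_subtype_val.comp (continuous_projIcc.comp continuous_fst)).prodMk
    (continuous_subtype_val.comp (continuous_projIcc.comp continuous_snd))
  have hprm : ∀ p, pr p ∈ Icc a b ×ˢ Icc c d := fun p => ⟨(projIcc a b hab p.1).2, (projIcc c d hcd p.2).2⟩
  have hpre : ∀ x ∈ Icc a b, ∀ y ∈ Icc c d, pr (x, y) = (x, y) := fun x hx y hy => by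
    simp only [hpr, projIcc_of_mem hab hx, projIcc_of_mem hcd hy]
  set g : ℝ × ℝ → ℂ := fun p => (X (pr p).1 (pr p).2 : ℂ) + (Y (pr p).1 (pr p).2 : ℂ) * Complex.I with hg
  have hgc : Continuous g := by
    have h1 := hX.comp_continuous hprc hprm
    have h2 := hY.comp_continuous hprc hprm
    exact (Complex.continuous_ofReal.comp h1).add ((Complex.continuous_ofReal.comp h2).mul continuous_const)
  have hre : ∀ p, (g p).re = X (pr p).1 (pr p).2 := fun p => by simp [hg]
  have him : ∀ p, (g p).im = Y (pr p).1 (pr p).2 := fun p => by simp [hg]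
  obtain ⟨L, hLc, hL⟩ := Complex.exists_continuousOn_eqOn_exp_comp (X := ℝ × ℝ) (U := univ)
    ((Homeomorph.Set.univ (ℝ × ℝ)).toHomotopyEquiv.simplyConnectedSpace_iff.2 inferInstance) isOpen_univ
    (g := g) hgc.continuousOn (by
      rintro ⟨p, -, hp⟩
      refine hne _ (hprm p).1 _ (hprm p).2 ⟨?_, ?_⟩
      · rw [← hre, hp]; rfl
      · rw [← him, hp]; rfl)
  have hLc : Continuous L := continuousOn_univ.1 hLc
  have hexp : ∀ p, Complex.exp (L p) = g p := fun p => hL (mem_univ p)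
  have hbI : b ∈ Icc a b := ⟨hab, le_rfl⟩
  have haI : a ∈ Icc a b := ⟨le_rfl, hab⟩
  have hdI : d ∈ Icc c d := ⟨hcd, le_rfl⟩
  have hcI : c ∈ Icc c d := ⟨le_rfl, hcd⟩
  set m := toIocDiv Real.two_pi_pos (-Real.pi) (L (b, d)).im with hm
  set h : ℝ → ℝ → ℝ := fun x y => (L (x, y)).im - m * (2 * Real.pi) with hh
  have hX' : ∀ x ∈ Icc a b, ∀ y ∈ Icc c d, ∃ ρ > 0, X x y = ρ * Real.cos (h x y) ∧ Y x y = ρ * Real.sin (h x y) := by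
    intro x hx y hy
    have h1 := hre (x, y)
    have h2 := him (x, y)
    rw [← hexp, hpre x hx y hy] at h1 h2
    refine ⟨_, Real.exp_pos (L (x, y)).re, ?_, ?_⟩
    · rw [← h1, Complex.exp_re, Real.cos_sub_int_mul_two_pi]
    · rw [← h2, Complex.exp_im, Real.sin_sub_int_mul_two_pi]
  have hhc : Continuous fun p : ℝ × ℝ => h p.1 p.2 := (Complex.continuous_im.comp hLc).sub continuous_const
  have hhx : ∀ y, Continuous fun x => h x y := fun y => hhc.comp (.prodMk_left y)
  have hhy : ∀ x, Continuous (h x) := fun x => hhc.comp (.prodMk_right x)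
  have hbd0 : h b d ∈ Ioc (-Real.pi) Real.pi := by
    have := sub_toIocDiv_zsmul_mem_Ioc Real.two_pi_pos (-Real.pi) (L (b, d)).im
    rw [zsmul_eq_mul] at this
    rwa [show -Real.pi + 2 * Real.pi = Real.pi by ring] at this
  have hcos : ∀ x ∈ Icc a b, ∀ y ∈ Icc c d, 0 < X x y → 0 < Real.cos (h x y) := by
    intro x hx y hy hpos
    obtain ⟨ρ, hρ, e1, -⟩ := hX' x hx y hy
    rw [e1] at hpos; exact pos_of_mul_pos_right hpos hρ.le
  have hbd : h b d ∈ Ioo (-(Real.pi / 2)) (Real.pi / 2) := by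
    have hc := hcos b hbI d hdI (hright d hdI)
    constructor
    · by_contra! hcon
      have := Real.cos_nonpos_of_pi_div_two_le_of_le (x := -h b d) (by linarith) (by linarith [hbd0.1])
      rw [Real.cos_neg] at this; linarith
    · by_contra! hcon
      have := Real.cos_nonpos_of_pi_div_two_le_of_le (x := h b d) hcon (by linarith [hbd0.2])
      linarith
  have hbc : h b c ∈ Ioo (-(Real.pi / 2)) (Real.pi / 2) := by
    refine mem_Ioo_of_avoid (hhy b).continuousOn hdI hcI (fun z hz => ?_) hbd
    have hc := hcos b hbI z hz (hright z hz)
    exact ⟨fun h0 => by simp [h0] at hc, fun h0 => by simp [h0] at hc⟩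
  have had : h a d ∈ Ioo (-Real.pi) (Real.pi / 2) := by
    refine mem_Ioo_of_avoid (φ := fun x => h x d) (hhx d).continuousOn hbI haI (fun z hz => ?_) ⟨by linarith [hbd.1], hbd.2⟩
    obtain ⟨ρ, hρ, e1, e2⟩ := hX' z hz d hdI
    constructor <;> exact fun h0 => htop z hz (by rw [e1, e2, h0]; simp [hρ.le])
  have hXa : ∀ y ∈ Icc c d, -(Real.pi / 2) < h a y → h a y < Real.pi / 2 → 0 < X a y := by
    intro y hy h1 h2
    obtain ⟨ρ, hρ, e1, -⟩ := hX' a haI y hy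
    exact e1.symm ▸ _root_.mul_pos hρ (Real.cos_pos_of_mem_Ioo ⟨h1, h2⟩)
  have had' : h a d ≤ -(Real.pi / 2) := not_lt.1 fun hcon => (hXa d hdI hcon had.2).not_ge hcorner
  have hac : h a c ≤ -(Real.pi / 2) := by
    by_contra! hcon
    obtain ⟨y, hy, heq, hlow⟩ := exists_first_le (hhy a).continuousOn hcon ⟨d, hdI, had'⟩
    obtain ⟨ρ, hρ, e1, e2⟩ := hX' a haI y (Ioc_subset_Icc_self hy)
    rw [heq, Real.cos_neg, Real.cos_pi_div_two, mul_zero] at e1; rw [heq, Real.sin_neg, Real.sin_pi_div_two] at e2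
    obtain ⟨z, hz1, hz2, hz3⟩ := ((hleft y hy e1 (by rw [e2]; linarith)).and ((eventually_mem_set.2
      (Ico_mem_nhdsLT hy.1)).and (((hhy a).tendsto y).mono_left nhdsWithin_le_nhds
      |>.eventually_lt_const (show h a y < Real.pi / 2 by rw [heq]; linarith)))).exists
    exact hz1.not_gt (hXa z ⟨hz2.1, hz2.2.le.trans hy.2⟩ (hlow z hz2) hz3)
  obtain ⟨x, hx, hxv⟩ := intermediate_value_Icc hab (hhx c).continuousOn (show -(Real.pi / 2) ∈ Icc _ _ from ⟨hac, hbc.1.le⟩)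
  obtain ⟨ρ, hρ, e1, e2⟩ := hX' x hx c hcI
  have hxv : h x c = -(Real.pi / 2) := hxv
  rw [hxv, Real.cos_neg, Real.cos_pi_div_two, mul_zero] at e1; rw [hxv, Real.sin_neg, Real.sin_pi_div_two] at e2
  exact ⟨x, hx, e1, by rw [e2]; linarith⟩

section aux
variable {n : ℕ} {f F u v θ : ℝ → ℝ} {C a b ℓ' ℓ bm bp : ℝ} {O : Set ℝ}

theorem Slab.energy_lt (S : Slab f F O ℓ' ℓ bm bp) (hn : 1 ≤ n)
    (h : IsTraj n f u v (Icc a b)) (ha : 0 < a) (hF : ∀ t ∈ Icc a b, HasDerivAt F (f (u t)) (u t))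
    (hm : ∀ t ∈ Icc a b, u t ∈ Ioo bm bp) {s t : ℝ} (hs : s ∈ Icc a b) (ht : t ∈ Icc a b) (hst : s < t)
    (hE : ℓ' < energy F u v s) : energy F u v t < energy F u v s := by
  have han := h.antitoneOn_energy ha hF
  refine lt_of_le_of_ne (han hs ht hst.le) fun heq => ?_
  have hsub : Icc s t ⊆ Icc a b := Icc_subset_Icc hs.1 ht.2
  obtain ⟨x, hx⟩ := exists_between hst
  have hxI := hsub (Ioo_subset_Icc_self hx)
  obtain ⟨k1, k2⟩ := (h.mono hsub).rest_of_energy_le hn (ha.trans_le hs.1) (fun y hy => hF y (hsub hy)) heq.ge x hx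
  have h2 := han hxI ht hx.2.le
  rw [heq, energy, energy, k1] at h2; rw [energy] at hE; linarith [S.crit _ (hm x hxI) k2]

theorem IsTraj.exists_ang (h : IsTraj n f u v (Icc a b)) (ha : 0 < a) (hab : a ≤ b)
    (hF : ∀ t ∈ Icc a b, HasDerivAt F (f (u t)) (u t)) (hfc : ContinuousOn (fun t => f (u t)) (Icc a b))
    (hal : ∀ t ∈ Icc a b, u t ≠ 0 ∨ v t ≠ 0) (C Θ : ℝ) :
    ∃ θ, AngTraj n f F C u v θ a b ∧ θ a ∈ Ico Θ (Θ + 2 * Real.pi) := by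
  obtain ⟨hcu, hcv⟩ := h.continuousOn
  have hk : ContinuousOn (fun t => kap C (u t)) (Icc a b) := (continuous_kap C).comp_continuousOn hcu
  have hω : ContinuousOn (angVel n f C u v) (Icc a b) := by
    unfold angVel
    refine ContinuousOn.div ?_ ((hk.pow 2).add (hcv.pow 2)) fun t ht => (sq_add_sq_pos_of (hal t ht)).ne'
    refine ContinuousOn.add (ContinuousOn.mul (by fun_prop) (hcv.pow 2)) (hk.mul (hfc.add ?_))
    exact continuousOn_const.mul (hcv.div continuousOn_id fun t ht => (ha.trans_le ht.1).ne')
  set ω := IccExtend hab ((Icc a b).domRestrict (angVel n f C u v)) with hωd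
  have hωc : Continuous ω := (continuousOn_iff_continuous_domRestrict.1 hω).Icc_extend'
  have hωe : ∀ t ∈ Icc a b, ω t = angVel n f C u v t := fun t ht => by rw [hωd, IccExtend_of_mem hab _ ht]; rfl
  set z : ℂ := ⟨kap C (u a), -v a⟩ with hz
  set θ₀ := toIcoMod Real.two_pi_pos Θ z.arg with hθ₀
  have hmod : θ₀ = z.arg - toIcoDiv Real.two_pi_pos Θ z.arg * (2 * Real.pi) := by rw [hθ₀, toIcoMod, zsmul_eq_mul]
  have hnorm : ‖z‖ = rho C u v a := by
    rw [Complex.norm_def, Complex.normSq_apply, rho, hz]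
    congr 1
    ring
  set θ : ℝ → ℝ := fun t => θ₀ + ∫ s in a..t, ω s with hθ
  have hθd : ∀ t, HasDerivAt θ (ω t) t := fun t => ((hωc.integral_hasStrictDerivAt a t).hasDerivAt).const_add θ₀
  have hθa : θ a = θ₀ := by simp [hθ]
  have hθc : Continuous θ := continuous_iff_continuousAt.2 fun t => (hθd t).continuousAt
  refine ⟨θ, ⟨ha, h, hF, fun t ht => ?_, fun t ht => ?_⟩, ?_⟩
  · rw [← hωe t ht]; exact (hθd t).hasDerivWithinAt
  · have hsub : Icc a t ⊆ Icc a b := Icc_subset_Icc_right ht.2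
    refine polar_of_hasDerivAt (n := n) (f := f) C ht.1 (hcu.mono hsub) (hcv.mono hsub) hθc.continuousOn
      (fun s hs => hal s (hsub hs)) (fun s hs => ?_) ?_ ?_
    · have hsI := hsub (Ioo_subset_Icc_self hs)
      have hnb : Icc a b ∈ 𝓝 s := Icc_mem_nhds hs.1 (hs.2.trans_le ht.2)
      refine ⟨(h s hsI).1.hasDerivAt hnb, (h s hsI).2.hasDerivAt hnb, ?_⟩
      rw [← hωe s hsI]; exact hθd s
    · rw [hθa, hmod, Real.cos_sub_int_mul_two_pi, ← hnorm, Complex.norm_mul_cos_arg]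
    · rw [hθa, hmod, Real.sin_sub_int_mul_two_pi, ← hnorm, Complex.norm_mul_sin_arg]; simp [hz]
  · rw [hθa]; exact toIcoMod_mem_Ico Real.two_pi_pos Θ z.arg

end aux

section family
variable {n : ℕ} {f F : ℝ → ℝ} {O I J K : Set ℝ} {u v : ℝ → ℝ → ℝ} {α a b T ℓ' ℓ bm bp : ℝ}

theorem Family.angTraj (H : Family n f F O I u v) (hα : α ∈ I) (C : ℝ) (ha : 0 < a)
    (hal : ∀ t ∈ Icc a b, u α t ≠ 0 ∨ v α t ≠ 0) :
    AngTraj n f F C (u α) (v α) (ang n f C (u α) (v α)) a b where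
  pos := ha
  traj := (H.reg α hα).traj.mono fun t ht => ha.trans_le ht.1
  hF t ht := H.hasDerivAt_F hα (ha.le.trans ht.1)
  ang t ht := ((H.reg α hα).hasDerivAt_ang (H.pos α hα) C (H.cont_f hα) (hal t ht) (ha.trans_le ht.1)).hasDerivWithinAt
  polar t ht := (H.reg α hα).polar (H.pos α hα) C (H.cont_f hα) (hal t ht) (ha.le.trans ht.1)

theorem Family.continuousOn_ang_prod (H : Family n f F O I u v) (hK : K ⊆ I) (C : ℝ) (hT : 0 ≤ T)
    (hal : ∀ α ∈ K, u α T ≠ 0 ∨ v α T ≠ 0) :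
    ContinuousOn (fun p : ℝ × ℝ => ang n f C (u p.1) (v p.1) p.2) (K ×ˢ Icc 0 T) := by
  rintro ⟨α, t⟩ ⟨hα, ht⟩; simp only at hα ht
  refine Metric.tendsto_nhds.2 fun ε hε => ?_
  have h1 := (H.reg α (hK hα)).continuousOn_ang (H.pos α (hK hα)) C (H.cont_f (hK hα)) (hal α hα) hT t ht
  have hfst : Tendsto (fun p : ℝ × ℝ => p.1) (𝓝[K ×ˢ Icc 0 T] (α, t)) (𝓝 α) := continuous_fst.continuousWithinAt
  have hsnd : Tendsto (fun p : ℝ × ℝ => p.2) (𝓝[K ×ˢ Icc 0 T] (α, t)) (𝓝[Icc 0 T] t) :=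
    tendsto_nhdsWithin_iff.2 ⟨continuous_snd.continuousWithinAt, by
      filter_upwards [self_mem_nhdsWithin] with p hp using hp.2⟩
  have h2 := Metric.tendsto_nhds.1 (h1.tendsto.comp hsnd) (ε / 2) (half_pos hε)
  filter_upwards [hfst.eventually (H.ang_close (hK hα) C hT (hal α hα) (half_pos hε)), h2,
    self_mem_nhdsWithin] with p hp1 hp2 hp3
  have h3 := hp1.2.2 p.2 hp3.2
  rw [← Real.dist_eq] at h3; simp only [Function.comp_apply] at hp2
  linarith [dist_triangle (ang n f C (u p.1) (v p.1) p.2) (ang n f C (u α) (v α) p.2) (ang n f C (u α) (v α) t)]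

theorem Family.exists_common_time (H : Family n f F O I u v) (hK : IsCompact K) (hKI : K ⊆ I) {e : ℝ}
    (hal : ∀ α ∈ K, ∀ t, 0 ≤ t → u α t ≠ 0 ∨ v α t ≠ 0)
    (hE : ∀ α ∈ K, ∃ t ≥ 1, energy F (u α) (v α) t < e) :
    ∃ b ≥ 1, ∀ α ∈ K, energy F (u α) (v α) b < e := by
  have : ∃ b ≥ (1 : ℝ), ∀ α ∈ K, α ∈ I → energy F (u α) (v α) b < e := by
    refine hK.induction_on (p := fun s => ∃ b ≥ (1 : ℝ), ∀ α ∈ s, α ∈ I → energy F (u α) (v α) b < e)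
      ⟨1, le_rfl, by simp⟩ (fun s t hst ⟨b, h1, h2⟩ => ⟨b, h1, fun α hα => h2 α (hst hα)⟩) ?_ ?_
    · rintro s t ⟨b, h1, h2⟩ ⟨b', h1', h2'⟩
      refine ⟨max b b', h1.trans (le_max_left _ _), ?_⟩
      rintro α (hα | hα) hI
      · exact (H.energy_le hI (by linarith) (le_max_left _ _)).trans_lt (h2 α hα hI)
      · exact (H.energy_le hI (by linarith) (le_max_right _ _)).trans_lt (h2' α hα hI)
    · intro α hα
      obtain ⟨t, ht, hEt⟩ := hE α hα
      have ht0 : (0 : ℝ) ≤ t := by linarith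
      have := (H.tendsto (hKI hα) ht0 fun s hs => hal α hα s hs.1).2.2.eventually_lt_const hEt
      exact ⟨_, mem_nhdsWithin_of_mem_nhds this, t, ht, fun a ha _ => ha⟩
  obtain ⟨b, h1, h2⟩ := this
  exact ⟨b, h1, fun α hα => h2 α hα (hKI hα)⟩

/-- In a good interval some solution drops below the bottom of the slab. -/
theorem Good.exists_low (H : Family n f F O I u v) (S : Slab f F O ℓ' ℓ bm bp) (hn : 1 ≤ n)
    (G : Good F I u v ℓ bm bp J) (hneg : ∃ s ∈ Ioo bm bp, F s < ℓ') :
    ∃ α ∈ J, ∃ t > 0, energy F (u α) (v α) t ≤ ℓ' := by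
  by_contra! hcon
  have hpi := Real.pi_pos
  have hal : ∀ α ∈ J, ∀ t, 0 ≤ t → u α t ≠ 0 ∨ v α t ≠ 0 := by
    intro α hα t ht
    rcases ht.eq_or_lt with rfl | ht
    · left; rw [(H.reg α (G.sub hα)).u_zero]; exact (H.pos α (G.sub hα)).ne'
    · by_contra! hc
      have := hcon α hα t ht
      rw [H.energy_of_dead hc.1 hc.2] at this; linarith [S.nn]
  have hanti : ∀ α ∈ J, AntitoneOn (energy F (u α) (v α)) (Ici 0) := fun α hα s hs t _ hst => H.energy_le (G.sub hα) hs hst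
  have hdec : ∀ e > ℓ', ∀ α ∈ J, ∃ t ≥ 1, energy F (u α) (v α) t < e := by
    intro e he α hα
    obtain ⟨t, ht, hEt, hm⟩ := G.under α hα
    obtain ⟨t', h1, h2⟩ := S.energy_decays H.nl hn (H.reg α (G.sub hα)).traj (H.mem_pos (G.sub hα)) ht hEt hm he
    exact ⟨max t' 1, le_max_right _ _, (H.energy_le (G.sub hα) (ht.le.trans h1) (le_max_left _ _)).trans_lt h2⟩
  have hmlt : ∀ α ∈ J, ∀ s t, 0 ≤ s → s < t → energy F (u α) (v α) t < energy F (u α) (v α) s :=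
    fun α hα s t hs hst => H.energy_lt hn (G.sub hα) hs hst (hal α hα s hs)
  have persist : ∀ α ∈ J, ∀ {k : ℕ} {t s : ℝ}, 0 ≤ t → t ≤ s →
      (k - 1 / 2) * Real.pi < ang n f 0 (u α) (v α) t → ∀ C, (k - 1) * Real.pi < ang n f C (u α) (v α) s := by
    intro α hα k t s ht hts h C
    have h1 := (H.reg α (G.sub hα)).ang_persist (H.pos α (G.sub hα)) 0 (H.cont_f (G.sub hα))
      (hal α hα s (ht.trans hts)) ht hts (k := (k : ℤ)) (by exact_mod_cast h)
    have h2 := (abs_lt.1 ((H.reg α (G.sub hα)).abs_ang_sub_ang_lt (H.pos α (G.sub hα)) C 0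
      (H.cont_f (G.sub hα)) (hal α hα s (ht.trans hts)) (ht.trans hts))).1
    push_cast at h1; linarith
  obtain ⟨e₁, he₁, he₁ℓ, hcross⟩ := S.exists_crossing H.nl hn hneg
  obtain ⟨a₀, ha₀J, ha₀⟩ := G.right 1 one_pos e₁ he₁ℓ
  obtain ⟨t₀, ht₀, hEt₀⟩ : ∃ t₀ > 1, energy F (u a₀) (v a₀) t₀ = e₁ := by
    obtain ⟨t, ht, hEt⟩ := hdec e₁ he₁ a₀ ha₀J
    obtain ⟨t₀, h1, h2⟩ := intermediate_value_Icc' ht ((H.continuousOn_energy (G.sub ha₀J)).mono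
      fun x hx => zero_le_one.trans hx.1) (show e₁ ∈ Icc _ _ from ⟨hEt.le, (ha₀ a₀ ha₀J le_rfl).le⟩)
    refine ⟨t₀, lt_of_le_of_ne h1.1 ?_, h2⟩
    rintro rfl; exact (ha₀ a₀ ha₀J le_rfl).ne' h2
  obtain ⟨K, hK2, hK⟩ := exists_nat_ang (ang n f 0 (u a₀) (v a₀) t₀ + 4 * Real.pi)
  replace hK := hK K le_rfl
  obtain ⟨T₂, hT₂, d₂, hd₂, hmany⟩ := H.many_of_high S hn he₁ he₁ℓ (k := K) (by omega)
  obtain ⟨p₂, hp₂J, hp₂⟩ := G.right T₂ hT₂ d₂ hd₂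
  have hIcc : ∀ p ∈ J, Icc a₀ p ⊆ J := fun p hp => G.conn.out ha₀J hp
  have hmax : ∀ p ∈ J, max a₀ p ∈ J := fun p hp => max_rec' (· ∈ J) ha₀J hp
  obtain ⟨b₁, hb₁, hEb₁⟩ := H.exists_common_time (isCompact_Icc (a := a₀) (b := p₂))
    ((hIcc p₂ hp₂J).trans G.sub) (e := e₁) (fun α hα => hal α (hIcc p₂ hp₂J hα))
    fun α hα => hdec e₁ he₁ α (hIcc p₂ hp₂J hα)
  obtain ⟨R', hR', hR'2, x, y, hx, hxm, hxE, hxE2⟩ := hcross b₁ (by linarith)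
  set R := 2 * b₁ with hR
  have hR'0 : 0 < R' := by linarith
  have hR0 : 0 < R := by linarith
  obtain ⟨p₃, hp₃J, hp₃⟩ := G.right R hR0 e₁ he₁ℓ
  obtain ⟨e, he, hee₁, heR⟩ : ∃ e, ℓ' < e ∧ e < e₁ ∧ ∀ α ∈ J, a₀ ≤ α → e < energy F (u α) (v α) R := by
    have hc : ContinuousOn (fun α => energy F (u α) (v α) R) (Icc a₀ (max a₀ p₃)) := fun α hα => by
      have hαJ : α ∈ J := hIcc _ (hmax p₃ hp₃J) hα
      exact (H.tendsto (G.sub hαJ) hR0.le fun s hs => hal α hαJ s hs.1).2.2.mono_left nhdsWithin_le_nhds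
    obtain ⟨m, hm, hmin⟩ := isCompact_Icc.exists_isMinOn (nonempty_Icc.2 (le_max_left a₀ p₃)) hc
    have hmJ : m ∈ J := hIcc _ (hmax p₃ hp₃J) hm
    obtain ⟨e, h1, h2⟩ := exists_between (lt_min he₁ (hcon m hmJ R hR0))
    refine ⟨e, h1, h2.trans_le (min_le_left _ _), fun α hα hαa => ?_⟩
    rcases le_total α p₃ with h | h
    · exact (h2.trans_le (min_le_right _ _)).trans_le (hmin ⟨hαa, h.trans (le_max_right _ _)⟩)
    · exact (h2.trans_le (min_le_left _ _)).trans (hp₃ α hα h)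
  obtain ⟨C, -, hray⟩ := S.exists_ray H.nl he
  have hxO : ∀ t ∈ Icc R' R, x t ∈ O := fun t ht => S.sub H.nl (Ioo_subset_Icc_self (hxm t ht))
  have hxF : ∀ t ∈ Icc R' R, HasDerivAt F (f (x t)) (x t) := fun t ht => H.nl.deriv _ (hxO t ht)
  have hxc : ContinuousOn (energy F x y) (Icc R' R) := fun t ht =>
    (hx.hasDerivWithinAt_energy ht (hxF t ht)).continuousWithinAt
  obtain ⟨T', hT'I, hT'E⟩ := intermediate_value_Icc' hR'2.le hxc
    (show e ∈ Icc _ _ from ⟨hxE2.trans he.le, by rw [hxE]; exact hee₁.le⟩)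
  have hsubT : Icc R' T' ⊆ Icc R' R := Icc_subset_Icc_right hT'I.2
  have hx' := hx.mono hsubT
  have hxanti := hx'.antitoneOn_energy hR'0 fun t ht => hxF t (hsubT ht)
  have hxe : ∀ t ∈ Icc R' T', e ≤ energy F x y t := fun t ht => by rw [← hT'E]; exact hxanti ht ⟨hT'I.1, le_rfl⟩ ht.2
  have hxal : ∀ t ∈ Icc R' T', x t ≠ 0 ∨ y t ≠ 0 := fun t ht => by
    by_contra! hc
    have := hxe t ht
    norm_num [energy, hc.1, hc.2, H.nl.F_zero] at this; linarith [S.nn]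
  obtain ⟨θ, A, hθ₀⟩ := hx'.exists_ang hR'0 hT'I.1 (fun t ht => hxF t (hsubT ht))
    (H.nl.cont.comp hx'.continuousOn.1 fun t ht => hxO t (hsubT ht)) hxal C (ang n f C (u a₀) (v a₀) t₀)
  have hθc : ContinuousOn θ (Icc R' T') := fun t ht => (A.ang t ht).continuousWithinAt
  obtain ⟨W, hW⟩ := isCompact_Icc.exists_bound_of_continuousOn hθc
  obtain ⟨K₂, hK₂2, hK₂⟩ := exists_nat_ang W
  replace hK₂ := hK₂ K₂ le_rfl
  obtain ⟨T₄, hT₄, d₄, hd₄, hmany₄⟩ := H.many_of_high S hn he₁ he₁ℓ (k := K₂) (by omega)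
  obtain ⟨p₄, hp₄J, hp₄⟩ := G.right T₄ hT₄ d₄ hd₄
  set a₂ := max a₀ p₄ with ha₂
  have ha₂J : a₂ ∈ J := hmax p₄ hp₄J
  have hP : Icc a₀ a₂ ⊆ J := hIcc a₂ ha₂J
  have hPI := hP.trans G.sub
  obtain ⟨b₂, hb₂, hEb₂⟩ := H.exists_common_time (isCompact_Icc (a := a₀) (b := a₂))
    hPI (e := e) (fun α hα => hal α (hP hα)) fun α hα => hdec e he α (hP hα)
  have h1sub : Icc 1 b₂ ⊆ Ici 0 := fun t ht => zero_le_one.trans ht.1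
  obtain ⟨r, hr, hrc⟩ := exists_levelTime (P := Icc a₀ a₂) (E := fun α => energy F (u α) (v α)) (lo := e) (hi := e₁) hb₂
    (fun t ht α hα => (H.tendsto (hPI hα) (h1sub ht) fun s hs => hal α (hP hα) s hs.1).2.2.mono_left nhdsWithin_le_nhds)
    (fun α hα => (H.continuousOn_energy (hPI hα)).mono h1sub)
    (fun α hα => (hanti α (hP hα)).mono h1sub)
    (fun α hα s hs t _ hst _ => hmlt α (hP hα) s t (h1sub hs) hst)
    (fun α hα => (ha₀ α (hP hα) hα.1).le) fun α hα => (hEb₂ α hα).le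
  obtain ⟨rx, hrx, hrxc⟩ := exists_levelTime (P := univ) (E := fun _ => energy F x y)
    (lo := e) (hi := e₁) hT'I.1 (fun t _ => continuousOn_const) (fun _ _ => hxc.mono hsubT)
    (fun _ _ => hxanti)
    (fun _ _ s hs t ht hst hE => S.energy_lt hn hx' hR'0 (fun t ht => hxF t (hsubT ht))
      (fun t ht => hxm t (hsubT ht)) hs ht hst (he.trans_le hE))
    (fun _ _ => hxE.ge) fun _ _ => hT'E.le
  replace hrx := fun s hs => hrx 0 (mem_univ _) s hs
  set q := rx 0 with hq
  have hqc : ContinuousOn q (Icc e e₁) := by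
    have : ContinuousOn (fun s : ℝ => ((0 : ℝ), s)) (Icc e e₁) := by fun_prop
    exact hrxc.comp this fun s hs => ⟨mem_univ _, hs⟩
  have hqp : ContinuousOn (fun p : ℝ × ℝ => q p.2) (Icc a₀ a₂ ×ˢ Icc e e₁) := hqc.comp continuousOn_snd fun p hp => hp.2
  have hangc : ContinuousOn (fun p : ℝ × ℝ => ang n f C (u p.1) (v p.1) (r p.1 p.2)) (Icc a₀ a₂ ×ˢ Icc e e₁) := by
    have := H.continuousOn_ang_prod (K := Icc a₀ a₂) hPI C (T := b₂) (by linarith) fun α hα => hal α (hP hα) b₂ (by linarith)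
    refine this.comp (continuousOn_fst.prodMk hrc) fun p hp => ⟨hp.1, ?_⟩
    have := (hr p.1 hp.1 p.2 hp.2).1
    exact ⟨h1sub this, this.2⟩
  have hlet : e ≤ e₁ := hee₁.le
  have huE : ∀ α ∈ J, ∀ t, 0 < t → energy F (u α) (v α) t < ℓ → u α t ∈ Ioo bm bp := fun α hα t ht h =>
    (G.under α hα).mem H S (G.sub hα) ht h
  have hI₁ : e₁ ∈ Icc e e₁ := ⟨hlet, le_rfl⟩
  have hqR : q e₁ = R' := by
    obtain ⟨g3, g4⟩ := hrx e₁ hI₁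
    by_contra hne
    exact (S.energy_lt hn hx' hR'0 (fun t ht => hxF t (hsubT ht)) (fun t ht => hxm t (hsubT ht)) ⟨le_rfl, hT'I.1⟩ g3
      (lt_of_le_of_ne g3.1 (Ne.symm hne)) (hxE ▸ he₁)).ne (g4.trans hxE.symm)
  have hstate : ∀ α ∈ Icc a₀ a₂, ∀ s ∈ Icc e e₁, ang n f C (u α) (v α) (r α s) - θ (q s) = 0 →
      u α (r α s) = x (q s) ∧ v α (r α s) = y (q s) := by
    intro α hα s hs h0
    obtain ⟨g1, g2⟩ := hr α hα s hs
    obtain ⟨g3, g4⟩ := hrx s hs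
    have hr0 : 0 < r α s := one_pos.trans_le g1.1
    obtain ⟨k1, k2⟩ := (H.reg α (hPI hα)).polar (H.pos α (hPI hα)) C (H.cont_f (hPI hα)) (hal α (hP hα) _ hr0.le) hr0.le
    obtain ⟨k3, k4⟩ := A.polar _ g3
    have hang : ang n f C (u α) (v α) (r α s) = θ (q s) := sub_eq_zero.1 h0
    rw [hang] at k1 k2
    exact S.ray_unique H.nl hray hs.1 (huE α (hP hα) _ hr0 (by rw [g2]; exact hs.2.trans_lt he₁ℓ))
      (hxm _ (hsubT g3)) (Real.sqrt_pos.2 (sq_add_sq_pos_of (hal α (hP hα) _ hr0.le))) (Real.sqrt_pos.2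
        (sq_add_sq_pos_of (hxal _ g3))) k1 k3 k2 k4 g2 g4
  obtain ⟨α, hα, hX, hY⟩ := exists_zero_below (X := fun α s => ang n f C (u α) (v α) (r α s) - θ (q s))
    (Y := fun α s => r α s - q s) (le_max_left a₀ p₄) hlet
    (hangc.sub (hθc.comp hqp fun p hp => (hrx p.2 hp.2).1)) (hrc.sub hqp)
    (fun α hα s hs ⟨h1, h2⟩ => by
      obtain ⟨k1, k2⟩ := hstate α hα s hs h1
      obtain ⟨g3, -⟩ := hrx s hs
      have h2 : r α s = q s := sub_eq_zero.1 h2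
      rw [h2] at k1 k2
      have hq0 : 0 < q s := hR'0.trans_le g3.1
      have hqR := (hsubT g3).2
      have RS := H.reg α (hPI hα)
      have := uniq_forward H.nl hq0.le (RS.traj.mono fun t ht => hq0.trans ht.1)
        (hx.mono (Ioo_subset_Icc_self.trans (Icc_subset_Icc_left g3.1))) (RS.cont_u.mono fun t ht => hq0.le.trans ht.1)
        (RS.cont_v.mono fun t ht => hq0.le.trans ht.1) (hx.mono (Icc_subset_Icc_left g3.1)).continuousOn.1
        (hx.mono (Icc_subset_Icc_left g3.1)).continuousOn.2 (fun t ht => H.mem_pos (hPI hα) t (hq0.trans_le ht.1))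
        (fun t ht => hxO t ⟨g3.1.trans ht.1, ht.2⟩) k1 k2 (fun t ht => (hal α (hP hα) t (hq0.le.trans ht.1)).imp_right
          fun h => ⟨hq0.trans_le ht.1, h⟩)
        R ⟨hqR, le_rfl⟩
      have h3 := hcon α (hP hα) R hR0
      rw [energy, this.1, this.2] at h3
      exact hxE2.not_gt h3)
    (fun α hα ⟨h1, h2⟩ => by
      have h1 : ang n f C (u α) (v α) (r α e₁) ≤ θ (q e₁) := by linarith
      obtain ⟨g1, g2⟩ := hr α hα e₁ hI₁
      have hr0 : 0 ≤ r α e₁ := h1sub g1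
      rcases le_total α p₂ with h | h
      · have h3 := hEb₁ α ⟨hα.1, h⟩
        linarith [(hanti α (hP hα)).reflect_lt (mem_Ici.2 (by linarith)) hr0 (h3.trans_eq g2.symm)]
      · obtain ⟨-, t, ht, -, hEt, hat⟩ := hmany α (hPI hα) (G.under α (hP hα)) (hp₂ α (hP hα) h)
        have htr := (hanti α (hP hα)).reflect_lt hr0 ht.le (g2.trans_lt hEt)
        have h3 := persist α (hP hα) ht.le htr.le hat C
        have h4 := (abs_lt.1 ((H.reg a₀ (G.sub ha₀J)).abs_ang_sub_ang_lt (H.pos a₀ (G.sub ha₀J)) C 0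
          (H.cont_f (G.sub ha₀J)) (hal a₀ ha₀J t₀ (by linarith)) (by linarith))).2
        rw [hqR] at h1
        linarith [hθ₀.2])
    (fun s hs => by
      obtain ⟨g1, g2⟩ := hr a₂ ⟨le_max_left _ _, le_rfl⟩ s hs
      obtain ⟨g3, g4⟩ := hrx s hs
      obtain ⟨-, t, ht, -, hEt, hat⟩ := hmany₄ a₂ (G.sub ha₂J) (G.under a₂ ha₂J) (hp₄ a₂ ha₂J (le_max_right _ _))
      have htr := (hanti a₂ ha₂J).reflect_lt (h1sub g1) ht.le (g2.trans_lt (hs.2.trans_lt hEt))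
      have h3 := persist a₂ ha₂J ht.le htr.le hat C
      have h4 := (le_abs_self _).trans (hW _ g3)
      linarith)
    (by
      obtain ⟨g1, g2⟩ := hr a₀ ⟨le_rfl, le_max_left _ _⟩ e₁ hI₁
      have h1 : r a₀ e₁ = t₀ := by
        rcases lt_trichotomy (r a₀ e₁) t₀ with h | h | h
        · linarith [hmlt a₀ ha₀J _ _ (h1sub g1) h]
        · exact h
        · linarith [hmlt a₀ ha₀J _ _ (by linarith) h]
      rw [h1, hqR]
      linarith [hθ₀.1])
    (fun s hs h1 h2 => by
      have hsI := Ioc_subset_Icc_self hs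
      have haI : a₀ ∈ Icc a₀ a₂ := ⟨le_rfl, le_max_left _ _⟩
      obtain ⟨k1, k2⟩ := hstate a₀ haI s hsI h1
      obtain ⟨g1, g2⟩ := hr a₀ haI s hsI
      have hr0 : 0 < r a₀ s := one_pos.trans_le g1.1
      have A₀ := H.angTraj (G.sub ha₀J) C one_pos (b := b₂) fun t ht => hal a₀ ha₀J t (h1sub ht)
      have hrs : ContinuousOn (r a₀) (Icc e e₁) := by
        have : ContinuousOn (fun s : ℝ => (a₀, s)) (Icc e e₁) := by fun_prop
        exact hrc.comp this fun s hs => ⟨haI, hs⟩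
      have := A₀.compare A hn hs (hrs s hsI) (hqc s hsI) (fun z hz => hr a₀ haI z hz) hrx
        ((hanti a₀ ha₀J).mono h1sub) hxanti rfl rfl (by linarith) k1 k2 (by linarith)
        (hray _ (huE a₀ ha₀J _ hr0 (by rw [g2]; exact hs.2.trans_lt he₁ℓ)) _ (hs.1.le.trans g2.ge))
      filter_upwards [this] with z hz
      linarith)
  have hI : e ∈ Icc e e₁ := ⟨le_rfl, hlet⟩
  obtain ⟨g1, g2⟩ := hr α hα e hI
  obtain ⟨g3, g4⟩ := hrx e hI
  have h1 := heR α (hP hα) hα.1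
  have hrR : r α e ≤ R := by linarith [(hsubT g3).2]
  have h2 := hanti α (hP hα) (mem_Ici.2 (h1sub g1)) (mem_Ici.2 hR0.le) hrR
  rw [g2] at h2; linarith

end family

section notch
variable {n : ℕ} {f F u v : ℝ → ℝ} {O : Set ℝ} {δ ω c T R a b s : ℝ}

/-- The interval to the right of a degenerate maximum point `δ` of `F`, at which `F` vanishes. -/
structure Notch (f F : ℝ → ℝ) (O : Set ℝ) (δ ω : ℝ) : Prop where
  pos : 0 < δ
  width : 0 < ω
  sub : Icc 0 (δ + ω) ⊆ O
  F_zero : F δ = 0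
  F_neg : ∀ s ∈ Ioo 0 δ, F s < 0
  f_pos : ∀ s ∈ Ioc δ (δ + ω), 0 < f s

theorem Notch.mono (N : Notch f F O δ ω) (H : Nonlin f F O) : StrictMonoOn F (Icc δ (δ + ω)) := by
  have hs : Icc δ (δ + ω) ⊆ O := (Icc_subset_Icc_left N.pos.le).trans N.sub
  exact strictMonoOn_Icc (fun x hx => (H.deriv x (hs hx)).continuousAt.continuousWithinAt) fun x hx =>
    ⟨_, H.deriv x (hs (Ioo_subset_Icc_self hx)), N.f_pos x ⟨hx.1, hx.2.le⟩⟩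

/-- `R` is the first time after `T` at which the trajectory leaves the notch downwards. -/
structure Bump (F : ℝ → ℝ) (δ ω c : ℝ) (u v : ℝ → ℝ) (T R : ℝ) : Prop where
  pos : 0 < T
  lt : T < R
  u_eq : u R = δ
  v_neg : v R < 0
  above : ∀ t ∈ Ico T R, 0 < max (u t - δ) (v t)
  mem : ∀ t ∈ Icc T R, u t ∈ Ioo 0 (δ + ω)
  energy : c / R ≤ energy F u v R

theorem Notch.exists_drop (N : Notch f F O δ ω) (H : Nonlin f F O) (hn : 1 ≤ n) :
    ∃ c > 0, ∃ T₀ > 0, ∀ u v, IsTraj n f u v (Ioi 0) → ∀ R ≥ T₀, ∀ z > R, 2 * δ / 3 < u R → u R ≤ δ → u z = 0 →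
      (∀ t ∈ Icc R z, v t < 0 ∧ 0 ≤ u t ∧ u t ≤ δ) → 0 < energy F u v z → c / R ≤ energy F u v R := by
  have hδ := N.pos
  have hO : Icc 0 δ ⊆ O := (Icc_subset_Icc_right (by linarith [N.width])).trans N.sub
  obtain ⟨w, hw, hwm⟩ := isCompact_Icc.exists_isMaxOn (nonempty_Icc.2 (by linarith : δ / 3 ≤ 2 * δ / 3))
    (f := F) fun x hx => (H.deriv x (hO ⟨by linarith [hx.1], by linarith [hx.2]⟩)).continuousAt.continuousWithinAt
  set m := -F w with hm
  have hm0 : 0 < m := neg_pos.2 (N.F_neg w ⟨by linarith [hw.1], by linarith [hw.2]⟩)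
  have hFm : ∀ s ∈ Icc (δ / 3) (2 * δ / 3), F s ≤ -m := fun s hs => by rw [hm, neg_neg]; exact hwm hs
  set c := (n : ℝ) * √(2 * m) * (δ / 3) with hc
  have hn0 : (0 : ℝ) < n := by exact_mod_cast hn
  have hc0 : 0 < c := by positivity
  refine ⟨c / 2, by positivity, c / m + 2 * δ ^ 2 / c, by positivity, fun u v h R hR z hz h1 h2 h3 hI hE => ?_⟩
  have hR1 : c / m ≤ R := le_trans (le_add_of_nonneg_right (by positivity)) hR
  have hR2 : 2 * δ ^ 2 / c ≤ R := le_trans (le_add_of_nonneg_left (by positivity)) hR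
  have hR0 : 0 < R := lt_of_lt_of_le (by positivity) hR1
  have hd := fun t (ht : R ≤ t) => h.hasDerivAt (hR0.trans_le ht)
  have hcu : ContinuousOn u (Icc R z) := fun t ht => (hd t ht.1).1.continuousAt.continuousWithinAt
  have hF : ∀ t ∈ Icc R z, HasDerivAt F (f (u t)) (u t) := fun t ht => H.deriv _ (hO (hI t ht).2)
  have hanti := h.antitone_energy hR0 hF
  have hmono : AntitoneOn u (Icc R z) := antiOn_Icc hcu fun t ht =>
    ⟨_, (hd t ht.1.le).1, (hI t (Ioo_subset_Icc_self ht)).1.le⟩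
  obtain ⟨p, hp, hup⟩ := intermediate_value_Icc' hz.le hcu (show 2 * δ / 3 ∈ Icc _ _ by rw [h3]; exact ⟨by linarith, h1.le⟩)
  obtain ⟨q, hq, huq⟩ := intermediate_value_Icc' hz.le hcu (show δ / 3 ∈ Icc _ _ by rw [h3]; exact ⟨by linarith, by linarith⟩)
  have hpq : p < q := by
    by_contra! hcon
    have := hmono hq hp hcon
    linarith
  have hpos : ∀ t ∈ Icc R z, 0 < energy F u v t := fun t ht => hE.trans_le (hanti ht ⟨hz.le, le_rfl⟩ ht.2)
  have hq0 : 0 < q := hR0.trans_le hq.1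
  have hpz : Icc p q ⊆ Icc R z := Icc_subset_Icc hp.1 hq.2
  have hfast : ∀ t ∈ Icc p q, √(2 * m) ≤ -v t := by
    intro t ht
    have a1 := hmono hp (hpz ht) ht.1
    have a2 := hmono (hpz ht) hq ht.2
    have a3 := hFm (u t) ⟨by linarith, by linarith⟩
    have a4 := hpos t (hpz ht)
    rw [energy] at a4; rw [← Real.sqrt_sq (neg_pos.2 (hI t (hpz ht)).1).le]
    exact Real.sqrt_le_sqrt (by linarith [neg_sq (v t)])
  have hdrop := le_drop (F := fun s => F (-s)) h.neg (hR0.trans_le hp.1) hpq.le (fun t ht => H.neg.deriv _ (by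
    simpa using hO (hI t (hpz ht)).2)) (Real.sqrt_nonneg _) hfast
  rw [energy_neg, hup, huq] at hdrop
  have hEp : c / q ≤ energy F u v p := by
    have e : (n : ℝ) * √(2 * m) / q * (-(δ / 3) - -(2 * δ / 3)) = c / q := by rw [hc]; ring
    linarith [hpos q hq]
  have hRq : R < q := hp.1.trans_lt hpq
  have hspeed : ∀ t ∈ Ioo R q, ∃ d, HasDerivAt u d t ∧ 2 * c / q ≤ d ^ 2 := fun t ht => by
    have htI : t ∈ Icc R z := ⟨ht.1.le, ht.2.le.trans hq.2⟩
    refine ⟨_, (hd t ht.1.le).1, ?_⟩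
    rw [mul_div_assoc]
    rcases le_total t p with htp | htp
    · have a1 := hanti htI hp htp
      have a2 : F (u t) ≤ 0 := by
        rcases (hI t htI).2.2.eq_or_lt with e | e
        · rw [e, N.F_zero]
        · have := hmono htI hp htp
          exact (N.F_neg _ ⟨by linarith, e⟩).le
      have a3 : energy F u v t = v t ^ 2 / 2 + F (u t) := rfl
      linarith
    · have a1 := pow_le_pow_left₀ (Real.sqrt_nonneg _) (hfast t ⟨htp, ht.2.le⟩) 2
      rw [neg_sq, Real.sq_sqrt (by positivity)] at a1
      have : c / q ≤ m := by rw [div_le_iff₀ hq0]; rw [div_le_iff₀ hm0] at hR1; nlinarith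
      linarith
  have hq2 : q ≤ 2 * R := by
    by_contra! hcon
    have a4 := slope_sq_le hRq (hcu.mono (Icc_subset_Icc_right hq.2)) hspeed (w := δ)
      (by rw [abs_le, huq]; constructor <;> linarith) (L := q / 2) (by linarith) (by linarith)
    have e : 2 * c / q * (q / 2) ^ 2 = c * q / 2 := by field_simp
    rw [e] at a4; rw [div_le_iff₀ hc0] at hR2; nlinarith
  have a1 := hanti (left_mem_Icc.2 hz.le) hp hp.1
  have a2 : c / 2 / R ≤ c / q := by rw [div_div]; exact div_le_div_of_nonneg_left hc0.le hq0 hq2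
  linarith

theorem Notch.exists_bump (N : Notch f F O δ ω) (H : Nonlin f F O) (hn : 1 ≤ n) :
    ∃ c > 0, ∃ η > 0, ∃ T₀ > 0, ∀ u v, IsTraj n f u v (Ioi 0) → ∀ T ≥ T₀, |u T - δ| < η →
      energy F u v T < η / T → (∀ t, 0 < t → u t ∈ O) → (∃ z > T, u z = 0 ∧ v z ≠ 0) →
      ∃ R, Bump F δ ω c u v T R := by
  obtain ⟨c, hc, T₀, hT₀, key⟩ := N.exists_drop H hn
  have hδ := N.pos
  have hω := N.width
  have hFω : 0 < F (δ + ω) := by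
    have := N.mono H (left_mem_Icc.2 (by linarith)) (right_mem_Icc.2 (by linarith)) (lt_add_of_pos_right δ hω)
    rwa [N.F_zero] at this
  refine ⟨c, hc, min (min (δ / 3) ω) (min c (F (δ + ω))), by positivity, T₀ + 1, by positivity,
    fun u v h T hT hu hE hO ⟨z₀, hz₀, hu₀, hv₀⟩ => ?_⟩
  have hT0 : 0 < T := by linarith
  have hd := fun t (ht : T ≤ t) => h.hasDerivAt (hT0.trans_le ht)
  have hcu : ∀ b, ContinuousOn u (Icc T b) := fun b t ht => (hd t ht.1).1.continuousAt.continuousWithinAt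
  have hcv : ∀ b, ContinuousOn v (Icc T b) := fun b t ht => (hd t ht.1).2.continuousAt.continuousWithinAt
  have hanti : ∀ s t, T ≤ s → s ≤ t → energy F u v t ≤ energy F u v s := fun s t hs hst =>
    h.antitone_energy (hT0.trans_le hs) (fun x hx => H.deriv _ (hO x (hT0.trans_le (hs.trans hx.1))))
      (left_mem_Icc.2 hst) (right_mem_Icc.2 hst) hst
  obtain ⟨b1, b2⟩ := abs_lt.1 (hu.trans_le (min_le_left _ _))
  have b3 : -(δ / 3) < u T - δ := by linarith [min_le_left (δ / 3) ω]
  have b4 : u T < δ + ω := by linarith [min_le_right (δ / 3) ω]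
  have hE' : energy F u v T < F (δ + ω) := by
    refine hE.trans_le ((div_le_self (by positivity) (by linarith)).trans ((min_le_right _ _).trans (min_le_right _ _)))
  have hEc : energy F u v T < c / T :=
    hE.trans_le (div_le_div_of_nonneg_right ((min_le_right _ _).trans (min_le_left _ _)) hT0.le)
  obtain ⟨z, ⟨hz, hzz⟩, huz, hup⟩ := exists_first_le (hcu z₀) (by linarith) ⟨z₀, ⟨hz₀.le, le_rfl⟩, hu₀.le⟩
  have hTz := hz
  have hzI : z ∈ Icc T z := ⟨hz.le, le_rfl⟩
  have hEp : ∀ t ∈ Icc T z, 0 < energy F u v t := by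
    intro t ht
    refine lt_of_lt_of_le ?_ (hanti t z₀ ht.1 (ht.2.trans hzz))
    rw [energy, hu₀, H.F_zero, add_zero]; positivity
  have hvz : v z < 0 := by
    have h1 : 0 ≤ -v z := deriv_nonneg_of_le_left (hd z hz.le).1.neg (by
      filter_upwards [Ico_mem_nhdsLT hTz] with t ht
      simp only [Pi.neg_apply, huz]
      linarith [hup t ht])
    have h2 := hEp z hzI
    rw [energy, huz, H.F_zero, add_zero] at h2
    refine lt_of_le_of_ne (by linarith) fun e => ?_
    rw [e] at h2; norm_num at h2
  have hvne : ∀ t ∈ Icc T z, u t ≤ δ → v t ≠ 0 := by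
    intro t ht hut e
    have h2 := hEp t ht
    rw [energy, e] at h2; norm_num at h2
    rcases hut.eq_or_lt with e | e
    · rw [e, N.F_zero] at h2; exact lt_irrefl _ h2
    · rcases ht.2.eq_or_lt with e' | e'
      · rw [e', huz, H.F_zero] at h2; exact lt_irrefl _ h2
      · exact lt_asymm h2 (N.F_neg _ ⟨hup t ⟨ht.1, e'⟩, e⟩)
  obtain ⟨R, ⟨hR, huR, hvR⟩, hRl⟩ := (isCompact_Icc.of_isClosed_subset (t := {t ∈ Icc T z | u t ≤ δ ∧ v t ≤ 0}) (by
      have := ((hcu z).preimage_isClosed_of_isClosed isClosed_Icc (isClosed_Iic (a := δ))).inter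
        ((hcv z).preimage_isClosed_of_isClosed isClosed_Icc (isClosed_Iic (a := (0 : ℝ))))
      convert this using 1
      ext t; simp; tauto) (sep_subset _ _)).exists_isLeast ⟨z, hzI, by rw [huz]; exact hδ.le, hvz.le⟩
  have habove : ∀ t ∈ Ico T R, 0 < max (u t - δ) (v t) := by
    intro t ht
    by_contra! hcon
    obtain ⟨k1, k2⟩ := max_le_iff.1 hcon
    exact (hRl ⟨⟨ht.1, ht.2.le.trans hR.2⟩, by linarith, k2⟩).not_gt ht.2
  have hvR' : v R < 0 := lt_of_le_of_ne hvR (hvne R hR huR)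
  have hleft : T < R → ¬ u R < δ := fun hTR hlt => by
    have hl := ((hd R hR.1).1.continuousAt.tendsto.eventually_lt_const hlt).and
      ((hd R hR.1).2.continuousAt.tendsto.eventually_lt_const hvR')
    obtain ⟨t, ⟨k1, k2⟩, k3⟩ := ((hl.filter_mono nhdsWithin_le_nhds).and (Ico_mem_nhdsLT hTR)).exists
    have := lt_max_iff.1 (habove t k3)
    rcases this with h | h <;> linarith
  have hRz : R < z := by
    refine lt_of_le_of_ne hR.2 ?_
    rintro rfl
    exact hleft hTz (by linarith)
  have hfall : ∀ t ∈ Icc R z, v t < 0 ∧ 0 ≤ u t ∧ u t ≤ δ := by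
    have hv0 : ∀ t ∈ Icc R z, v t ≤ 0 := by
      by_contra! hcon
      obtain ⟨t, ht, hvt⟩ := hcon
      obtain ⟨x, hx, hvx, hlt⟩ := exists_first_ge ((hcv t).mono (Icc_subset_Icc_left hR.1)) hvR' ⟨t, ⟨ht.1, le_rfl⟩, hvt.le⟩
      have := antiOn_Icc ((hcu x).mono (Icc_subset_Icc_left hR.1)) fun t ht =>
        ⟨_, (hd t (hR.1.trans ht.1.le)).1, (hlt t ⟨ht.1.le, ht.2⟩).le⟩
      exact hvne x ⟨hR.1.trans hx.1.le, hx.2.trans ht.2⟩ ((this (left_mem_Icc.2 hx.1.le) (right_mem_Icc.2 hx.1.le)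
        hx.1.le).trans huR) hvx
    intro t ht
    have hut : u t ≤ δ := by
      have := antiOn_Icc ((hcu z).mono (Icc_subset_Icc_left hR.1)) fun t ht =>
        ⟨_, (hd t (hR.1.trans ht.1.le)).1, hv0 t (Ioo_subset_Icc_self ht)⟩
      exact (this (left_mem_Icc.2 hRz.le) ht ht.1).trans huR
    have htz : t ∈ Icc T z := ⟨hR.1.trans ht.1, ht.2⟩
    refine ⟨lt_of_le_of_ne (hv0 t ht) (hvne t htz hut), ?_, hut⟩
    rcases ht.2.eq_or_lt with e | e
    · rw [e, huz]
    · exact (hup t ⟨htz.1, e⟩).le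
  have hTR : T < R := by
    refine lt_of_le_of_ne hR.1 ?_
    rintro rfl
    exact (key u v h T (by linarith) z hTz (by linarith) huR huz hfall (hEp z hzI)).not_gt hEc
  have huRδ : u R = δ := le_antisymm huR (not_lt.1 (hleft hTR))
  refine ⟨R, hT0, hTR, huRδ, hvR', habove, fun t ht => ⟨hup t ⟨ht.1, ht.2.trans_lt hRz⟩, ?_⟩,
    key u v h R (by linarith) z hRz (by linarith) huR huz hfall (hEp z hzI)⟩
  by_contra! hcon
  obtain ⟨x, hx, hxe⟩ := intermediate_value_Icc ht.1 (hcu t) (show δ + ω ∈ Icc _ _ from ⟨b4.le, hcon⟩)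
  have h1 := F_le_energy F u v x
  have h2 := hanti T x le_rfl hx.1
  rw [hxe] at h1; linarith

end notch

section notch
variable {n : ℕ} {f F u v : ℝ → ℝ} {O : Set ℝ} {δ ω c T R a b s : ℝ}

theorem Bump.above_of_above (B : Bump F δ ω c u v T R) (h : IsTraj n f u v (Ioi 0)) {t : ℝ} (ht : T ≤ t)
    (hst : t ≤ s) (hs : s < R) (hu : δ < u t) : δ < u s := by
  by_contra! hcon
  have hd := fun x (hx : t ≤ x) => (h.hasDerivAt (B.pos.trans_le (ht.trans hx))).1
  obtain ⟨x, hx, hux, hlt⟩ := exists_first_le (fun x hx => (hd x hx.1).continuousAt.continuousWithinAt) hu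
    ⟨s, ⟨hst, le_rfl⟩, hcon⟩
  have hv : 0 ≤ -v x := deriv_nonneg_of_le_left (hd x hx.1.le).neg (by
    filter_upwards [Ico_mem_nhdsLT hx.1] with y hy using neg_le_neg (hux ▸ (hlt y hy).le))
  rcases lt_max_iff.1 (B.above x ⟨ht.trans hx.1.le, hx.2.trans_lt hs⟩) with h | h <;> linarith

theorem Notch.half (N : Notch f F O δ ω) (H : Nonlin f F O) (n : ℕ) (hc : 0 < c) :
    ∃ R₀, ∀ u v T R, IsTraj n f u v (Ioi 0) → Bump F δ ω c u v T R → R₀ ≤ R → 4 * T < R →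
      δ < u (R / 2) ∧ ∀ w₀ ∈ Ioc 0 ω, u (R / 2) ≤ δ + w₀ → ¬ ∀ w ∈ Icc 0 w₀, F (δ + w) -
        F (δ + w₀) / (2 * w₀) * w ≤ F (u (R / 2)) - F (δ + w₀) / (2 * w₀) * (u (R / 2) - δ) := by
  have hδ := N.pos
  have hω := N.width
  refine ⟨1024 * 4 ^ n * (δ + ω) ^ 2 / c, fun u v T R h B hR hTR => ?_⟩
  have hT := B.pos
  have hR0 : 0 < R := hT.trans B.lt
  have h4 : (1 : ℝ) ≤ 4 ^ n := one_le_pow₀ (by norm_num)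
  rw [div_le_iff₀ hc] at hR
  have hRc : 1024 * (δ + ω) ^ 2 ≤ R * c := le_trans (by nlinarith [sq_nonneg (δ + ω)]) hR
  have hd := fun t (ht : T ≤ t) => h.hasDerivAt (hT.trans_le ht)
  have hcu : ContinuousOn u (Icc T R) := fun t ht => (hd t ht.1).1.continuousAt.continuousWithinAt
  have hO : ∀ t ∈ Icc T R, u t ∈ O := fun t ht => N.sub ⟨(B.mem t ht).1.le, (B.mem t ht).2.le⟩
  have hE : ∀ t ∈ Icc T R, c / R ≤ energy F u v t := fun t ht => B.energy.trans
    (h.antitone_energy hT (fun x hx => H.deriv _ (hO x hx)) ht (right_mem_Icc.2 B.lt.le) ht.2)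
  have hv2 : ∀ t, v t ^ 2 / 2 = energy F u v t - F (u t) := fun t => by simp [energy]
  have short : ∀ b ∈ Ioc T (R / 2), u b ≤ δ → b - T ≤ R / 8 := by
    intro b hb hub
    by_contra! hcon
    have hbR : b < R := by linarith [hb.2]
    have h3 := slope_sq_le (m := 2 * (c / R)) (w := δ + ω) hb.1 (hcu.mono (Icc_subset_Icc_right hbR.le)) (fun t ht => by
      have htI : t ∈ Icc T R := ⟨ht.1.le, (ht.2.trans hbR).le⟩
      refine ⟨_, (hd t ht.1.le).1, ?_⟩
      have a1 : F (u t) ≤ 0 := by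
        have : u t ≤ δ := by
          by_contra! hcc
          exact hub.not_gt (B.above_of_above h ht.1.le ht.2.le hbR hcc)
        rcases this.eq_or_lt with e | e
        · rw [e, N.F_zero]
        · exact (N.F_neg _ ⟨(B.mem t htI).1, e⟩).le
      linarith [hv2 t, hE t htI]) (by
        have k1 := B.mem b ⟨hb.1.le, hbR.le⟩
        have k2 := B.mem T ⟨le_rfl, B.lt.le⟩
        rw [abs_le]
        constructor <;> linarith [k1.1, k1.2, k2.1, k2.2]) (by positivity) hcon.le
    have e : 2 * (c / R) * (R / 8) ^ 2 = R * c / 32 := by field_simp; norm_num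
    nlinarith
  have hy : δ < u (R / 2) := by
    by_contra! hcon
    linarith [short (R / 2) ⟨by linarith, le_rfl⟩ hcon]
  refine ⟨hy, fun w₀ hw₀ hle hmax => ?_⟩
  set y := u (R / 2) with hyd
  set G := F (δ + w₀) with hG
  have hm := (N.mono H).monotoneOn
  have hlem : ∀ s ∈ Icc δ (δ + w₀), s ∈ Icc δ (δ + ω) := fun s hs => ⟨hs.1, by linarith [hs.2, hw₀.2]⟩
  have hG0 : 0 ≤ G := by
    have := hm (left_mem_Icc.2 (by linarith)) (hlem (δ + w₀) ⟨by linarith [hw₀.1], le_rfl⟩) (by linarith [hw₀.1])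
    rwa [N.F_zero] at this
  have hk0 : 0 ≤ G / (2 * w₀) := div_nonneg hG0 (by linarith [hw₀.1])
  have gen : ∀ p q, T ≤ p → p < q → q ≤ R → u p ∈ Icc δ y → u q ∈ Icc δ y →
      (∀ t ∈ Ioo p q, u t ∈ Ioo δ y ∧ (4 ^ n)⁻¹ * (F y - F (u t)) ≤ v t ^ 2 / 2) → q - p ≤ R / 8 := by
    intro p q hp hpq hq hup huq hI
    by_contra! hcon
    have hcs := hcu.mono (Icc_subset_Icc hp hq)
    have hdp : ∀ t ∈ Ioo p q, T ≤ t := fun t ht => hp.trans ht.1.le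
    rcases lt_or_ge G (c / R / 2) with hA | hB
    · have h3 := slope_sq_le (m := c / R) (w := δ + ω) hpq hcs (fun t ht => by
        have a1 : F (u t) ≤ G := hm (hlem _ ⟨(hI t ht).1.1.le, (hI t ht).1.2.le.trans hle⟩)
          (hlem _ ⟨by linarith [hw₀.1], le_rfl⟩) ((hI t ht).1.2.le.trans hle)
        exact ⟨_, (hd t (hdp t ht)).1, by linarith [hv2 t, hE t ⟨hdp t ht, ht.2.le.trans hq⟩]⟩) (by
          rw [abs_le]
          constructor <;> linarith [hup.1, hup.2, huq.1, huq.2, hw₀.2]) (by positivity) hcon.le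
      have e : c / R * (R / 8) ^ 2 = R * c / 64 := by field_simp; norm_num
      nlinarith
    · set k := G / (2 * w₀) with hk
      have a4 := slope_sq_le (g := fun t => √(y - u t)) (m := (4 ^ n : ℝ)⁻¹ * k / 2) (w := √w₀) hpq
        (continuousOn_const.sub hcs).sqrt (fun t ht => by
          have hg := sub_pos.2 (hI t ht).1.2
          refine ⟨_, ((hd t (hdp t ht)).1.const_sub y).sqrt hg.ne', ?_⟩
          have a1 := hmax (u t - δ) ⟨by linarith [(hI t ht).1.1], by linarith [(hI t ht).1.2]⟩
          rw [add_sub_cancel] at a1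
          have a2 : (4 ^ n : ℝ)⁻¹ * (k * (y - u t)) ≤ (4 ^ n)⁻¹ * (F y - F (u t)) :=
            mul_le_mul_of_nonneg_left (by linarith) (by positivity)
          rw [div_pow, mul_pow, Real.sq_sqrt hg.le, neg_sq, le_div_iff₀ (by positivity)]
          linarith [(hI t ht).2]) (by
          have a1 := Real.sqrt_le_sqrt (show y - u q ≤ w₀ by linarith [huq.1])
          have a2 := Real.sqrt_le_sqrt (show y - u p ≤ w₀ by linarith [hup.1])
          rw [abs_le]
          constructor <;> linarith [Real.sqrt_nonneg (y - u q), Real.sqrt_nonneg (y - u p)]) (by positivity) hcon.le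
      have hw := hw₀.1
      rw [Real.sq_sqrt hw.le] at a4
      have a3 : c / R / 2 / (2 * w₀) ≤ k := div_le_div_of_nonneg_right hB (by positivity)
      have e : (4 ^ n : ℝ)⁻¹ * (c / R / 2 / (2 * w₀)) / 2 * (R / 8) ^ 2 = R * c / (512 * 4 ^ n * w₀) := by
        field_simp; norm_num
      have a4 := e.symm.trans_le (le_trans (by gcongr) a4)
      rw [div_le_iff₀ (by positivity)] at a4
      have : w₀ ^ 2 ≤ (δ + ω) ^ 2 := pow_le_pow_left₀ hw.le (by linarith [hw₀.2]) 2
      have : 0 < (4 : ℝ) ^ n * (δ + ω) ^ 2 := by positivity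
      nlinarith
  have hweight : ∀ p q, T ≤ p → q ≤ R → (∀ t ∈ Ioo p q, δ < u t) → StrictAntiOn (fun t => t ^ n * v t) (Icc p q) := by
    intro p q hp hq hI
    have hdw := fun t (ht : p ≤ t) => (h.weighted (mem_Ioi.2 (hT.trans_le (hp.trans ht)))
      (hT.trans_le (hp.trans ht)).ne').hasDerivAt (Ioi_mem_nhds (hT.trans_le (hp.trans ht)))
    refine strictAntiOn_Icc (fun t ht => (hdw t ht.1).continuousAt.continuousWithinAt) fun t ht => ⟨_, hdw t ht.1.le, ?_⟩
    have h1 := N.f_pos (u t) ⟨hI t ht, (B.mem t ⟨hp.trans ht.1.le, ht.2.le.trans hq⟩).2.le⟩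
    have : 0 < t := hT.trans_le (hp.trans ht.1.le)
    exact neg_neg_of_pos (by positivity)
  have hyI : y ∈ Icc δ (δ + ω) := hlem y ⟨hy.le, hle⟩
  rcases le_or_gt (v (R / 2)) 0 with hv | hv
  · have hab : ∀ t ∈ Ico (R / 2) R, δ < u t := fun t ht => B.above_of_above h (by linarith) ht.1 ht.2 hy
    have hsa := hweight (R / 2) R (by linarith) le_rfl fun t ht => hab t (Ioo_subset_Ico_self ht)
    have hvn : ∀ t ∈ Ioc (R / 2) R, v t < 0 := by
      intro t ht
      have ht0 : 0 < t := by linarith [ht.1]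
      have h1 := hsa ⟨le_rfl, by linarith⟩ ⟨ht.1.le, ht.2⟩ ht.1
      have h2 : (R / 2) ^ n * v (R / 2) ≤ 0 := mul_nonpos_of_nonneg_of_nonpos (by positivity) hv
      by_contra! hcon
      have : 0 ≤ t ^ n * v t := by positivity
      simp only at h1; linarith
    have hus := strictAntiOn_Icc (hcu.mono (Icc_subset_Icc_left (by linarith))) fun t ht =>
      ⟨_, (hd t (by linarith [ht.1])).1, hvn t ⟨ht.1, ht.2.le⟩⟩
    have hψ : MonotoneOn (fun t => (t ^ n * v t) ^ 2 / 2 + ((R / 2) ^ n) ^ 2 * F (u t)) (Icc (R / 2) R) := by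
      have hdψ : ∀ t ∈ Icc (R / 2) R, HasDerivAt (fun t => (t ^ n * v t) ^ 2 / 2 + ((R / 2) ^ n) ^ 2 * F (u t))
          (-(f (u t) * v t) * ((t ^ n) ^ 2 - ((R / 2) ^ n) ^ 2)) t := fun t ht => by
        have ht0 : 0 < t := by linarith [ht.1]
        have htT : T ≤ t := by linarith [ht.1]
        have h1 := (h.weighted (mem_Ioi.2 ht0) ht0.ne').hasDerivAt (Ioi_mem_nhds ht0)
        have h2 := (H.deriv _ (hO t ⟨htT, ht.2⟩)).comp t (hd t htT).1
        refine (((h1.pow 2).div_const 2).add (h2.const_mul (((R / 2) ^ n) ^ 2))).congr_deriv ?_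
        push_cast; ring
      refine monoOn_Icc (fun t ht => (hdψ t ht).continuousAt.continuousWithinAt)
        fun t ht => ⟨_, hdψ t (Ioo_subset_Icc_self ht), ?_⟩
      have h1 := N.f_pos (u t) ⟨hab t (Ioo_subset_Ico_self ht), (B.mem t ⟨by linarith [ht.1], ht.2.le⟩).2.le⟩
      have h2 := hvn t ⟨ht.1, ht.2.le⟩
      refine mul_nonneg (by nlinarith) (sub_nonneg.2 ?_)
      have := ht.1.le
      gcongr
    have := gen (R / 2) R (by linarith) (by linarith) le_rfl ⟨hy.le, le_rfl⟩
      ⟨B.u_eq.ge, by rw [B.u_eq]; exact hy.le⟩ fun t ht => by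
        have ht0 : 0 < t := by linarith [ht.1]
        refine ⟨⟨hab t (Ioo_subset_Ico_self ht), hus ⟨le_rfl, by linarith⟩ (Ioo_subset_Icc_self ht) ht.1⟩, ?_⟩
        have h1 := hψ ⟨le_rfl, by linarith⟩ (Ioo_subset_Icc_self ht) ht.1.le
        simp only at h1
        have h2 : 0 ≤ ((R / 2) ^ n * v (R / 2)) ^ 2 / 2 := by positivity
        have h3 : ((R / 2) ^ n) ^ 2 * (F y - F (u t)) ≤ (R ^ n) ^ 2 * (v t ^ 2 / 2) := by
          have : (t ^ n) ^ 2 * (v t ^ 2 / 2) ≤ (R ^ n) ^ 2 * (v t ^ 2 / 2) := by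
            have := ht.2.le
            gcongr
          rw [mul_pow] at h1; linarith
        have e : ((R / 2) ^ n) ^ 2 = (R ^ n) ^ 2 * (4 ^ n)⁻¹ := by
          rw [div_pow, div_pow, ← pow_mul 2, mul_comm n 2, pow_mul 2]; norm_num
          rfl
        rw [e, mul_assoc] at h3
        exact le_of_mul_le_mul_left h3 (by positivity)
    linarith
  · have fin : ∀ p, T ≤ p → p < R / 2 → δ ≤ u p → (∀ t ∈ Ioc p (R / 2), δ < u t) → R / 2 - p ≤ R / 8 := by
      intro p hp hpR hup hab
      have hsa := hweight p (R / 2) hp (by linarith) fun t ht => hab t (Ioo_subset_Ioc_self ht)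
      have hvp : ∀ t ∈ Ioo p (R / 2), 0 < v t := by
        intro t ht
        have h1 := hsa (Ioo_subset_Icc_self ht) ⟨hpR.le, le_rfl⟩ ht.2
        have h2 : 0 < (R / 2) ^ n * v (R / 2) := by positivity
        have ht0 : 0 < t := by linarith [ht.1]
        exact pos_of_mul_pos_right (h2.trans h1) (by positivity)
      have hus := strictMonoOn_Icc (hcu.mono (Icc_subset_Icc hp (by linarith))) fun t ht =>
        ⟨_, (hd t (hp.trans ht.1.le)).1, hvp t ht⟩
      refine gen p (R / 2) hp hpR (by linarith) ⟨hup, (hus ⟨le_rfl, hpR.le⟩ ⟨hpR.le, le_rfl⟩ hpR).le⟩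
        ⟨hy.le, le_rfl⟩ fun t ht => ?_
      have h1 := hab t (Ioo_subset_Ioc_self ht)
      have h2 := hus (Ioo_subset_Icc_self ht) ⟨hpR.le, le_rfl⟩ ht.2
      refine ⟨⟨h1, h2⟩, ?_⟩
      have h3 := hm ⟨h1.le, h2.le.trans hyI.2⟩ hyI h2.le
      have h5 := h.antitone_energy hT (b := R) (fun x hx => H.deriv _ (hO x hx)) ⟨hp.trans ht.1.le, by linarith [ht.2]⟩
        ⟨by linarith, by linarith⟩ ht.2.le
      have h6 := F_le_energy F u v (R / 2)
      rw [hv2 t]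
      have : (4 ^ n : ℝ)⁻¹ * (F y - F (u t)) ≤ 1 * (F y - F (u t)) :=
        mul_le_mul_of_nonneg_right (inv_le_one_of_one_le₀ h4) (by linarith)
      linarith
    by_cases hex : ∃ t ∈ Icc T (R / 2), u t ≤ δ
    · obtain ⟨p, ⟨hp, hpR⟩, hup, hab⟩ := exists_last_le (hcu.mono (Icc_subset_Icc_right (by linarith))) hex hy
      have h1 := fin p hp hpR hup.ge hab
      rcases hp.eq_or_lt with e | e
      · linarith
      · linarith [short p ⟨e, hpR.le⟩ hup.le]
    · push Not at hex
      linarith [fin T le_rfl (by linarith) (hex T ⟨le_rfl, by linarith⟩).le fun t ht => hex t ⟨ht.1.le, ht.2⟩]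

end notch

section notch
variable {n : ℕ} {f F : ℝ → ℝ} {O I : Set ℝ} {δ ω : ℝ}

/-- A path of trajectories starting at one that converges to a degenerate maximum point: the other
trajectories cannot all return to zero. -/
theorem Notch.no_path (N : Notch f F O δ ω) (H : Nonlin f F O) (hn : 1 ≤ n) {U V : ℝ → ℝ → ℝ} {τ₀ : ℝ}
    (hτ₀ : 0 < τ₀) (htr : ∀ τ ∈ Ioc 0 τ₀, IsTraj n f (U τ) (V τ) (Ioi 0) ∧ ∀ t, 0 < t → U τ t ∈ O)
    (hal : ∀ τ ∈ Ioc 0 τ₀, ∀ z, U τ z ≠ 0 → ∀ t ∈ Icc 0 z, U τ t ≠ 0 ∨ V τ t ≠ 0)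
    (hclose : ∀ τ ∈ Ioc 0 τ₀, ∀ T, (∀ t ∈ Ico 0 T, U τ t ≠ 0 ∨ V τ t ≠ 0) → ∀ ε > 0,
      ∀ᶠ a in 𝓝 τ, ∀ t ∈ Icc 0 T, |U a t - U τ t| < ε ∧ |V a t - V τ t| < ε)
    (hsmall : ∀ η > 0, ∀ T₁, ∃ T ≥ T₁, ∀ T' ≥ T, ∀ᶠ τ in 𝓝[>] (0 : ℝ), ∀ t ∈ Icc T T',
      |U τ t - δ| < η ∧ energy F (U τ) (V τ) t < η / t)
    (hz : ∀ T > 0, ∀ᶠ τ in 𝓝[>] (0 : ℝ), ∃ z > T, U τ z = 0 ∧ V τ z ≠ 0) : False := by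
  obtain ⟨c, hc, η₀, hη₀, T₀, hT₀, key⟩ := N.exists_bump H hn
  obtain ⟨R₀, hhalf⟩ := N.half H n hc
  have hηc : 0 < min η₀ c := lt_min hη₀ hc
  obtain ⟨T, hT, hsm⟩ := hsmall _ hηc T₀
  have hT0 : 0 < T := lt_of_lt_of_le hT₀ hT
  obtain ⟨τ₁, hτ₁, hev⟩ : ∃ τ₁ ∈ Ioc 0 τ₀, ∀ τ ∈ Ioc 0 τ₁, (∀ t ∈ Icc T (max T (max R₀ (4 * T))),
      |U τ t - δ| < min η₀ c ∧ energy F (U τ) (V τ) t < min η₀ c / t) ∧ ∃ z > T, U τ z = 0 ∧ V τ z ≠ 0 := by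
    obtain ⟨x, hx, hxs⟩ := mem_nhdsGT_iff_exists_Ioc_subset.1 ((hsm _ (le_max_left T (max R₀ (4 * T)))).and (hz T hT0))
    exact ⟨min x τ₀, ⟨lt_min hx hτ₀, min_le_right _ _⟩, fun τ hτ => hxs ⟨hτ.1, hτ.2.trans (min_le_left _ _)⟩⟩
  have hsub : Ioc 0 τ₁ ⊆ Ioc 0 τ₀ := Ioc_subset_Ioc_right hτ₁.2
  have hex : ∀ τ ∈ Ioc 0 τ₁, ∃ R, Bump F δ ω c (U τ) (V τ) T R := by
    intro τ hτ
    obtain ⟨k1, k2⟩ := hev τ hτ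
    obtain ⟨k3, k4⟩ := k1 T ⟨le_rfl, le_max_left _ _⟩
    exact key _ _ (htr τ (hsub hτ)).1 T hT (k3.trans_le (min_le_left _ _))
      (k4.trans_le (div_le_div_of_nonneg_right (min_le_left _ _) hT0.le)) (htr τ (hsub hτ)).2 k2
  choose! R hR using hex
  have hR0 : ∀ τ ∈ Ioc 0 τ₁, 0 < R τ := fun τ hτ => hT0.trans (hR τ hτ).lt
  have halR : ∀ τ ∈ Ioc 0 τ₁, ∀ t ∈ Icc 0 (R τ), U τ t ≠ 0 ∨ V τ t ≠ 0 := fun τ hτ =>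
    hal τ (hsub hτ) (R τ) (by rw [(hR τ hτ).u_eq]; exact N.pos.ne')
  have late : ∀ τ ∈ Ioc 0 τ₁, ∀ X, (∀ t ∈ Icc T X, energy F (U τ) (V τ) t < min η₀ c / t) → X < R τ := by
    refine fun τ hτ X hX => not_le.1 fun hcon => (hX (R τ) ⟨(hR τ hτ).lt.le, hcon⟩).not_ge ?_
    exact (div_le_div_of_nonneg_right (min_le_right _ _) (hR0 τ hτ).le).trans (hR τ hτ).energy
  have hbig : ∀ τ ∈ Ioc 0 τ₁, max T (max R₀ (4 * T)) < R τ := fun τ hτ => late τ hτ _ fun t ht => ((hev τ hτ).1 t ht).2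
  have h4T : ∀ τ ∈ Ioc 0 τ₁, 4 * T < R τ := fun τ hτ => ((le_max_right _ _).trans (le_max_right _ _)).trans_lt (hbig τ hτ)
  have hh := fun τ (hτ : τ ∈ Ioc 0 τ₁) => hhalf (U τ) (V τ) T (R τ) (htr τ (hsub hτ)).1 (hR τ hτ)
    (((le_max_left _ _).trans (le_max_right _ _)).trans (hbig τ hτ).le) (h4T τ hτ)
  have hRc : ∀ τ ∈ Ioc 0 τ₁, Tendsto R (𝓝[Ioc 0 τ₁] τ) (𝓝 (R τ)) := by
    intro τ hτ
    have B := hR τ hτ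
    have hRτ := hR0 τ hτ
    have hd := fun t (ht : 0 < t) => (htr τ (hsub hτ)).1.hasDerivAt ht
    have hleft : ∀ x < R τ, ∀ᶠ a in 𝓝[Ioc 0 τ₁] τ, x < R a := by
      intro x hx
      rcases lt_or_ge x T with hxT | hxT
      · filter_upwards [self_mem_nhdsWithin] with a ha using hxT.trans (hR a ha).lt
      have hcm : ContinuousOn (fun t => max (U τ t - δ) (V τ t)) (Icc T x) := fun t ht =>
        have ht0 := hT0.trans_le ht.1
        ((hd t ht0).1.continuousAt.continuousWithinAt.sub continuousWithinAt_const).max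
          (hd t ht0).2.continuousAt.continuousWithinAt
      obtain ⟨m, hm, hmin⟩ := isCompact_Icc.exists_isMinOn (nonempty_Icc.2 hxT) hcm
      have hμ := B.above m ⟨hm.1, hm.2.trans_lt hx⟩
      have hcl := hclose τ (hsub hτ) x (fun t ht => halR τ hτ t ⟨ht.1, (ht.2.trans hx).le⟩) _ hμ
      filter_upwards [hcl.filter_mono nhdsWithin_le_nhds, self_mem_nhdsWithin] with a ha haI
      by_contra! hcon
      have B' := hR a haI
      obtain ⟨k1, k2⟩ := ha (R a) ⟨(hR0 a haI).le, hcon⟩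
      have k3 : _ ≤ max (U τ (R a) - δ) (V τ (R a)) := hmin ⟨B'.lt.le, hcon⟩
      rw [B'.u_eq] at k1
      have k4 := B'.v_neg
      rcases max_cases (U τ (R a) - δ) (V τ (R a)) with ⟨e, -⟩ | ⟨e, -⟩ <;> rw [e] at k3
      · linarith [(abs_lt.1 k1).1]
      · linarith [(abs_lt.1 k2).1]
    refine tendsto_order.2 ⟨hleft, fun x hx => ?_⟩
    obtain ⟨s, hs, hsv⟩ := mem_nhdsGT_iff_exists_Ioc_subset.1 (nhdsWithin_le_nhds (s := Ioi (R τ))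
      (((hd _ hRτ).2.continuousAt.tendsto.eventually_lt_const B.v_neg).and
        ((hd _ hRτ).1.continuousAt.tendsto.eventually_const_lt (show 0 < U τ (R τ) by rw [B.u_eq]; exact N.pos))))
    set t := min s ((R τ + x) / 2) with ht
    have hRt : R τ < t := lt_min hs (by linarith)
    have htx : t < x := (min_le_right _ _).trans_lt (by linarith)
    have htI : t ∈ Ioc (R τ) s := ⟨hRt, min_le_left _ _⟩
    obtain ⟨g1, g2⟩ := hsv htI
    have hd1 := fun y (hy : R τ ≤ y) => (hd y (hRτ.trans_le hy)).1
    have g3 := strictAntiOn_Icc (HasDerivAt.continuousOn fun y hy => hd1 y hy.1) (fun y hy => ⟨_, hd1 y hy.1.le,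
      (hsv ⟨hy.1, hy.2.le.trans htI.2⟩).1⟩) ⟨le_rfl, hRt.le⟩ ⟨hRt.le, le_rfl⟩ hRt
    rw [B.u_eq] at g3
    have hcl := hclose τ (hsub hτ) t (fun y hy => hal τ (hsub hτ) t g2.ne' y ⟨hy.1, hy.2.le⟩)
      (min (δ - U τ t) (-V τ t)) (lt_min (by linarith) (by linarith))
    filter_upwards [hcl.filter_mono nhdsWithin_le_nhds, self_mem_nhdsWithin] with a ha haI
    by_contra! hcon
    obtain ⟨k1, k2⟩ := ha t ⟨(hRτ.trans hRt).le, le_rfl⟩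
    have := (hR a haI).above t ⟨(B.lt.trans hRt).le, htx.trans_le hcon⟩
    rw [lt_max_iff] at this
    have k3 := (abs_lt.1 (k1.trans_le (min_le_left _ _))).2
    have k4 := (abs_lt.1 (k2.trans_le (min_le_right _ _))).2
    rcases this with h | h <;> linarith
  have hyc : ContinuousOn (fun τ => U τ (R τ / 2)) (Ioc 0 τ₁) := by
    intro τ hτ
    have hRτ := hR0 τ hτ
    refine Metric.tendsto_nhds.2 fun ε hε => ?_
    have h1 := ((htr τ (hsub hτ)).1.hasDerivAt (half_pos hRτ)).1.continuousAt.tendsto.comp ((hRc τ hτ).div_const 2)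
    have hcl := hclose τ (hsub hτ) (R τ) (fun y hy => halR τ hτ y ⟨hy.1, hy.2.le⟩) (ε / 2) (half_pos hε)
    filter_upwards [hcl.filter_mono nhdsWithin_le_nhds, Metric.tendsto_nhds.1 h1 (ε / 2) (half_pos hε),
      self_mem_nhdsWithin, (hRc τ hτ).eventually_lt_const (show R τ < 2 * R τ by linarith)] with a h2 h3 h4 h5
    have h6 := (h2 (R a / 2) ⟨by linarith [(hR a h4).lt], by linarith⟩).1
    rw [← Real.dist_eq] at h6; simp only [Function.comp_apply] at h3
    linarith [dist_triangle (U a (R a / 2)) (U τ (R a / 2)) (U τ (R τ / 2))]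
  have hI₁ : τ₁ ∈ Ioc 0 τ₁ := ⟨hτ₁.1, le_rfl⟩
  set w₀ := U τ₁ (R τ₁ / 2) - δ with hw₀d
  have hw₀ : w₀ ∈ Ioc 0 ω := by
    have := ((hR τ₁ hI₁).mem (R τ₁ / 2) ⟨by linarith [h4T τ₁ hI₁], by linarith [hR0 τ₁ hI₁]⟩).2
    exact ⟨sub_pos.2 (hh τ₁ hI₁).1, by rw [hw₀d]; linarith⟩
  have hmono := N.mono H
  have hpos : ∀ w ∈ Ioc 0 ω, 0 < F (δ + w) := fun w hw => by
    have := hmono (left_mem_Icc.2 (by linarith [N.width])) (⟨by linarith [hw.1], by linarith [hw.2]⟩ : δ + w ∈ Icc δ (δ + ω))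
      (by linarith [hw.1])
    rwa [N.F_zero] at this
  set k := F (δ + w₀) / (2 * w₀) with hk
  obtain ⟨w, hw, hwm⟩ := isCompact_Icc.exists_isMaxOn (nonempty_Icc.2 hw₀.1.le) (f := fun w => F (δ + w) - k * w)
    (fun x hx => by
      have hO : δ + x ∈ O := N.sub ⟨by linarith [hx.1, N.pos], by linarith [hx.2, hw₀.2]⟩
      have : ContinuousAt (fun w => F (δ + w)) x := ContinuousAt.comp (f := fun w => δ + w) (g := F)
        (H.deriv _ hO).continuousAt (by fun_prop)
      exact (this.sub (by fun_prop)).continuousWithinAt)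
  have hwpos : 0 < w := by
    refine lt_of_le_of_ne hw.1 ?_
    rintro rfl
    have h1 : F (δ + w₀) - k * w₀ ≤ F (δ + 0) - k * 0 := hwm (right_mem_Icc.2 hw₀.1.le)
    have h2 : k * w₀ = F (δ + w₀) / 2 := by rw [hk]; have := hw₀.1.ne'; field_simp
    rw [h2, add_zero, N.F_zero] at h1; linarith [hpos w₀ hw₀]
  have hwω : w ∈ Ioc 0 ω := ⟨hwpos, hw.2.trans hw₀.2⟩
  obtain ⟨τ₂, hτ₂, hy₂⟩ : ∃ τ₂ ∈ Ioc 0 τ₁, U τ₂ (R τ₂ / 2) < δ + w := by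
    set X := max T (min η₀ c / F (δ + w)) with hX
    have hXT : T ≤ X := le_max_left _ _
    obtain ⟨τ, h1, h2⟩ := ((hsm (2 * X) (by linarith)).and (Ioc_mem_nhdsGT hτ₁.1)).exists
    refine ⟨τ, h2, ?_⟩
    by_contra! hcon
    have B := hR τ h2
    have hXR : 2 * X < R τ := late τ h2 _ fun t ht => (h1 t ht).2
    have hmem : R τ / 2 ∈ Icc T (R τ) := ⟨by linarith, by linarith⟩
    have h3 := hmono.monotoneOn (⟨by linarith, by linarith [hwω.2]⟩ : δ + w ∈ Icc δ (δ + ω))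
      ⟨by linarith, (B.mem _ hmem).2.le⟩ hcon
    have h4 := F_le_energy F (U τ) (V τ) (R τ / 2)
    have h5 := (htr τ (hsub h2)).1.antitone_energy (hT0.trans_le hXT) (b := R τ) (F := F)
      (fun t ht => H.deriv _ ((htr τ (hsub h2)).2 t ((hT0.trans_le hXT).trans_le ht.1)))
      ⟨le_rfl, by linarith⟩ ⟨by linarith, hmem.2⟩ (by linarith : X ≤ R τ / 2)
    have h6 := (h1 X ⟨hXT, by linarith⟩).2
    have h7 : min η₀ c / X ≤ F (δ + w) := by
      rw [div_le_iff₀ (hT0.trans_le hXT), ← div_le_iff₀' (hpos w hwω)]; exact le_max_right _ _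
    linarith
  obtain ⟨τ, hτ, hye⟩ := intermediate_value_Icc hτ₂.2 (hyc.mono fun x hx => ⟨hτ₂.1.trans_le hx.1, hx.2⟩)
    (show δ + w ∈ Icc _ _ from ⟨hy₂.le, by linarith [hw.2]⟩)
  simp only at hye
  refine (hh τ ⟨hτ₂.1.trans_le hτ.1, hτ.2⟩).2 w₀ hw₀ (by rw [hye]; linarith [hw.2]) fun x hx => ?_
  rw [hye, add_sub_cancel_left]; exact hwm hx

section family
variable {u v : ℝ → ℝ → ℝ} {α s σ : ℝ}

theorem Family.no_path (H : Family n f F O I u v) (hn : 1 ≤ n) (hα : α ∈ I) (hal : ∀ t, 0 ≤ t → u α t ≠ 0 ∨ v α t ≠ 0)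
    (hlim : ∀ η > 0, ∀ᶠ t in atTop, |u α t - s| < η ∧ energy F (u α) (v α) t < η / t)
    (hz : ∀ T > 0, ∀ᶠ τ in 𝓝[>] (0 : ℝ), α + σ * τ ∈ I ∧ ∃ z > T, u (α + σ * τ) z = 0 ∧ v (α + σ * τ) z ≠ 0)
    (hN : Notch f F O s ω ∨ Notch (fun s => -f (-s)) (fun s => F (-s)) (Neg.neg ⁻¹' O) (-s) ω) : False := by
  have hpath : ∀ τ, Tendsto (fun τ => α + σ * τ) (𝓝 τ) (𝓝 (α + σ * τ)) := fun τ => Continuous.tendsto (by fun_prop) τ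
  have hp0 := tendsto_ray α σ
  obtain ⟨τ₀, hτ₀, hI⟩ := mem_nhdsGT_iff_exists_Ioc_subset.1 ((hz 1 one_pos).mono fun τ h => h.1)
  have hI : ∀ τ ∈ Ioc 0 τ₀, α + σ * τ ∈ I := fun τ hτ => hI hτ
  have hsmall : ∀ η > 0, ∀ T₁, ∃ T ≥ T₁, ∀ T' ≥ T, ∀ᶠ τ in 𝓝[>] (0 : ℝ), ∀ t ∈ Icc T T',
      |u (α + σ * τ) t - s| < η ∧ energy F (u (α + σ * τ)) (v (α + σ * τ)) t < η / t := by
    intro η hη T₁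
    obtain ⟨T₂, hT₂⟩ := eventually_atTop.1 (hlim (η / 2) (half_pos hη))
    set T := max (max T₁ T₂) 1 with hT
    have hT1 : 1 ≤ T := le_max_right _ _
    have hTT₂ : T₂ ≤ T := (le_max_right _ _).trans (le_max_left _ _)
    refine ⟨T, (le_max_left _ _).trans (le_max_left _ _), fun T' hT' => ?_⟩
    have hE : ∀ m : ℕ, ∀ᶠ a in 𝓝 α, a ∈ I ∧ ∀ t ∈ Icc T (2 ^ m * T), energy F (u a) (v a) t < η / t := by
      have hpt : ∀ t ≥ T, ∀ᶠ a in 𝓝 α, a ∈ I ∧ energy F (u a) (v a) t < η / 2 / t := fun t ht =>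
        (show ∀ᶠ a in 𝓝 α, a ∈ I from H.isOpen.mem_nhds hα).and ((H.tendsto hα (by linarith)
          fun x hx => hal x hx.1).2.2.eventually_lt_const (hT₂ t (hTT₂.trans ht)).2)
      intro m
      induction m with
      | zero =>
        filter_upwards [hpt T le_rfl] with a ha
        refine ⟨ha.1, fun t ht => ?_⟩
        obtain rfl : T = t := le_antisymm ht.1 (by linarith [ht.2])
        exact ha.2.trans (div_lt_div_of_pos_right (half_lt_self hη) (by linarith))
      | succ m ih =>
        have h2 : T ≤ 2 ^ m * T := le_mul_of_one_le_left (by linarith) (one_le_pow₀ (by norm_num))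
        filter_upwards [ih, hpt (2 ^ m * T) h2] with a ha hb
        refine ⟨ha.1, fun t ht => ?_⟩
        rcases le_total t (2 ^ m * T) with h | h
        · exact ha.2 t ⟨ht.1, h⟩
        · refine (H.energy_le ha.1 (by linarith) h).trans_lt (hb.2.trans_le ?_)
          rw [div_div]
          have := ht.2
          rw [pow_succ] at this
          exact div_le_div_of_nonneg_left hη.le (by linarith) (by linarith)
    obtain ⟨m, hm⟩ := pow_unbounded_of_one_lt T' (one_lt_two : (1 : ℝ) < 2)
    have hmT : T' ≤ 2 ^ m * T := hm.le.trans (le_mul_of_one_le_right (by positivity) hT1)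
    filter_upwards [hp0.eventually (hE m), hp0.eventually (H.close hα (T := T') (fun t ht => hal t ht.1) (half_pos hη))]
      with τ h1 h2 t ht
    refine ⟨?_, h1.2 t ⟨ht.1, ht.2.trans hmT⟩⟩
    have h3 := (h2.2 t ⟨by linarith [ht.1], ht.2⟩).1
    have h4 := (hT₂ t (hTT₂.trans ht.1)).1
    have := abs_add_le (u (α + σ * τ) t - u α t) (u α t - s)
    rw [sub_add_sub_cancel] at this; linarith
  have hcl : ∀ τ ∈ Ioc 0 τ₀, ∀ T, (∀ t ∈ Ico 0 T, u (α + σ * τ) t ≠ 0 ∨ v (α + σ * τ) t ≠ 0) → ∀ ε > 0,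
      ∀ᶠ a in 𝓝 τ, ∀ t ∈ Icc 0 T, |u (α + σ * a) t - u (α + σ * τ) t| < ε ∧
        |v (α + σ * a) t - v (α + σ * τ) t| < ε := fun τ hτ T hne ε hε =>
    ((hpath τ).eventually (H.close (hI τ hτ) hne hε)).mono fun a ha => ha.2
  rcases hN with hN | hN
  · exact hN.no_path H.nl hn hτ₀ (U := fun τ => u (α + σ * τ)) (V := fun τ => v (α + σ * τ))
      (fun τ hτ => ⟨(H.reg _ (hI τ hτ)).traj, H.mem_pos (hI τ hτ)⟩)
      (fun τ hτ z hz => H.alive (hI τ hτ) (Or.inl hz)) hcl hsmall fun T hT => (hz T hT).mono fun τ h => h.2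
  · have hsub : ∀ a b : ℝ, |-a - -b| = |a - b| := fun a b => by rw [neg_sub_neg, abs_sub_comm]
    refine hN.no_path H.nl.neg hn hτ₀ (U := fun τ t => -u (α + σ * τ) t) (V := fun τ t => -v (α + σ * τ) t)
      (fun τ hτ => ⟨(H.reg _ (hI τ hτ)).traj.neg, fun t ht => by simpa using H.mem_pos (hI τ hτ) t ht⟩)
      (fun τ hτ z hz t ht => by
        have := H.alive (hI τ hτ) (T := z) (Or.inl (by simpa using hz)) t ht
        simpa using this) (fun τ hτ T hne ε hε => ?_) (fun η hη T₁ => ?_) fun T hT => (hz T hT).mono fun τ h => by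
          simpa using h.2
    · simp only [hsub]
      exact hcl τ hτ T (by simpa using hne) ε hε
    · simp only [hsub, energy_neg]; exact hsmall η hη T₁

end family
end notch

section right
variable {n : ℕ} {f F : ℝ → ℝ} {O I : Set ℝ} {u v : ℝ → ℝ → ℝ} {α c e r K T : ℝ}

theorem RegSol.hasDerivAt_weighted {u v : ℝ → ℝ} (h : RegSol n f α u v) {t : ℝ} (ht : 0 < t) :
    HasDerivAt (fun t => t ^ n * v t) (-(t ^ n * f (u t))) t :=
  (h.traj.weighted (mem_Ioi.2 ht) ht.ne').hasDerivAt (Ioi_mem_nhds ht)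

theorem RegSol.continuousOn_weighted {u v : ℝ → ℝ} (h : RegSol n f α u v) {t : ℝ} (m : ℕ) :
    ContinuousOn (fun t => t ^ m * v t) (Icc 0 t) :=
  (continuous_pow m).continuousOn.mul (h.cont_v.mono fun _ hx => hx.1)

theorem RegSol.neg_le_v {u v : ℝ → ℝ} (h : RegSol n f α u v) {A s : ℝ} (hs : 0 < s)
    (hf : ∀ t ∈ Ioo 0 s, f (u t) ≤ A) : -(A / (n + 1) * s) ≤ v s := by
  have hφ := monoOn_Icc ((h.continuousOn_weighted n).add (by fun_prop : ContinuousOn (fun x => A / (n + 1) * x ^ (n + 1))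
    (Icc 0 s))) fun x hx => ⟨_, (h.hasDerivAt_weighted hx.1).add ((hasDerivAt_pow (n + 1) x).const_mul _), by
      have := mul_nonneg (pow_nonneg hx.1.le n) (sub_nonneg.2 (hf x hx))
      push_cast; field_simp
      linarith⟩
  have h1 := hφ ⟨le_rfl, hs.le⟩ ⟨hs.le, le_rfl⟩ hs.le
  simp only [Pi.add_apply, h.v_zero, mul_zero, zero_pow n.succ_ne_zero, add_zero] at h1
  have h2 : 0 ≤ s ^ n * (v s + A / (n + 1) * s) := by rw [pow_succ] at h1; linarith
  linarith [nonneg_of_mul_nonneg_right h2 (pow_pos hs n)]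

theorem RegSol.v_nonpos {u v : ℝ → ℝ} (h : RegSol n f α u v) {s : ℝ} (hs : 0 < s)
    (hf : ∀ t ∈ Ioo 0 s, 0 ≤ f (u t)) : v s ≤ 0 := by
  have h1 := antiOn_Icc (h.continuousOn_weighted n) (fun x hx => ⟨_, h.hasDerivAt_weighted hx.1,
    neg_nonpos.2 (mul_nonneg (pow_nonneg hx.1.le n) (hf x hx))⟩) ⟨le_rfl, hs.le⟩ ⟨hs.le, le_rfl⟩ hs.le
  simp only [h.v_zero, mul_zero] at h1; exact nonpos_of_mul_nonpos_right h1 (pow_pos hs n)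

/-- Solutions starting close to an equilibrium stay close to it for a long time. -/
theorem Family.high_near_equilibrium (H : Family n f F O I u v)
    (hI : ∀ a ∈ I, ∀ s, a ≤ s → s < c → s ∈ I) (hIc : ∀ a ∈ I, a < c) (hne : I.Nonempty) (hr : 0 < r)
    (hK : 0 ≤ K) (hlip : ∀ s ∈ Ioo (c - r) c, f s ≤ K * (c - s)) (he : ∃ hi < c, ∀ s, hi < s → s < c → e < F s)
    (hT : 0 < T) : ∃ p ∈ I, ∀ α ∈ I, p ≤ α → e < energy F (u α) (v α) T := by
  obtain ⟨a, ha⟩ := hne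
  obtain ⟨hi, hic, hiF⟩ := he
  set ρ := min r (min (c - a) (c - hi)) with hρ
  have hρ0 : 0 < ρ := lt_min hr (lt_min (sub_pos.2 (hIc a ha)) (sub_pos.2 hic))
  have hρr : ρ ≤ r := min_le_left _ _
  have hρa : ρ ≤ c - a := (min_le_right _ _).trans (min_le_left _ _)
  have hρh : ρ ≤ c - hi := (min_le_right _ _).trans (min_le_right _ _)
  set p := c - ρ / 2 * Real.exp (-(K * T * T)) with hp
  have hexp : Real.exp (-(K * T * T)) ≤ 1 := Real.exp_le_one_iff.2 (by have := hT.le; simp only [neg_nonpos]; positivity)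
  have hpc : p < c := by have := Real.exp_pos (-(K * T * T)); rw [hp]; linarith [mul_pos (half_pos hρ0) this]
  have hpρ : c - ρ < p := by rw [hp]; nlinarith
  refine ⟨p, hI a ha p (by linarith) hpc, fun α hα hpα => ?_⟩
  have hreg := H.reg α hα
  obtain ⟨_, -, -, -, -, hrange⟩ := H.range hα
  have hαc := hIc α hα
  have hle : ∀ t, 0 ≤ t → u α t < c := fun t ht => (hrange α hα le_rfl t ht).2.trans_lt hαc
  suffices hs : ∀ t ∈ Icc 0 T, c - ρ < u α t by
    have := hiF (u α T) (by linarith [hs T ⟨hT.le, le_rfl⟩]) (hle T hT.le)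
    exact this.trans_le (F_le_energy F (u α) (v α) T)
  intro t₀ ht₀
  by_contra! hcon
  obtain ⟨t, ht, hut, hin⟩ := exists_first_le (hreg.cont_u.mono fun x hx => hx.1) (by rw [hreg.u_zero]; linarith)
    ⟨t₀, ht₀, hcon⟩
  have ht0 := ht.1
  have hf : ∀ s ∈ Ioo 0 t, 0 < f (u α s) ∧ f (u α s) ≤ K * (c - u α s) := fun s hs => by
    have h1 := hin s (Ioo_subset_Ico_self hs)
    have h2 := hle s hs.1.le
    exact ⟨H.f_pos _ (hI a ha _ (by linarith) h2), hlip _ ⟨by linarith, h2⟩⟩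
  have hsub : Icc 0 t ⊆ Ici 0 := fun x hx => hx.1
  have hu := antiOn_Icc (hreg.cont_u.mono hsub) fun s hs => ⟨_, (hreg.traj.hasDerivAt hs.1).1,
    hreg.v_nonpos hs.1 fun x hx => (hf x ⟨hx.1, hx.2.trans hs.2⟩).1.le⟩
  have hv : ∀ s ∈ Ioo 0 t, -(K * T * (c - u α s)) ≤ v α s := by
    intro s hs
    have hA := mul_nonneg hK (sub_nonneg.2 (hle s hs.1.le).le)
    have h1 := hreg.neg_le_v hs.1 fun x hx => (hf x ⟨hx.1, hx.2.trans hs.2⟩).2.trans (mul_le_mul_of_nonneg_left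
      (sub_le_sub_left (hu ⟨hx.1.le, (hx.2.trans hs.2).le⟩ (Ioo_subset_Icc_self hs) hx.2.le) c) hK)
    have h2 := mul_le_mul (div_le_self hA (by linarith [n.cast_nonneg (α := ℝ)] : (1 : ℝ) ≤ n + 1))
      (hs.2.le.trans ht.2) hs.1.le hA
    linarith
  have hfin : AntitoneOn (fun s => (c - u α s) * Real.exp (-(K * T * s))) (Icc 0 t) := by
    refine antiOn_Icc ((continuousOn_const.sub (hreg.cont_u.mono hsub)).mul (by fun_prop)) fun s hs =>
      ⟨_, ((hreg.traj.hasDerivAt hs.1).1.const_sub c).mul (((hasDerivAt_id s).const_mul (K * T)).fun_neg.exp), ?_⟩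
    have := mul_nonneg (sub_nonneg.2 (hv s hs)) (Real.exp_pos (-(K * T * s))).le
    simp only [id]; linarith
  have h1 := hfin ⟨le_rfl, ht0.le⟩ ⟨ht0.le, le_rfl⟩ ht0.le
  simp only [mul_zero, neg_zero, Real.exp_zero, mul_one, hreg.u_zero] at h1
  have h2 : Real.exp (-(K * T * T)) ≤ Real.exp (-(K * T * t)) := Real.exp_le_exp.2 (by
    have := mul_le_mul_of_nonneg_left ht.2 (mul_nonneg hK hT.le)
    linarith)
  have h3 := Real.exp_pos (-(K * T * T))
  nlinarith

/-- The Pohozaev function and its derivative. -/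
theorem RegSol.hasDerivAt_pohozaev {u v : ℝ → ℝ} (h : RegSol n f α u v) {t : ℝ} (ht : 0 < t)
    (hF : HasDerivAt F (f (u t)) (u t)) :
    HasDerivAt (fun t => t ^ (n + 1) * energy F u v t + ((n : ℝ) - 1) / 2 * (t ^ n * v t * u t))
      (t ^ n * ((2 * (n + 1) * F (u t) - (n - 1) * u t * f (u t)) / 2)) t := by
  have h1 := (hasDerivAt_pow (n + 1) t).mul (h.traj.hasDerivAt_energy ht hF)
  have h2 := ((h.hasDerivAt_weighted ht).mul (h.traj.hasDerivAt ht).1).const_mul (((n : ℝ) - 1) / 2)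
  refine (h1.add h2).congr_deriv ?_
  simp only [energy, Nat.add_sub_cancel, pow_succ]; push_cast; field_simp; ring

/-- Under the growth condition, solutions starting high keep a large energy for a long time. -/
theorem Family.high_of_growth (H : Family n f F O I u v) (hI : ∀ a ∈ I, ∀ s, a ≤ s → s ∈ I) (hne : I.Nonempty)
    {Q : ℝ → ℝ} (hQ : ∀ s, Q s = 2 * (n + 1) * F s - (n - 1) * s * f s) {C θ : ℝ} (hC : 0 ≤ C)
    (hQC : ∀ s ∈ O, -C ≤ Q s) (hθ : θ ∈ Ioo 0 1)
    (hgr : ∀ B : ℝ, ∀ᶠ s in atTop, ∀ s₁ ∈ Icc (θ * s) s, ∀ s₂ ∈ Icc (θ * s) s,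
      B < Q s₂ * (s / f s₁) ^ (((n + 1 : ℕ) : ℝ) / 2))
    {lo hi : ℝ} (hlo : lo ∈ O) (hhi : hi ∈ O) (hlev : ∀ s ∈ O, F s ≤ e → s ∈ Icc lo hi) (hT : 0 < T) :
    ∃ p ∈ I, ∀ α ∈ I, p ≤ α → e < energy F (u α) (v α) T := by
  obtain ⟨a, ha⟩ := hne
  have ha0 := H.pos a ha
  obtain ⟨m, hm⟩ := isCompact_Icc.exists_bound_of_continuousOn (s := Icc lo hi) (f := F)
    fun x hx => (H.nl.deriv x (H.nl.icc_subset hlo hhi hx)).continuousAt.continuousWithinAt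
  set N : ℝ := ((n + 1 : ℕ) : ℝ) with hN
  have hN0 : 0 < N := by positivity
  set W := T ^ (n + 1) * |e| + |((n : ℝ) - 1) / 2| * (T ^ n * √(2 * (|e| + m)) * (|lo| + |hi|)) + C * T ^ n * T with hW
  set κ := (2 * N * (1 - θ)) ^ (N / 2) / (2 * N) with hκ
  have h2N : 0 < 2 * N * (1 - θ) := mul_pos (by positivity) (sub_pos.2 hθ.2)
  have hκ0 : 0 < κ := div_pos (Real.rpow_pos_of_pos h2N _) (by positivity)
  obtain ⟨s₀, hs₀⟩ := eventually_atTop.1 (hgr (max (W / κ) 0))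
  set p := max (max a s₀) ((|a| + |hi| + 1) / θ) with hp
  refine ⟨p, hI a ha p ((le_max_left _ _).trans (le_max_left _ _)), fun α hα hpα => ?_⟩
  by_contra! hcon
  have hreg := H.reg α hα
  have hα0 := H.pos α hα
  obtain ⟨_, -, -, -, -, hrange⟩ := H.range hα
  have hαθ : |a| + |hi| + 1 ≤ θ * α := by
    have := (le_max_right _ _).trans hpα
    rwa [div_le_iff₀' hθ.1] at this
  have hle : ∀ t, 0 ≤ t → u α t ≤ α := fun t ht => (hrange α hα le_rfl t ht).2
  have huT := hlev _ (H.mem α hα T hT.le) ((F_le_energy F (u α) (v α) T).trans hcon)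
  have huθ : u α T < θ * α := by linarith [huT.2, le_abs_self hi, abs_nonneg a]
  have hcu : ContinuousOn (u α) (Icc 0 T) := hreg.cont_u.mono fun x hx => hx.1
  have hθα : θ * α < α := by nlinarith [hθ.2]
  obtain ⟨t, ht, hut, hlt⟩ := exists_first_le hcu (by rwa [hreg.u_zero]) ⟨T, ⟨hT.le, le_rfl⟩, huθ.le⟩
  have ht0 := ht.1
  have hin : ∀ s ∈ Ioo 0 t, u α s ∈ Icc (θ * α) α := fun s hs => ⟨(hlt s (Ioo_subset_Ico_self hs)).le, hle s hs.1.le⟩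
  have hIcc : ∀ s ∈ Icc (θ * α) α, s ∈ I := fun s hs => hI a ha s (by linarith [hs.1, le_abs_self a, abs_nonneg hi])
  have hO : Icc (θ * α) α ⊆ O := fun s hs => H.sub (hIcc s hs)
  have hα' : s₀ ≤ α := ((le_max_right _ _).trans (le_max_left _ _)).trans hpα
  obtain ⟨s₁, hs₁, hmax⟩ := isCompact_Icc.exists_isMaxOn (nonempty_Icc.2 hθα.le) (H.nl.cont.mono hO)
  have hQc : ContinuousOn Q (Icc (θ * α) α) := by
    rw [funext hQ]
    have hFc : ContinuousOn F (Icc (θ * α) α) := fun x hx => (H.nl.deriv x (hO hx)).continuousAt.continuousWithinAt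
    exact (hFc.const_mul _).sub ((continuousOn_const.mul continuousOn_id).mul (H.nl.cont.mono hO))
  obtain ⟨s₂, hs₂, hmin⟩ := isCompact_Icc.exists_isMinOn (nonempty_Icc.2 hθα.le) hQc
  have hbig := hs₀ α hα' s₁ hs₁ s₂ hs₂
  have hf₁ : 0 < f s₁ := H.f_pos s₁ (hIcc s₁ hs₁)
  have hq : 0 < Q s₂ := by
    have h1 := (le_max_right (W / κ) 0).trans_lt hbig
    exact pos_of_mul_pos_left h1 (by positivity)
  -- the time needed to reach `θ α`
  have hv : ∀ s ∈ Ioo 0 t, -(f s₁ / N * s) ≤ v α s := by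
    intro s hs; rw [hN, Nat.cast_succ]
    exact hreg.neg_le_v hs.1 fun x hx => hmax (hin x ⟨hx.1, hx.2.trans hs.2⟩)
  have htime : 2 * N * (1 - θ) * (α / f s₁) ≤ t ^ 2 := by
    have h1 := monoOn_Icc ((hreg.cont_u.mono fun x hx => hx.1).add (by fun_prop :
      ContinuousOn (fun x => f s₁ / N * (x ^ 2 / 2)) (Icc 0 t))) (fun x hx => ⟨_, (hreg.traj.hasDerivAt hx.1).1.add
        (((hasDerivAt_pow 2 x).div_const 2).const_mul _), by have := hv x hx; norm_num; linarith⟩)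
      ⟨le_rfl, ht0.le⟩ ⟨ht0.le, le_rfl⟩ ht0.le
    simp only [Pi.add_apply, hreg.u_zero] at h1
    have h2 : (1 - θ) * α ≤ f s₁ / N * (t ^ 2 / 2) := by linarith
    have h3 : 2 * N * (1 - θ) * (α / f s₁) = 2 * N / f s₁ * ((1 - θ) * α) := by ring
    have h4 : t ^ 2 = 2 * N / f s₁ * (f s₁ / N * (t ^ 2 / 2)) := by field_simp
    rw [h3, h4]; gcongr
  have hpow : (2 * N * (1 - θ)) ^ (N / 2) * (α / f s₁) ^ (N / 2) ≤ t ^ (n + 1) := by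
    rw [← Real.mul_rpow h2N.le (by positivity)]
    refine (Real.rpow_le_rpow (by positivity) htime (by positivity)).trans (le_of_eq ?_)
    rw [← Real.rpow_natCast t 2, ← Real.rpow_mul ht0.le, ← Real.rpow_natCast t (n + 1)]
    congr 1
    rw [hN]; push_cast; ring
  set P := fun t => t ^ (n + 1) * energy F (u α) (v α) t + ((n : ℝ) - 1) / 2 * (t ^ n * v α t * u α t) with hP
  have hPd : ∀ x, 0 < x → HasDerivAt P (x ^ n * (Q (u α x) / 2)) x := fun x hx => by
    rw [hQ]; exact hreg.hasDerivAt_pohozaev hx (H.hasDerivAt_F hα hx.le)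
  have hPc : ContinuousOn P (Icc 0 T) := by
    refine ((continuous_pow _).continuousOn.mul ((H.continuousOn_energy hα).mono fun x hx => hx.1)).add
      (continuousOn_const.mul ((hreg.continuousOn_weighted n).mul hcu))
  have hPt : Q s₂ / (2 * N) * t ^ (n + 1) ≤ P t := by
    have h1 := monoOn_Icc ((hPc.mono (Icc_subset_Icc_right ht.2)).sub (by fun_prop :
      ContinuousOn (fun x => Q s₂ / (2 * N) * x ^ (n + 1)) (Icc 0 t))) (fun x hx => ⟨_, (hPd x hx.1).sub
        ((hasDerivAt_pow (n + 1) x).const_mul _), by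
          have : Q s₂ ≤ _ := hmin (hin x hx)
          have := mul_nonneg (pow_nonneg hx.1.le n) (sub_nonneg.2 this)
          rw [← hN, Nat.add_sub_cancel]; field_simp
          linarith⟩) ⟨le_rfl, ht0.le⟩ ⟨ht0.le, le_rfl⟩ ht0.le
    have h0 : P 0 = 0 := by simp [hP, hreg.v_zero]
    simp only [Pi.sub_apply, h0] at h1; simp at h1; linarith
  have hPT : P t - C * T ^ n * T ≤ P T := by
    have h1 := monoOn_Icc ((hPc.mono (Icc_subset_Icc_left ht0.le)).add (by fun_prop :
      ContinuousOn (fun x => C * T ^ n * x) (Icc t T))) (fun x hx => ⟨_, (hPd x (ht0.trans hx.1)).add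
        ((hasDerivAt_id x).const_mul _), by
          have hx0 := ht0.trans hx.1
          have h1 := hQC _ (H.mem α hα x hx0.le)
          have h2 : x ^ n ≤ T ^ n := pow_le_pow_left₀ hx0.le hx.2.le n
          have h3 := pow_pos hx0 n
          nlinarith⟩) ⟨le_rfl, ht.2⟩ ⟨ht.2, le_rfl⟩ ht.2
    simp only [Pi.add_apply] at h1
    have : 0 ≤ C * T ^ n * t := by positivity
    linarith
  have hPup : P T ≤ T ^ (n + 1) * |e| + |((n : ℝ) - 1) / 2| * (T ^ n * √(2 * (|e| + m)) * (|lo| + |hi|)) := by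
    have hvT : |v α T| ≤ √(2 * (|e| + m)) := by
      rw [← Real.sqrt_sq_eq_abs]
      refine Real.sqrt_le_sqrt ?_
      have h1 := (abs_le.1 (hm _ huT)).1
      rw [energy] at hcon; linarith [le_abs_self e]
    have huT' : |u α T| ≤ |lo| + |hi| := by
      rw [abs_le]; constructor
      · linarith [huT.1, neg_abs_le lo, abs_nonneg hi]
      · linarith [huT.2, le_abs_self hi, abs_nonneg lo]
    refine add_le_add (mul_le_mul_of_nonneg_left (hcon.trans (le_abs_self e)) (by positivity)) ?_
    refine (le_abs_self _).trans ?_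
    rw [abs_mul, abs_mul, abs_mul, abs_of_pos (pow_pos hT n)]; gcongr
  have h1 : W / κ * κ < Q s₂ * (α / f s₁) ^ (N / 2) * κ := mul_lt_mul_of_pos_right ((le_max_left _ _).trans_lt hbig) hκ0
  rw [div_mul_cancel₀ _ hκ0.ne'] at h1
  have h2 : Q s₂ * (α / f s₁) ^ (N / 2) * κ =
      Q s₂ / (2 * N) * ((2 * N * (1 - θ)) ^ (N / 2) * (α / f s₁) ^ (N / 2)) := by rw [hκ]; ring
  have h3 := mul_le_mul_of_nonneg_left hpow (by positivity : 0 ≤ Q s₂ / (2 * N))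
  linarith

end right

section shape
variable {f F : ℝ → ℝ} {O : Set ℝ} {δ a b s z g m : ℝ}

theorem Nonlin.strictMonoOn (H : Nonlin f F O) (hO : Icc a b ⊆ O) (hf : ∀ s ∈ Ioo a b, 0 < f s) : StrictMonoOn F (Icc a b) :=
  strictMonoOn_of_deriv_pos (convex_Icc _ _) (fun x hx => (H.deriv x (hO hx)).continuousAt.continuousWithinAt) fun x hx => by
      rw [(H.deriv x (hO (interior_subset hx))).deriv]; rw [interior_Icc] at hx; exact hf x hx

theorem Nonlin.strictAntiOn (H : Nonlin f F O) (hO : Icc a b ⊆ O) (hf : ∀ s ∈ Ioo a b, f s < 0) : StrictAntiOn F (Icc a b) :=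
  strictAntiOn_of_deriv_neg (convex_Icc _ _) (fun x hx => (H.deriv x (hO hx)).continuousAt.continuousWithinAt) fun x hx => by
      rw [(H.deriv x (hO (interior_subset hx))).deriv]; rw [interior_Icc] at hx; exact hf x hx

theorem Nonlin.contF (H : Nonlin f F O) (hO : Icc a b ⊆ O) : ContinuousOn F (Icc a b) := fun x hx =>
  (H.deriv x (hO hx)).continuousAt.continuousWithinAt

theorem Nonlin.exists_interior_max (H : Nonlin f F O) (hO : Icc a b ⊆ O) (hs : s ∈ Ioo a b) (ha : F a < F s)
    (hb : F b ≤ F s) : ∃ z ∈ Ioo a b, IsLocalMax F z ∧ F s ≤ F z := by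
  obtain ⟨z, hz, hmax⟩ := isCompact_Icc.exists_isMaxOn ⟨s, Ioo_subset_Icc_self hs⟩ (H.contF hO)
  by_cases h : z ∈ Ioo a b
  · exact ⟨z, h, hmax.isLocalMax (Icc_mem_nhds h.1 h.2), (hmax (Ioo_subset_Icc_self hs))⟩
  · have hzs : F z ≤ F s := by grind
    refine ⟨s, hs, ?_, le_rfl⟩
    filter_upwards [Icc_mem_nhds hs.1 hs.2] with w hw using (hmax hw).trans hzs

/-- The shape of the potential `F` that is common to both ends: it is negative close to `0`, and
further away `f` has finitely many zeros, at all of which it changes sign. -/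
structure Shape (f F : ℝ → ℝ) (O : Set ℝ) (δ : ℝ) : Prop where
  nl : Nonlin f F O
  pos : 0 < δ
  F_neg : ∀ s ∈ O, 0 < |s| → |s| < δ → F s < 0
  fin : {z | z ∈ O ∧ δ < |z| ∧ f z = 0}.Finite
  sign : ∀ z ∈ O, δ < |z| → f z = 0 → ChangesSignAt f z

theorem Shape.neg (P : Shape f F O δ) : Shape (fun s => -f (-s)) (fun s => F (-s)) (Neg.neg ⁻¹' O) δ where
  nl := P.nl.neg
  pos := P.pos
  F_neg s hs h1 h2 := P.F_neg (-s) hs (by rwa [abs_neg]) (by rwa [abs_neg])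
  fin := (P.fin.image Neg.neg).subset fun z hz =>
    ⟨-z, ⟨hz.1, by rw [abs_neg]; exact hz.2.1, neg_eq_zero.1 hz.2.2⟩, neg_neg z⟩
  sign z hz h1 h2 := by
    obtain ⟨ε, hε, h⟩ := P.sign (-z) hz (by rwa [abs_neg]) (neg_eq_zero.1 h2)
    refine ⟨ε, hε, fun s hs t ht => ?_⟩
    linarith [h (-t) ⟨by linarith [ht.2], by linarith [ht.1]⟩ (-s) ⟨by linarith [hs.2], by linarith [hs.1]⟩]

theorem Shape.nonpos (P : Shape f F O δ) (hs : s ∈ O) (h : |s| ≤ δ) : F s ≤ 0 := by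
  rcases eq_or_ne s 0 with rfl | h0
  · exact P.nl.F_zero.le
  have hd := (P.nl.deriv s hs).continuousAt
  refine le_of_tendsto (by have : ContinuousAt (fun t : ℝ => F (t * s)) 1 := ContinuousAt.comp (f := fun t : ℝ => t * s) (g := F) (by simpa using hd) (by fun_prop); have h := this.tendsto.mono_left (nhdsWithin_le_nhds (s := Iio 1)); simpa using h) ?_
  filter_upwards [Ioo_mem_nhdsLT (one_pos)] with t ht
  have hs0 := abs_pos.2 h0
  have e : |t * s| = t * |s| := by grind
  have hm : t * s ∈ O := by
    rcases lt_or_gt_of_ne h0 with h' | h'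
    · exact P.nl.icc_subset hs P.nl.zero_mem ⟨by nlinarith [ht.2], by nlinarith [ht.1]⟩
    · exact P.nl.icc_subset P.nl.zero_mem hs ⟨by nlinarith [ht.1], by nlinarith [ht.2]⟩
  exact (P.F_neg _ hm (by rw [e]; exact mul_pos ht.1 hs0) (by rw [e]; nlinarith [ht.2])).le

theorem Shape.lt_abs (P : Shape f F O δ) (hs : s ∈ O) (h : 0 < F s) : δ < |s| := by
  by_contra! hc
  linarith [P.nonpos hs hc]

theorem Shape.sides (P : Shape f F O δ) (hz : z ∈ O) (hδ : δ < |z|) (hf : f z = 0) : ∃ ε > 0, Icc (z - ε) (z + ε) ⊆ O ∧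
      ((StrictMonoOn F (Icc (z - ε) z) ∧ StrictAntiOn F (Icc z (z + ε))) ∨
      (StrictAntiOn F (Icc (z - ε) z) ∧ StrictMonoOn F (Icc z (z + ε)))) := by
  obtain ⟨ε, hε, h⟩ := P.sign z hz hδ hf
  obtain ⟨ε', hε', h'⟩ := Metric.nhds_basis_closedBall.mem_iff.1 (P.nl.isOpen.mem_nhds hz)
  rw [Real.closedBall_eq_Icc] at h'
  set r := min ε ε' with hr
  have hr0 := lt_min hε hε'
  have h1 : r ≤ ε := min_le_left _ _
  have hsub : Icc (z - r) (z + r) ⊆ O := by grind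
  have hl : Icc (z - r) z ⊆ O := by grind
  have hrr : Icc z (z + r) ⊆ O := by grind
  have hp : ∀ s ∈ Ioo (z - r) z, ∀ t ∈ Ioo z (z + r), f s * f t < 0 := by grind
  have hs₀ : z - r / 2 ∈ Ioo (z - r) z := by grind
  have ht₀ : z + r / 2 ∈ Ioo z (z + r) := by grind
  refine ⟨r, hr0, hsub, ?_⟩
  rcases mul_neg_iff.1 (hp _ hs₀ _ ht₀) with ⟨k1, k2⟩ | ⟨k1, k2⟩
  · left
    refine ⟨P.nl.strictMonoOn hl fun s hs => ?_, P.nl.strictAntiOn hrr fun t ht => ?_⟩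
    · exact pos_of_mul_neg_left (hp s hs _ ht₀) k2.le
    · exact neg_of_mul_neg_right (hp _ hs₀ t ht) k1.le
  · right
    refine ⟨P.nl.strictAntiOn hl fun s hs => ?_, P.nl.strictMonoOn hrr fun t ht => ?_⟩
    · exact neg_of_mul_neg_left (hp s hs _ ht₀) k2.le
    · exact pos_of_mul_neg_right (hp _ hs₀ t ht) k1.le

theorem Shape.peak_cases_pos (P : Shape f F O δ) (hs : s ∈ O) (h0 : 0 < s) (hf : f s = 0) (hF : 0 ≤ F s)
    (hle : ∀ w ∈ Icc 0 s, F w ≤ F s) :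
    (∃ ρ > 0, ρ < s ∧ Icc (s - ρ) (s + ρ) ⊆ O ∧ ∀ w ∈ Icc (s - ρ) (s + ρ), w ≠ s → F w < F s) ∨
      F s = 0 ∧ ∃ ω, Notch f F O s ω := by
  have hδs : δ ≤ s := by
    by_contra! hc
    exact hF.not_gt (P.F_neg s hs (by rwa [abs_of_pos h0]) (by rwa [abs_of_pos h0]))
  rcases hδs.eq_or_lt with rfl | hlt
  · have hF0 := le_antisymm (P.nonpos hs (abs_of_pos h0).le) hF
    have hneg : ∀ w ∈ Ioo 0 δ, F w < 0 := fun w hw =>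
      P.F_neg w (P.nl.icc_subset P.nl.zero_mem hs ⟨hw.1.le, hw.2.le⟩) (by rw [abs_of_pos hw.1]; exact hw.1)
        (by rw [abs_of_pos hw.1]; exact hw.2)
    obtain ⟨ε, hε, hεO⟩ := Metric.nhds_basis_closedBall.mem_iff.1 (P.nl.isOpen.mem_nhds hs)
    rw [Real.closedBall_eq_Icc] at hεO
    obtain ⟨x, hx, hxz⟩ : ∃ x > δ, ∀ w ∈ Ioc δ x, w ∈ O → f w ≠ 0 := by
      have : ∀ᶠ w in 𝓝[>] δ, w ∉ {z | z ∈ O ∧ δ < |z| ∧ f z = 0} := by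
        refine nhdsWithin_le_nhds (P.fin.isClosed.isOpen_compl.mem_nhds ?_)
        simp [abs_of_pos h0]
      obtain ⟨x, hx, hxs⟩ := mem_nhdsGT_iff_exists_Ioc_subset.1 this
      exact ⟨x, hx, fun w hw hwO e => hxs hw ⟨hwO, by rw [abs_of_pos (h0.trans hw.1)]; exact hw.1, e⟩⟩
    set r := min (min ε (x - δ)) (δ / 2) with hr
    have hr0 := lt_min (lt_min hε (sub_pos.2 hx)) (half_pos h0)
    have r1 : r ≤ ε := (min_le_left _ _).trans (min_le_left _ _)
    have r2 : r ≤ x - δ := (min_le_left _ _).trans (min_le_right _ _)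
    have r3 : r ≤ δ / 2 := min_le_right _ _
    have hsub : Icc (δ - r) (δ + r) ⊆ O := (Icc_subset_Icc (by linarith) (by linarith)).trans hεO
    have hrO : Icc δ (δ + r) ⊆ O := (Icc_subset_Icc_left (by linarith)).trans hsub
    have hne : ∀ w ∈ Ioc δ (δ + r), f w ≠ 0 := fun w hw => hxz w ⟨hw.1, by linarith [hw.2]⟩ (hrO ⟨hw.1.le, hw.2⟩)
    have hsgn : ∀ w ∈ Ioc δ (δ + r), ∀ w' ∈ Ioc δ (δ + r), f w < 0 → f w' < 0 := by
      intro w hw w' hw' h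
      by_contra! hc
      have hsub' := OrdConnected.uIcc_subset ordConnected_Ioc hw hw'
      obtain ⟨y, hy, hy0⟩ := intermediate_value_uIcc (P.nl.cont.mono ((hsub'.trans Ioc_subset_Icc_self).trans hrO))
        (mem_uIcc.2 (Or.inl ⟨h.le, hc⟩))
      exact hne y (hsub' hy) hy0
    have hrI : δ + r ∈ Ioc δ (δ + r) := ⟨by linarith, le_rfl⟩
    by_cases hcase : f (δ + r) < 0
    · left
      refine ⟨r, hr0, by linarith, hsub, fun w hw hne => ?_⟩
      rw [hF0]
      rcases lt_or_gt_of_ne hne with h | h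
      · exact hneg w ⟨by linarith [hw.1], h⟩
      · have := P.nl.strictAntiOn hrO (fun y hy => hsgn _ hrI y (Ioo_subset_Ioc_self hy) hcase)
          ⟨le_rfl, by linarith⟩ ⟨h.le, hw.2⟩ h
        rwa [hF0] at this
    · right
      refine ⟨hF0, r, h0, hr0, ?_, hF0, hneg, fun w hw => ?_⟩
      · exact P.nl.icc_subset P.nl.zero_mem (hrO ⟨by linarith, le_rfl⟩)
      · grind
  · left
    obtain ⟨ε, hε, hsub, ⟨h1, h2⟩ | ⟨h1, -⟩⟩ := P.sides hs (by rwa [abs_of_pos h0]) hf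
    · have hm : min ε (s / 2) ≤ ε := min_le_left _ _
      refine ⟨min ε (s / 2), lt_min hε (half_pos h0), (min_le_right _ _).trans_lt (half_lt_self h0),
        (Icc_subset_Icc (by linarith) (by linarith)).trans hsub, fun w hw hne => ?_⟩
      rcases lt_or_gt_of_ne hne with h | h
      · exact h1 ⟨by linarith [hw.1], h.le⟩ ⟨by linarith, le_rfl⟩ h
      · exact h2 ⟨le_rfl, by linarith⟩ ⟨h.le, by linarith [hw.2]⟩ h
    · have hx : max (s - ε) 0 < s := max_lt (by linarith) h0
      exact absurd (hle _ ⟨le_max_right _ _, hx.le⟩) (not_le.2 (h1 ⟨le_max_left _ _, hx.le⟩ ⟨by linarith, le_rfl⟩ hx))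

theorem Shape.peak_cases (P : Shape f F O δ) (hs : s ∈ O) (h0 : s ≠ 0) (hf : f s = 0) (hF : 0 ≤ F s)
    (hle : ∀ w ∈ uIcc 0 s, F w ≤ F s) :
    (∃ ρ > 0, ρ < |s| ∧ Icc (s - ρ) (s + ρ) ⊆ O ∧ ∀ w ∈ Icc (s - ρ) (s + ρ), w ≠ s → F w < F s) ∨
      F s = 0 ∧ ∃ ω, Notch f F O s ω ∨ Notch (fun s => -f (-s)) (fun s => F (-s)) (Neg.neg ⁻¹' O) (-s) ω := by
  rcases lt_or_gt_of_ne h0 with h | h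
  · rw [uIcc_of_ge h.le] at hle
    rcases P.neg.peak_cases_pos (s := -s) (by simpa using hs) (by linarith) (by simpa using hf) (by simpa using hF)
      (fun w hw => by simpa using hle (-w) ⟨by linarith [hw.2], by linarith [hw.1]⟩) with
      ⟨ρ, hρ, h1, h2, h3⟩ | ⟨h1, ω, h2⟩
    · refine Or.inl ⟨ρ, hρ, by rwa [abs_of_neg h], fun w hw => ?_, fun w hw hne => ?_⟩
      · simpa using (h2 (show -w ∈ _ from ⟨by linarith [hw.2], by linarith [hw.1]⟩))
      · simpa using (h3 (-w) ⟨by linarith [hw.2], by linarith [hw.1]⟩ (fun e => hne (neg_injective e)))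
    · grind
  · rw [uIcc_of_le h.le] at hle
    rcases P.peak_cases_pos hs h hf hF hle with h' | ⟨h1, ω, h2⟩
    · rw [abs_of_pos h]; exact Or.inl h'
    · grind

theorem Shape.isLocalMax_right (P : Shape f F O δ) (hz : z ∈ O) (hF : 0 < F z) (hm : IsLocalMax F z) :
    ∃ ε > 0, ∀ w ∈ Ioc z (z + ε), F w < F z := by
  obtain ⟨ε, hε, hsub, ⟨-, h⟩ | ⟨-, h⟩⟩ := P.sides hz (P.lt_abs hz hF) (hm.hasDerivAt_eq_zero (P.nl.deriv z hz))
  · exact ⟨ε, hε, fun w hw => h ⟨le_rfl, by linarith⟩ ⟨hw.1.le, hw.2⟩ hw.1⟩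
  · obtain ⟨w, h1, h2⟩ := ((hm.filter_mono nhdsWithin_le_nhds).and (Ioc_mem_nhdsGT (lt_add_of_pos_right z hε))).exists
    exact absurd (h ⟨le_rfl, by linarith⟩ ⟨h2.1.le, h2.2⟩ h2.1) (not_lt.2 h1)

/-- `m` is the end of the chain of successive least elements of `S` starting at `g`. -/
def PeakEnd (S : ℝ → Set ℝ) (g m : ℝ) : Prop :=
  ∃ (M : ℕ) (γ : ℕ → ℝ), γ 0 = g ∧ (∀ i < M, IsLeast (S (γ i)) (γ (i + 1))) ∧ S (γ M) = ∅ ∧ γ M = m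

theorem PeakEnd.unique {S : ℝ → Set ℝ} {m' : ℝ} (h : PeakEnd S g m) (h' : PeakEnd S g m') : m = m' := by
  obtain ⟨M, γ, h0, h1, h2, rfl⟩ := h
  obtain ⟨M', γ', h0', h1', h2', rfl⟩ := h'
  have key : ∀ i, i ≤ M → i ≤ M' → γ i = γ' i := by
    intro i
    induction i with
    | zero => intros; rw [h0, h0']
    | succ i ih =>
      intro hi hi'
      have := h1' i (by omega)
      rw [← ih (by omega) (by omega)] at this
      exact (h1 i (by omega)).unique this
  rcases lt_trichotomy M M' with h | h | h
  · have := h1' M h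
    rw [← key M le_rfl h.le, h2] at this; exact absurd this.1 (notMem_empty _)
  · subst h; exact key M le_rfl le_rfl
  · have := h1 M' h
    rw [key M' h.le le_rfl, h2'] at this; exact absurd this.1 (notMem_empty _)

theorem Shape.exists_peakEnd (P : Shape f F O δ) {S : ℝ → Set ℝ}
    (hS : ∀ g, 0 ≤ g → ∀ s, s ∈ S g ↔ s ∈ O ∧ g < s ∧ IsLocalMax F s ∧ F g < F s) (N : ℕ) :
    ∀ g ∈ O, 0 ≤ g → 0 ≤ F g → (S g).ncard ≤ N → ∃ m ∈ O, PeakEnd S g m ∧ g ≤ m ∧ S m = ∅ ∧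
      (∀ s ∈ Ico g m, F s < F m) ∧ (m = g ∨ IsLocalMax F m ∧ F g < F m) := by
  have hfin : ∀ g, 0 ≤ g → 0 ≤ F g → (S g).Finite := fun g hg hFg => P.fin.subset fun s hs => by
    obtain ⟨h1, -, h3, h4⟩ := (hS g hg s).1 hs
    exact ⟨h1, P.lt_abs h1 (hFg.trans_lt h4), h3.hasDerivAt_eq_zero (P.nl.deriv s h1)⟩
  induction N with
  | zero =>
    intro g hgO hg hFg hN
    have := (ncard_eq_zero (hfin g hg hFg)).1 (by omega)
    exact ⟨g, hgO, ⟨0, fun _ => g, rfl, by simp, this, rfl⟩, le_rfl, this, fun s hs => absurd hs.2 (not_lt.2 hs.1), Or.inl rfl⟩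
  | succ N ih =>
    intro g hgO hg hFg hN
    rcases (S g).eq_empty_or_nonempty with he | hne
    · exact ⟨g, hgO, ⟨0, fun _ => g, rfl, by simp, he, rfl⟩, le_rfl, he, fun s hs => absurd hs.2 (not_lt.2 hs.1), Or.inl rfl⟩
    obtain ⟨g₁, hg₁⟩ : ∃ g₁, IsLeast (S g) g₁ := (hfin g hg hFg).isCompact.exists_isLeast hne
    obtain ⟨k1, k2, k3, k4⟩ := (hS g hg g₁).1 hg₁.1
    have hlt := ncard_lt_ncard ⟨fun s hs => by
      obtain ⟨j1, j2, j3, j4⟩ := (hS g₁ (hg.trans k2.le) s).1 hs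
      exact (hS g hg s).2 ⟨j1, k2.trans j2, j3, k4.trans j4⟩, fun hsub => lt_irrefl _
        ((hS g₁ (hg.trans k2.le) g₁).1 (hsub hg₁.1)).2.1⟩ (hfin g hg hFg)
    obtain ⟨m, hmO, ⟨M, γ, h0, h1, h2, h3⟩, hle, hempty, hbelow, hor⟩ := ih g₁ k1 (hg.trans k2.le) (by linarith) (by omega)
    have hFm : F g₁ ≤ F m := by grind
    refine ⟨m, hmO, ⟨M + 1, fun i => Nat.casesOn i g γ, rfl, fun i hi => ?_, h2, h3⟩, k2.le.trans hle, hempty,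
      fun s hs => ?_, Or.inr ⟨?_, by linarith⟩⟩
    · cases i with
      | zero => show IsLeast (S g) (γ 0); rw [h0]; exact hg₁
      | succ i => exact h1 i (by omega)
    · rcases lt_or_ge s g₁ with h | h
      · refine lt_of_lt_of_le ?_ hFm
        by_contra! hc
        have hgs : g < s := by grind
        obtain ⟨z, hz, hz1, hz2⟩ := P.nl.exists_interior_max (P.nl.icc_subset hgO k1) ⟨hgs, h⟩ (by linarith) hc
        exact (hg₁.2 ((hS g hg z).2 ⟨P.nl.icc_subset hgO k1 (Ioo_subset_Icc_self hz), hz.1, hz1, by linarith⟩)).not_gt hz.2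
      · exact hbelow s ⟨h, hs.2⟩
    · grind

end shape

section profile
variable {n : ℕ} {f F : ℝ → ℝ} {O I : Set ℝ} {u v : ℝ → ℝ → ℝ} {δ b m β ℓ ℓ' bm bp α c : ℝ} {L : EReal}

theorem Nonlin.first_level (H : Nonlin f F O) (hb : b ∈ O) (h0 : 0 < b) (hℓ : 0 < ℓ) (hF : ℓ < F b) :
    ∃ p ∈ Ioc 0 b, F p = ℓ ∧ ∀ s ∈ Ico 0 p, F s < ℓ := by
  have hc := H.contF (H.icc_subset H.zero_mem hb)
  obtain ⟨p, ⟨hp, hpF⟩, hmin⟩ := (isCompact_Icc.of_isClosed_subset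
    (hc.preimage_isClosed_of_isClosed isClosed_Icc (isClosed_singleton))
    inter_subset_left).exists_isLeast (by
      obtain ⟨y, hy, hyF⟩ := intermediate_value_Icc h0.le hc ⟨by rw [H.F_zero]; exact hℓ.le, hF.le⟩
      exact ⟨y, hy, hyF⟩)
  have hp0 : p ≠ 0 := by
    rintro rfl
    have : F 0 = ℓ := hpF
    linarith [H.F_zero]
  refine ⟨p, ⟨lt_of_le_of_ne hp.1 hp0.symm, hp.2⟩, hpF, fun s hs => ?_⟩
  by_contra! hge
  obtain ⟨y, hy, hyF⟩ := intermediate_value_Icc hs.1 (hc.mono (Icc_subset_Icc_right (hs.2.le.trans hp.2)))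
    ⟨by rw [H.F_zero]; exact hℓ.le, hge⟩
  exact (hmin ⟨⟨hy.1, hy.2.trans (hs.2.le.trans hp.2)⟩, hyF⟩).not_gt (hy.2.trans_lt hs.2)

/-- The interval `(bm, bp)` is the component of `{F < ℓ}` that contains `0`. -/
structure Well (F : ℝ → ℝ) (O : Set ℝ) (ℓ bm bp : ℝ) : Prop where
  bm_neg : bm < 0
  bp_pos : 0 < bp
  bm_mem : bm ∈ O
  bp_mem : bp ∈ O
  F_bm : F bm = ℓ
  F_bp : F bp = ℓ
  below : ∀ s ∈ Ioo bm bp, F s < ℓ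

/-- A potential of the given shape that tends to its strict supremum `L` at both ends of `O`, and has
a positive peak. -/
structure Profile (f F : ℝ → ℝ) (O : Set ℝ) (δ : ℝ) (L : EReal) : Prop where
  shape : Shape f F O δ
  lt : ∀ s ∈ O, (F s : EReal) < L
  low : ∀ e : ℝ, (e : EReal) < L → ∃ lo ∈ O, lo < 0 ∧ ∀ s ∈ O, s ≤ lo → e < F s
  high : ∀ e : ℝ, (e : EReal) < L → ∃ hi ∈ O, 0 < hi ∧ ∀ s ∈ O, hi ≤ s → e < F s

theorem Profile.exists_well (P : Profile f F O δ L) (hℓ : 0 < ℓ) (hL : (ℓ : EReal) < L) : ∃ bm bp, Well F O ℓ bm bp := by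
  have H := P.shape.nl
  obtain ⟨hi, h1, h2, h3⟩ := P.high ℓ hL
  obtain ⟨lo, l1, l2, l3⟩ := P.low ℓ hL
  obtain ⟨p, hp, hpF, hpb⟩ := H.first_level h1 h2 hℓ (h3 hi h1 le_rfl)
  obtain ⟨q, hq, hqF, hqb⟩ := H.neg.first_level (b := -lo) (by simpa using l1) (by linarith) hℓ
    (by simpa using l3 lo l1 le_rfl)
  refine ⟨-q, p, by linarith [hq.1], hp.1, H.icc_subset l1 H.zero_mem ⟨by linarith [hq.2], by linarith [hq.1]⟩,
    H.icc_subset H.zero_mem h1 ⟨hp.1.le, hp.2⟩, hqF, hpF, fun s hs => ?_⟩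
  rcases le_total 0 s with h | h
  · exact hpb s ⟨h, hs.2⟩
  · simpa using hqb (-s) ⟨by linarith, by linarith [hs.1]⟩

/-- The positive critical values of the potential. -/
def critValues (f F : ℝ → ℝ) (O : Set ℝ) : Set ℝ := F '' {z | z ∈ O ∧ f z = 0 ∧ 0 < F z}

theorem Shape.finite_critValues (P : Shape f F O δ) : (critValues f F O).Finite :=
  (P.fin.subset fun _ hz => ⟨hz.1, P.lt_abs hz.1 hz.2.2, hz.2.1⟩).image F

theorem Well.slab (W : Well F O ℓ bm bp) (H : Nonlin f F O) (h0 : 0 ≤ ℓ') (hlt : ℓ' < ℓ)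
    (h : ∀ x ∈ critValues f F O, ℓ' < x → ℓ ≤ x) : Slab f F O ℓ' ℓ bm bp where
  nn := h0
  lt := hlt
  bm_neg := W.bm_neg
  bp_pos := W.bp_pos
  bm_mem := W.bm_mem
  bp_mem := W.bp_mem
  F_bm := W.F_bm
  F_bp := W.F_bp
  below := W.below
  crit s hs hf := by
    by_contra! hc
    exact (h _ ⟨s, ⟨H.icc_subset W.bm_mem W.bp_mem (Ioo_subset_Icc_self hs), hf, h0.trans_lt hc⟩, rfl⟩ hc).not_gt
      (W.below s hs)

theorem Shape.exists_level_below (P : Shape f F O δ) (hℓ : 0 < ℓ) :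
    ∃ ℓ', 0 ≤ ℓ' ∧ ℓ' < ℓ ∧ (∀ x ∈ critValues f F O, ℓ' < x → ℓ ≤ x) ∧ (ℓ' = 0 ∨ ℓ' ∈ critValues f F O) := by
  obtain ⟨x, hx, hmax⟩ := ((P.finite_critValues.inter_of_left (Iio ℓ)).insert 0).isCompact.exists_isGreatest
    ⟨0, mem_insert _ _⟩
  have hx' : x < ℓ ∧ (x = 0 ∨ x ∈ critValues f F O) := by grind
  refine ⟨x, hmax (mem_insert _ _), hx'.1, fun y hy hxy => ?_, hx'.2⟩
  by_contra! hc
  exact (hmax (mem_insert_of_mem _ ⟨hy, hc⟩)).not_gt hxy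

theorem Shape.exists_level_above (P : Shape f F O δ) (hL : (ℓ : EReal) < L) :
    ∃ ℓ', ℓ < ℓ' ∧ (ℓ' : EReal) < L ∧ ∀ x ∈ critValues f F O, ℓ < x → ℓ' ≤ x := by
  obtain ⟨y, hy1, hy2⟩ := EReal.lt_iff_exists_real_btwn.1 hL
  have hy1 : ℓ < y := by exact_mod_cast hy1
  obtain ⟨x, hx, hmin⟩ := ((P.finite_critValues.inter_of_left (Ioi ℓ)).insert y).isCompact.exists_isLeast ⟨y, mem_insert _ _⟩
  refine ⟨x, ?_, (EReal.coe_le_coe_iff.2 (hmin (mem_insert _ _))).trans_lt hy2,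
    fun z hz hlz => hmin (mem_insert_of_mem _ ⟨hz, hlz⟩)⟩
  grind

theorem Shape.strict_peak (P : Shape f F O δ) {s : ℝ} (hs : s ∈ O) (hf : f s = 0) (hF : 0 < F s)
    (hle : ∀ w ∈ uIcc 0 s, F w ≤ F s) :
    ∃ ρ > 0, ρ < |s| ∧ Icc (s - ρ) (s + ρ) ⊆ O ∧ ∀ w ∈ Icc (s - ρ) (s + ρ), w ≠ s → F w < F s := by
  exact (P.peak_cases hs (by rintro rfl; linarith [P.nl.F_zero]) hf hF.le hle).resolve_right fun h => by linarith

theorem Shape.no_limit_path (P : Shape f F O δ) (H : Family n f F O I u v) (hn : 1 ≤ n) {s : ℝ} (hs : s ∈ O)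
    (h0 : s ≠ 0) (hf : f s = 0) (hF : F s = 0) (hle : ∀ w ∈ uIcc 0 s, F w ≤ 0) (hα : α ∈ I)
    (hal : ∀ t, 0 ≤ t → u α t ≠ 0 ∨ v α t ≠ 0)
    (hlim : ∀ η > 0, ∀ᶠ t in atTop, |u α t - s| < η ∧ energy F (u α) (v α) t < η / t) (σ : ℝ)
    (hz : ∀ T > 0, ∀ᶠ τ in 𝓝[>] (0 : ℝ), α + σ * τ ∈ I ∧ ∃ z > T, u (α + σ * τ) z = 0 ∧ v (α + σ * τ) z ≠ 0) :
    False := by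
  rcases P.peak_cases hs h0 hf hF.ge (by rwa [hF]) with ⟨ρ, hρ, hρs, hsub, hmax⟩ | ⟨-, ω, hN⟩
  · obtain ⟨η, hη, h⟩ := near_max hn P.nl hρ hsub hmax one_pos
    obtain ⟨T, ⟨h1, h2⟩, hT⟩ := ((hlim η hη).and (eventually_ge_atTop 1)).exists
    obtain ⟨t1, -, t2⟩ := H.tendsto hα (zero_le_one.trans hT) fun t ht => hal t ht.1
    have hlin : Tendsto (fun τ => α + σ * τ) (𝓝[>] 0) (𝓝 α) := by
      have : ContinuousAt (fun τ : ℝ => α + σ * τ) 0 := by fun_prop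
      simpa using this.tendsto.mono_left (nhdsWithin_le_nhds)
    have e1 := hlin.eventually (t1.eventually (Metric.isOpen_ball.mem_nhds (by rwa [Metric.mem_ball, Real.dist_eq])))
    obtain ⟨τ, ⟨k1, k2⟩, hI, z, hzT, hu, -⟩ := ((e1.and (hlin.eventually (t2.eventually (Iio_mem_nhds h2)))).and (hz T (by linarith))).exists
    have := h _ _ (H.reg _ hI).traj T hT z hzT.le k1 (by rw [hF, sub_zero]; exact k2)
      (fun r hr => H.mem _ hI r (by linarith [hr.1])) (by rw [energy, hu, H.nl.F_zero, hF]; positivity) z ⟨hzT.le, le_rfl⟩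
    grind
  · exact H.no_path hn hα hal hlim hz hN

theorem Profile.descent (P : Profile f F O δ L) (H : Family n f F O I u v) (hn : 1 ≤ n)
    (hhigh : ∀ T > 0, ∀ e : ℝ, (e : EReal) < L → ∃ p ∈ I, ∀ α ∈ I, p ≤ α → e < energy F (u α) (v α) T)
    (hc : c ∈ I) {ℓ₁ : ℝ}
    (hu : ∀ ℓ bm bp, ℓ ≤ ℓ₁ → Well F O ℓ bm bp → ∀ α ∈ I, α ≤ c → ¬ Under F u v ℓ bm bp α) :
    ∀ (N : ℕ) (ℓ bm bp α : ℝ), ℓ ≤ ℓ₁ → 0 < ℓ → (ℓ : EReal) < L → Well F O ℓ bm bp → α ∈ I →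
      Under F u v ℓ bm bp α → (critValues f F O ∩ Iio ℓ).ncard ≤ N →
    ∃ k₀ : ℕ, ∀ k ≥ k₀, ∃ x₁ ∈ I, ∃ x₂ ∈ I, c < x₁ ∧ x₁ < x₂ ∧
      (HasExactlySignChanges (u x₁) k ∧ Tendsto (u x₁) atTop (𝓝 0)) ∧
      (HasExactlySignChanges (u x₂) k ∧ Tendsto (u x₂) atTop (𝓝 0)) := by
  intro N
  induction N with
  | zero => ?_
  | succ N ih => ?_
  all_goals
    intro ℓ bm bp α hℓ₁ hℓ hL W hα hU hN
    obtain ⟨ℓ', h0, hlt, hcrit, hor⟩ := P.shape.exists_level_below hℓ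
    have S := W.slab P.shape.nl h0 hlt hcrit
    obtain ⟨J, G, hleft⟩ := H.exists_good S (fun T hT e he => hhigh T hT e ((EReal.coe_lt_coe_iff.2 he).trans hL)) hα hU
    have hcα : c ≤ α := le_of_not_ge fun h => hu ℓ bm bp hℓ₁ W α hα h hU
    have hleft := hleft ⟨c, hc, hcα, hu ℓ bm bp hℓ₁ W c hc le_rfl⟩
    have hcJ : ∀ x ∈ J, c < x := fun x hx => lt_of_not_ge fun h => hu ℓ bm bp hℓ₁ W x (G.sub hx) h (G.under x hx)
    rcases hor with rfl | hV
  rotate_left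
  · have : ℓ' ∈ critValues f F O ∩ Iio ℓ := ⟨hV, hlt⟩
    rw [Nat.le_zero, ncard_eq_zero (P.shape.finite_critValues.inter_of_left _)] at hN; rw [hN] at this
    exact absurd this (notMem_empty _)
  rotate_left
  · have hpos : 0 < ℓ' := by
      obtain ⟨z, hz, rfl⟩ := hV
      exact hz.2.2
    have hL' : (ℓ' : EReal) < L := (EReal.coe_lt_coe_iff.2 hlt).trans hL
    obtain ⟨bm', bp', W'⟩ := P.exists_well hpos hL'
    obtain ⟨α', hα', hU'⟩ := G.descend H S hn hpos W'.bm_neg W'.bp_pos W'.F_bm W'.F_bp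
      (fun s hs hf hF hle => P.shape.strict_peak hs hf (hF ▸ hpos) hle)
      (G.exists_low H S hn ⟨0, ⟨W.bm_neg, W.bp_pos⟩, by rwa [H.nl.F_zero]⟩)
    refine ih ℓ' bm' bp' α' (hlt.le.trans hℓ₁) hpos hL' W' (G.sub hα') hU' (Nat.lt_succ_iff.1
      (lt_of_lt_of_le (ncard_lt_ncard ?_ (P.shape.finite_critValues.inter_of_left _)) hN))
    exact ⟨fun x hx => ⟨hx.1, lt_trans hx.2 hlt⟩, fun h => lt_irrefl ℓ' (h ⟨hV, hlt⟩).2⟩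
  all_goals
    obtain ⟨ε, hε, hεO⟩ := Metric.nhds_basis_closedBall.mem_iff.1 (H.nl.isOpen.mem_nhds H.nl.zero_mem)
    rw [Real.closedBall_eq_Icc, zero_sub, zero_add] at hεO
    have hδ := P.shape.pos
    have hρ : 0 < min ε (δ / 2) := lt_min hε (half_pos hδ)
    have hsub : Icc (-min ε (δ / 2)) (min ε (δ / 2)) ⊆ O :=
      (Icc_subset_Icc (neg_le_neg (min_le_left _ _)) (min_le_left _ _)).trans hεO
    have hneg : ∀ w ∈ Icc (-min ε (δ / 2)) (min ε (δ / 2)), w ≠ 0 → F w < 0 := fun w hw hne =>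
      P.shape.F_neg w (hsub hw) (abs_pos.2 hne) ((abs_le.2 hw).trans_lt ((min_le_right _ _).trans_lt (half_lt_self hδ)))
    obtain ⟨k₀, hk⟩ := G.bottom H S hn hleft hρ hsub hneg
      (fun s hs h0 hf hF hle α hα => P.shape.no_limit_path H hn hs h0 hf hF hle hα)
      (G.exists_low H S hn (by
        have hb : 0 < min (min ε (δ / 2)) (bp / 2) := lt_min hρ (half_pos W.bp_pos)
        exact ⟨_, ⟨W.bm_neg.trans hb, (min_le_right _ _).trans_lt (half_lt_self W.bp_pos)⟩,
          hneg _ ⟨by linarith, min_le_left _ _⟩ hb.ne'⟩))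
    refine ⟨k₀, fun k hk' => ?_⟩
    obtain ⟨x₁, h1, x₂, h2, h3⟩ := hk k hk'
    exact ⟨x₁, G.sub h1, x₂, G.sub h2, hcJ x₁ h1, h3⟩

theorem Profile.exists_last (P : Profile f F O δ L) (hm : m ∈ O) (hF : 0 < F m) (hmax : IsLocalMax F m)
    (hS : ∀ s ∈ O, m < s → IsLocalMax F s → F s ≤ F m) :
    ∃ β, IsGreatest {s | m < s ∧ s ∈ O ∧ F s = F m} β ∧ (∀ s ∈ Icc m β, F s ≤ F m) ∧ ∀ s ∈ O, β ≤ s → 0 < f s := by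
  have H := P.shape.nl
  obtain ⟨ε, hε, hlt⟩ := P.shape.isLocalMax_right hm hF hmax
  obtain ⟨w, hw, hwO⟩ := (inter_mem (Ioc_mem_nhdsGT (lt_add_of_pos_right m hε))
    (nhdsWithin_le_nhds (H.isOpen.mem_nhds hm)) |> Filter.nonempty_of_mem)
  obtain ⟨hi, hiO, -, hhi⟩ := P.high (F m) (P.lt m hm)
  have hwhi : w ≤ hi := le_of_not_ge fun h => (hhi w hwO h).not_gt (hlt w hw)
  have hc := H.contF (H.icc_subset hwO hiO)
  obtain ⟨β, ⟨hβ, hβF⟩, hβmax⟩ := (isCompact_Icc.of_isClosed_subset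
    (hc.preimage_isClosed_of_isClosed isClosed_Icc (isClosed_singleton (x := F m)))
    inter_subset_left).exists_isGreatest (by
      obtain ⟨y, hy, hyF⟩ := intermediate_value_Icc hwhi hc ⟨(hlt w hw).le, (hhi hi hiO le_rfl).le⟩
      exact ⟨y, hy, hyF⟩)
  have hβF : F β = F m := hβF
  have hβO : β ∈ O := H.icc_subset hwO hiO hβ
  have hmβ : m < β := hw.1.trans_le hβ.1
  have hgr : IsGreatest {s | m < s ∧ s ∈ O ∧ F s = F m} β := by
    refine ⟨⟨hmβ, hβO, hβF⟩, fun s hs => hβmax ⟨⟨?_, ?_⟩, hs.2.2⟩⟩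
    · by_contra! h
      exact (hlt s ⟨hs.1, h.le.trans hw.2⟩).ne hs.2.2
    · by_contra! h
      exact (hhi s hs.2.1 h.le).ne' hs.2.2
  have habove : ∀ s ∈ O, β < s → F m < F s := fun s hs hβs => by
    by_contra! hle
    rcases le_total hi s with h | h
    · exact (hhi s hs h).not_ge hle
    obtain ⟨y, hy, hyF⟩ := intermediate_value_Icc h (H.contF (H.icc_subset hs hiO)) ⟨hle, (hhi hi hiO le_rfl).le⟩
    exact (hgr.2 ⟨hmβ.trans (hβs.trans_le hy.1), H.icc_subset hs hiO hy, hyF⟩).not_gt (hβs.trans_le hy.1)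
  have hbelow : ∀ s ∈ Icc m β, F s ≤ F m := fun s hs => by
    by_contra! h
    have hsm : m < s := lt_of_le_of_ne hs.1 (by rintro rfl; exact lt_irrefl _ h)
    have hsβ : s < β := lt_of_le_of_ne hs.2 (by rintro rfl; exact h.ne' hβF)
    obtain ⟨z, hz, hz1, hz2⟩ := H.exists_interior_max (H.icc_subset hm hβO) ⟨hsm, hsβ⟩ h (by linarith)
    exact (hS z (H.icc_subset hm hβO (Ioo_subset_Icc_self hz)) hz.1 hz1).not_gt (by linarith)
  have hmono : ∀ a ∈ O, β ≤ a → ∀ b ∈ O, a < b → F a < F b := fun a ha hβa b hb hab => by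
    rcases hβa.eq_or_lt with rfl | hβa
    · rw [hβF]; exact habove b hb hab
    by_contra! hle
    obtain ⟨z, hz, hz1, hz2⟩ := H.exists_interior_max (H.icc_subset hβO hb) ⟨hβa, hab⟩
      (by rw [hβF]; exact habove a ha hβa) hle
    exact (hS z (H.icc_subset hβO hb (Ioo_subset_Icc_self hz)) (hmβ.trans hz.1) hz1).not_gt ((habove a ha hβa).trans_le hz2)
  refine ⟨β, hgr, hbelow, fun s hs hβs => ?_⟩
  have hFs : 0 < F s := by
    rcases hβs.eq_or_lt with rfl | h
    · rwa [hβF]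
    · exact hF.trans (habove s hs h)
  have hnn : 0 ≤ f s := by
    refine ge_of_tendsto ((hasDerivWithinAt_iff_tendsto_slope' self_notMem_Ioi).1
      ((H.deriv s hs).hasDerivWithinAt (s := Ioi s))) ?_
    filter_upwards [self_mem_nhdsWithin, nhdsWithin_le_nhds (H.isOpen.mem_nhds hs)] with y hy hyO
    rw [slope_def_field]; exact div_nonneg (sub_nonneg.2 (hmono s hs hβs y hyO hy).le) (sub_nonneg.2 (le_of_lt hy))
  refine lt_of_le_of_ne hnn fun h0 => ?_
  obtain ⟨r, hr, hsub, ⟨-, h⟩ | ⟨h, -⟩⟩ := P.shape.sides hs (P.shape.lt_abs hs hFs) h0.symm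
  · exact (h ⟨le_rfl, by linarith⟩ ⟨by linarith, le_rfl⟩ (lt_add_of_pos_right s hr)).not_gt
      (hmono s hs hβs _ (hsub ⟨by linarith, le_rfl⟩) (lt_add_of_pos_right s hr))
  · rcases hβs.eq_or_lt with rfl | hlt
    · have hx : max (β - r) m < β := max_lt (by linarith) hmβ
      have := h ⟨le_max_left _ _, hx.le⟩ ⟨by linarith, le_rfl⟩ hx
      linarith [hbelow _ ⟨le_max_right _ _, hx.le⟩]
    · have hx : max (s - r) β < s := max_lt (by linarith) hlt
      have := h ⟨le_max_left _ _, hx.le⟩ ⟨by linarith, le_rfl⟩ hx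
      exact this.not_gt (hmono _ (hsub ⟨le_max_left _ _, by linarith⟩) (le_max_right _ _) s hs hx)

theorem Profile.exists_solutions (P : Profile f F O δ L) (hn : 1 ≤ n) (hm : m ∈ O) (h0 : 0 < m) (hF : 0 < F m)
    (hlt : ∀ s ∈ Ico 0 m, F s < F m) (hβ : IsGreatest {s | m < s ∧ s ∈ O ∧ F s = F m} β)
    (hle : ∀ s ∈ Icc m β, F s ≤ F m) (hf : ∀ s ∈ O, β ≤ s → 0 < f s)
    (hhigh : ∀ (I : Set ℝ) (u v : ℝ → ℝ → ℝ), Family n f F O I u v → (∀ a ∈ I, ∀ s ∈ O, a ≤ s → s ∈ I) →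
      I.Nonempty → ∀ T > 0, ∀ e : ℝ, (e : EReal) < L → ∃ p ∈ I, ∀ α ∈ I, p ≤ α → e < energy F (u α) (v α) T) :
    ∃ (I : Set ℝ) (u v : ℝ → ℝ → ℝ), Family n f F O I u v ∧ ∃ k₀ : ℕ, ∀ k ≥ k₀, ∃ x₁ ∈ I, ∃ x₂ ∈ I, β < x₁ ∧ x₁ < x₂ ∧
      (HasExactlySignChanges (u x₁) k ∧ Tendsto (u x₁) atTop (𝓝 0)) ∧
      (HasExactlySignChanges (u x₂) k ∧ Tendsto (u x₂) atTop (𝓝 0)) := by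
  have H := P.shape.nl
  obtain ⟨⟨hmβ, hβO, hβF⟩, -⟩ := hβ
  obtain ⟨a, ha, haf⟩ : ∃ a ∈ Ico m β, ∀ s ∈ Ioc a β, 0 < f s := by
    have : ∀ᶠ s in 𝓝[≤] β, 0 < f s := nhdsWithin_le_nhds ((H.cont.continuousAt
      (H.isOpen.mem_nhds hβO)).eventually (Ioi_mem_nhds (hf β hβO le_rfl)))
    exact (mem_nhdsLE_iff_exists_mem_Ico_Ioc_subset hmβ).1 this
  have haO : Ioi a ∩ O ⊆ O := inter_subset_right
  have hfI : ∀ s ∈ Ioi a ∩ O, 0 < f s := fun s hs => by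
    rcases le_total β s with h | h
    · exact hf s hs.2 h
    · exact haf s ⟨hs.1, h⟩
  obtain ⟨u, v, Fam⟩ := exists_family n H haO (fun s hs => h0.trans_le (ha.1.trans (le_of_lt hs.1)))
    (isOpen_Ioi.inter H.isOpen) (ordConnected_Ioi.inter H.conn)
    (fun x hx y hy hxy => H.strictMonoOn (H.icc_subset hx.2 hy.2)
      (fun s hs => hfI s ⟨lt_trans hx.1 hs.1, H.icc_subset hx.2 hy.2 (Ioo_subset_Icc_self hs)⟩)
      ⟨le_rfl, hxy.le⟩ ⟨hxy.le, le_rfl⟩ hxy) hfI (fun x hx => by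
      obtain ⟨lo, h1, h2, h3⟩ := P.low (F x) (P.lt x hx.2)
      exact ⟨lo, h1, h2, h3 lo h1 le_rfl⟩)
  refine ⟨_, u, v, Fam, ?_⟩
  have hβI : β ∈ Ioi a ∩ O := ⟨ha.2, hβO⟩
  have hhigh := hhigh _ u v Fam (fun x hx s hs hxs => ⟨lt_of_lt_of_le hx.1 hxs, hs⟩) ⟨β, hβI⟩
  have hE0 : ∀ α ∈ Ioi a ∩ O, energy F (u α) (v α) 0 = F α := fun α hα => by
    rw [energy, (Fam.reg α hα).u_zero, (Fam.reg α hα).v_zero]; ring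
  have hnot : ∀ ℓ bm bp, ℓ ≤ F m → Well F O ℓ bm bp → ∀ α ∈ Ioi a ∩ O, α ≤ β → ¬ Under F u v ℓ bm bp α := by
    rintro ℓ bm bp hℓ W α hα hαβ ⟨t, ht, hE, hut⟩
    have hmα : m < α := ha.1.trans_lt hα.1
    have hbp : bp ≤ m := by
      by_contra! h
      linarith [W.below m ⟨W.bm_neg.trans h0, h⟩]
    obtain ⟨r, hr, hur⟩ := intermediate_value_Icc' ht.le ((Fam.reg α hα).cont_u.mono Icc_subset_Ici_self)
      (show m ∈ Icc _ _ from ⟨by linarith [hut.2], by rw [(Fam.reg α hα).u_zero]; exact hmα.le⟩)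
    have hr0 : 0 < r := lt_of_le_of_ne hr.1 (by
      rintro rfl; rw [(Fam.reg α hα).u_zero] at hur
      exact hmα.ne' hur)
    have h1 := Fam.energy_lt hn hα le_rfl hr0 (Or.inl (by rw [(Fam.reg α hα).u_zero]; exact (h0.trans hmα).ne'))
    rw [hE0 α hα] at h1
    have h2 : F m ≤ energy F (u α) (v α) r := by rw [energy, hur]; nlinarith [sq_nonneg (v α r)]
    linarith [hle α ⟨hmα.le, hαβ⟩]
  have hmL := P.lt m hm
  obtain ⟨ℓ₀, hℓ₀, hℓ₀L, hcrit⟩ := P.shape.exists_level_above hmL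
  obtain ⟨bm, bp, W⟩ := P.exists_well (hF.trans hℓ₀) hℓ₀L
  obtain ⟨bm', bp', W'⟩ := P.exists_well hF hmL
  have S := W.slab H hF.le hℓ₀ hcrit
  have hβbp : β < bp := by
    by_contra! h
    rcases lt_or_ge bp m with h' | h'
    · linarith [hlt bp ⟨W.bp_pos.le, h'⟩, W.F_bp]
    · linarith [hle bp ⟨h', h⟩, W.F_bp]
  have hU : Under F u v ℓ₀ bm bp β := by
    have R := Fam.reg β hβI
    have hcu : Tendsto (u β) (𝓝[>] 0) (𝓝 β) := by
      have := (R.cont_u 0 self_mem_Ici).mono_left (nhdsWithin_mono 0 Ioi_subset_Ici_self)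
      rwa [R.u_zero] at this
    obtain ⟨t, h1, h2⟩ := ((hcu.eventually (Ioo_mem_nhds (W.bm_neg.trans (h0.trans hmβ)) hβbp)).and
      self_mem_nhdsWithin).exists
    refine ⟨t, h2, lt_of_le_of_lt (Fam.energy_le hβI le_rfl (le_of_lt h2)) ?_, h1⟩
    rwa [hE0 β hβI, hβF]
  obtain ⟨J, G, -⟩ := Fam.exists_good S (fun T hT e he => hhigh T hT e ((EReal.coe_lt_coe_iff.2 he).trans hℓ₀L)) hβI hU
  obtain ⟨α, hα, hUα⟩ := G.descend Fam S hn hF W'.bm_neg W'.bp_pos W'.F_bm W'.F_bp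
    (fun s hs hf hFs hle => P.shape.strict_peak hs hf (hFs ▸ hF) hle)
    (G.exists_low Fam S hn ⟨0, ⟨W.bm_neg, W.bp_pos⟩, by rwa [H.F_zero]⟩)
  exact P.descent Fam hn hhigh hβI hnot _ (F m) bm' bp' α le_rfl hF hmL W' (G.sub hα) hUα le_rfl

end profile

section regularity
variable {n : ℕ} {f F : ℝ → ℝ} {O I : Set ℝ} {u v : ℝ → ℝ → ℝ} {α : ℝ}

theorem RegSol.tendsto_div {u v : ℝ → ℝ} (h : RegSol n f α u v) (hf : Tendsto (fun t => f (u t)) (𝓝[>] 0) (𝓝 (f α))) :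
    Tendsto (fun t => v t / t) (𝓝[>] 0) (𝓝 (-f α / (n + 1))) := by
  have hv : Tendsto v (𝓝[>] 0) (𝓝 0) := by
    have := (h.cont_v 0 self_mem_Ici).mono_left (nhdsWithin_mono 0 Ioi_subset_Ici_self)
    rwa [h.v_zero] at this
  have key := HasDerivAt.lhopital_zero_nhdsGT
    (f' := fun t => -(t ^ n * f (u t))) (g' := fun t => (n + 1) * t ^ n) (l := 𝓝 (-f α / (n + 1)))
    (by filter_upwards [self_mem_nhdsWithin] with t ht using h.hasDerivAt_weighted ht)
    (Eventually.of_forall fun t => by simpa using hasDerivAt_pow (n + 1) t)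
    (by filter_upwards [self_mem_nhdsWithin] with t ht using (mul_pos (by positivity) (pow_pos ht n)).ne')
    (by simpa using (((continuous_pow n).tendsto 0).mono_left nhdsWithin_le_nhds).mul hv)
    (by
      have : Tendsto (fun t : ℝ => t ^ (n + 1)) (𝓝[>] 0) (𝓝 (0 ^ (n + 1))) :=
        ((continuous_pow (n + 1)).tendsto 0).mono_left nhdsWithin_le_nhds
      simpa using this)
    (by
      refine (hf.neg.div_const (n + 1)).congr' ?_
      filter_upwards [self_mem_nhdsWithin] with t ht
      have : t ^ n ≠ 0 := (pow_pos ht n).ne'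
      field_simp)
  refine key.congr' ?_
  filter_upwards [self_mem_nhdsWithin] with t ht
  have : t ^ n ≠ 0 := (pow_pos ht n).ne'
  grind

theorem contDiffOn_two_Ici {u v w : ℝ → ℝ} (hu : ∀ t ∈ Ici (0 : ℝ), HasDerivWithinAt u (v t) (Ici 0) t)
    (hv : ∀ t ∈ Ici (0 : ℝ), HasDerivWithinAt v (w t) (Ici 0) t) (hw : ContinuousOn w (Ici 0)) :
    ContDiffOn ℝ 2 u (Ici 0) := by
  have hU := uniqueDiffOn_Ici 0
  rw [show (2 : WithTop ℕ∞) = 1 + 1 from one_add_one_eq_two.symm, contDiffOn_succ_iff_derivWithin hU]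
  exact ⟨fun t ht => (hu t ht).differentiableWithinAt, by simp,
    ((contDiffOn_one_iff_derivWithin hU).2 ⟨fun t ht => (hv t ht).differentiableWithinAt, hw.congr fun t ht => (hv t ht).derivWithin (hU t ht)⟩).congr fun t ht => (hu t ht).derivWithin (hU t ht)⟩

theorem Family.isRadialSolution (H : Family n f F O I u v) (hα : α ∈ I) {γm γs : EReal}
    (hO : O ⊆ nonlinDomain γm γs) (hlim : Tendsto (u α) atTop (𝓝 0)) :
    IsRadialSolution (n + 1) f γm γs (u α) := by
  have R := H.reg α hα
  have hfc := H.cont_f hα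
  have hf0 : Tendsto (fun t => f (u α t)) (𝓝[>] 0) (𝓝 (f α)) := by
    simpa only [R.u_zero] using ((hfc 0 self_mem_Ici).mono_left (nhdsWithin_mono 0 Ioi_subset_Ici_self))
  have hu' := fun t ht => (R.traj t ht).1.hasDerivAt (Ioi_mem_nhds ht)
  have hv' := fun t ht => (R.traj t ht).2.hasDerivAt (Ioi_mem_nhds ht)
  have hu0 : HasDerivWithinAt (u α) 0 (Ici 0) 0 := by
    refine hasDerivWithinAt_Ici_of_tendsto_deriv (fun t ht => (hu' t ht).differentiableAt.differentiableWithinAt)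
      ((R.cont_u 0 self_mem_Ici).mono Ioi_subset_Ici_self) self_mem_nhdsWithin ?_
    have := (R.cont_v 0 self_mem_Ici).mono_left (nhdsWithin_mono 0 Ioi_subset_Ici_self)
    rw [R.v_zero] at this
    refine this.congr' ?_
    filter_upwards [self_mem_nhdsWithin] with t ht using (hu' t ht).deriv.symm
  have hwl : Tendsto (fun t => -(n / t) * v α t - f (u α t)) (𝓝[>] 0) (𝓝 (-f α / (n + 1))) := by
    have := ((R.tendsto_div hf0).const_mul (-(n : ℝ))).sub hf0
    grind
  have hv0 : HasDerivWithinAt (v α) (-f α / (n + 1)) (Ici 0) 0 := by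
    refine hasDerivWithinAt_Ici_of_tendsto_deriv (fun t ht => (hv' t ht).differentiableAt.differentiableWithinAt)
      ((R.cont_v 0 self_mem_Ici).mono Ioi_subset_Ici_self) self_mem_nhdsWithin ?_
    refine hwl.congr' ?_
    filter_upwards [self_mem_nhdsWithin] with t ht using (hv' t ht).deriv.symm
  refine ⟨contDiffOn_two_Ici (v := v α) (w := Function.update (fun t => -(n / t) * v α t - f (u α t)) 0
      (-f α / (n + 1))) (fun t ht => ?_) (fun t ht => ?_) fun t ht => ?_,
    fun r hr => hO (H.mem α hα r hr), fun r hr => ?_, hu0, hlim⟩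
  · rcases (mem_Ici.1 ht).eq_or_lt with rfl | h
    · rwa [R.v_zero]
    · exact (hu' t h).hasDerivWithinAt
  · rcases (mem_Ici.1 ht).eq_or_lt with rfl | h
    · rwa [Function.update_self]
    · rw [Function.update_of_ne h.ne']; exact (hv' t h).hasDerivWithinAt
  · rcases (mem_Ici.1 ht).eq_or_lt with rfl | h
    · rw [continuousWithinAt_update_same, Ici_sdiff_left]; exact hwl
    · rw [continuousWithinAt_update_of_ne h.ne']
      exact ((((continuousOn_const.div continuousOn_id fun t ht => ne_of_gt ht).neg.mul (R.cont_v.mono Ioi_subset_Ici_self)).sub (hfc.mono Ioi_subset_Ici_self)).continuousAt (Ioi_mem_nhds h)).continuousWithinAt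
  · have h2 : deriv (deriv (u α)) r = -(n / r) * v α r - f (u α r) := by
      have : deriv (u α) =ᶠ[𝓝 r] v α := by filter_upwards [Ioi_mem_nhds hr] with t ht using (hu' t ht).deriv
      rw [this.deriv_eq, (hv' r hr).deriv]
    rw [h2, (hu' r hr).deriv]; push_cast; ring

end regularity

section endpoints
variable {f : ℝ → ℝ} {γm γs : EReal}

/-- The interior of the domain of the nonlinearity. -/
def nonlinInterior (γm γs : EReal) : Set ℝ := {s : ℝ | γm < (s : EReal) ∧ (s : EReal) < γs}

theorem isOpen_nonlinInterior : IsOpen (nonlinInterior γm γs) := isOpen_Ioo.preimage continuous_coe_real_ereal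

theorem nonlinInterior_subset : nonlinInterior γm γs ⊆ nonlinDomain γm γs := fun _ h => ⟨h.1, h.2.le⟩

theorem ordConnected_nonlinDomain : (nonlinDomain γm γs).OrdConnected :=
  ⟨fun _ hx _ hy _ hz => ⟨hx.1.trans_le (EReal.coe_le_coe_iff.2 hz.1), (EReal.coe_le_coe_iff.2 hz.2).trans hy.2⟩⟩

theorem nonlin_primitiveF (h1 : γm < 0) (h2 : 0 < γs) (hc : ContinuousOn f (nonlinDomain γm γs)) (h0 : f 0 = 0)
    (hl : LocallyLipschitzOn (nonlinDomain γm γs \ {0}) f) :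
    Nonlin f (primitiveF f) (nonlinInterior γm γs) where
  isOpen := isOpen_nonlinInterior
  conn := ⟨fun _ hx _ hy _ hz => ⟨hx.1.trans_le (EReal.coe_le_coe_iff.2 hz.1), (EReal.coe_le_coe_iff.2 hz.2).trans_lt hy.2⟩⟩
  zero_mem := ⟨h1, h2⟩
  cont := hc.mono nonlinInterior_subset
  deriv s hs := by
    have hcO := hc.mono nonlinInterior_subset
    exact intervalIntegral.integral_hasDerivAt_right
      (hc.mono (ordConnected_nonlinDomain.uIcc_subset ⟨h1, h2.le⟩ (nonlinInterior_subset hs))).intervalIntegrable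
      (hcO.stronglyMeasurableAtFilter isOpen_nonlinInterior s hs) (hcO.continuousAt (isOpen_nonlinInterior.mem_nhds hs))
  lip s hs hs0 := by
    obtain ⟨K, t, ht, hK⟩ := hl ⟨nonlinInterior_subset hs, hs0⟩
    have : nonlinDomain γm γs \ {0} ∈ 𝓝 s := by
      filter_upwards [isOpen_nonlinInterior.mem_nhds hs, isOpen_ne.mem_nhds hs0] with x hx h using
        ⟨nonlinInterior_subset hx, h⟩
    exact ⟨K, t, nhdsWithin_eq_nhds.2 this ▸ ht, hK⟩
  f_zero := h0
  F_zero := intervalIntegral.integral_same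

theorem exists_of_eventually_rightOf {p : ℝ → Prop} (hγ : γm < 0) (h : ∀ᶠ s in rightOf γm, p s) :
    ∃ lo : ℝ, γm < lo ∧ lo < 0 ∧ ∀ s : ℝ, γm < s → s ≤ lo → p s := by
  obtain ⟨V, hV, hVp⟩ := mem_comap.1 h
  obtain ⟨b, hb, hbV⟩ := (mem_nhdsGT_iff_exists_Ioo_subset' hγ).1 hV
  obtain ⟨lo, h1, h2⟩ := EReal.lt_iff_exists_real_btwn.1 (lt_min hb hγ)
  exact ⟨lo, h1, by exact_mod_cast h2.trans_le (min_le_right _ _), fun s hs hle => hVp (hbV ⟨hs, (EReal.coe_le_coe_iff.2 hle).trans_lt (h2.trans_le (min_le_left _ _))⟩)⟩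

end endpoints

section assembly
variable {n : ℕ} {f : ℝ → ℝ} {γm γs : EReal} {δ m β c : ℝ} {L : EReal}

theorem Profile.radial_solutions (P : Profile f (primitiveF f) (nonlinInterior γm γs) δ L) (hn : 1 ≤ n) (hγm : γm < 0)
    (hpeak : ∃ γ ∈ nonlinInterior γm γs, δ < γ ∧ IsLocalMax (primitiveF f) γ ∧ 0 < primitiveF f γ)
    (hhigh : ∀ β, (∀ s ∈ nonlinInterior γm γs, β ≤ s → 0 < f s) → ∀ (I : Set ℝ) (u v : ℝ → ℝ → ℝ),
      Family n f (primitiveF f) (nonlinInterior γm γs) I u v →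
      (∀ a ∈ I, ∀ s ∈ nonlinInterior γm γs, a ≤ s → s ∈ I) → I.Nonempty → ∀ T > 0, ∀ e : ℝ, (e : EReal) < L →
      ∃ p ∈ I, ∀ α ∈ I, p ≤ α → e < energy (primitiveF f) (u α) (v α) T) :
    (∃! β : ℝ, IsBetaStar f γs β) ∧
    ∀ β : ℝ, IsBetaStar f γs β → ∃ k₀ : ℕ, ∀ k : ℕ, k₀ ≤ k → ∃ u₁ u₂ : ℝ → ℝ, ¬ EqOn u₁ u₂ (Ici 0) ∧
          (IsRadialSolution (n + 1) f γm γs u₁ ∧ β < u₁ 0 ∧ (u₁ 0 : EReal) < γs ∧ HasExactlySignChanges u₁ k) ∧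
          (IsRadialSolution (n + 1) f γm γs u₂ ∧ β < u₂ 0 ∧ (u₂ 0 : EReal) < γs ∧ HasExactlySignChanges u₂ k) := by
  have H := P.shape.nl
  have hlow : ∀ g : ℝ, 0 ≤ g → γm < (g : EReal) := fun g hg => hγm.trans_le (by exact_mod_cast hg)
  have hS : ∀ g, 0 ≤ g → ∀ s, s ∈ higherPeaks f γs g ↔ s ∈ nonlinInterior γm γs ∧ g < s ∧
      IsLocalMax (primitiveF f) s ∧ primitiveF f g < primitiveF f s := fun g hg s =>
    ⟨fun h => ⟨⟨hlow s (hg.trans h.1.le), h.2.1⟩, h.1, h.2.2⟩, fun h => ⟨h.2.1, h.1.2, h.2.2⟩⟩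
  obtain ⟨m, hmO, hend, hm0, hempty, hlt, hor⟩ := P.shape.exists_peakEnd hS _ 0 H.zero_mem le_rfl H.F_zero.ge le_rfl
  obtain ⟨hmax, hFm⟩ := hor.resolve_left (by
    rintro rfl
    obtain ⟨γ, h1, h2, h3, h4⟩ := hpeak
    exact eq_empty_iff_forall_notMem.1 hempty γ ((hS 0 le_rfl γ).2 ⟨h1, P.shape.pos.trans h2, h3, by rwa [H.F_zero]⟩))
  rw [H.F_zero] at hFm
  have hm : 0 < m := lt_of_le_of_ne hm0 (by rintro rfl; linarith [H.F_zero])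
  obtain ⟨β, hβ, hle, hf⟩ := P.exists_last hmO hFm hmax fun s hs hms hsm => by
    by_contra! h
    exact eq_empty_iff_forall_notMem.1 hempty s ((hS m hm0 s).2 ⟨hs, hms, hsm, h⟩)
  have hset : {s : ℝ | m < s ∧ s ∈ nonlinInterior γm γs ∧ primitiveF f s = primitiveF f m} =
      {s : ℝ | m < s ∧ (s : EReal) < γs ∧ primitiveF f s = primitiveF f m} := by
    ext s
    exact ⟨fun h => ⟨h.1, h.2.1.2, h.2.2⟩, fun h => ⟨h.1, ⟨hlow s (hm.trans h.1).le, h.2.1⟩, h.2.2⟩⟩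
  have huniq : ∀ b, IsBetaStar f γs b → b = β := by
    rintro b ⟨M, γ, ⟨g0, g1, g2⟩, hb⟩
    obtain rfl : m = γ M := hend.unique ⟨M, γ, g0, g1, g2, rfl⟩
    exact hb.unique (hset ▸ hβ)
  have hstar : IsBetaStar f γs β := by
    obtain ⟨M, γ, g0, g1, g2, rfl⟩ := hend
    exact ⟨M, γ, ⟨g0, g1, g2⟩, hset ▸ hβ⟩
  refine ⟨⟨β, hstar, huniq⟩, fun b hb => ?_⟩
  obtain rfl := huniq b hb
  obtain ⟨I, u, v, Fam, k₀, hk⟩ := P.exists_solutions hn hmO hm hFm hlt hβ hle hf (hhigh b hf)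
  refine ⟨k₀, fun k hkk => ?_⟩
  obtain ⟨x₁, h1, x₂, h2, hb1, h12, ⟨s1, l1⟩, s2, l2⟩ := hk k hkk
  have e1 := (Fam.reg x₁ h1).u_zero
  have e2 := (Fam.reg x₂ h2).u_zero
  refine ⟨u x₁, u x₂, fun h => ?_, ⟨Fam.isRadialSolution h1 nonlinInterior_subset l1, by rwa [e1], ?_, s1⟩,
    Fam.isRadialSolution h2 nonlinInterior_subset l2, by rw [e2]; exact hb1.trans h12, ?_, s2⟩
  · have := h self_mem_Ici
    rw [e1, e2] at this; exact h12.ne this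
  · rw [e1]; exact (Fam.sub h1).2
  · rw [e2]; exact (Fam.sub h2).2

theorem AssumptionA1.nonlin (A : AssumptionA1 f γm c) : Nonlin f (primitiveF f) (nonlinInterior γm c) :=
  nonlin_primitiveF A.lower_neg (by exact_mod_cast A.upper_pos) A.cont A.zero A.lip

theorem AssumptionA1.exists_profile (A : AssumptionA1 f γm c) :
    ∃ δ, Profile f (primitiveF f) (nonlinInterior γm c) δ (primitiveF f c : ℝ) ∧
      ∃ γ ∈ nonlinInterior γm c, δ < γ ∧ IsLocalMax (primitiveF f) γ ∧ 0 < primitiveF f γ := by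
  obtain ⟨δ, hδ, hneg, ⟨γ, g1, g2, g3, g4⟩, hfin, hsign⟩ := A.exists_delta
  have hmem : ∀ z ∈ nonlinInterior γm c, δ < |z| → (γm < (z : EReal) ∧ z < -δ) ∨ (δ < z ∧ z < c) := fun z hz h => by
    rcases lt_abs.1 h with h | h
    · exact Or.inr ⟨h, EReal.coe_lt_coe_iff.1 hz.2⟩
    · exact Or.inl ⟨hz.1, by linarith⟩
  have hc0 := A.upper_pos
  refine ⟨δ, ⟨⟨A.nonlin, hδ, fun s hs => hneg s (nonlinInterior_subset hs),
    hfin.subset fun z hz => ⟨hmem z hz.1 hz.2.1, hz.2.2⟩, fun z hz h => hsign z (hmem z hz h)⟩,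
    fun s hs => EReal.coe_lt_coe_iff.2 (A.lt_top s hs.1 (EReal.coe_lt_coe_iff.1 hs.2)), fun e he => ?_, fun e he => ?_⟩,
    γ, ⟨A.lower_neg.trans (by exact_mod_cast hδ.trans g1), by exact_mod_cast g2⟩, g1, g3, g4⟩
  · obtain ⟨lo, h1, h2, h3⟩ := exists_of_eventually_rightOf A.lower_neg
      (A.lim_lower.eventually (Ioi_mem_nhds (EReal.coe_lt_coe_iff.1 he)))
    exact ⟨lo, ⟨h1, by exact_mod_cast h2.trans hc0⟩, h2, fun s hs => h3 s hs.1⟩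
  · have hsub : uIcc 0 c ⊆ nonlinDomain γm c := ordConnected_nonlinDomain.uIcc_subset
      ⟨A.lower_neg, by exact_mod_cast hc0.le⟩ ⟨A.lower_neg.trans (by exact_mod_cast hc0), le_rfl⟩
    have hcont : ContinuousOn (primitiveF f) (uIcc 0 c) := intervalIntegral.continuousOn_primitive_interval
      ((A.cont.mono hsub).integrableOn_compact isCompact_uIcc)
    rw [uIcc_of_le hc0.le] at hcont
    have hlim : Tendsto (primitiveF f) (𝓝[<] c) (𝓝 (primitiveF f c)) :=
      (hcont c ⟨hc0.le, le_rfl⟩).mono_left (nhdsWithin_le_iff.2 (Icc_mem_nhdsLT hc0))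
    obtain ⟨l, hl, hle⟩ := (mem_nhdsLT_iff_exists_Ioo_subset' hc0).1
      (hlim.eventually (Ioi_mem_nhds (EReal.coe_lt_coe_iff.1 he)))
    have hmid : max l 0 < c := max_lt hl hc0
    have h0 := le_max_right l 0
    refine ⟨(max l 0 + c) / 2, ⟨A.lower_neg.trans (by exact_mod_cast (by linarith)),
      by exact_mod_cast (by linarith)⟩, by linarith, fun s hs h => hle ⟨?_, EReal.coe_lt_coe_iff.1 hs.2⟩⟩
    linarith [le_max_left l 0]

theorem AssumptionA1.exists_lipschitz (A : AssumptionA1 f γm c) :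
    ∃ r > 0, ∃ K, 0 ≤ K ∧ ∀ s ∈ Ioo (c - r) c, f s ≤ K * (c - s) := by
  have hc0 := A.upper_pos
  have hcd : c ∈ nonlinDomain γm c \ {0} := ⟨⟨A.lower_neg.trans (by exact_mod_cast hc0), le_rfl⟩, hc0.ne'⟩
  obtain ⟨K, t, ht, hK⟩ := A.lip hcd
  have hct := mem_of_mem_nhdsWithin hcd ht
  have ht' : t ∈ 𝓝[<] c := by
    refine nhdsWithin_le_iff.2 ?_ ht
    filter_upwards [Ioo_mem_nhdsLT hc0] with s hs
    exact ⟨⟨A.lower_neg.trans (by exact_mod_cast hs.1), by exact_mod_cast hs.2.le⟩, hs.1.ne'⟩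
  obtain ⟨l, hl, hlt⟩ := (mem_nhdsLT_iff_exists_Ioo_subset' hc0).1 ht'
  refine ⟨c - l, sub_pos.2 hl, K, K.2, fun s hs => ?_⟩
  rw [sub_sub_cancel] at hs
  have := hK.dist_le_mul s (hlt hs) c hct
  rw [Real.dist_eq, Real.dist_eq, A.zero_top, sub_zero, abs_sub_comm, abs_of_pos (sub_pos.2 hs.2)] at this
  exact (le_abs_self _).trans this

theorem AssumptionA1.high (A : AssumptionA1 f γm c) (P : Profile f (primitiveF f) (nonlinInterior γm c) δ (primitiveF f c : ℝ))
    {I : Set ℝ} {u v : ℝ → ℝ → ℝ} (H : Family n f (primitiveF f) (nonlinInterior γm c) I u v)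
    (hI : ∀ a ∈ I, ∀ s ∈ nonlinInterior γm c, a ≤ s → s ∈ I) (hne : I.Nonempty) {T : ℝ} (hT : 0 < T) {e : ℝ}
    (he : (e : EReal) < (primitiveF f c : ℝ)) :
    ∃ p ∈ I, ∀ α ∈ I, p ≤ α → e < energy (primitiveF f) (u α) (v α) T := by
  obtain ⟨r, hr, K, hK, hlip⟩ := A.exists_lipschitz
  obtain ⟨hi, h1, -, h3⟩ := P.high e he
  exact H.high_near_equilibrium (fun a ha s has hs => hI a ha s
    ⟨(H.sub ha).1.trans_le (by exact_mod_cast has), by exact_mod_cast hs⟩ has)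
    (fun a ha => EReal.coe_lt_coe_iff.1 (H.sub ha).2) hne hr hK hlip
    ⟨hi, EReal.coe_lt_coe_iff.1 h1.2, fun s hs hsc => h3 s
      ⟨h1.1.trans (by exact_mod_cast hs), by exact_mod_cast hsc⟩ hs.le⟩ hT

theorem AssumptionA2.nonlin {N : ℕ} (A : AssumptionA2 N f γm) : Nonlin f (primitiveF f) (nonlinInterior γm ⊤) :=
  nonlin_primitiveF A.lower_neg EReal.zero_lt_top A.cont A.zero A.lip

theorem AssumptionA2.exists_profile {N : ℕ} (A : AssumptionA2 N f γm) :
    ∃ δ L, Profile f (primitiveF f) (nonlinInterior γm ⊤) δ L ∧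
      ∃ γ ∈ nonlinInterior γm ⊤, δ < γ ∧ IsLocalMax (primitiveF f) γ ∧ 0 < primitiveF f γ := by
  obtain ⟨δ, hδ, hneg, ⟨γ, g1, g3, g4⟩, hfin, hsign⟩ := A.exists_delta
  obtain ⟨L, htop, hbot, hlt⟩ := A.lim_ends
  have hmem : ∀ z ∈ nonlinInterior γm ⊤, δ < |z| → (γm < (z : EReal) ∧ z < -δ) ∨ δ < z := fun z hz h => by
    rcases lt_abs.1 h with h | h
    · exact Or.inr h
    · exact Or.inl ⟨hz.1, by linarith⟩
  refine ⟨δ, L, ⟨⟨A.nonlin, hδ, fun s hs => hneg s (nonlinInterior_subset hs),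
    hfin.subset fun z hz => ⟨hmem z hz.1 hz.2.1, hz.2.2⟩, fun z hz h => hsign z (hmem z hz h)⟩,
    fun s hs => hlt s (nonlinInterior_subset hs), fun e he => ?_, fun e he => ?_⟩,
    γ, ⟨A.lower_neg.trans (by exact_mod_cast hδ.trans g1), EReal.coe_lt_top γ⟩, g1, g3, g4⟩
  · obtain ⟨lo, h1, h2, h3⟩ := exists_of_eventually_rightOf A.lower_neg (hbot.eventually (Ioi_mem_nhds he))
    exact ⟨lo, ⟨h1, EReal.coe_lt_top lo⟩, h2, fun s hs h => EReal.coe_lt_coe_iff.1 (h3 s hs.1 h)⟩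
  · obtain ⟨hi, hhi⟩ := eventually_atTop.1 (htop.eventually (Ioi_mem_nhds he))
    have hpos : (0 : ℝ) < max hi 1 := one_pos.trans_le (le_max_right _ _)
    exact ⟨max hi 1, ⟨A.lower_neg.trans (by exact_mod_cast hpos), EReal.coe_lt_top _⟩, hpos,
      fun s _ h => EReal.coe_lt_coe_iff.1 (hhi s ((le_max_left _ _).trans h))⟩

theorem AssumptionA2.exists_growth {N : ℕ} (A : AssumptionA2 N f γm) :
    ∃ θ ∈ Ioo (0 : ℝ) 1, ∀ B : ℝ, ∀ᶠ s in atTop, ∀ s₁ ∈ Icc (θ * s) s, ∀ s₂ ∈ Icc (θ * s) s,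
      B < pohozaevQ N f s₂ * (s / f s₁) ^ ((N : ℝ) / 2) := by
  obtain ⟨θ, hθ, h⟩ := A.q_growth
  refine ⟨θ, hθ, fun B => ?_⟩
  filter_upwards [h.eventually (Ioi_mem_nhds (EReal.coe_lt_top B))] with s hs s₁ h1 s₂ h2
  exact EReal.coe_lt_coe_iff.1 (lt_of_lt_of_le hs ((iInf₂_le s₁ h1).trans (iInf₂_le s₂ h2)))

theorem AssumptionA2.exists_lower_bound {N : ℕ} (A : AssumptionA2 N f γm) (hf : ∀ s ∈ nonlinInterior γm ⊤, β ≤ s → 0 < f s) :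
    ∃ C, 0 ≤ C ∧ ∀ s ∈ nonlinInterior γm ⊤, -C ≤ pohozaevQ N f s := by
  obtain ⟨s₀, h1, h2, hQ⟩ := A.q_pos
  obtain ⟨θ, hθ, hgr⟩ := A.exists_growth
  obtain ⟨S, hS⟩ := eventually_atTop.1 (hgr 0)
  have H := A.nonlin
  have hmem : ∀ s : ℝ, 0 ≤ s → s ∈ nonlinInterior γm ⊤ := fun s hs =>
    ⟨A.lower_neg.trans_le (by exact_mod_cast hs), EReal.coe_lt_top s⟩
  have hbig : ∀ s, max (max S β) 1 ≤ s → 0 < pohozaevQ N f s := fun s hs => by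
    have hs1 : 1 ≤ s := (le_max_right _ _).trans hs
    have hsS : max S β ≤ s := (le_max_left _ _).trans hs
    have hin : s ∈ Icc (θ * s) s := ⟨by nlinarith [hθ.2], le_rfl⟩
    have hfs := hf s (hmem s (by linarith)) ((le_max_right _ _).trans hsS)
    exact (pos_iff_pos_of_mul_pos (hS s ((le_max_left _ _).trans hsS) s hin s hin)).2
      (Real.rpow_pos_of_pos (div_pos (by linarith) hfs) _)
  have hsub : Icc s₀ (max (max S β) 1) ⊆ nonlinInterior γm ⊤ := H.icc_subset ⟨h1, EReal.coe_lt_top s₀⟩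
    (hmem _ (zero_le_one.trans (le_max_right _ _)))
  have hcont : ContinuousOn (pohozaevQ N f) (Icc s₀ (max (max S β) 1)) := by
    unfold pohozaevQ
    exact (continuousOn_const.mul (H.contF hsub)).sub ((continuousOn_const.mul continuousOn_id).mul (H.cont.mono hsub))
  obtain ⟨C, hC⟩ := isCompact_Icc.exists_bound_of_continuousOn hcont
  refine ⟨max C 0, le_max_right _ _, fun s hs => ?_⟩
  rcases lt_or_ge s s₀ with h | h
  · linarith [hQ s hs.1 h, le_max_right C 0]
  rcases le_total s (max (max S β) 1) with h' | h'
  · have := (abs_le.1 (hC s ⟨h, h'⟩)).1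
    linarith [le_max_left C 0]
  · linarith [hbig s h', le_max_right C 0]

theorem AssumptionA2.high (A : AssumptionA2 (n + 1) f γm) (P : Profile f (primitiveF f) (nonlinInterior γm ⊤) δ L)
    (hf : ∀ s ∈ nonlinInterior γm ⊤, β ≤ s → 0 < f s) {I : Set ℝ} {u v : ℝ → ℝ → ℝ}
    (H : Family n f (primitiveF f) (nonlinInterior γm ⊤) I u v)
    (hI : ∀ a ∈ I, ∀ s ∈ nonlinInterior γm ⊤, a ≤ s → s ∈ I) (hne : I.Nonempty) {T : ℝ} (hT : 0 < T) {e : ℝ}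
    (he : (e : EReal) < L) :
    ∃ p ∈ I, ∀ α ∈ I, p ≤ α → e < energy (primitiveF f) (u α) (v α) T := by
  obtain ⟨C, hC, hQC⟩ := A.exists_lower_bound hf
  obtain ⟨θ, hθ, hgr⟩ := A.exists_growth
  obtain ⟨lo, l1, -, l3⟩ := P.low e he
  obtain ⟨hi, h1, -, h3⟩ := P.high e he
  refine H.high_of_growth (fun a ha s has => hI a ha s ⟨(H.sub ha).1.trans_le (by exact_mod_cast has),
    EReal.coe_lt_top s⟩ has) hne (fun s => ?_) hC hQC hθ hgr l1 h1 (fun s hs hle => ⟨?_, ?_⟩) hT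
  · unfold pohozaevQ; push_cast; ring
  · by_contra! h
    exact (l3 s hs h.le).not_ge hle
  · by_contra! h
    exact (h3 s hs h.le).not_ge hle

end assembly

theorem theorem1p1 (N : ℕ) (hN : 2 ≤ N) (f : ℝ → ℝ) (γm γs : EReal) (hf : (∃ c : ℝ, γs = (c : EReal) ∧ AssumptionA1 f γm c) ∨
      (γs = ⊤ ∧ AssumptionA2 N f γm)) :
    (∃! β : ℝ, IsBetaStar f γs β) ∧
    ∀ β : ℝ, IsBetaStar f γs β → ∃ k₀ : ℕ, ∀ k : ℕ, k₀ ≤ k → ∃ u₁ u₂ : ℝ → ℝ, ¬ EqOn u₁ u₂ (Ici 0) ∧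
          (IsRadialSolution N f γm γs u₁ ∧ β < u₁ 0 ∧ (u₁ 0 : EReal) < γs ∧ HasExactlySignChanges u₁ k) ∧
          (IsRadialSolution N f γm γs u₂ ∧ β < u₂ 0 ∧ (u₂ 0 : EReal) < γs ∧ HasExactlySignChanges u₂ k) := by
  obtain ⟨n, rfl⟩ : ∃ n, N = n + 1 := ⟨N - 1, by omega⟩
  have hn : 1 ≤ n := by omega
  rcases hf with ⟨c, rfl, A⟩ | ⟨rfl, A⟩
  · obtain ⟨δ, P, hpeak⟩ := A.exists_profile
    exact P.radial_solutions hn A.lower_neg hpeak fun _ _ _ _ _ H hI hne _ hT _ he => A.high P H hI hne hT he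
  · obtain ⟨δ, L, P, hpeak⟩ := A.exists_profile
    exact P.radial_solutions hn A.lower_neg hpeak fun _ hf _ _ _ H hI hne _ hT _ he => A.high P hf H hI hne hT he
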